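/- For a function $\phi$ on $\mathbb R$ write $\check\phi(x)=\int_{\mathbb R}\phi(\xi)e^{i\xi x}\,d\xi$ and, for an integer $m\ge 0$, $\phi_m(\xi)=\phi(2^{-m}\xi)$. For functions $f,g$ on $\mathbb R^2$ and $k$ on $\mathbb R$ write $(f*_1k)(x,y)=\int_{\mathbb R}f(x-s,y)k(s)\,ds$ and $(g*_2k)(x,y)=\int_{\mathbb R}g(x,y-s)k(s)\,ds$. Let $\rho,\phi\in C_0^\infty(\mathbb R)$ be complex-valued with $\operatorname{supp}\rho,\ \operatorname{supp}\phi\subseteq\{\xi:\tfrac12<|\xi|<2\}$, and define $$T_m(f,g)(x,y)=\int_{\mathbb R}(f*_1\check\phi_m)(x+t,y)\,(g*_2\check\phi_m)(x,y+t^2)\,\rho(t)\,dt,$$ where $\check\phi_m$ denotes $(\phi_m)^{\vee}$. Then, with $\varepsilon_0=\tfrac1{75}$, there is a constant $C>0$ depending only on $\rho$ and $\phi$ such that for all integers $m\ge 0$ and all $f,g\in L^2(\mathbb R^2)$: the integral $(f*_1\check\phi_m)(x,y)$ converges absolutely for almost every $y$ and all $x$, the integral $(g*_2\check\phi_m)(x,y)$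 for almost every $x$ and all $y$, and the integral defining $T_m(f,g)(x,y)$ for almost every $(x,y)$; moreover $T_m(f,g)\in L^1(\mathbb R^2)$ and $$\|T_m(f,g)\|_{L^1(\mathbb R^2)}\le C\,2^{-\varepsilon_0 m}\,\|f\|_{L^2(\mathbb R^2)}\,\|g\|_{L^2(\mathbb R^2)}.$$ -/

import Mathlib

open MeasureTheory
open scoped ContDiff

noncomputable section

/-- The inverse Fourier transform on the line, with the normalization
`φ̌(x) = ∫ φ(ξ) e^{i ξ x} dξ`. -/
def invFourier (φ : ℝ → ℂ) (x : ℝ) : ℂ :=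
  ∫ ξ : ℝ, φ ξ * Complex.exp (Complex.I * (ξ : ℂ) * (x : ℂ))

/-- The dyadic dilate `φ_m(ξ) = φ(ξ / 2^m)`. -/
def dyadicDilate (m : ℕ) (φ : ℝ → ℂ) (ξ : ℝ) : ℂ :=
  φ (ξ / 2 ^ m)

/-- Convolution in the first variable: `(f *₁ k)(x, y) = ∫ f(x - s, y) k(s) ds`. -/
def convFst (f : ℝ × ℝ → ℂ) (k : ℝ → ℂ) (p : ℝ × ℝ) : ℂ :=
  ∫ s : ℝ, f (p.1 - s, p.2) * k s

/-- Convolution in the second variable: `(g *₂ k)(x, y) = ∫ g(x, y - s) k(s) ds`. -/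
def convSnd (g : ℝ × ℝ → ℂ) (k : ℝ → ℂ) (p : ℝ × ℝ) : ℂ :=
  ∫ s : ℝ, g (p.1, p.2 - s) * k s

/-- The integrand `(f *₁ φ̌_m)(x + t, y) (g *₂ φ̌_m)(x, y + t²) ρ(t)`, where `p = (x, y)`. -/
def parabolicIntegrand (ρ φ : ℝ → ℂ) (m : ℕ) (f g : ℝ × ℝ → ℂ) (p : ℝ × ℝ) (t : ℝ) : ℂ :=
  convFst f (invFourier (dyadicDilate m φ)) (p.1 + t, p.2) *
    convSnd g (invFourier (dyadicDilate m φ)) (p.1, p.2 + t ^ 2) * ρ t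

/-- The operator `T_m(f, g)(x, y)`, where `p = (x, y)`. -/
def parabolicT (ρ φ : ℝ → ℂ) (m : ℕ) (f g : ℝ × ℝ → ℂ) (p : ℝ × ℝ) : ℂ :=
  ∫ t : ℝ, parabolicIntegrand ρ φ m f g p t

end

/-! The idea is to compare the curve with its tangents and to analyse the resulting bilinear forms
by a local Fourier transform. Put `L = 2 ^ m`, `F = f *₁ φ̌_m` and `G = g *₂ φ̌_m`. Since `φ`
vanishes near the origin, `F` is `L⁻¹` times a derivative in `x`, and a derivative of `G` in `y`
costs `L`. By a reflection only `t > 0` matters.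

Let `δ = L ^ (-3/5)`. In time `δ` the parabola departs from its tangent by `δ²`, which is small
against the wavelength `1 / L`, so averages over the parabola may be replaced by averages over
pieces of length `δ` of its tangents (`tangentAverage`, `exists_bound_sub_tangentAverage`).
Expanding `F` and `G` at scale `δ` by `localFourier`, a tangential average becomes an integral in
`κ` that pairs the frequency `κ` of `F` in `x` with the frequency `κ / (2t)` of `G` in `y`. The
frequencies of `F` are of three kinds, relative to thresholds `R = L ^ (1/3)` and `d = L ^ (1/60)`.

* Low frequencies, `|κ| ≤ R`. The function `F` has frequency about `Lδ = L ^ (2/5)` in these units,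
  so little of its mass is there: `lintegral_localFourier_low_le`.
* High frequencies at which the local Fourier transform of `F` has more than the proportion `d⁻⁸` of
  its mass. They form a set of measure at most `d⁸`. With `κ = e^z`, the form is an average over
  translates along the curve `(t, -t², log 2t)` in space. Its Fourier multiplier decays in the third
  frequency, because differencing twice removes the quadratic phase
  (`exists_bound_oscillatory_log`); hence the second function may be spread out in `z`, and it then
  has little mass on sets of small measure: `exists_bound_sparse`.
* All other frequencies, where the local Fourier transform is flat. The form is written on the cells
  of side `δ` as the integral of `a(v, κ) b(u, κ) e^{2πiκ(u - v/(2t))}`, normalized by the masses of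
  `a` and `b`, and squared. The average over the slope `1 / (2t)` makes the contribution of pairs of
  distant frequencies small, and flatness that of close pairs: `exists_bound_flat`.

Each loss is at most `L ^ (-1/75)` (`exists_bound_curve_average`). All bounds are proved for the sum
of squares of the norms, and homogeneity turns this into their product. Young's inequality and
density carry the estimate from continuous functions of compact support to `L²`. -/

/-! ### Averages of translates as Fourier multipliers -/

open FourierTransform in
/-- The `L²` pairing with a translate, on the Fourier side: translation by `v` becomes
multiplication by the character `e^{-2πi⟨v, ξ⟩}`. -/
theorem inner_translate_eq_integral_fourier {E : Type*} [NormedAddCommGroup E]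
    [InnerProductSpace ℝ E] [FiniteDimensional ℝ E] [MeasurableSpace E] [BorelSpace E]
    (f g : Lp ℂ 2 (volume : Measure E)) (v : E) :
    inner ℂ g (Lp.compMeasurePreserving (fun x => x - v) (measurePreserving_sub_right volume v) f) =
      ∫ ξ, Complex.exp (-(2 * Real.pi * inner ℝ v ξ : ℝ) * Complex.I) *
        ((𝓕 f : Lp ℂ 2 (volume : Measure E)) ξ *
          (starRingEnd ℂ) ((𝓕 g : Lp ℂ 2 (volume : Measure E)) ξ)) := by
  set e : E → ℂ := fun ξ => Complex.exp ((2 * Real.pi * inner ℝ v ξ : ℝ) * Complex.I) with he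
  have hec : Continuous e := by fun_prop
  have hen : ∀ ξ, ‖e ξ‖ = 1 := fun ξ => Complex.norm_exp_ofReal_mul_I _
  have hG : MemLp (fun ξ => e ξ * (𝓕 g : Lp ℂ 2 (volume : Measure E)) ξ) 2
      (volume : Measure E) := by
    refine (Lp.memLp (𝓕 g : Lp ℂ 2 (volume : Measure E))).of_le ?_ ?_
    · exact hec.aestronglyMeasurable.mul (Lp.aestronglyMeasurable _)
    · exact Filter.Eventually.of_forall fun ξ => by simp [hen]
  have hR : ∀ f : Lp ℂ 2 (volume : Measure E),
      ∫ ξ, Complex.exp (-(2 * Real.pi * inner ℝ v ξ : ℝ) * Complex.I) *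
        ((𝓕 f : Lp ℂ 2 (volume : Measure E)) ξ *
          (starRingEnd ℂ) ((𝓕 g : Lp ℂ 2 (volume : Measure E)) ξ)) =
      inner ℂ (hG.toLp _) (𝓕 f : Lp ℂ 2 (volume : Measure E)) := by
    intro f
    rw [L2.inner_def]
    refine integral_congr_ae ?_
    filter_upwards [hG.coeFn_toLp] with ξ hξ
    rw [hξ]
    simp only [he, RCLike.inner_apply, map_mul, ← Complex.exp_conj, Complex.conj_I,
      Complex.conj_ofReal]
    rw [show -((2 * Real.pi * inner ℝ v ξ : ℝ) : ℂ) * Complex.I =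
      ((2 * Real.pi * inner ℝ v ξ : ℝ) : ℂ) * -Complex.I by ring]
    ring
  have hcont : Continuous (Lp.compMeasurePreserving (E := ℂ) (p := 2) (fun x : E => x - v)
      (measurePreserving_sub_right volume v)) := (Lp.isometry_compMeasurePreserving _).continuous
  have hF : Continuous (fun f : Lp ℂ 2 (volume : Measure E) =>
      (𝓕 f : Lp ℂ 2 (volume : Measure E))) := ContinuousFourier.continuous_fourier
  rw [hR]
  refine DenseRange.induction_on (p := fun f : Lp ℂ 2 (volume : Measure E) => inner ℂ g
    (Lp.compMeasurePreserving (fun x => x - v) (measurePreserving_sub_right volume v) f) =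
    inner ℂ (hG.toLp _) (𝓕 f : Lp ℂ 2 (volume : Measure E)))
    (SchwartzMap.denseRange_toLpCLM (E := E) (F := ℂ) (μ := volume) (p := 2) (by simp))
    f ?_ ?_
  · exact isClosed_eq (continuous_const.inner hcont) (continuous_const.inner hF)
  intro s
  rw [← MeasureTheory.Lp.inner_fourier_eq]
  have h1 : Lp.compMeasurePreserving (fun x : E => x - v) (measurePreserving_sub_right volume v)
      (SchwartzMap.toLpCLM ℝ ℂ 2 volume s) = (s.compSubConstCLM ℝ v).toLp 2 volume := by
    apply Lp.ext
    have hq := (measurePreserving_sub_right (volume : Measure E) v).quasiMeasurePreserving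
    filter_upwards [Lp.coeFn_compMeasurePreserving (SchwartzMap.toLpCLM ℝ ℂ 2 volume s)
      (measurePreserving_sub_right volume v), (s.compSubConstCLM ℝ v).coeFn_toLp 2 volume,
      hq.ae (s.coeFn_toLp 2 volume)] with x hx hx2 hx3
    rw [hx, hx2]
    exact hx3
  rw [h1, ← hR, L2.inner_def, SchwartzMap.toLp_fourier_eq]
  refine integral_congr_ae ?_
  have h2 : (𝓕 (SchwartzMap.toLpCLM ℝ ℂ 2 volume s) : Lp ℂ 2 (volume : Measure E)) =
    (𝓕 s).toLp 2 volume := SchwartzMap.toLp_fourier_eq s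
  filter_upwards [(𝓕 (s.compSubConstCLM ℝ v)).coeFn_toLp 2 volume,
    (𝓕 s).coeFn_toLp 2 volume] with ξ h3 h4
  rw [h2, h3, h4]
  have h5 : (𝓕 (s.compSubConstCLM ℝ v)) ξ =
      Complex.exp (-(2 * Real.pi * inner ℝ v ξ : ℝ) * Complex.I) * (𝓕 s) ξ := by
    rw [SchwartzMap.fourier_coe, SchwartzMap.fourier_coe]
    have := congrFun (VectorFourier.fourierIntegral_comp_add_right Real.fourierChar
      (volume : Measure E) (innerₗ E) (s : E → ℂ) (-v)) ξ
    have h6 : (s.compSubConstCLM ℝ v : E → ℂ) = s ∘ fun w => w + -v := by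
      ext x
      simp [sub_eq_add_neg]
    rw [h6]
    refine this.trans ?_
    rw [Circle.smul_def, Real.fourierChar_apply, smul_eq_mul]
    congr 2
    simp
  rw [h5]
  simp only [RCLike.inner_apply]
  ring

open FourierTransform in
/-- Averaging translates along a curve `γ` is a Fourier multiplier. If the multiplier of the average
along `γ`, minus that along the shifted curve `γ + e`, is bounded by `B`, then so is the
corresponding bilinear form on `L²`. -/
theorem norm_integral_inner_translate_sub_le {E : Type*} [NormedAddCommGroup E]
    [InnerProductSpace ℝ E] [FiniteDimensional ℝ E] [MeasurableSpace E] [BorelSpace E]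
    (f g : Lp ℂ 2 (volume : Measure E)) {γ : ℝ → E} (hγ : Measurable γ) {w : ℝ → ℝ}
    (hw : Integrable w) (e : E) {B : ℝ}
    (hB : ∀ ξ : E, ‖∫ t, (w t : ℂ) *
      (Complex.exp (-(2 * Real.pi * inner ℝ (γ t) ξ : ℝ) * Complex.I) -
        Complex.exp (-(2 * Real.pi * inner ℝ (γ t + e) ξ : ℝ) * Complex.I))‖ ≤ B) :
    ‖∫ t, (w t : ℂ) *
      (inner ℂ g (Lp.compMeasurePreserving (fun x => x - γ t)
          (measurePreserving_sub_right volume (γ t)) f) -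
        inner ℂ g (Lp.compMeasurePreserving (fun x => x - (γ t + e))
          (measurePreserving_sub_right volume (γ t + e)) f))‖ ≤ B * (‖f‖ * ‖g‖) := by
  set q : E → ℂ := fun ξ => (𝓕 f : Lp ℂ 2 (volume : Measure E)) ξ *
          (starRingEnd ℂ) ((𝓕 g : Lp ℂ 2 (volume : Measure E)) ξ) with hq
  have hqi : Integrable q := by
    have := L2.integrable_inner (𝕜 := ℂ) (𝓕 g : Lp ℂ 2 (volume : Measure E))
      (𝓕 f : Lp ℂ 2 (volume : Measure E))
    simpa only [RCLike.inner_apply] using this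
  have hqn : ∫ ξ, ‖q ξ‖ ≤ ‖f‖ * ‖g‖ := by
    have h1 := integral_mul_norm_le_Lp_mul_Lq (μ := (volume : Measure E)) (E := ℂ)
      (f := (𝓕 f : Lp ℂ 2 (volume : Measure E))) (g := (𝓕 g : Lp ℂ 2 (volume : Measure E)))
      Real.HolderConjugate.two_two (by simpa using Lp.memLp _) (by simpa using Lp.memLp _)
    have h2 : ∀ f : Lp ℂ 2 (volume : Measure E), (∫ a, ‖f a‖ ^ (2 : ℝ)) ^ (1 / (2 : ℝ)) = ‖f‖ := by
      intro f
      rw [← Real.sqrt_eq_rpow, Real.sqrt_eq_iff_mul_self_eq (integral_nonneg fun _ => by positivity)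
        (norm_nonneg _), ← sq, ← inner_self_eq_norm_sq (𝕜 := ℂ), L2.inner_def]
      simp only [inner_self_eq_norm_sq_to_K, Real.rpow_two]
      rw [← RCLike.ofReal_re (K := ℂ) (∫ a, ‖f a‖ ^ 2), ← integral_ofReal]
      simp
    rw [h2, h2, Lp.norm_fourier_eq, Lp.norm_fourier_eq] at h1
    refine le_trans (le_of_eq ?_) h1
    refine integral_congr_ae (Filter.Eventually.of_forall fun ξ => ?_)
    simp [hq]
  set K : ℝ → E → ℂ := fun t ξ =>
      (Complex.exp (-(2 * Real.pi * inner ℝ (γ t) ξ : ℝ) * Complex.I) -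
        Complex.exp (-(2 * Real.pi * inner ℝ (γ t + e) ξ : ℝ) * Complex.I)) with hK
  have hexp : ∀ v ξ : E, ‖Complex.exp (-(2 * Real.pi * inner ℝ v ξ : ℝ) * Complex.I)‖ = 1 := by
    intro v ξ
    rw [← Complex.ofReal_neg, Complex.norm_exp_ofReal_mul_I]
  have hei : ∀ v : E, Integrable fun ξ =>
      Complex.exp (-(2 * Real.pi * inner ℝ v ξ : ℝ) * Complex.I) * q ξ := by
    intro v
    refine hqi.bdd_mul (c := 1) (Continuous.aestronglyMeasurable (by fun_prop))
      (Filter.Eventually.of_forall fun ξ => (hexp v ξ).le)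
  have hKm : Measurable (fun p : ℝ × E => K p.1 p.2) := by
    have h1 : Measurable fun p : ℝ × E => inner ℝ (γ p.1) p.2 :=
      (hγ.comp measurable_fst).inner measurable_snd
    have h2 : Measurable fun p : ℝ × E => inner ℝ (γ p.1 + e) p.2 :=
      ((hγ.comp measurable_fst).add_const e).inner measurable_snd
    simp only [hK]
    fun_prop
  have hprod : Integrable (fun p : ℝ × E => (w p.1 : ℂ) * (K p.1 p.2 * q p.2))
      (volume.prod volume) := by
    have h1 : Integrable (fun p : ℝ × E => (w p.1 : ℂ) * q p.2) (volume.prod volume) :=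
      hw.ofReal.mul_prod hqi
    have h2 : Integrable (fun p : ℝ × E => K p.1 p.2 * ((w p.1 : ℂ) * q p.2))
        (volume.prod volume) := by
      refine h1.bdd_mul (c := 2) hKm.aestronglyMeasurable (Filter.Eventually.of_forall fun p => ?_)
      refine (norm_sub_le _ _).trans ?_
      rw [hexp, hexp]
      norm_num
    refine h2.congr (Filter.Eventually.of_forall fun p => ?_)
    simp only
    ring
  have h1 : ∀ t, (w t : ℂ) *
      (inner ℂ g (Lp.compMeasurePreserving (fun x => x - γ t)
          (measurePreserving_sub_right volume (γ t)) f) -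
        inner ℂ g (Lp.compMeasurePreserving (fun x => x - (γ t + e))
          (measurePreserving_sub_right volume (γ t + e)) f)) =
      ∫ ξ, (w t : ℂ) * (K t ξ * q ξ) := by
    intro t
    rw [inner_translate_eq_integral_fourier, inner_translate_eq_integral_fourier,
      ← integral_sub (hei _) (hei _), ← integral_const_mul]
    refine integral_congr_ae (Filter.Eventually.of_forall fun ξ => ?_)
    simp only [hK]
    ring
  simp_rw [h1]
  rw [integral_integral_swap hprod]
  have h3 : ∀ ξ, ∫ t, (w t : ℂ) * (K t ξ * q ξ) = (∫ t, (w t : ℂ) * K t ξ) * q ξ := by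
    intro ξ
    rw [← integral_mul_const]
    refine integral_congr_ae (Filter.Eventually.of_forall fun ξ => ?_)
    simp only
    ring
  simp_rw [h3]
  have hB0 : 0 ≤ B := (norm_nonneg _).trans (hB 0)
  calc ‖∫ ξ, (∫ t, (w t : ℂ) * K t ξ) * q ξ‖ ≤ ∫ ξ, B * ‖q ξ‖ := by
        refine norm_integral_le_of_norm_le (hqi.norm.const_mul B)
          (Filter.Eventually.of_forall fun ξ => ?_)
        rw [norm_mul]
        exact mul_le_mul_of_nonneg_right (hB ξ) (norm_nonneg _)
    _ ≤ B * (‖f‖ * ‖g‖) := by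
        rw [integral_const_mul]
        exact mul_le_mul_of_nonneg_left hqn hB0

/-- The inner product of nonnegative functions as a Lebesgue integral. -/
theorem inner_translate_toLp_eq_lintegral {E : Type*} [NormedAddCommGroup E]
    [InnerProductSpace ℝ E] [FiniteDimensional ℝ E] [MeasurableSpace E] [BorelSpace E]
    {a c : E → ENNReal} (ha : Measurable a) (hc : Measurable c)
    (ha' : ∀ᵐ x, a x ≠ ⊤) (hc' : ∀ᵐ x, c x ≠ ⊤)
    (hf : MemLp (fun x => ((c x).toReal : ℂ)) 2 (volume : Measure E))
    (hg : MemLp (fun x => ((a x).toReal : ℂ)) 2 (volume : Measure E)) (v : E) :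
    inner ℂ (hg.toLp _) (Lp.compMeasurePreserving (fun x => x - v)
      (measurePreserving_sub_right volume v) (hf.toLp _)) =
      (((∫⁻ x, a x * c (x - v)).toReal : ℝ) : ℂ) ∧ ∫⁻ x, a x * c (x - v) ≠ ⊤ := by
  have hq := (measurePreserving_sub_right (volume : Measure E) v).quasiMeasurePreserving
  have hint := L2.integrable_inner (𝕜 := ℂ) (hg.toLp _) (Lp.compMeasurePreserving (fun x => x - v)
      (measurePreserving_sub_right volume v) (hf.toLp _))
  have hae : (fun x => inner ℂ ((hg.toLp _ : Lp ℂ 2 (volume : Measure E)) x)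
      ((Lp.compMeasurePreserving (fun x => x - v)
      (measurePreserving_sub_right volume v) (hf.toLp _) : Lp ℂ 2 (volume : Measure E)) x))
      =ᵐ[volume]
      fun x => (((a x * c (x - v)).toReal : ℝ) : ℂ) := by
    filter_upwards [hg.coeFn_toLp, Lp.coeFn_compMeasurePreserving (hf.toLp _)
      (measurePreserving_sub_right volume v), hq.ae hf.coeFn_toLp] with x h1 h2 h3
    rw [h1, h2, Function.comp_apply, h3]
    simp [mul_comm]
  have hfin : ∀ᵐ x, a x * c (x - v) ≠ ⊤ := by
    filter_upwards [ha', hq.ae hc'] with x h1 h2 using ENNReal.mul_ne_top h1 h2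
  have hmeas : Measurable fun x => a x * c (x - v) := ha.mul (hc.comp (measurable_id.sub_const v))
  have hint2 : Integrable fun x => (a x * c (x - v)).toReal := by
    have := (hint.congr hae).re
    simpa using this
  constructor
  · rw [L2.inner_def, integral_congr_ae hae, integral_complex_ofReal,
      integral_toReal hmeas.aemeasurable (hfin.mono fun x hx => lt_top_iff_ne_top.2 hx)]
  · have h1 := hint2.lintegral_lt_top
    have h2 : ∫⁻ x, a x * c (x - v) = ∫⁻ x, ENNReal.ofReal (a x * c (x - v)).toReal := by
      refine lintegral_congr_ae ?_
      filter_upwards [hfin] with x hx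
      rw [ENNReal.ofReal_toReal hx]
    rw [h2]
    exact h1.ne

/-- The bilinear form of the average along `γ` compared with that along the shifted curve `γ + e`,
for nonnegative functions, with a sum of squares in place of a product. -/
theorem lintegral_curve_translate_le {E : Type*} [NormedAddCommGroup E]
    [InnerProductSpace ℝ E] [FiniteDimensional ℝ E] [MeasurableSpace E] [BorelSpace E]
    {a c : E → ENNReal} (ha : Measurable a) (hc : Measurable c)
    {γ : ℝ → E} (hγ : Measurable γ) {w : ℝ → ℝ}
    (hw : Integrable w) (hw0 : ∀ t, 0 ≤ w t) (e : E) {B : ℝ}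
    (hB : ∀ ξ : E, ‖∫ t, (w t : ℂ) *
      (Complex.exp (-(2 * Real.pi * inner ℝ (γ t) ξ : ℝ) * Complex.I) -
        Complex.exp (-(2 * Real.pi * inner ℝ (γ t + e) ξ : ℝ) * Complex.I))‖ ≤ B) (hBp : 0 < B) :
    ∫⁻ t, ENNReal.ofReal (w t) * ∫⁻ x, a x * c (x - γ t) ≤
      (∫⁻ t, ENNReal.ofReal (w t) * ∫⁻ x, a x * c (x - (γ t + e))) +
        ENNReal.ofReal B * ((∫⁻ x, a x ^ 2) + ∫⁻ x, c x ^ 2) := by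
  by_cases ha2 : ∫⁻ x, a x ^ 2 = ⊤
  · simp [ha2, ENNReal.mul_top, hBp]
  by_cases hc2 : ∫⁻ x, c x ^ 2 = ⊤
  · simp [hc2, ENNReal.mul_top, hBp]
  have hfin : ∀ {b : E → ENNReal}, Measurable b → ∫⁻ x, b x ^ 2 ≠ ⊤ → ∀ᵐ x, b x ≠ ⊤ := by
    intro b hb hb2
    filter_upwards [ae_lt_top (hb.pow_const 2) hb2] with x hx h
    simp [h] at hx
  have hnorm : ∀ {b : E → ENNReal}, (∀ᵐ x, b x ≠ ⊤) →
      ∫⁻ x, ‖((b x).toReal : ℂ)‖ₑ ^ 2 = ∫⁻ x, b x ^ 2 := by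
    intro b hb
    refine lintegral_congr_ae ?_
    filter_upwards [hb] with x hx
    have h0 : ‖((b x).toReal : ℂ)‖ₑ = b x := by
      rw [← ofReal_norm, Complex.norm_real, Real.norm_of_nonneg ENNReal.toReal_nonneg,
        ENNReal.ofReal_toReal hx]
    rw [h0]
  have hmem : ∀ {b : E → ENNReal}, Measurable b → ∫⁻ x, b x ^ 2 ≠ ⊤ →
      MemLp (fun x => ((b x).toReal : ℂ)) 2 (volume : Measure E) := by
    intro b hb hb2
    refine ⟨(Complex.measurable_ofReal.comp hb.ennreal_toReal).aestronglyMeasurable, ?_⟩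
    rw [eLpNorm_lt_top_iff_lintegral_rpow_enorm_lt_top (by simp) (by simp)]
    simpa [hnorm (hfin hb hb2)] using lt_top_iff_ne_top.2 hb2
  have hnormLp : ∀ {b : E → ENNReal} (hb : Measurable b) (hb2 : ∫⁻ x, b x ^ 2 ≠ ⊤),
      ENNReal.ofReal (‖(hmem hb hb2).toLp _‖ ^ 2) = ∫⁻ x, b x ^ 2 := by
    intro b hb hb2
    rw [Lp.norm_toLp, ENNReal.ofReal_pow ENNReal.toReal_nonneg,
      ENNReal.ofReal_toReal (hmem hb hb2).eLpNorm_ne_top,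
      eLpNorm_eq_lintegral_rpow_enorm_toReal (by simp) (by simp), ← ENNReal.rpow_natCast,
      ← ENNReal.rpow_mul]
    simp [hnorm (hfin hb hb2)]
  set f := (hmem hc hc2).toLp _ with hf
  set g := (hmem ha ha2).toLp _ with hg
  have hP : ∀ v, inner ℂ g (Lp.compMeasurePreserving (fun x => x - v)
      (measurePreserving_sub_right volume v) f) =
      (((∫⁻ x, a x * c (x - v)).toReal : ℝ) : ℂ) ∧ ∫⁻ x, a x * c (x - v) ≠ ⊤ :=
    fun v => inner_translate_toLp_eq_lintegral ha hc (hfin ha ha2) (hfin hc hc2) _ _ v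
  set p : E → ℝ := fun v => (∫⁻ x, a x * c (x - v)).toReal with hp
  have hpP : ∀ v, ∫⁻ x, a x * c (x - v) = ENNReal.ofReal (p v) :=
    fun v => (ENNReal.ofReal_toReal (hP v).2).symm
  have hp0 : ∀ v, 0 ≤ p v := fun v => ENNReal.toReal_nonneg
  have hpm : Measurable p := by
    apply Measurable.ennreal_toReal
    apply Measurable.lintegral_prod_right'
      (f := fun q : E × E => a q.2 * c (q.2 - q.1))
    fun_prop
  have hpb : ∀ v, ‖p v‖ ≤ ‖g‖ * ‖f‖ := by
    intro v
    have h1 := norm_inner_le_norm (𝕜 := ℂ) g (Lp.compMeasurePreserving (fun x => x - v)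
      (measurePreserving_sub_right volume v) f)
    rw [(hP v).1, Lp.norm_compMeasurePreserving, Complex.norm_real] at h1
    exact h1
  have hwi : ∀ {η : ℝ → E}, Measurable η → Integrable fun t => w t * p (η t) := by
    intro η hη
    have := hw.bdd_mul (c := ‖g‖ * ‖f‖) (hpm.comp hη).aestronglyMeasurable
      (Filter.Eventually.of_forall fun t => hpb (η t))
    exact this.congr (Filter.Eventually.of_forall fun t => mul_comm _ _)
  have hlin : ∀ {η : ℝ → E}, Measurable η →
      ∫⁻ t, ENNReal.ofReal (w t) * ∫⁻ x, a x * c (x - η t) =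
        ENNReal.ofReal (∫ t, w t * p (η t)) := by
    intro η hη
    rw [ofReal_integral_eq_lintegral_ofReal (hwi hη)
      (Filter.Eventually.of_forall fun t => mul_nonneg (hw0 t) (hp0 _))]
    refine lintegral_congr fun t => ?_
    rw [hpP, ENNReal.ofReal_mul (hw0 t)]
  have key := norm_integral_inner_translate_sub_le f g hγ hw e hB
  have hγe : Measurable fun t => γ t + e := hγ.add_const e
  have h2 : ∫ t, (w t : ℂ) *
      (inner ℂ g (Lp.compMeasurePreserving (fun x => x - γ t)
          (measurePreserving_sub_right volume (γ t)) f) -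
        inner ℂ g (Lp.compMeasurePreserving (fun x => x - (γ t + e))
          (measurePreserving_sub_right volume (γ t + e)) f)) =
      (((∫ t, w t * p (γ t)) - ∫ t, w t * p (γ t + e) : ℝ) : ℂ) := by
    rw [← integral_sub (hwi hγ) (hwi hγe), ← integral_complex_ofReal]
    refine integral_congr_ae (Filter.Eventually.of_forall fun t => ?_)
    simp only
    rw [(hP _).1, (hP _).1]
    push_cast
    ring
  rw [h2, Complex.norm_real] at key
  have h3 : ∫ t, w t * p (γ t) ≤ (∫ t, w t * p (γ t + e)) + B * (‖g‖ ^ 2 + ‖f‖ ^ 2) := by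
    have h4 := (le_abs_self _).trans key
    nlinarith [mul_le_mul_of_nonneg_left (two_mul_le_add_sq ‖f‖ ‖g‖) hBp.le,
      mul_nonneg hBp.le (mul_nonneg (norm_nonneg f) (norm_nonneg g))]
  rw [hlin hγ, hlin hγe, ← hnormLp ha ha2, ← hnormLp hc hc2,
    ← ENNReal.ofReal_add (by positivity) (by positivity), ← ENNReal.ofReal_mul hBp.le,
    ← ENNReal.ofReal_add (integral_nonneg fun t => mul_nonneg (hw0 t) (hp0 _)) (by positivity)]
  exact ENNReal.ofReal_le_ofReal h3

/-! ### Oscillatory integrals with logarithmic phase -/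

/-- Weyl differencing: squaring an integral trades the integrand for its multiplicative
differences. -/
theorem enorm_integral_sq_le_lintegral_diff {f : ℝ → ℂ} (hf : Integrable f) :
    ‖∫ t, f t‖ₑ ^ 2 ≤ ∫⁻ h, ‖∫ t, f (t + h) * (starRingEnd ℂ) (f t)‖ₑ := by
  have hfc : Integrable (fun t => (starRingEnd ℂ) (f t)) := by
    simpa using (Complex.conjCLE.integrable_comp_iff (φ := f)).2 hf
  have h0 : Integrable (fun p : ℝ × ℝ => f p.1 * (starRingEnd ℂ) (f p.2))
      (volume.prod volume) := hf.mul_prod hfc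
  have h1 : Integrable (fun p : ℝ × ℝ => f (p.2 + p.1) * (starRingEnd ℂ) (f p.2))
      (volume.prod volume) := by
    have hmp : MeasurePreserving (fun p : ℝ × ℝ => (p.2 + p.1, p.2)) (volume.prod volume)
        (volume.prod volume) :=
      Measure.measurePreserving_swap.comp (measurePreserving_prod_add_swap volume volume)
    exact hmp.integrable_comp_of_integrable h0
  have h2 : (∫ t, f t) * (starRingEnd ℂ) (∫ t, f t) =
      ∫ h, ∫ t, f (t + h) * (starRingEnd ℂ) (f t) := by
    rw [integral_integral_swap h1, ← integral_conj, ← integral_const_mul]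
    refine integral_congr_ae (Filter.Eventually.of_forall fun t => ?_)
    simp only
    rw [integral_mul_const, integral_add_left_eq_self]
  calc ‖∫ t, f t‖ₑ ^ 2 = ‖(∫ t, f t) * (starRingEnd ℂ) (∫ t, f t)‖ₑ := by
        rw [enorm_mul, sq, RCLike.enorm_conj]
    _ ≤ _ := by
        rw [h2]
        exact enorm_integral_le_lintegral_enorm _

theorem lintegral_mul_sq_le {α : Type*} [MeasurableSpace α] {μ : Measure α} {f g : α → ENNReal}
    (hf : AEMeasurable f μ) (hg : AEMeasurable g μ) :
    (∫⁻ x, f x * g x ∂μ) ^ 2 ≤ (∫⁻ x, f x ^ 2 ∂μ) * ∫⁻ x, g x ^ 2 ∂μ := by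
  have h := ENNReal.lintegral_mul_le_Lp_mul_Lq μ Real.HolderConjugate.two_two hf hg
  have h2 := pow_le_pow_left' h 2
  rw [mul_pow, ← ENNReal.rpow_natCast, ← ENNReal.rpow_natCast, ← ENNReal.rpow_natCast,
    ← ENNReal.rpow_mul, ← ENNReal.rpow_mul] at h2
  simpa using h2

/-- Oscillatory integrals with a smooth amplitude: one integration by parts, with the amplitude
`Ψ` written as `K g'`. -/
theorem norm_integral_exp_le_of_mul_deriv {K g Ψ : ℝ → ℝ} (hK : ContDiff ℝ 1 K)
    (hKc : HasCompactSupport K) (hg : ContDiff ℝ 1 g) {c : ℝ}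
    (hΨ : ∀ t, K t * deriv g t = c * Ψ t) (ζ : ℝ) :
    |ζ| * |c| * ‖∫ t, (Ψ t : ℂ) * Complex.exp ((ζ * g t : ℝ) * Complex.I)‖ ≤
      ∫ t, |deriv K t| := by
  set Z : ℝ → ℂ := fun t => (K t : ℂ) * Complex.exp ((ζ * g t : ℝ) * Complex.I) with hZ
  set Z1 : ℝ → ℂ := fun t =>
    ((deriv K t : ℝ) : ℂ) * Complex.exp ((ζ * g t : ℝ) * Complex.I) with hZ1
  set Z2 : ℝ → ℂ := fun t => (Ψ t : ℂ) * Complex.exp ((ζ * g t : ℝ) * Complex.I) with hZ2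
  have hd : ∀ t, HasDerivAt Z (Z1 t + (ζ * c : ℝ) * Complex.I * Z2 t) t := by
    intro t
    have h1 : HasDerivAt (fun t => (K t : ℂ)) ((deriv K t : ℝ) : ℂ) t :=
      (hK.differentiable (by simp) t).hasDerivAt.ofReal_comp
    have h2 : HasDerivAt (fun t => ((ζ * g t : ℝ) : ℂ) * Complex.I)
        (((ζ * deriv g t : ℝ) : ℂ) * Complex.I) t :=
      (((hg.differentiable (by simp) t).hasDerivAt.const_mul ζ).ofReal_comp).mul_const _
    convert! h1.mul h2.cexp using 1
    have h3 : (K t : ℂ) * ((deriv g t : ℝ) : ℂ) = (c : ℂ) * (Ψ t : ℂ) := by exact_mod_cast hΨ t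
    simp only [hZ1, hZ2]
    push_cast
    linear_combination (-(ζ : ℂ) * Complex.I * Complex.exp ((ζ : ℂ) * (g t : ℂ) * Complex.I)) * h3
  have hK1 : Continuous (deriv K) := hK.continuous_deriv (by simp)
  have hKc1 : HasCompactSupport (deriv K) := hKc.deriv
  have hgc := hg.continuous
  have hKcc := hK.continuous
  have hZi : Integrable Z := by
    refine Continuous.integrable_of_hasCompactSupport (by fun_prop) ?_
    exact (hKc.comp_left (g := fun x : ℝ => (x : ℂ)) (by simp)).mul_right
  have hZ1i : Integrable Z1 := by
    refine Continuous.integrable_of_hasCompactSupport (by fun_prop) ?_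
    exact (hKc1.comp_left (g := fun x : ℝ => (x : ℂ)) (by simp)).mul_right
  have hgd : Continuous (deriv g) := hg.continuous_deriv (by simp)
  have hZ2i : Integrable fun t => (ζ * c : ℝ) * Complex.I * Z2 t := by
    have h4 : Integrable fun t => ((ζ : ℂ) * Complex.I) *
        (((K t * deriv g t : ℝ) : ℂ) * Complex.exp ((ζ * g t : ℝ) * Complex.I)) := by
      refine Continuous.integrable_of_hasCompactSupport (by fun_prop) ?_
      exact (((hKc.mul_right (f' := deriv g)).comp_left
        (g := fun x : ℝ => (x : ℂ)) (by simp)).mul_right).mul_left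
    refine h4.congr (Filter.Eventually.of_forall fun t => ?_)
    simp only [hΨ, hZ2]
    push_cast
    ring
  have h5 := integral_eq_zero_of_hasDerivAt_of_integrable hd (hZ1i.add hZ2i) hZi
  rw [integral_add hZ1i hZ2i, integral_const_mul] at h5
  have h6 : |ζ| * |c| * ‖∫ t, Z2 t‖ = ‖∫ t, Z1 t‖ := by
    rw [← norm_neg (∫ t, Z1 t), ← eq_neg_of_add_eq_zero_right h5, norm_mul, norm_mul,
      Complex.norm_real, Complex.norm_I, mul_one, Real.norm_eq_abs, abs_mul]
  rw [h6]
  refine (norm_integral_le_integral_norm _).trans (le_of_eq ?_)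
  refine integral_congr_ae (Filter.Eventually.of_forall fun t => ?_)
  simp only [hZ1, norm_mul, Complex.norm_exp_ofReal_mul_I, Complex.norm_real, mul_one,
    Real.norm_eq_abs]

theorem exists_contDiff_eq_one_of_mem_Icc {a b : ℝ} (a' b' : ℝ) (ha : a' < a)
    (hb : b < b') :
    ∃ w : ℝ → ℝ, ContDiff ℝ ∞ w ∧ HasCompactSupport w ∧ (∀ t ∈ Set.Icc a b, w t = 1) ∧
      tsupport w ⊆ Set.Icc a' b' ∧ ∀ t, w t ∈ Set.Icc (0 : ℝ) 1 := by
  obtain ⟨f, hf1, hf2, hf3, hf4⟩ := exists_contMDiff_support_eq_eq_one_iff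
    (modelWithCornersSelf ℝ ℝ) (n := (⊤ : ℕ∞)) (s := Set.Ioo a' b') (t := Set.Icc a b) isOpen_Ioo
    isClosed_Icc (fun x hx => ⟨ha.trans_le hx.1, hx.2.trans_lt hb⟩)
  have hts : tsupport f ⊆ Set.Icc a' b' := by
    rw [tsupport, hf3]
    exact closure_minimal Set.Ioo_subset_Icc_self isClosed_Icc
  exact ⟨f, hf1.contDiff, HasCompactSupport.of_support_subset_isCompact isCompact_Icc
    (subset_tsupport f |>.trans hts), fun t ht => (hf4 t).1 ht, hts,
    fun t => hf2 (Set.mem_range_self t)⟩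

/-- A smooth function on the line agreeing with `φ` on `[a, b]`, where `φ` is smooth on a
neighbourhood of `[a, b]`. -/
theorem exists_contDiff_eqOn_Ioo {φ : ℝ → ℝ} {a b a' b' : ℝ} (ha : a' < a)
    (hb : b < b') (hφ : ∀ t ∈ Set.Icc a' b', ContDiffAt ℝ ∞ φ t) :
    ∃ ℓ : ℝ → ℝ, ContDiff ℝ ∞ ℓ ∧ ∀ t ∈ Set.Icc a b, ℓ t = φ t := by
  obtain ⟨w, h1, h2, h3, h4, -⟩ := exists_contDiff_eq_one_of_mem_Icc a' b' ha hb
  refine ⟨fun t => w t * φ t, ?_, fun t ht => by simp [h3 t ht]⟩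
  refine contDiff_iff_contDiffAt.2 fun t => ?_
  by_cases ht : t ∈ tsupport w
  · exact h1.contDiffAt.mul (hφ t (h4 ht))
  · refine contDiffAt_const (c := (0 : ℝ)) |>.congr_of_eventuallyEq ?_
    filter_upwards [notMem_tsupport_iff_eventuallyEq.1 ht] with s hs
    simp [hs]

/-- The phase and amplitude after differencing twice. The quadratic part of the phase becomes
constant, and the difference `g` of the logarithms has derivative
`hh'(2t + h + h') / (t(t + h)(t + h')(t + h + h'))`. -/
theorem exists_bound_deriv_differenced_amplitude {w : ℝ → ℝ} (hw : ContDiff ℝ ∞ w)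
    (hws : tsupport w ⊆ Set.Icc (1 / 4) (9 / 4)) :
    ∃ ℓ : ℝ → ℝ, ContDiff ℝ ∞ ℓ ∧ (∀ t ∈ Set.Icc (1 / 4 : ℝ) (9 / 4), ℓ t = Real.log t) ∧
    ∃ C : ℝ, 0 ≤ C ∧ ∀ h h' : ℝ, ∃ K : ℝ → ℝ, ContDiff ℝ 1 K ∧ HasCompactSupport K ∧
      (∫ t, |deriv K t|) ≤ C ∧
      ∀ t, K t * deriv (fun t => ℓ (t + h + h') + ℓ t - ℓ (t + h) - ℓ (t + h')) t =
        (h * h') * (w (t + h + h') * w (t + h') * w (t + h) * w t) := by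
  obtain ⟨ℓ, hℓ, hℓe⟩ := exists_contDiff_eqOn_Ioo (φ := Real.log) (a := 1 / 5) (b := 10)
    (a' := 1 / 6) (b' := 11) (by norm_num) (by norm_num)
    (fun t ht => Real.contDiffAt_log.2 (by have := ht.1; intro h; norm_num [h] at this))
  obtain ⟨p, hp, hpe⟩ := exists_contDiff_eqOn_Ioo (φ := fun t => t⁻¹) (a := 1 / 5) (b := 10)
    (a' := 1 / 6) (b' := 11) (by norm_num) (by norm_num)
    (fun t ht => contDiffAt_inv ℝ (by have := ht.1; intro h; norm_num [h] at this))
  have hw0 : ∀ t, w t ≠ 0 → t ∈ Set.Icc (1 / 4 : ℝ) (9 / 4) := fun t ht =>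
    hws (subset_tsupport w ht)
  have hℓd : ∀ t ∈ Set.Icc (1 / 4 : ℝ) (9 / 4), HasDerivAt ℓ t⁻¹ t := by
    intro t ht
    have ht0 : t ≠ 0 := by
      have := ht.1
      intro h
      norm_num [h] at this
    refine (Real.hasDerivAt_log ht0).congr_of_eventuallyEq ?_
    filter_upwards [Icc_mem_nhds (a := (1 / 5 : ℝ)) (b := 10) (by linarith [ht.1])
      (by linarith [ht.2])] with s hs using hℓe s hs
  refine ⟨ℓ, hℓ, fun t ht => hℓe t ⟨by linarith [ht.1], by linarith [ht.2]⟩, ?_⟩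
  set 𝒦 : ℝ × ℝ × ℝ → ℝ := fun q =>
    (w (q.1 + q.2.1 + q.2.2) * w (q.1 + q.2.2) * w (q.1 + q.2.1) * w q.1) *
    ((q.1 + q.2.1 + q.2.2) * (q.1 + q.2.2) * (q.1 + q.2.1) * q.1) *
      p (2 * q.1 + q.2.1 + q.2.2) with h𝒦
  have h𝒦s : ContDiff ℝ ∞ 𝒦 := by fun_prop
  have hsupp : ∀ q, 𝒦 q ≠ 0 → q ∈ Set.Icc (1 / 4 : ℝ) (9 / 4) ×ˢ
      (Set.Icc (-2 : ℝ) 2 ×ˢ Set.Icc (-2 : ℝ) 2) := by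
    intro q hq
    simp only [h𝒦, mul_ne_zero_iff] at hq
    obtain ⟨⟨⟨⟨⟨h1, h2⟩, h3⟩, h4⟩, -⟩, -⟩ := hq
    have h2 := hw0 _ h2
    have h3 := hw0 _ h3
    have h4 := hw0 _ h4
    simp only [Set.mem_Icc] at h2 h3 h4
    simp only [Set.mem_prod, Set.mem_Icc]
    refine ⟨h4, ⟨?_, ?_⟩, ?_, ?_⟩ <;> linarith [h4.1, h4.2, h3.1, h3.2, h2.1, h2.2]
  have h𝒦c : HasCompactSupport 𝒦 := HasCompactSupport.of_support_subset_isCompact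
    (isCompact_Icc.prod (isCompact_Icc.prod isCompact_Icc)) hsupp
  obtain ⟨L, hL⟩ := (h𝒦s.of_le (by simp)).lipschitzWith_of_hasCompactSupport h𝒦c one_ne_zero
  refine ⟨2 * L, by positivity, fun h h' => ⟨fun t => 𝒦 (t, h, h'), ?_, ?_, ?_, ?_⟩⟩
  · exact (h𝒦s.comp (by fun_prop : ContDiff ℝ ∞ fun t : ℝ => (t, h, h'))).of_le (by simp)
  · exact HasCompactSupport.of_support_subset_isCompact (isCompact_Icc (a := (1 / 4 : ℝ))
      (b := 9 / 4)) fun t ht => (hsupp _ ht).1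
  · have h1 : ∀ t, |deriv (fun t => 𝒦 (t, h, h')) t| ≤ L := by
      intro t
      have h2 : LipschitzWith L fun t => 𝒦 (t, h, h') := by
        have := hL.comp (LipschitzWith.of_dist_le_mul (K := 1) (f := fun t : ℝ => (t, h, h'))
          (fun a b => by simp [Prod.dist_eq]))
        rw [mul_one] at this
        exact this
      exact norm_deriv_le_of_lipschitz h2
    have h3 : ∀ t, t ∉ Set.Icc (1 / 4 : ℝ) (9 / 4) → |deriv (fun t => 𝒦 (t, h, h')) t| = 0 := by
      intro t ht
      rw [abs_eq_zero]
      by_contra hne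
      have h4 : t ∈ tsupport (fun t => 𝒦 (t, h, h')) :=
        support_deriv_subset (f := fun t => 𝒦 (t, h, h')) (by simpa using hne)
      refine ht ((closure_minimal (fun t ht => (hsupp (t, h, h') ht).1) isClosed_Icc) h4)
    rw [← setIntegral_eq_integral_of_forall_compl_eq_zero (s := Set.Icc (1 / 4 : ℝ) (9 / 4)) h3]
    have h5 := norm_setIntegral_le_of_norm_le_const (μ := volume) (s := Set.Icc (1 / 4 : ℝ) (9 / 4))
      (f := fun t => |deriv (fun t => 𝒦 (t, h, h')) t|) (C := L) (by simp)
      (fun t _ => by simpa using h1 t)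
    refine (le_abs_self _).trans (h5.trans (le_of_eq ?_))
    rw [Real.volume_real_Icc]
    norm_num [mul_comm]
  · intro t
    by_cases hz : w (t + h + h') * w (t + h') * w (t + h) * w t = 0
    · simp [h𝒦, hz]
    simp only [mul_eq_zero, not_or] at hz
    have h1 := hw0 _ hz.1.1.1
    have h2 := hw0 _ hz.1.1.2
    have h3 := hw0 _ hz.1.2
    have h4 := hw0 _ hz.2
    have hd : HasDerivAt (fun t => ℓ (t + h + h') + ℓ t - ℓ (t + h) - ℓ (t + h'))
        ((t + h + h')⁻¹ + t⁻¹ - (t + h)⁻¹ - (t + h')⁻¹) t := by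
      have e1 : HasDerivAt (fun t => ℓ (t + h + h')) (t + h + h')⁻¹ t := by
        rw [add_assoc] at h1 ⊢
        simpa only [add_assoc] using (hℓd _ h1).comp_add_const t (h + h')
      exact ((e1.add (hℓd _ h4)).sub ((hℓd _ h3).comp_add_const t h)).sub
        ((hℓd _ h2).comp_add_const t h')
    rw [hd.deriv]
    simp only [Set.mem_Icc] at h1 h2 h3 h4
    have n1 : t + h + h' ≠ 0 := by linarith [h1.1]
    have n2 : t + h' ≠ 0 := by linarith [h2.1]
    have n3 : t + h ≠ 0 := by linarith [h3.1]
    have n4 : t ≠ 0 := by linarith [h4.1]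
    have n5 : t * 2 + h + h' ≠ 0 := by linarith [h4.1, h1.1]
    simp only [h𝒦]
    rw [hpe (2 * t + h + h') ⟨by linarith [h4.1, h1.1], by linarith [h4.2, h1.2]⟩]
    have e : (t + h + h')⁻¹ + t⁻¹ - (t + h)⁻¹ - (t + h')⁻¹ = h * h' * (2 * t + h + h') *
        ((t + h + h')⁻¹ * (t + h')⁻¹ * (t + h)⁻¹ * t⁻¹) := by
      field_simp
      ring
    rw [e, mul_comm 2 t]
    field_simp

theorem lintegral_abs_rpow_neg_half_lt_top (a : ℝ) :
    ∫⁻ h in Set.Icc (-a) a, ENNReal.ofReal (|h| ^ (-(1 / 2) : ℝ)) < ⊤ := by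
  have h1 : IntegrableOn (fun x : ℝ => |x| ^ (-(1 / 2) : ℝ)) (Set.Ioc 0 |a|) := by
    have h2 := (intervalIntegrable_iff_integrableOn_Ioc_of_le (abs_nonneg a)).1
      (intervalIntegral.intervalIntegrable_rpow' (a := 0) (b := |a|) (r := -(1 / 2)) (by norm_num))
    exact h2.congr_fun (fun x hx => by simp only [abs_of_pos hx.1]) measurableSet_Ioc
  have h3 : IntegrableOn (fun x : ℝ => |x| ^ (-(1 / 2) : ℝ)) (Set.Ico (-|a|) 0) := by
    have h4 := h1.comp_neg
    simpa using h4
  have h5 : IntegrableOn (fun x : ℝ => |x| ^ (-(1 / 2) : ℝ)) (Set.Icc (-a) a) := by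
    have h6 : IntegrableOn (fun x : ℝ => |x| ^ (-(1 / 2) : ℝ)) {(0 : ℝ)} := by simp
    refine ((h1.union h3).union h6).mono_set fun x hx => ?_
    have hb := le_abs_self a
    rcases lt_trichotomy x 0 with h | h | h
    · left; right; exact ⟨by linarith [hx.1], h⟩
    · right; exact h
    · left; left; exact ⟨h, by linarith [hx.2]⟩
  have h7 := h5.lintegral_lt_top
  exact h7

/-- Van der Corput's estimate for the phases `αt + βt² + ζ log t`, uniform in `α` and `β`. -/
theorem exists_bound_oscillatory_log {w : ℝ → ℝ} (hw : ContDiff ℝ ∞ w)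
    (hws : tsupport w ⊆ Set.Icc (1 / 4) (9 / 4)) :
    ∃ C : ℝ, 0 < C ∧ ∀ α β ζ : ℝ, ζ ≠ 0 →
      ‖∫ t, (w t : ℂ) * Complex.exp ((α * t + β * t ^ 2 + ζ * Real.log t : ℝ) * Complex.I)‖ ≤
        C * |ζ| ^ (-(1 / 8) : ℝ) := by
  obtain ⟨ℓ, hℓ, hℓe, C₁, hC₁, hK⟩ := exists_bound_deriv_differenced_amplitude hw hws
  have hw0 : ∀ t, w t ≠ 0 → t ∈ Set.Icc (1 / 4 : ℝ) (9 / 4) := fun t ht =>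
    hws (subset_tsupport w ht)
  have hwc : HasCompactSupport w := HasCompactSupport.of_support_subset_isCompact isCompact_Icc
    (fun t ht => hw0 t ht)
  have hwcont := hw.continuous
  have hℓcont := hℓ.continuous
  obtain ⟨A, hA⟩ := hwcont.bounded_above_of_compact_support hwc
  have hA0 : 0 ≤ A := (norm_nonneg _).trans (hA 0)
  set I : Set ℝ := Set.Icc (-2) 2 with hI
  set M : ENNReal := ∫⁻ h in I, ENNReal.ofReal (|h| ^ (-(1 / 2) : ℝ)) with hM
  have hMtop : M ≠ ⊤ := (lintegral_abs_rpow_neg_half_lt_top 2).ne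
  set C₂ : ℝ := C₁ + 2 * A ^ 4 with hC₂
  have hC₂0 : 0 ≤ C₂ := by positivity
  refine ⟨(4 * (C₂ * (M.toReal * M.toReal)) + 1) ^ (1 / 4 : ℝ), by positivity,
    fun α β ζ hζ => ?_⟩
  set φ : ℝ → ℝ := fun t => α * t + β * t ^ 2 + ζ * ℓ t with hφ
  set f : ℝ → ℂ := fun t => (w t : ℂ) * Complex.exp ((φ t : ℝ) * Complex.I) with hf
  have hfe : ∫ t, (w t : ℂ) * Complex.exp
      ((α * t + β * t ^ 2 + ζ * Real.log t : ℝ) * Complex.I) = ∫ t, f t := by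
    refine integral_congr_ae (Filter.Eventually.of_forall fun t => ?_)
    by_cases ht : w t = 0
    · simp [hf, ht]
    · simp only [hf, hφ]
      rw [hℓe t (hw0 t ht)]
  rw [hfe]
  have hfcont : Continuous f := by fun_prop
  have hfc : HasCompactSupport f :=
    (hwc.comp_left (g := fun x : ℝ => (x : ℂ)) (by simp)).mul_right
  have hf0 : ∀ t, f t ≠ 0 → t ∈ Set.Icc (1 / 4 : ℝ) (9 / 4) := by
    intro t ht
    refine hw0 t fun h => ht ?_
    simp [hf, h]
  set D : ℝ → ℝ → ℂ := fun h t => f (t + h) * (starRingEnd ℂ) (f t) with hD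
  have hDc : ∀ h, HasCompactSupport (D h) := fun h =>
    (hfc.comp_left (g := starRingEnd ℂ) (by simp)).mul_left
  have hDcont : ∀ h, Continuous (D h) := fun h => by
    have : Continuous fun t => f (t + h) := hfcont.comp (by fun_prop)
    exact this.mul (Complex.continuous_conj.comp hfcont)
  have hDz : ∀ h, h ∉ I → ∀ t, D h t = 0 := by
    intro h hh t
    by_contra hne
    simp only [hD, mul_ne_zero_iff, map_ne_zero] at hne
    have e1 := hf0 _ hne.1
    have e2 := hf0 _ hne.2
    simp only [Set.mem_Icc] at e1 e2
    exact hh ⟨by linarith [e1.1, e2.2], by linarith [e1.2, e2.1]⟩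
  -- After differencing twice, the linear phase is gone, the quadratic one is constant, and what is
  -- left of `ζ log t` has derivative of size `|ζ h h'|`: integrate by parts once, and interpolate
  -- with the trivial bound to make the result integrable in `h` and `h'`.
  have hpt : ∀ h h' : ℝ, h ≠ 0 → h' ≠ 0 →
      ‖∫ t, D h (t + h') * (starRingEnd ℂ) (D h t)‖ ≤
        C₂ * |ζ| ^ (-(1 / 2) : ℝ) * (|h| ^ (-(1 / 2) : ℝ) * |h'| ^ (-(1 / 2) : ℝ)) := by
    intro h h' hh hh'
    obtain ⟨K, hK1, hK2, hK3, hK4⟩ := hK h h'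
    set Ψ : ℝ → ℝ := fun t => w (t + h + h') * w (t + h') * w (t + h) * w t with hΨ
    set g : ℝ → ℝ := fun t => ℓ (t + h + h') + ℓ t - ℓ (t + h) - ℓ (t + h') with hg
    have e1 : ∀ t, D h (t + h') * (starRingEnd ℂ) (D h t) =
        Complex.exp ((2 * β * h * h' : ℝ) * Complex.I) *
          ((Ψ t : ℂ) * Complex.exp ((ζ * g t : ℝ) * Complex.I)) := by
      intro t
      simp only [hD, hf, hφ, hΨ, hg, map_mul, Complex.conj_ofReal, ← Complex.exp_conj,
        Complex.conj_I, map_neg, neg_neg, add_right_comm t h' h]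
      have e2 : ∀ a b c d e : ℂ, ∀ p q r s : ℂ, a + b + c + d = e →
          p * Complex.exp a * (q * Complex.exp b) * (r * Complex.exp c * (s * Complex.exp d)) =
          p * q * r * s * Complex.exp e := by
        intro a b c d e p q r s h
        rw [← h, Complex.exp_add, Complex.exp_add, Complex.exp_add]
        ring
      rw [e2 _ _ _ _ (((2 * β * h * h' : ℝ) : ℂ) * Complex.I +
        ((ζ * (ℓ (t + h + h') + ℓ t - ℓ (t + h) - ℓ (t + h')) : ℝ) : ℂ) * Complex.I)]
      · rw [Complex.exp_add]
        push_cast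
        ring
      · push_cast
        ring
    simp_rw [e1]
    rw [integral_const_mul, norm_mul, Complex.norm_exp_ofReal_mul_I, one_mul]
    set m := ‖∫ t, (Ψ t : ℂ) * Complex.exp ((ζ * g t : ℝ) * Complex.I)‖ with hm
    have hgs : ContDiff ℝ 1 g := by
      have := hℓ.of_le (m := 1) (by simp)
      fun_prop
    have b1 : |ζ| * |h * h'| * m ≤ C₁ :=
      (norm_integral_exp_le_of_mul_deriv hK1 hK2 hgs hK4 ζ).trans hK3
    have b2 : m ≤ 2 * A ^ 4 := by
      have b3 : ∀ t, t ∉ Set.Icc (1 / 4 : ℝ) (9 / 4) →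
          (Ψ t : ℂ) * Complex.exp ((ζ * g t : ℝ) * Complex.I) = 0 := by
        intro t ht
        have : w t = 0 := by
          by_contra hne
          exact ht (hw0 t hne)
        simp [hΨ, this]
      rw [hm, ← setIntegral_eq_integral_of_forall_compl_eq_zero b3]
      refine (norm_setIntegral_le_of_norm_le_const (C := A ^ 4) (by simp) fun t _ => ?_).trans ?_
      · rw [norm_mul, Complex.norm_exp_ofReal_mul_I, mul_one, Complex.norm_real]
        simp only [hΨ, norm_mul]
        calc _ ≤ A * A * A * A := by gcongr <;> apply hA
          _ = A ^ 4 := by ring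
      · rw [Real.volume_real_Icc]
        norm_num [mul_comm]
    have hm0 : 0 ≤ m := norm_nonneg _
    set X := |ζ| * |h * h'| with hX
    have hX0 : 0 < X := by positivity
    have e3 : |ζ| ^ (-(1 / 2) : ℝ) * (|h| ^ (-(1 / 2) : ℝ) * |h'| ^ (-(1 / 2) : ℝ)) =
        X ^ (-(1 / 2) : ℝ) := by
      rw [hX, abs_mul, Real.mul_rpow (by positivity) (by positivity),
        Real.mul_rpow (by positivity) (by positivity)]
    rw [mul_assoc, e3, Real.rpow_neg hX0.le, ← div_eq_mul_inv, le_div_iff₀ (by positivity),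
      ← Real.sqrt_eq_rpow]
    have hs := Real.sqrt_nonneg X
    have hs2 := Real.sq_sqrt hX0.le
    rcases le_or_gt 1 X with hX1 | hX1
    · have : √X ≤ X := by
        rw [Real.sqrt_le_left (by linarith)]
        nlinarith
      nlinarith [mul_le_mul_of_nonneg_left this hm0, pow_nonneg hA0 4]
    · have : √X ≤ 1 := by
        rw [Real.sqrt_le_one]
        exact hX1.le
      nlinarith [mul_le_mul_of_nonneg_left this hm0, pow_nonneg hA0 4]
  have hmeas : ∀ F : ℝ → ℝ → ℂ, (∀ h, h ∉ I → ∀ t, F h t = 0) →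
      ∫⁻ h, ‖∫ t, F h t‖ₑ = ∫⁻ h in I, ‖∫ t, F h t‖ₑ := by
    intro F hF
    rw [← lintegral_indicator measurableSet_Icc]
    refine lintegral_congr fun h => ?_
    by_cases hh : h ∈ I
    · rw [Set.indicator_of_mem hh]
    · rw [Set.indicator_of_notMem hh]
      simp [hF h hh]
  have hDjm : Measurable fun h => ‖∫ t, D h t‖ₑ := by
    have : StronglyMeasurable fun h => ∫ t, D h t := by
      refine StronglyMeasurable.integral_prod_right (f := fun h t => D h t) ?_
      refine Continuous.stronglyMeasurable ?_
      simp only [hD]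
      exact (hfcont.comp (by fun_prop)).mul
        (Complex.continuous_conj.comp (hfcont.comp (by fun_prop)))
    exact this.measurable.enorm
  have s1 : ‖∫ t, f t‖ₑ ^ 2 ≤ ∫⁻ h in I, ‖∫ t, D h t‖ₑ := by
    rw [← hmeas D hDz]
    exact enorm_integral_sq_le_lintegral_diff (hfcont.integrable_of_hasCompactSupport hfc)
  have s2 : (∫⁻ h in I, ‖∫ t, D h t‖ₑ) ^ 2 ≤ 4 * ∫⁻ h in I, ‖∫ t, D h t‖ₑ ^ 2 := by
    have := lintegral_mul_sq_le (μ := volume.restrict I) (f := fun _ => 1)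
      (g := fun h => ‖∫ t, D h t‖ₑ) aemeasurable_const hDjm.aemeasurable
    simp only [one_mul, one_pow, lintegral_const, Measure.restrict_apply_univ] at this
    refine this.trans (le_of_eq ?_)
    rw [hI, Real.volume_Icc]
    norm_num
  have s3 : ∀ h, h ≠ 0 → ‖∫ t, D h t‖ₑ ^ 2 ≤
      ENNReal.ofReal (C₂ * |ζ| ^ (-(1 / 2) : ℝ)) *
        (ENNReal.ofReal (|h| ^ (-(1 / 2) : ℝ)) * M) := by
    intro h hh
    refine (enorm_integral_sq_le_lintegral_diff
      ((hDcont h).integrable_of_hasCompactSupport (hDc h))).trans ?_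
    rw [hmeas (fun h' t => D h (t + h') * (starRingEnd ℂ) (D h t))]
    · rw [hM, ← lintegral_const_mul _ (by fun_prop), ← lintegral_const_mul _ (by fun_prop)]
      refine lintegral_mono_ae ?_
      filter_upwards [ae_restrict_of_ae (Measure.ae_ne volume (0 : ℝ))] with h' hh'
      rw [← ENNReal.ofReal_mul (by positivity), ← ENNReal.ofReal_mul (by positivity),
        ← ofReal_norm]
      exact ENNReal.ofReal_le_ofReal (hpt h h' hh hh')
    · intro h' hh' t
      by_contra hne
      simp only [mul_ne_zero_iff, map_ne_zero, hD] at hne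
      have e1 := hf0 _ hne.1.2
      have e2 := hf0 _ hne.2.2
      simp only [Set.mem_Icc] at e1 e2
      exact hh' ⟨by linarith [e1.1, e2.2], by linarith [e1.2, e2.1]⟩
  have s4 : ∫⁻ h in I, ‖∫ t, D h t‖ₑ ^ 2 ≤
      ENNReal.ofReal (C₂ * |ζ| ^ (-(1 / 2) : ℝ)) * (M * M) := by
    rw [hM, ← lintegral_mul_const _ (by fun_prop), ← hM,  ← lintegral_const_mul _ (by fun_prop)]
    refine lintegral_mono_ae ?_
    filter_upwards [ae_restrict_of_ae (Measure.ae_ne volume (0 : ℝ))] with h hh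
    exact s3 h hh
  have s5 : ‖∫ t, f t‖ ^ 4 ≤ 4 * (C₂ * |ζ| ^ (-(1 / 2) : ℝ) * (M.toReal * M.toReal)) := by
    have e1 : ENNReal.ofReal (‖∫ t, f t‖ ^ 4) = (‖∫ t, f t‖ₑ ^ 2) ^ 2 := by
      rw [ENNReal.ofReal_pow (norm_nonneg _), ofReal_norm, ← pow_mul]
    have e2 : ENNReal.ofReal (4 * (C₂ * |ζ| ^ (-(1 / 2) : ℝ) * (M.toReal * M.toReal))) =
        4 * (ENNReal.ofReal (C₂ * |ζ| ^ (-(1 / 2) : ℝ)) * (M * M)) := by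
      rw [ENNReal.ofReal_mul (by norm_num),
        ENNReal.ofReal_mul (p := C₂ * |ζ| ^ (-(1 / 2) : ℝ)) (by positivity),
        ENNReal.ofReal_mul ENNReal.toReal_nonneg, ENNReal.ofReal_toReal hMtop]
      norm_num
    refine (ENNReal.ofReal_le_ofReal_iff (by positivity)).1 ?_
    rw [e1, e2]
    calc (‖∫ t, f t‖ₑ ^ 2) ^ 2 ≤ (∫⁻ h in I, ‖∫ t, D h t‖ₑ) ^ 2 := by gcongr
      _ ≤ 4 * ∫⁻ h in I, ‖∫ t, D h t‖ₑ ^ 2 := s2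
      _ ≤ _ := by gcongr
  have hz : 0 < |ζ| := abs_pos.2 hζ
  refine le_of_pow_le_pow_left₀ (n := 4) (by norm_num) (by positivity) ?_
  rw [mul_pow, ← Real.rpow_natCast (_ ^ (1 / 4 : ℝ)), ← Real.rpow_mul (by positivity),
    ← Real.rpow_natCast (|ζ| ^ _), ← Real.rpow_mul hz.le]
  norm_num at s5 ⊢
  have : 0 ≤ |ζ| ^ (-(1 / 2) : ℝ) := by positivity
  nlinarith

/-! ### Bilinear forms with sparse frequency fibres -/

theorem ENNReal.mul_le_ofReal_mul_sq_add {ε : ℝ} (hε : 0 < ε) (a b : ENNReal) :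
    a * b ≤ ENNReal.ofReal ε * a ^ 2 + ENNReal.ofReal ε⁻¹ * b ^ 2 := by
  have hε' : 0 < ε⁻¹ := inv_pos.2 hε
  by_cases ha : a = ⊤
  · simp [ha, ENNReal.mul_top, hε]
  by_cases hb : b = ⊤
  · simp [hb, ENNReal.mul_top, hε]
  lift a to NNReal using ha
  lift b to NNReal using hb
  rw [← ENNReal.ofReal_coe_nnreal, ← ENNReal.ofReal_coe_nnreal,
    ← ENNReal.ofReal_mul (by positivity),
    ← ENNReal.ofReal_pow (by positivity), ← ENNReal.ofReal_pow (by positivity),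
    ← ENNReal.ofReal_mul hε.le, ← ENNReal.ofReal_mul hε'.le,
    ← ENNReal.ofReal_add (by positivity) (by positivity)]
  refine ENNReal.ofReal_le_ofReal ?_
  have h1 : ε * ε⁻¹ = 1 := mul_inv_cancel₀ hε.ne'
  have h2 : 0 ≤ ε⁻¹ * (ε * (a : ℝ) - b / 2) ^ 2 := by positivity
  have h3 : ε⁻¹ * (ε * (a : ℝ) - b / 2) ^ 2 = ε * a ^ 2 - a * b + ε⁻¹ * b ^ 2 / 4 := by
    field_simp
    ring
  nlinarith [mul_nonneg hε'.le (sq_nonneg (b : ℝ))]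

theorem lintegral_euclideanSpace_fin_three {F : ℝ × ℝ × ℝ → ENNReal} (hF : Measurable F) :
    ∫⁻ w : EuclideanSpace ℝ (Fin 3), F (w 0, w 1, w 2) = ∫⁻ x, ∫⁻ y, ∫⁻ z, F (x, y, z) := by
  have h1 : MeasurePreserving (fun w : EuclideanSpace ℝ (Fin 3) => (w 0, w 1, w 2))
      volume (volume : Measure (ℝ × ℝ × ℝ)) := by
    have e1 := PiLp.volume_preserving_ofLp (Fin 3)
    have e2 := volume_preserving_piFinSuccAbove (fun _ : Fin 3 => ℝ) 0
    have e3 := volume_preserving_finTwoArrow ℝ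
    have e4 := ((MeasurePreserving.id (volume : Measure ℝ)).prod e3).comp (e2.comp e1)
    exact e4
  refine (h1.lintegral_comp hF).trans ?_
  rw [Measure.volume_eq_prod, lintegral_prod _ hF.aemeasurable]
  refine lintegral_congr fun x => ?_
  rw [Measure.volume_eq_prod, lintegral_prod]
  exact (hF.comp measurable_prodMk_left).aemeasurable

/-- The sparse case, in logarithmic frequency coordinates: if `a` has `z`-fibres of measure at most
`s`, then the average over translates along the curve `(t, -t², log 2t)` gains a power of `s`.
Up to an error controlled by the decay of the multiplier, `c` may be averaged over `z`-shifts in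
`(0, r)`, after which the sparsity of `a` can be used. -/
theorem exists_bound_curve_average_sparse {w : ℝ → ℝ} (hw : ContDiff ℝ ∞ w) (hw0 : ∀ t, 0 ≤ w t)
    (hws : tsupport w ⊆ Set.Icc (1 / 4) (9 / 4)) :
    ∃ C : ℝ, 0 < C ∧ ∀ (a c : ℝ × ℝ × ℝ → ENNReal), Measurable a → Measurable c →
      ∀ s : ℝ, 0 < s → (∀ x y, volume {z | a (x, y, z) ≠ 0} ≤ ENNReal.ofReal s) →
      ∫⁻ t, ENNReal.ofReal (w t) *
          ∫⁻ x, ∫⁻ y, ∫⁻ z, a (x, y, z) * c (x - t, y + t ^ 2, z - Real.log (2 * t)) ≤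
        ENNReal.ofReal (C * s ^ (1 / 10 : ℝ)) *
          ((∫⁻ x, ∫⁻ y, ∫⁻ z, a (x, y, z) ^ 2) + ∫⁻ x, ∫⁻ y, ∫⁻ z, c (x, y, z) ^ 2) := by
  obtain ⟨C, hC, hosc⟩ := exists_bound_oscillatory_log hw hws
  have hwsupp : ∀ t, w t ≠ 0 → t ∈ Set.Icc (1 / 4 : ℝ) (9 / 4) := fun t ht =>
    hws (subset_tsupport w ht)
  have hwc : HasCompactSupport w := HasCompactSupport.of_support_subset_isCompact isCompact_Icc
    hwsupp
  have hwi : Integrable w := hw.continuous.integrable_of_hasCompactSupport hwc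
  have hwnn : 0 ≤ ∫ t, w t := integral_nonneg hw0
  refine ⟨2 * C + ∫ t, w t, by positivity, fun a c ha hc s hs hsupp => ?_⟩
  set a' : EuclideanSpace ℝ (Fin 3) → ENNReal := fun w => a (w 0, w 1, w 2) with ha'
  set c' : EuclideanSpace ℝ (Fin 3) → ENNReal := fun w => c (w 0, w 1, w 2) with hc'
  have hcoord : Measurable fun w : EuclideanSpace ℝ (Fin 3) => (w 0, w 1, w 2) := by fun_prop
  have ha'm : Measurable a' := ha.comp hcoord
  have hc'm : Measurable c' := hc.comp hcoord
  set γ : ℝ → EuclideanSpace ℝ (Fin 3) := fun t => !₂[t, -t ^ 2, Real.log (2 * t)] with hγ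
  have hγm : Measurable γ := by
    simp only [hγ]
    refine (PiLp.volume_preserving_toLp (Fin 3)).measurable.comp (measurable_pi_iff.2 fun i => ?_)
    fin_cases i
    · exact measurable_id
    · simp only [Fin.mk_one, Matrix.cons_val_one, Matrix.cons_val_zero]
      fun_prop
    · simp only [Fin.reduceFinMk, Matrix.cons_val]
      fun_prop
  -- A vertical shift by `h` multiplies by `1 - e^{iζh}`, so that `|ζ|^{-1/8}` becomes `h^{1/8}`.
  have hmult : ∀ h : ℝ, 0 < h → ∀ ξ : EuclideanSpace ℝ (Fin 3), ‖∫ t, (w t : ℂ) *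
      (Complex.exp (-(2 * Real.pi * inner ℝ (γ t) ξ : ℝ) * Complex.I) -
        Complex.exp (-(2 * Real.pi * inner ℝ (γ t + !₂[0, 0, h]) ξ : ℝ) * Complex.I))‖ ≤
      2 * C * h ^ (1 / 8 : ℝ) := by
    intro h hh ξ
    set ζ : ℝ := -(2 * Real.pi * ξ 2) with hζ
    set u : ℂ := Complex.exp ((ζ * Real.log 2 : ℝ) * Complex.I) *
      (1 - Complex.exp (Complex.I * (ζ * h : ℝ))) with hu
    have e1 : ∀ t, (w t : ℂ) *
        (Complex.exp (-(2 * Real.pi * inner ℝ (γ t) ξ : ℝ) * Complex.I) -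
          Complex.exp (-(2 * Real.pi * inner ℝ (γ t + !₂[0, 0, h]) ξ : ℝ) * Complex.I)) =
        (w t : ℂ) * Complex.exp ((-(2 * Real.pi * ξ 0) * t + (2 * Real.pi * ξ 1) * t ^ 2 +
          ζ * Real.log t : ℝ) * Complex.I) * u := by
      intro t
      by_cases ht : w t = 0
      · simp [ht]
      have ht0 : t ≠ 0 := by
        have := (hwsupp t ht).1
        intro h
        norm_num [h] at this
      have i1 : inner ℝ (γ t) ξ = t * ξ 0 - t ^ 2 * ξ 1 + Real.log (2 * t) * ξ 2 := by
        simp [hγ, PiLp.inner_apply, Fin.sum_univ_three]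
        ring
      have i2 : inner ℝ (!₂[0, 0, h] : EuclideanSpace ℝ (Fin 3)) ξ = h * ξ 2 := by
        simp [PiLp.inner_apply, Fin.sum_univ_three, mul_comm]
      rw [inner_add_left, i1, i2, Real.log_mul two_ne_zero ht0, mul_assoc (w t : ℂ)]
      congr 1
      simp only [hu, mul_sub, mul_one, ← Complex.exp_add]
      congr 2 <;> · simp only [hζ]; push_cast; ring
    simp_rw [e1]
    rw [integral_mul_const, norm_mul]
    have hun : ‖u‖ = ‖Complex.exp (Complex.I * (ζ * h : ℝ)) - 1‖ := by
      rw [hu, norm_mul, Complex.norm_exp_ofReal_mul_I, one_mul, norm_sub_rev]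
    have hu1 : ‖u‖ ≤ |ζ| * h := by
      rw [hun]
      refine (Real.norm_exp_I_mul_ofReal_sub_one_le).trans (le_of_eq ?_)
      rw [Real.norm_eq_abs, abs_mul, abs_of_pos hh]
    have hu2 : ‖u‖ ≤ 2 := by
      rw [hun, mul_comm]
      refine (norm_sub_le _ _).trans ?_
      rw [Complex.norm_exp_ofReal_mul_I]
      norm_num
    by_cases hz : ζ = 0
    · have : ‖u‖ ≤ 0 := by simpa [hz] using hu1
      rw [le_antisymm this (norm_nonneg _), mul_zero]
      positivity
    have hz' : 0 < |ζ| := abs_pos.2 hz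
    have hX : ‖u‖ ≤ 2 * (|ζ| * h) ^ (1 / 8 : ℝ) := by
      rcases le_or_gt (|ζ| * h) 1 with h1 | h1
      · have h2 := Real.rpow_le_rpow_of_exponent_ge (by positivity) h1
          (show (1 / 8 : ℝ) ≤ 1 by norm_num)
        rw [Real.rpow_one] at h2
        linarith [show 0 < |ζ| * h by positivity]
      · have := Real.one_le_rpow h1.le (show (0 : ℝ) ≤ 1 / 8 by norm_num)
        linarith
    calc _ ≤ (C * |ζ| ^ (-(1 / 8) : ℝ)) * (2 * (|ζ| * h) ^ (1 / 8 : ℝ)) := by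
          gcongr
          exact hosc _ _ ζ hz
      _ = 2 * C * h ^ (1 / 8 : ℝ) := by
          rw [Real.mul_rpow hz'.le hh.le, Real.rpow_neg hz'.le]
          field_simp
  have hstep : ∀ h : ℝ, 0 < h →
      ∫⁻ t, ENNReal.ofReal (w t) *
          ∫⁻ x, ∫⁻ y, ∫⁻ z, a (x, y, z) * c (x - t, y + t ^ 2, z - Real.log (2 * t)) ≤
      (∫⁻ t, ENNReal.ofReal (w t) *
          ∫⁻ x, ∫⁻ y, ∫⁻ z, a (x, y, z) * c (x - t, y + t ^ 2, z - Real.log (2 * t) - h)) +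
        ENNReal.ofReal (2 * C * h ^ (1 / 8 : ℝ)) *
          ((∫⁻ x, ∫⁻ y, ∫⁻ z, a (x, y, z) ^ 2) + ∫⁻ x, ∫⁻ y, ∫⁻ z, c (x, y, z) ^ 2) := by
    intro h hh
    have key := lintegral_curve_translate_le ha'm hc'm hγm hwi hw0 !₂[0, 0, h] (hmult h hh)
      (by positivity)
    have e1 : ∀ t, ∫⁻ w, a' w * c' (w - γ t) =
        ∫⁻ x, ∫⁻ y, ∫⁻ z, a (x, y, z) * c (x - t, y + t ^ 2, z - Real.log (2 * t)) := by
      intro t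
      rw [← lintegral_euclideanSpace_fin_three (F := fun q => a q * c (q.1 - t, q.2.1 + t ^ 2,
        q.2.2 - Real.log (2 * t))) (by fun_prop)]
      refine lintegral_congr fun w => ?_
      simp [ha', hc', hγ]
    have e2 : ∀ t, ∫⁻ w, a' w * c' (w - (γ t + !₂[0, 0, h])) =
        ∫⁻ x, ∫⁻ y, ∫⁻ z, a (x, y, z) * c (x - t, y + t ^ 2, z - Real.log (2 * t) - h) := by
      intro t
      rw [← lintegral_euclideanSpace_fin_three (F := fun q => a q * c (q.1 - t, q.2.1 + t ^ 2,
        q.2.2 - Real.log (2 * t) - h)) (by fun_prop)]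
      refine lintegral_congr fun w => ?_
      simp [ha', hc', hγ, sub_sub]
    simp_rw [e1, e2] at key
    rw [← lintegral_euclideanSpace_fin_three (F := fun q => a q ^ 2) (by fun_prop),
      ← lintegral_euclideanSpace_fin_three (F := fun q => c q ^ 2) (by fun_prop)]
    exact key
  set S : ENNReal := (∫⁻ x, ∫⁻ y, ∫⁻ z, a (x, y, z) ^ 2) +
    ∫⁻ x, ∫⁻ y, ∫⁻ z, c (x, y, z) ^ 2 with hS
  set Λ := ∫⁻ t, ENNReal.ofReal (w t) *
          ∫⁻ x, ∫⁻ y, ∫⁻ z, a (x, y, z) * c (x - t, y + t ^ 2, z - Real.log (2 * t)) with hΛ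
  -- The two errors are `r^{1/8}` and `(s / r)^{1/2}`; this `r` makes them equal, to `η`.
  set r : ℝ := s ^ (4 / 5 : ℝ) with hr
  have hr0 : 0 < r := by positivity
  set η : ℝ := s ^ (1 / 10 : ℝ) with hη
  have hη0 : 0 < η := by positivity
  have hηr : η⁻¹ * s = η * r := by
    rw [inv_mul_eq_iff_eq_mul₀ hη0.ne', hη, hr, ← Real.rpow_add hs, ← Real.rpow_add hs]
    norm_num
  have hr8 : r ^ (1 / 8 : ℝ) = η := by
    rw [hr, hη, ← Real.rpow_mul hs.le]
    norm_num
  -- For shifts averaged over `(0, r)`, each fibre of `a` has measure at most `s`, while `c` has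
  -- been spread over length `r`.
  have havg : ∫⁻ h in Set.Ioc 0 r, (∫⁻ t, ENNReal.ofReal (w t) *
          ∫⁻ x, ∫⁻ y, ∫⁻ z, a (x, y, z) * c (x - t, y + t ^ 2, z - Real.log (2 * t) - h)) ≤
      ENNReal.ofReal (∫ t, w t) * (ENNReal.ofReal (η * r) * S) := by
    have hwm : Measurable w := hw.continuous.measurable
    rw [lintegral_lintegral_swap (by fun_prop), ofReal_integral_eq_lintegral_ofReal hwi
      (Filter.Eventually.of_forall hw0), ← lintegral_mul_const _ (by fun_prop)]
    refine lintegral_mono fun t => ?_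
    rw [lintegral_const_mul _ (by fun_prop)]
    refine mul_le_mul_right ?_ _
    rw [lintegral_lintegral_swap (by fun_prop)]
    have hxy : ∀ x y, ∫⁻ h in Set.Ioc 0 r, ∫⁻ z, a (x, y, z) *
        c (x - t, y + t ^ 2, z - Real.log (2 * t) - h) ≤
        ENNReal.ofReal (η * r) *
          ((∫⁻ z, a (x, y, z) ^ 2) + ∫⁻ z, c (x - t, y + t ^ 2, z) ^ 2) := by
      intro x y
      set A : Set ℝ := {z | a (x, y, z) ≠ 0} with hA
      have hAm : MeasurableSet A :=
        (measurableSet_singleton 0).compl.preimage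
          (ha.comp (by fun_prop : Measurable fun z => (x, y, z)))
      set c₁ : ℝ → ENNReal := fun z => c (x - t, y + t ^ 2, z) with hc₁
      have hc₁m : Measurable c₁ := by fun_prop
      have hpt : ∀ z h, a (x, y, z) * c₁ (z - Real.log (2 * t) - h) ≤
          ENNReal.ofReal η * a (x, y, z) ^ 2 +
            A.indicator 1 z * (ENNReal.ofReal η⁻¹ * c₁ (z - Real.log (2 * t) - h) ^ 2) := by
        intro z h
        by_cases hz : a (x, y, z) = 0
        · simp [hz]
        · rw [Set.indicator_of_mem (show z ∈ A from hz), Pi.one_apply, one_mul]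
          exact ENNReal.mul_le_ofReal_mul_sq_add hη0 _ _
      have hind : Measurable (A.indicator (1 : ℝ → ENNReal)) := measurable_one.indicator hAm
      rw [lintegral_lintegral_swap (by fun_prop)]
      calc ∫⁻ z, ∫⁻ h in Set.Ioc 0 r, a (x, y, z) * c₁ (z - Real.log (2 * t) - h)
          ≤ ∫⁻ z, (ENNReal.ofReal (η * r) * a (x, y, z) ^ 2 +
              A.indicator 1 z * (ENNReal.ofReal η⁻¹ * ∫⁻ z, c₁ z ^ 2)) := by
            refine lintegral_mono fun z => (lintegral_mono fun h => hpt z h).trans ?_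
            rw [lintegral_add_left measurable_const, setLIntegral_const, Real.volume_Ioc, sub_zero,
              ENNReal.ofReal_mul hη0.le, lintegral_const_mul _ (by fun_prop),
              lintegral_const_mul _ (by fun_prop)]
            gcongr ?_ + _ * (_ * ?_)
            · rw [mul_right_comm]
            · refine (setLIntegral_le_lintegral _ _).trans (le_of_eq ?_)
              exact lintegral_sub_left_eq_self (fun h => c₁ h ^ 2) _
        _ = ENNReal.ofReal (η * r) * (∫⁻ z, a (x, y, z) ^ 2) +
              volume A * (ENNReal.ofReal η⁻¹ * ∫⁻ z, c₁ z ^ 2) := by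
            rw [lintegral_add_left (by fun_prop), lintegral_const_mul _ (by fun_prop),
              lintegral_mul_const _ hind, lintegral_indicator_one hAm]
        _ ≤ ENNReal.ofReal (η * r) * (∫⁻ z, a (x, y, z) ^ 2) +
              ENNReal.ofReal s * (ENNReal.ofReal η⁻¹ * ∫⁻ z, c₁ z ^ 2) := by
            gcongr
            exact hsupp x y
        _ = _ := by
            rw [← mul_assoc, ← ENNReal.ofReal_mul hs.le, mul_comm s, hηr, mul_add]
    calc ∫⁻ x, ∫⁻ h in Set.Ioc 0 r, ∫⁻ y, ∫⁻ z, a (x, y, z) *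
          c (x - t, y + t ^ 2, z - Real.log (2 * t) - h)
        = ∫⁻ x, ∫⁻ y, ∫⁻ h in Set.Ioc 0 r, ∫⁻ z, a (x, y, z) *
          c (x - t, y + t ^ 2, z - Real.log (2 * t) - h) := by
          refine lintegral_congr fun x => ?_
          rw [lintegral_lintegral_swap (by fun_prop)]
      _ ≤ ∫⁻ x, ∫⁻ y, ENNReal.ofReal (η * r) *
          ((∫⁻ z, a (x, y, z) ^ 2) + ∫⁻ z, c (x - t, y + t ^ 2, z) ^ 2) :=
          lintegral_mono fun x => lintegral_mono fun y => hxy x y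
      _ = ENNReal.ofReal (η * r) * ((∫⁻ x, ∫⁻ y, ∫⁻ z, a (x, y, z) ^ 2) +
          ∫⁻ x, ∫⁻ y, ∫⁻ z, c (x - t, y + t ^ 2, z) ^ 2) := by
          rw [← lintegral_add_left (by fun_prop), ← lintegral_const_mul _ (by fun_prop)]
          refine lintegral_congr fun x => ?_
          rw [← lintegral_add_left (by fun_prop), ← lintegral_const_mul _ (by fun_prop)]
      _ = ENNReal.ofReal (η * r) * S := by
          rw [lintegral_sub_right_eq_self (fun x => ∫⁻ y, ∫⁻ z, c (x, y + t ^ 2, z) ^ 2) t, hS]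
          congr 2
          refine lintegral_congr fun x => ?_
          rw [lintegral_add_right_eq_self (fun y => ∫⁻ z, c (x, y, z) ^ 2)]
  have hfin : ENNReal.ofReal r * Λ ≤ ENNReal.ofReal r *
      (ENNReal.ofReal ((2 * C + ∫ t, w t) * η) * S) := by
    have h1 : ENNReal.ofReal r * Λ = ∫⁻ h in Set.Ioc 0 r, Λ := by
      rw [setLIntegral_const, Real.volume_Ioc, sub_zero, mul_comm]
    rw [h1]
    calc ∫⁻ h in Set.Ioc 0 r, Λ ≤ ∫⁻ h in Set.Ioc 0 r, ((∫⁻ t, ENNReal.ofReal (w t) *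
          ∫⁻ x, ∫⁻ y, ∫⁻ z, a (x, y, z) * c (x - t, y + t ^ 2, z - Real.log (2 * t) - h)) +
          ENNReal.ofReal (2 * C * η) * S) := by
          refine setLIntegral_mono' measurableSet_Ioc fun h hh => (hstep h hh.1).trans ?_
          gcongr
          rw [← hr8]
          exact Real.rpow_le_rpow hh.1.le hh.2 (by norm_num)
      _ = (∫⁻ h in Set.Ioc 0 r, (∫⁻ t, ENNReal.ofReal (w t) *
          ∫⁻ x, ∫⁻ y, ∫⁻ z, a (x, y, z) * c (x - t, y + t ^ 2, z - Real.log (2 * t) - h))) +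
          ENNReal.ofReal r * (ENNReal.ofReal (2 * C * η) * S) := by
          rw [lintegral_add_right _ measurable_const, setLIntegral_const, Real.volume_Ioc, sub_zero,
            mul_comm (ENNReal.ofReal r)]
      _ ≤ ENNReal.ofReal (∫ t, w t) * (ENNReal.ofReal (η * r) * S) +
          ENNReal.ofReal r * (ENNReal.ofReal (2 * C * η) * S) := by gcongr
      _ = _ := by
          rw [add_mul (2 * C), ENNReal.ofReal_add (by positivity) (by positivity),
            ENNReal.ofReal_mul hη0.le, ENNReal.ofReal_mul hwnn]
          ring
  exact (ENNReal.mul_le_mul_iff_right (by simpa using hr0) ENNReal.ofReal_ne_top).1 hfin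

theorem lintegral_Ioi_eq_lintegral_exp (F : ℝ → ENNReal) :
    ∫⁻ κ in Set.Ioi 0, F κ = ∫⁻ z, ENNReal.ofReal (Real.exp z) * F (Real.exp z) := by
  have h := lintegral_image_eq_lintegral_abs_deriv_mul (s := Set.univ) (f := Real.exp)
    (f' := Real.exp) MeasurableSet.univ (fun x _ => (Real.hasDerivAt_exp x).hasDerivWithinAt)
    Real.exp_injective.injOn F
  rw [Set.image_univ, Real.range_exp, Measure.restrict_univ] at h
  simpa [abs_of_pos (Real.exp_pos _)] using h

/-- The sparse case over positive frequencies, by the substitution `κ = e^z`. -/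
theorem exists_bound_sparse_pos :
    ∃ C : ℝ, 0 < C ∧ ∀ (a c : ℝ × ℝ × ℝ → ENNReal), Measurable a → Measurable c →
      ∀ M R : ℝ, 0 < M → 0 < R → (∀ x y κ, a (x, y, κ) ≠ 0 → R < |κ|) →
      (∀ x y, volume {κ | a (x, y, κ) ≠ 0} ≤ ENNReal.ofReal M) →
      ∫⁻ t in Set.Icc (1 / 2 : ℝ) 2, ∫⁻ x, ∫⁻ y, ∫⁻ κ in Set.Ioi 0,
          a (x + t, y, κ) * c (x, y + t ^ 2, κ / (2 * t)) ≤
        ENNReal.ofReal (C * (M / R) ^ (1 / 10 : ℝ)) *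
          ((∫⁻ x, ∫⁻ y, ∫⁻ κ, a (x, y, κ) ^ 2) + ∫⁻ x, ∫⁻ y, ∫⁻ ν, c (x, y, ν) ^ 2) := by
  obtain ⟨w, hw1, -, hw3, hw4, hw5⟩ := exists_contDiff_eq_one_of_mem_Icc (a := 1 / 2) (b := 2)
    (1 / 4) (9 / 4) (by norm_num) (by norm_num)
  obtain ⟨C, hC, hbd⟩ := exists_bound_curve_average_sparse hw1 (fun t => (hw5 t).1) hw4
  refine ⟨2 * C, by positivity, fun a c ha hc M R hM hR hsupp hfib => ?_⟩
  -- `e` is the square root of the Jacobian, one factor for each of `a` and `c`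
  set e : ℝ → ENNReal := fun z => ENNReal.ofReal (Real.exp (z / 2)) with he
  have hem : Measurable e := by fun_prop
  have he2 : ∀ z, e z ^ 2 = ENNReal.ofReal (Real.exp z) := by
    intro z
    rw [he, ← ENNReal.ofReal_pow (Real.exp_pos _).le, ← Real.exp_nat_mul]
    congr 2
    push_cast
    ring
  set a' : ℝ × ℝ × ℝ → ENNReal := fun q => e q.2.2 * a (q.1, q.2.1, Real.exp q.2.2) with ha'
  set c' : ℝ × ℝ × ℝ → ENNReal := fun q => e q.2.2 * c (q.1, q.2.1, Real.exp q.2.2) with hc'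
  have hsq : ∀ b : ℝ × ℝ × ℝ → ENNReal,
      ∫⁻ x, ∫⁻ y, ∫⁻ z, (e z * b (x, y, Real.exp z)) ^ 2 ≤ ∫⁻ x, ∫⁻ y, ∫⁻ κ, b (x, y, κ) ^ 2 := by
    intro b
    refine lintegral_mono fun x => lintegral_mono fun y => ?_
    simp_rw [mul_pow, he2]
    rw [← lintegral_Ioi_eq_lintegral_exp fun κ => b (x, y, κ) ^ 2]
    exact setLIntegral_le_lintegral _ _
  have hfib' : ∀ x y, volume {z | a' (x, y, z) ≠ 0} ≤ ENNReal.ofReal (M / R) := by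
    intro x y
    set A : Set ℝ := {κ | a (x, y, κ) ≠ 0} with hA
    have hAm : MeasurableSet A :=
      (measurableSet_singleton 0).compl.preimage
        (ha.comp (by fun_prop : Measurable fun z => (x, y, z)))
    have h1 : {z | a' (x, y, z) ≠ 0} ⊆ Real.exp ⁻¹' A := by
      intro z hz
      simp only [ha', Set.mem_ofPred_eq, mul_ne_zero_iff] at hz
      exact hz.2
    have hAm' : MeasurableSet (Real.exp ⁻¹' A) := Real.measurable_exp hAm
    calc volume {z | a' (x, y, z) ≠ 0} ≤ volume (Real.exp ⁻¹' A) := measure_mono h1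
      _ = ∫⁻ z, (Real.exp ⁻¹' A).indicator 1 z := (lintegral_indicator_one hAm').symm
      _ ≤ ∫⁻ z, ENNReal.ofReal (Real.exp z) *
            (ENNReal.ofReal R⁻¹ * A.indicator 1 (Real.exp z)) := by
          refine lintegral_mono fun z => ?_
          by_cases hz : Real.exp z ∈ A
          · rw [Set.indicator_of_mem (show z ∈ Real.exp ⁻¹' A from hz), Set.indicator_of_mem hz,
              Pi.one_apply, Pi.one_apply, mul_one, ← ENNReal.ofReal_mul (Real.exp_pos _).le,
              ENNReal.one_le_ofReal, ← div_eq_mul_inv, one_le_div hR]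
            have := hsupp x y _ hz
            rw [abs_of_pos (Real.exp_pos _)] at this
            exact this.le
          · rw [Set.indicator_of_notMem (show z ∉ Real.exp ⁻¹' A from hz)]
            exact zero_le
      _ = ∫⁻ κ in Set.Ioi 0, ENNReal.ofReal R⁻¹ * A.indicator 1 κ :=
          (lintegral_Ioi_eq_lintegral_exp fun κ => ENNReal.ofReal R⁻¹ * A.indicator 1 κ).symm
      _ ≤ ∫⁻ κ, ENNReal.ofReal R⁻¹ * A.indicator 1 κ := setLIntegral_le_lintegral _ _
      _ = ENNReal.ofReal R⁻¹ * volume A := by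
          rw [lintegral_const_mul _ (measurable_one.indicator hAm), lintegral_indicator_one hAm]
      _ ≤ ENNReal.ofReal R⁻¹ * ENNReal.ofReal M := by
          gcongr
          exact hfib x y
      _ = ENNReal.ofReal (M / R) := by
          rw [← ENNReal.ofReal_mul (by positivity), mul_comm, div_eq_mul_inv]
  have key := hbd a' c' (by fun_prop) (by fun_prop) (M / R) (by positivity) hfib'
  have hpt : ∀ t ∈ Set.Icc (1 / 2 : ℝ) 2, ∀ x y, ∫⁻ κ in Set.Ioi 0,
      a (x, y, κ) * c (x - t, y + t ^ 2, κ / (2 * t)) ≤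
      2 * ∫⁻ z, a' (x, y, z) * c' (x - t, y + t ^ 2, z - Real.log (2 * t)) := by
    intro t ht x y
    have ht0 : 0 < 2 * t := by linarith [ht.1]
    rw [lintegral_Ioi_eq_lintegral_exp, ← lintegral_const_mul' _ _ (by simp)]
    refine lintegral_mono fun z => ?_
    have h1 : Real.exp (z - Real.log (2 * t)) = Real.exp z / (2 * t) := by
      rw [Real.exp_sub, Real.exp_log ht0]
    have h2 : ENNReal.ofReal (Real.exp z) ≤ 2 * (e z * e (z - Real.log (2 * t))) := by
      rw [he, ← ENNReal.ofReal_mul (Real.exp_pos _).le, ← Real.exp_add,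
        show (2 : ENNReal) = ENNReal.ofReal 2 by simp, ← ENNReal.ofReal_mul (by norm_num)]
      refine ENNReal.ofReal_le_ofReal ?_
      have h3 : Real.log (2 * t) ≤ 2 * Real.log 2 := by
        rw [show 2 * Real.log 2 = Real.log (2 ^ 2) by rw [Real.log_pow]; norm_num]
        exact Real.log_le_log ht0 (by linarith [ht.2])
      calc Real.exp z ≤ Real.exp (Real.log 2 + (z / 2 + (z - Real.log (2 * t)) / 2)) :=
            Real.exp_le_exp.2 (by linarith)
        _ = _ := by rw [Real.exp_add, Real.exp_log (by norm_num)]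
    simp only [ha', hc', h1]
    calc _ ≤ 2 * (e z * e (z - Real.log (2 * t))) * (a (x, y, Real.exp z) *
          c (x - t, y + t ^ 2, Real.exp z / (2 * t))) := by gcongr
      _ = _ := by ring
  calc ∫⁻ t in Set.Icc (1 / 2 : ℝ) 2, ∫⁻ x, ∫⁻ y, ∫⁻ κ in Set.Ioi 0,
          a (x + t, y, κ) * c (x, y + t ^ 2, κ / (2 * t))
      ≤ ∫⁻ t in Set.Icc (1 / 2 : ℝ) 2, 2 * (ENNReal.ofReal (w t) *
          ∫⁻ x, ∫⁻ y, ∫⁻ z, a' (x, y, z) * c' (x - t, y + t ^ 2, z - Real.log (2 * t))) := by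
        refine setLIntegral_mono' measurableSet_Icc fun t ht => ?_
        rw [hw3 t ht, ENNReal.ofReal_one, one_mul, ← lintegral_const_mul' _ _ (by simp)]
        rw [← lintegral_sub_right_eq_self _ t]
        refine lintegral_mono fun x => ?_
        rw [← lintegral_const_mul' _ _ (by simp)]
        refine lintegral_mono fun y => ?_
        simp only [sub_add_cancel]
        exact hpt t ht x y
    _ ≤ ∫⁻ t, 2 * (ENNReal.ofReal (w t) *
          ∫⁻ x, ∫⁻ y, ∫⁻ z, a' (x, y, z) * c' (x - t, y + t ^ 2, z - Real.log (2 * t))) :=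
        setLIntegral_le_lintegral _ _
    _ = 2 * ∫⁻ t, (ENNReal.ofReal (w t) *
          ∫⁻ x, ∫⁻ y, ∫⁻ z, a' (x, y, z) * c' (x - t, y + t ^ 2, z - Real.log (2 * t))) :=
        lintegral_const_mul' _ _ (by simp)
    _ ≤ 2 * (ENNReal.ofReal (C * (M / R) ^ (1 / 10 : ℝ)) *
          ((∫⁻ x, ∫⁻ y, ∫⁻ z, a' (x, y, z) ^ 2) + ∫⁻ x, ∫⁻ y, ∫⁻ z, c' (x, y, z) ^ 2)) := by
        gcongr
    _ ≤ 2 * (ENNReal.ofReal (C * (M / R) ^ (1 / 10 : ℝ)) *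
          ((∫⁻ x, ∫⁻ y, ∫⁻ κ, a (x, y, κ) ^ 2) + ∫⁻ x, ∫⁻ y, ∫⁻ ν, c (x, y, ν) ^ 2)) := by
        gcongr ?_ * (?_ * (?_ + ?_))
        · exact le_rfl
        · exact le_rfl
        · exact hsq a
        · exact hsq c
    _ = _ := by
        rw [← mul_assoc, mul_assoc 2 C, ENNReal.ofReal_mul (p := 2) (by norm_num),
          ENNReal.ofReal_ofNat]

/-- A bilinear form with a sparse factor: if for every `(x, y)` the function `a (x, y, ·)` lives on
a set of measure at most `M` of frequencies larger than `R`, then averaging in `t` gains a power of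
`M / R` over the Cauchy–Schwarz inequality. -/
theorem exists_bound_sparse :
    ∃ C : ℝ, 0 < C ∧ ∀ (a c : ℝ × ℝ × ℝ → ENNReal), Measurable a → Measurable c →
      ∀ M R : ℝ, 0 < M → 0 < R → (∀ x y κ, a (x, y, κ) ≠ 0 → R < |κ|) →
      (∀ x y, volume {κ | a (x, y, κ) ≠ 0} ≤ ENNReal.ofReal M) →
      ∫⁻ t in Set.Icc (1 / 2 : ℝ) 2, ∫⁻ x, ∫⁻ y, ∫⁻ κ,
          a (x + t, y, κ) * c (x, y + t ^ 2, κ / (2 * t)) ≤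
        ENNReal.ofReal (C * (M / R) ^ (1 / 10 : ℝ)) *
          ((∫⁻ x, ∫⁻ y, ∫⁻ κ, a (x, y, κ) ^ 2) + ∫⁻ x, ∫⁻ y, ∫⁻ ν, c (x, y, ν) ^ 2) := by
  obtain ⟨C, hC, hbd⟩ := exists_bound_sparse_pos
  refine ⟨2 * C, by positivity, fun a c ha hc M R hM hR hsupp hfib => ?_⟩
  have hneg : ∀ F : ℝ → ENNReal, ∫⁻ κ, F (-κ) = ∫⁻ κ, F κ := fun F => by
    simpa using lintegral_sub_left_eq_self F (0 : ℝ)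
  have hsplit : ∀ F : ℝ → ENNReal, ∫⁻ κ, F κ =
      (∫⁻ κ in Set.Ioi 0, F κ) + ∫⁻ κ in Set.Ioi 0, F (-κ) := by
    intro F
    have h1 : ∫⁻ κ in Set.Ioi 0, F (-κ) = ∫⁻ κ in Set.Iio 0, F κ := by
      rw [← lintegral_indicator measurableSet_Ioi, ← lintegral_indicator measurableSet_Iio,
        ← hneg ((Set.Iio 0).indicator F)]
      refine lintegral_congr fun κ => ?_
      by_cases h : 0 < κ
      · rw [Set.indicator_of_mem (show κ ∈ Set.Ioi 0 from h),
          Set.indicator_of_mem (show -κ ∈ Set.Iio 0 by simpa using h)]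
      · rw [Set.indicator_of_notMem (show κ ∉ Set.Ioi 0 from h),
          Set.indicator_of_notMem (show -κ ∉ Set.Iio 0 by simpa using h)]
    rw [h1, ← setLIntegral_congr (Ioi_ae_eq_Ici (a := (0 : ℝ))).symm, ← Set.compl_Iio, add_comm,
      lintegral_add_compl _ measurableSet_Iio]
  have k1 := hbd a c ha hc M R hM hR hsupp hfib
  have k2 := hbd (fun q => a (q.1, q.2.1, -q.2.2)) (fun q => c (q.1, q.2.1, -q.2.2))
    (by fun_prop) (by fun_prop) M R hM hR
    (fun x y κ h => by simpa using hsupp x y (-κ) h)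
    (fun x y => by
      have := hfib x y
      rw [← Measure.measure_preimage_neg] at this
      exact this)
  have e1 : ∀ x y, ∫⁻ κ, a (x, y, -κ) ^ 2 = ∫⁻ κ, a (x, y, κ) ^ 2 :=
    fun x y => hneg fun κ => a (x, y, κ) ^ 2
  have e2 : ∀ x y, ∫⁻ κ, c (x, y, -κ) ^ 2 = ∫⁻ κ, c (x, y, κ) ^ 2 :=
    fun x y => hneg fun κ => c (x, y, κ) ^ 2
  simp only [e1, e2] at k2
  simp_rw [hsplit fun κ => a (_, _, κ) * c (_, _, κ / _)]
  calc _ = (∫⁻ t in Set.Icc (1 / 2 : ℝ) 2, ∫⁻ x, ∫⁻ y, ∫⁻ κ in Set.Ioi 0,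
          a (x + t, y, κ) * c (x, y + t ^ 2, κ / (2 * t))) +
          ∫⁻ t in Set.Icc (1 / 2 : ℝ) 2, ∫⁻ x, ∫⁻ y, ∫⁻ κ in Set.Ioi 0,
          a (x + t, y, -κ) * c (x, y + t ^ 2, -κ / (2 * t)) := by
        rw [← lintegral_add_left (by fun_prop)]
        refine lintegral_congr fun t => ?_
        rw [← lintegral_add_left (by fun_prop)]
        refine lintegral_congr fun x => ?_
        rw [← lintegral_add_left (by fun_prop)]
    _ ≤ _ := by
        simp only [neg_div] at k2 ⊢
        refine (add_le_add k1 k2).trans (le_of_eq ?_)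
        rw [← two_mul, ← mul_assoc, mul_assoc 2 C, ENNReal.ofReal_mul (p := 2) (by norm_num),
          ENNReal.ofReal_ofNat]

/-! ### The local Fourier transform -/

open FourierTransform in
theorem lintegral_enorm_fourier_sq {A : ℝ → ℂ} (hA : ContDiff ℝ ∞ A) (hAc : HasCompactSupport A) :
    ∫⁻ κ, ‖𝓕 A κ‖ₑ ^ 2 = ∫⁻ p, ‖A p‖ₑ ^ 2 := by
  set s := hAc.toSchwartzMap hA
  have h1 := SchwartzMap.integral_norm_sq_fourier s
  have h2 : ∀ f : SchwartzMap ℝ ℂ, ∫⁻ x, ‖f x‖ₑ ^ 2 = ENNReal.ofReal (∫ x, ‖f x‖ ^ 2) := by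
    intro f
    rw [ofReal_integral_eq_lintegral_ofReal]
    · refine lintegral_congr fun x => ?_
      rw [ENNReal.ofReal_pow (norm_nonneg _), ofReal_norm]
    · exact (memLp_two_iff_integrable_sq_norm f.continuous.aestronglyMeasurable).1 (f.memLp 2)
    · exact Filter.Eventually.of_forall fun x => by positivity
  have h3 := h2 (𝓕 s)
  rw [h1, ← h2 s] at h3
  exact h3

open FourierTransform in
theorem integrable_fourier_of_hasCompactSupport {A : ℝ → ℂ} (hA : ContDiff ℝ ∞ A)
    (hAc : HasCompactSupport A) : Integrable (𝓕 A) :=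
  (𝓕 (hAc.toSchwartzMap hA)).integrable

open FourierTransform in
theorem eq_integral_fourier_of_hasCompactSupport {A : ℝ → ℂ} (hA : ContDiff ℝ ∞ A)
    (hAc : HasCompactSupport A) (p : ℝ) :
    A p = ∫ κ, Complex.exp ((2 * Real.pi * (κ * p) : ℝ) * Complex.I) * 𝓕 A κ := by
  have h1 := congrFun (Continuous.fourierInv_fourier_eq hA.continuous
    (hA.continuous.integrable_of_hasCompactSupport hAc)
    (integrable_fourier_of_hasCompactSupport hA hAc)) p
  rw [← h1, Real.fourierInv_eq']
  simp only [smul_eq_mul]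
  refine integral_congr_ae (Filter.Eventually.of_forall fun κ => ?_)
  simp [mul_comm]

open FourierTransform in
/-- The local Fourier transform in the first variable, at the point `(X, y)` and at scale `δ`: the
Fourier transform, at the frequency `κ`, of `p ↦ χ(p) h(X + δp, y)`. Here `q = (X, y, κ)`. -/
noncomputable def localFourier (χ : ℝ → ℝ) (δ : ℝ) (h : ℝ × ℝ → ℂ) (q : ℝ × ℝ × ℝ) : ℂ :=
  𝓕 (fun p => (χ p : ℂ) * h (q.1 + δ * p, q.2.1)) q.2.2

section localFourier

variable {χ : ℝ → ℝ} {h : ℝ × ℝ → ℂ}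

theorem localFourier_eq_integral (δ : ℝ) (q : ℝ × ℝ × ℝ) : localFourier χ δ h q =
    ∫ p, Complex.exp ((-(2 * Real.pi * (p * q.2.2)) : ℝ) * Complex.I) *
      ((χ p : ℂ) * h (q.1 + δ * p, q.2.1)) := by
  rw [localFourier, Real.fourier_real_eq_integral_exp_smul]
  refine integral_congr_ae (Filter.Eventually.of_forall fun p => ?_)
  simp only [smul_eq_mul]
  congr 3
  push_cast
  ring

theorem continuous_localFourier (hχ : Continuous χ) (hχc : HasCompactSupport χ)
    (hh : Continuous h) (δ : ℝ) : Continuous (localFourier χ δ h) := by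
  have h1 : localFourier χ δ h = fun q => ∫ p, Complex.exp
      ((-(2 * Real.pi * (p * q.2.2)) : ℝ) * Complex.I) *
      ((χ p : ℂ) * h (q.1 + δ * p, q.2.1)) := by
    funext q
    exact localFourier_eq_integral δ q
  rw [h1]
  have h2 : Continuous fun q : ℝ × ℝ × ℝ => ∫ p in tsupport χ, Complex.exp
      ((-(2 * Real.pi * (p * q.2.2)) : ℝ) * Complex.I) *
      ((χ p : ℂ) * h (q.1 + δ * p, q.2.1)) := by
    refine continuous_parametric_integral_of_continuous ?_ hχc
    simp only [Function.uncurry_def]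
    fun_prop
  refine h2.congr fun q => setIntegral_eq_integral_of_forall_compl_eq_zero fun p hp => ?_
  simp [image_eq_zero_of_notMem_tsupport hp]

theorem contDiff_mul_comp_affine (hχ : ContDiff ℝ ∞ χ) (hs : ∀ y, ContDiff ℝ ∞ fun x => h (x, y))
    (δ X y : ℝ) : ContDiff ℝ ∞ fun p => (χ p : ℂ) * h (X + δ * p, y) :=
  (Complex.ofRealCLM.contDiff.comp hχ).mul
    ((hs y).comp (by fun_prop : ContDiff ℝ ∞ fun p => X + δ * p))

theorem hasCompactSupport_mul_comp_affine (hχc : HasCompactSupport χ)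
    (δ X y : ℝ) : HasCompactSupport fun p => (χ p : ℂ) * h (X + δ * p, y) :=
  (hχc.comp_left (g := fun x : ℝ => (x : ℂ)) (by simp)).mul_right

theorem lintegral_localFourier_sq (hχ : ContDiff ℝ ∞ χ) (hχc : HasCompactSupport χ)
    (hs : ∀ y, ContDiff ℝ ∞ fun x => h (x, y)) (δ X y : ℝ) :
    ∫⁻ κ, ‖localFourier χ δ h (X, y, κ)‖ₑ ^ 2 =
      ∫⁻ p, ‖χ p‖ₑ ^ 2 * ‖h (X + δ * p, y)‖ₑ ^ 2 := by
  refine (lintegral_enorm_fourier_sq (contDiff_mul_comp_affine hχ hs δ X y)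
    (hasCompactSupport_mul_comp_affine hχc δ X y)).trans (lintegral_congr fun p => ?_)
  rw [enorm_mul, mul_pow, ← ofReal_norm (χ p : ℂ), Complex.norm_real, ofReal_norm]

theorem integrable_localFourier (hχ : ContDiff ℝ ∞ χ) (hχc : HasCompactSupport χ)
    (hs : ∀ y, ContDiff ℝ ∞ fun x => h (x, y)) (δ X y : ℝ) :
    Integrable fun κ => localFourier χ δ h (X, y, κ) :=
  integrable_fourier_of_hasCompactSupport (contDiff_mul_comp_affine hχ hs δ X y)
    (hasCompactSupport_mul_comp_affine hχc δ X y)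

theorem mul_eq_integral_localFourier (hχ : ContDiff ℝ ∞ χ) (hχc : HasCompactSupport χ)
    (hs : ∀ y, ContDiff ℝ ∞ fun x => h (x, y)) (δ X y p : ℝ) :
    (χ p : ℂ) * h (X + δ * p, y) =
      ∫ κ, Complex.exp ((2 * Real.pi * (κ * p) : ℝ) * Complex.I) * localFourier χ δ h (X, y, κ) :=
  eq_integral_fourier_of_hasCompactSupport (contDiff_mul_comp_affine hχ hs δ X y)
    (hasCompactSupport_mul_comp_affine hχc δ X y) p

theorem lintegral_lintegral_localFourier_sq (hχ : ContDiff ℝ ∞ χ) (hχc : HasCompactSupport χ)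
    (hh : Continuous h) (hs : ∀ y, ContDiff ℝ ∞ fun x => h (x, y)) (δ : ℝ) :
    ∫⁻ X, ∫⁻ y, ∫⁻ κ, ‖localFourier χ δ h (X, y, κ)‖ₑ ^ 2 =
      (∫⁻ p, ‖χ p‖ₑ ^ 2) * ∫⁻ x, ∫⁻ y, ‖h (x, y)‖ₑ ^ 2 := by
  simp_rw [lintegral_localFourier_sq hχ hχc hs]
  have hχm := hχ.continuous.measurable
  have hhm := hh.measurable
  rw [← lintegral_mul_const _ (by fun_prop)]
  calc _ = ∫⁻ X, ∫⁻ p, ∫⁻ y, ‖χ p‖ₑ ^ 2 * ‖h (X + δ * p, y)‖ₑ ^ 2 := by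
        refine lintegral_congr fun X => ?_
        rw [lintegral_lintegral_swap (by fun_prop)]
    _ = ∫⁻ p, ∫⁻ X, ∫⁻ y, ‖χ p‖ₑ ^ 2 * ‖h (X + δ * p, y)‖ₑ ^ 2 := by
        rw [lintegral_lintegral_swap (by fun_prop)]
    _ = _ := by
        refine lintegral_congr fun p => ?_
        rw [lintegral_add_right_eq_self (fun X => ∫⁻ y, ‖χ p‖ₑ ^ 2 * ‖h (X, y)‖ₑ ^ 2),
          ← lintegral_const_mul _ (by fun_prop)]
        refine lintegral_congr fun x => ?_
        rw [lintegral_const_mul _ (by fun_prop)]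

open FourierTransform in
/-- Integration by parts: the local Fourier transform of a derivative, up to a change of window. -/
theorem localFourier_deriv {H : ℝ × ℝ → ℂ} (hχ : ContDiff ℝ ∞ χ) (hχc : HasCompactSupport χ)
    (hs : ∀ y, ContDiff ℝ ∞ fun x => h (x, y))
    (hHs : ∀ y, ContDiff ℝ ∞ fun x => H (x, y)) {L : ℝ}
    (hd : ∀ x y, HasDerivAt (fun x => H (x, y)) (L * h (x, y)) x) (δ : ℝ) (q : ℝ × ℝ × ℝ) :
    (L * δ : ℝ) * localFourier χ δ h q =
      2 * Real.pi * Complex.I * q.2.2 * localFourier χ δ H q - localFourier (deriv χ) δ H q := by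
  obtain ⟨X, y, κ⟩ := q
  set B : ℝ → ℂ := fun p => (χ p : ℂ) * H (X + δ * p, y) with hB
  have hχ' : ContDiff ℝ ∞ (deriv χ) := by
    exact (contDiff_infty_iff_deriv.1 hχ).2
  have hBs : ContDiff ℝ ∞ B := contDiff_mul_comp_affine hχ hHs δ X y
  have hBc : HasCompactSupport B := hasCompactSupport_mul_comp_affine hχc δ X y
  have hB' : deriv B = (fun p => ((deriv χ p : ℝ) : ℂ) * H (X + δ * p, y)) +
      fun p => ((L * δ : ℝ) : ℂ) * ((χ p : ℂ) * h (X + δ * p, y)) := by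
    funext p
    have h1 : HasDerivAt (fun p => (χ p : ℂ)) ((deriv χ p : ℝ) : ℂ) p :=
      (hχ.differentiable (by simp) p).hasDerivAt.ofReal_comp
    have h2 : HasDerivAt (fun p => H (X + δ * p, y))
        ((δ : ℝ) • ((L : ℂ) * h (X + δ * p, y))) p := by
      have h3 : HasDerivAt (fun p : ℝ => X + δ * p) δ p := by
        simpa using ((hasDerivAt_id p).const_mul δ).const_add X
      exact (hd (X + δ * p) y).scomp p h3
    have h3 : HasDerivAt B _ p := h1.mul h2
    rw [h3.deriv]
    simp only [Pi.add_apply, Complex.real_smul]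
    push_cast
    ring
  have h5 := Real.fourier_deriv (f := B) (hBs.continuous.integrable_of_hasCompactSupport hBc)
    (hBs.differentiable (by simp))
    ((hBs.continuous_deriv (by simp)).integrable_of_hasCompactSupport hBc.deriv)
  have h6 := congrFun h5 κ
  have i1 : Integrable fun p => ((deriv χ p : ℝ) : ℂ) * H (X + δ * p, y) :=
    (contDiff_mul_comp_affine hχ' hHs δ X y).continuous.integrable_of_hasCompactSupport
      (hasCompactSupport_mul_comp_affine hχc.deriv δ X y)
  have i2 : Integrable fun p => ((L * δ : ℝ) : ℂ) * ((χ p : ℂ) * h (X + δ * p, y)) :=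
    ((contDiff_mul_comp_affine hχ hs δ X y).continuous.integrable_of_hasCompactSupport
      (hasCompactSupport_mul_comp_affine hχc δ X y)).const_mul _
  have h7 : 𝓕 (deriv B) κ = localFourier (deriv χ) δ H (X, y, κ) +
      (L * δ : ℝ) * localFourier χ δ h (X, y, κ) := by
    rw [hB']
    simp only [localFourier, Real.fourier_real_eq_integral_exp_smul, Pi.add_apply, smul_add]
    rw [integral_add, ← integral_const_mul]
    · congr 1
      refine integral_congr_ae (Filter.Eventually.of_forall fun p => ?_)
      simp only [smul_eq_mul]
      ring
    · simpa [mul_comm] using i1.bdd_mul (c := 1)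
        (f := fun v : ℝ => Complex.exp (↑(-2 * Real.pi * v * κ) * Complex.I))
        (Continuous.aestronglyMeasurable (by fun_prop))
        (Filter.Eventually.of_forall fun v => (Complex.norm_exp_ofReal_mul_I _).le)
    · simpa [mul_comm] using i2.bdd_mul (c := 1)
        (f := fun v : ℝ => Complex.exp (↑(-2 * Real.pi * v * κ) * Complex.I))
        (Continuous.aestronglyMeasurable (by fun_prop))
        (Filter.Eventually.of_forall fun v => (Complex.norm_exp_ofReal_mul_I _).le)
  rw [h7] at h6
  have h8 : (2 * Real.pi * Complex.I * κ) • 𝓕 B κ =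
    2 * Real.pi * Complex.I * κ * localFourier χ δ H (X, y, κ) := rfl
  rw [h8] at h6
  linear_combination h6

/-- The low local frequencies of a function that oscillates at frequency `L` are small. -/
theorem lintegral_localFourier_low_le {H : ℝ × ℝ → ℂ} (hχ : ContDiff ℝ ∞ χ)
    (hχc : HasCompactSupport χ)
    (hs : ∀ y, ContDiff ℝ ∞ fun x => h (x, y)) (hH : Continuous H)
    (hHs : ∀ y, ContDiff ℝ ∞ fun x => H (x, y)) {L : ℝ}
    (hd : ∀ x y, HasDerivAt (fun x => H (x, y)) (L * h (x, y)) x) {δ R : ℝ} (hLδ : 0 < L * δ)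
    (hR : 1 ≤ R) :
    ∫⁻ X, ∫⁻ y, ∫⁻ κ in Set.Icc (-R) R, ‖localFourier χ δ h (X, y, κ)‖ₑ ^ 2 ≤
      ENNReal.ofReal (80 * (R / (L * δ)) ^ 2) * (((∫⁻ p, ‖χ p‖ₑ ^ 2) + ∫⁻ p, ‖deriv χ p‖ₑ ^ 2) *
        ∫⁻ x, ∫⁻ y, ‖H (x, y)‖ₑ ^ 2) := by
  have hχ' : ContDiff ℝ ∞ (deriv χ) := (contDiff_infty_iff_deriv.1 hχ).2
  have hpt : ∀ X y, ∀ κ ∈ Set.Icc (-R) R, ‖localFourier χ δ h (X, y, κ)‖ₑ ^ 2 ≤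
      ENNReal.ofReal (80 * (R / (L * δ)) ^ 2) * (‖localFourier χ δ H (X, y, κ)‖ₑ ^ 2 +
        ‖localFourier (deriv χ) δ H (X, y, κ)‖ₑ ^ 2) := by
    intro X y κ hκ
    simp only [← ofReal_norm, ← ENNReal.ofReal_pow (norm_nonneg _)]
    rw [← ENNReal.ofReal_add (by positivity) (by positivity), ← ENNReal.ofReal_mul (by positivity)]
    refine ENNReal.ofReal_le_ofReal ?_
    have h1 := localFourier_deriv hχ hχc hs hHs hd δ (X, y, κ)
    set u := ‖localFourier χ δ h (X, y, κ)‖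
    set v := ‖localFourier χ δ H (X, y, κ)‖ with hv
    set w := ‖localFourier (deriv χ) δ H (X, y, κ)‖ with hw
    have h2 : L * δ * u ≤ 2 * Real.pi * |κ| * v + w := by
      have h3 := congrArg norm h1
      rw [norm_mul, Complex.norm_real, Real.norm_of_nonneg hLδ.le] at h3
      rw [h3]
      refine (norm_sub_le _ _).trans (le_of_eq ?_)
      simp only [norm_mul, Complex.norm_real, Complex.norm_I, Real.norm_eq_abs,
        abs_of_pos Real.pi_pos, mul_one, hv, hw]
      norm_num
    have hκ' : |κ| ≤ R := abs_le.2 hκ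
    have hpi : Real.pi ≤ 3.15 := Real.pi_lt_d2.le
    have hv0 : 0 ≤ v := norm_nonneg _
    have hw0 : 0 ≤ w := norm_nonneg _
    have h4 : L * δ * u ≤ R * (6.3 * v + w) := by
      have h5 : 2 * Real.pi * |κ| * v ≤ 6.3 * R * v := by
        have := mul_le_mul hpi hκ' (abs_nonneg _) (by norm_num)
        nlinarith
      nlinarith
    have h6 : u ≤ R / (L * δ) * (6.3 * v + w) := by
      rw [div_mul_eq_mul_div, le_div_iff₀ hLδ]
      linarith
    have h7 := pow_le_pow_left₀ (norm_nonneg _) h6 2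
    have h8 : 0 ≤ (R / (L * δ)) ^ 2 := by positivity
    refine h7.trans ?_
    rw [mul_pow, mul_comm 80, mul_assoc]
    refine mul_le_mul_of_nonneg_left ?_ h8
    nlinarith [sq_nonneg (v - 6.3 * w)]
  have hc1 := (continuous_localFourier hχ.continuous hχc hH δ).measurable
  have hc2 := (continuous_localFourier hχ'.continuous hχc.deriv hH δ).measurable
  rw [add_mul, ← lintegral_lintegral_localFourier_sq hχ hχc hH hHs δ,
    ← lintegral_lintegral_localFourier_sq hχ' hχc.deriv hH hHs δ,
    ← lintegral_add_left (by fun_prop), ← lintegral_const_mul _ (by fun_prop)]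
  refine lintegral_mono fun X => ?_
  rw [← lintegral_add_left (by fun_prop), ← lintegral_const_mul _ (by fun_prop)]
  refine lintegral_mono fun y => ?_
  rw [← lintegral_add_left (by fun_prop), ← lintegral_const_mul _ (by fun_prop)]
  exact (setLIntegral_mono' measurableSet_Icc (hpt X y)).trans (setLIntegral_le_lintegral _ _)

end localFourier

/-! ### Bilinear forms with flat frequency fibres -/

/-- The `TT*` identity as an inequality: the `L²` norm of `x ↦ ∫ f(x, v) dv` is controlled by the
correlations of the functions `f(·, v)`. -/
theorem lintegral_enorm_integral_sq_le {X V : Type*} [MeasurableSpace X] [MeasurableSpace V]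
    {μ : Measure X} {ν : Measure V} [SFinite μ] [SFinite ν] {f : X → V → ℂ}
    (hf : Integrable (fun p : X × (V × V) => f p.1 p.2.1 * (starRingEnd ℂ) (f p.1 p.2.2))
      (μ.prod (ν.prod ν))) :
    ∫⁻ x, ‖∫ v, f x v ∂ν‖ₑ ^ 2 ∂μ ≤
      ∫⁻ q : V × V, ‖∫ x, f x q.1 * (starRingEnd ℂ) (f x q.2) ∂μ‖ₑ ∂(ν.prod ν) := by
  have h1 : ∀ x, ∫ q : V × V, f x q.1 * (starRingEnd ℂ) (f x q.2) ∂(ν.prod ν) =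
      ((‖∫ v, f x v ∂ν‖ ^ 2 : ℝ) : ℂ) := by
    intro x
    rw [integral_prod_mul (fun v => f x v) (fun v => (starRingEnd ℂ) (f x v)), integral_conj,
      RCLike.mul_conj]
    norm_cast
  have h2 : Integrable (fun x => ‖∫ v, f x v ∂ν‖ ^ 2) μ := by
    have := hf.integral_prod_left
    simp only [h1] at this
    refine this.re.congr (Filter.Eventually.of_forall fun x => ?_)
    simp only [RCLike.re_to_complex, Complex.ofReal_re]
  have h3 : ∫⁻ x, ‖∫ v, f x v ∂ν‖ₑ ^ 2 ∂μ = ‖∫ x, ((‖∫ v, f x v ∂ν‖ ^ 2 : ℝ) : ℂ) ∂μ‖ₑ := by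
    rw [integral_complex_ofReal, ← ofReal_norm, Complex.norm_real,
      Real.norm_of_nonneg (integral_nonneg fun x => by positivity),
      ofReal_integral_eq_lintegral_ofReal h2 (Filter.Eventually.of_forall fun x => by positivity)]
    refine lintegral_congr fun x => ?_
    rw [ENNReal.ofReal_pow (norm_nonneg _), ofReal_norm]
  rw [h3]
  simp_rw [← h1]
  rw [integral_integral_swap hf]
  exact enorm_integral_le_lintegral_enorm _

theorem enorm_integral_sq_le_of_isProbabilityMeasure {V : Type*} [MeasurableSpace V]
    {ν : Measure V} [IsProbabilityMeasure ν] {φ : V → ℂ} (hφ : AEMeasurable φ ν) :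
    ‖∫ v, φ v ∂ν‖ₑ ^ 2 ≤ ∫⁻ v, ‖φ v‖ₑ ^ 2 ∂ν := by
  have h := lintegral_mul_sq_le (μ := ν) (f := fun _ => 1) (g := fun v => ‖φ v‖ₑ)
    aemeasurable_const hφ.enorm
  simp only [one_mul, one_pow, lintegral_const, measure_univ] at h
  exact (pow_le_pow_left' (enorm_integral_le_lintegral_enorm _) 2).trans h

theorem lintegral_gaussian_eq {Δ : ℝ} (hΔ : Δ ≠ 0) (v : ℝ) :
    ∫⁻ v', ENNReal.ofReal (Real.exp (-Real.pi * (Δ * (v - v')) ^ 2)) =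
      ENNReal.ofReal (1 / |Δ|) := by
  rw [lintegral_sub_left_eq_self (fun v' => ENNReal.ofReal (Real.exp (-Real.pi * (Δ * v') ^ 2))) v]
  have h1 : ∀ x : ℝ, -Real.pi * (Δ * x) ^ 2 = -(Real.pi * Δ ^ 2) * x ^ 2 := fun x => by ring
  simp_rw [h1]
  rw [← ofReal_integral_eq_lintegral_ofReal (integrable_exp_neg_mul_sq (by positivity))
    (Filter.Eventually.of_forall fun x => (Real.exp_pos _).le), integral_gaussian]
  congr 1
  rw [show Real.pi / (Real.pi * Δ ^ 2) = (1 / |Δ|) ^ 2 by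
    rw [div_pow, sq_abs]; field_simp]
  exact Real.sqrt_sq (by positivity)

/-- Averaging the squared Fourier transform of `φ` over the frequencies `Δs` with a Gaussian weight
in `s` gains `1 / |Δ|`. -/
theorem lintegral_gaussian_mul_fourier_sq_le {ν : Measure ℝ} [IsFiniteMeasure ν]
    (hν : ν ≤ volume) {φ : ℝ → ℂ} (hφm : Measurable φ) (hφ : Integrable φ ν) {Δ : ℝ} (hΔ : Δ ≠ 0) :
    ∫⁻ s, ENNReal.ofReal (Real.exp (-Real.pi * s ^ 2)) *
        ‖∫ v, φ v * Complex.exp ((-(2 * Real.pi * (Δ * v * s)) : ℝ) * Complex.I) ∂ν‖ₑ ^ 2 ≤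
      ENNReal.ofReal (1 / |Δ|) * ∫⁻ v, ‖φ v‖ₑ ^ 2 ∂ν := by
  set g : ℝ → ℝ := fun s => Real.exp (-Real.pi / 2 * s ^ 2) with hg
  set f : ℝ → ℝ → ℂ := fun s v => (g s : ℂ) * (φ v *
    Complex.exp ((-(2 * Real.pi * (Δ * v * s)) : ℝ) * Complex.I)) with hf
  have hg2 : ∀ s, g s * g s = Real.exp (-Real.pi * s ^ 2) := by
    intro s
    rw [hg, ← Real.exp_add]
    congr 1
    ring
  have hgm : Measurable g := by fun_prop
  have hL : ∀ s, ENNReal.ofReal (Real.exp (-Real.pi * s ^ 2)) *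
        ‖∫ v, φ v * Complex.exp ((-(2 * Real.pi * (Δ * v * s)) : ℝ) * Complex.I) ∂ν‖ₑ ^ 2 =
      ‖∫ v, f s v ∂ν‖ₑ ^ 2 := by
    intro s
    have hgs : ‖(g s : ℂ)‖ₑ ^ 2 = ENNReal.ofReal (g s * g s) := by
      rw [← ofReal_norm, Complex.norm_real, Real.norm_of_nonneg (Real.exp_pos _).le,
        ← ENNReal.ofReal_pow (Real.exp_pos _).le, sq]
    simp only [hf]
    rw [integral_const_mul, enorm_mul, mul_pow, hgs, hg2]
  simp_rw [hL]
  have hff : ∀ s v v', f s v * (starRingEnd ℂ) (f s v') = φ v * (starRingEnd ℂ) (φ v') *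
      (Complex.exp ((-2 * Real.pi * s * (Δ * (v - v')) : ℝ) * Complex.I) *
        (Real.exp (-Real.pi * s ^ 2) : ℂ)) := by
    intro s v v'
    rw [← hg2]
    simp only [hf, map_mul, Complex.conj_ofReal, ← Complex.exp_conj, Complex.conj_I]
    have : Complex.exp ((-2 * Real.pi * s * (Δ * (v - v')) : ℝ) * Complex.I) =
      Complex.exp ((-(2 * Real.pi * (Δ * v * s)) : ℝ) * Complex.I) *
        Complex.exp ((-(2 * Real.pi * (Δ * v' * s)) : ℝ) * -Complex.I) := by
      rw [← Complex.exp_add]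
      congr 1
      push_cast
      ring
    rw [this]
    push_cast
    ring
  have hgi : Integrable fun s : ℝ => (Real.exp (-Real.pi * s ^ 2) : ℂ) := by
    have := (integrable_exp_neg_mul_sq Real.pi_pos).ofReal (𝕜 := ℂ)
    simpa using this
  have hφc : Integrable (fun v => (starRingEnd ℂ) (φ v)) ν := by
    simpa using (Complex.conjCLE.integrable_comp_iff (φ := φ)).2 hφ
  have hint : Integrable (fun p : ℝ × (ℝ × ℝ) => f p.1 p.2.1 * (starRingEnd ℂ) (f p.1 p.2.2))
      (volume.prod (ν.prod ν)) := by
    have h1 := hgi.mul_prod (hφ.mul_prod hφc)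
    have h2 := h1.bdd_mul (c := 1) (f := fun p : ℝ × (ℝ × ℝ) =>
      Complex.exp ((-2 * Real.pi * p.1 * (Δ * (p.2.1 - p.2.2)) : ℝ) * Complex.I))
      (Continuous.aestronglyMeasurable (by fun_prop))
      (Filter.Eventually.of_forall fun p => (Complex.norm_exp_ofReal_mul_I _).le)
    refine h2.congr (Filter.Eventually.of_forall fun p => ?_)
    simp only [hff]
    ring
  refine (lintegral_enorm_integral_sq_le hint).trans ?_
  have hcorr : ∀ v v', ∫ s, f s v * (starRingEnd ℂ) (f s v') = φ v * (starRingEnd ℂ) (φ v') *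
      (Real.exp (-Real.pi * (Δ * (v - v')) ^ 2) : ℂ) := by
    intro v v'
    simp_rw [hff]
    rw [integral_const_mul]
    congr 1
    have h1 := congrFun (fourier_gaussian_pi (b := 1) (by simp)) (Δ * (v - v'))
    rw [Real.fourier_real_eq_integral_exp_smul] at h1
    simp only [smul_eq_mul, mul_one, Complex.one_cpow, div_one, one_mul] at h1
    push_cast at h1 ⊢
    exact h1
  set E : ℝ → ℝ → ENNReal := fun v v' =>
    ENNReal.ofReal (Real.exp (-Real.pi * (Δ * (v - v')) ^ 2)) with hE
  have hEs : ∀ v v', E v v' = E v' v := by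
    intro v v'
    simp only [hE]
    congr 3
    ring
  have hEm : Measurable fun q : ℝ × ℝ => E q.1 q.2 := by fun_prop
  have hEi : ∀ v, ∫⁻ v', E v v' ∂ν ≤ ENNReal.ofReal (1 / |Δ|) := fun v =>
    (lintegral_mono' hν le_rfl).trans (lintegral_gaussian_eq hΔ v).le
  have half : ∫⁻ q : ℝ × ℝ, ‖φ q.1‖ₑ ^ 2 * E q.1 q.2 ∂(ν.prod ν) ≤
      ENNReal.ofReal (1 / |Δ|) * ∫⁻ v, ‖φ v‖ₑ ^ 2 ∂ν := by
    rw [lintegral_prod _ (by fun_prop), ← lintegral_const_mul _ (by fun_prop)]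
    refine lintegral_mono fun v => ?_
    simp only
    rw [lintegral_const_mul _ (by fun_prop), mul_comm]
    exact mul_le_mul_left (hEi v) _
  have hpt : ∀ q : ℝ × ℝ, 2 * ‖∫ s, f s q.1 * (starRingEnd ℂ) (f s q.2)‖ₑ ≤
      ‖φ q.1‖ₑ ^ 2 * E q.1 q.2 + ‖φ q.2‖ₑ ^ 2 * E q.2 q.1 := by
    intro q
    rw [hcorr, hEs q.2 q.1, ← add_mul, enorm_mul, enorm_mul, RCLike.enorm_conj, ← mul_assoc]
    refine mul_le_mul' ?_ ?_
    · rw [← mul_assoc]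
      simp only [enorm]
      exact_mod_cast two_mul_le_add_sq ‖φ q.1‖₊ ‖φ q.2‖₊
    · rw [← ofReal_norm, Complex.norm_real,
        Real.norm_of_nonneg (Real.exp_pos _).le]
  have hsum : 2 * ∫⁻ q : ℝ × ℝ, ‖∫ s, f s q.1 * (starRingEnd ℂ) (f s q.2)‖ₑ ∂(ν.prod ν) ≤
      2 * (ENNReal.ofReal (1 / |Δ|) * ∫⁻ v, ‖φ v‖ₑ ^ 2 ∂ν) := by
    rw [← lintegral_const_mul' _ _ (by simp)]
    refine (lintegral_mono hpt).trans ?_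
    rw [lintegral_add_left (by fun_prop), two_mul]
    refine add_le_add half ?_
    exact (lintegral_prod_swap (μ := ν) (ν := ν)
      (fun q : ℝ × ℝ => ‖φ q.1‖ₑ ^ 2 * E q.1 q.2)).le.trans half
  exact (ENNReal.mul_le_mul_iff_right (by simp) (by simp)).1 hsum

/-- The product of two half-densities: for `a = 0` both sides are governed by `0⁻¹ = 0`. -/
theorem enorm_inv_sqrt_mul_sq {a : ℝ} (ha : 0 ≤ a) (z : ℂ) :
    ‖((Real.sqrt a)⁻¹ : ℂ) * z‖ₑ ^ 2 = ENNReal.ofReal a⁻¹ * ‖z‖ₑ ^ 2 := by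
  rw [enorm_mul, mul_pow]
  congr 1
  rw [← Complex.ofReal_inv, ← ofReal_norm, Complex.norm_real,
    Real.norm_of_nonneg (by positivity), ← ENNReal.ofReal_pow (by positivity), inv_pow,
    Real.sq_sqrt ha]

theorem ofReal_inv_mul_sq_le (a : ℝ) :
    ENNReal.ofReal a⁻¹ * ENNReal.ofReal a ^ 2 ≤ ENNReal.ofReal a := by
  rcases le_or_gt a 0 with h | h
  · simp [ENNReal.ofReal_of_nonpos h]
  · rw [← ENNReal.ofReal_pow h.le, ← ENNReal.ofReal_mul (by positivity)]
    apply ENNReal.ofReal_le_ofReal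
    field_simp
    exact le_rfl

/-- The correlation of the rows `A(·, κ)` and `A(·, κ')`, with weight `1 / α` and phase
`(κ - κ') v s`. -/
noncomputable def weightedCorrelation (ν : Measure ℝ) (A : ℝ → ℝ → ℂ) (α : ℝ → ℝ)
    (s κ κ' : ℝ) : ℂ :=
  ∫ v, ((α v)⁻¹ : ℂ) * (A v κ * (starRingEnd ℂ) (A v κ')) *
    Complex.exp ((-(2 * Real.pi * ((κ - κ') * v * s)) : ℝ) * Complex.I) ∂ν

theorem enorm_exp_ofReal_mul_I (x : ℝ) : ‖Complex.exp ((x : ℝ) * Complex.I)‖ₑ = 1 := by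
  rw [← ofReal_norm, Complex.norm_exp_ofReal_mul_I, ENNReal.ofReal_one]

theorem measurable_weightedCorrelation {ν : Measure ℝ} [SFinite ν] {A : ℝ → ℝ → ℂ}
    (hA : Measurable fun q : ℝ × ℝ => A q.1 q.2) {α : ℝ → ℝ} (hα : Measurable α) (s : ℝ) :
    Measurable fun q : ℝ × ℝ => weightedCorrelation ν A α s q.1 q.2 := by
  have h1 := hA.comp (by fun_prop : Measurable fun q : (ℝ × ℝ) × ℝ => (q.2, q.1.1))
  have h2 := hA.comp (by fun_prop : Measurable fun q : (ℝ × ℝ) × ℝ => (q.2, q.1.2))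
  have h3 : Measurable fun q : (ℝ × ℝ) × ℝ =>
      ((α q.2)⁻¹ : ℂ) * (A q.2 q.1.1 * (starRingEnd ℂ) (A q.2 q.1.2)) *
        Complex.exp ((-(2 * Real.pi * ((q.1.1 - q.1.2) * q.2 * s)) : ℝ) * Complex.I) := by
    refine (Measurable.mul (by fun_prop) (h1.mul
      (Complex.continuous_conj.measurable.comp h2))).mul (by fun_prop)
  exact (h3.stronglyMeasurable.integral_prod_right (ν := ν)).measurable

/-- Without flatness, the correlations are bounded by Jensen's inequality in `v`. -/
theorem lintegral_weightedCorrelation_sq_le {ν : Measure ℝ} [IsProbabilityMeasure ν]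
    {A : ℝ → ℝ → ℂ} (hA : Measurable fun q : ℝ × ℝ => A q.1 q.2) {α : ℝ → ℝ} (hα : Measurable α)
    (hα0 : ∀ v, 0 ≤ α v) (hAα : ∀ v, ∫⁻ κ, ‖A v κ‖ₑ ^ 2 ≤ ENNReal.ofReal (α v) ^ 2) (s : ℝ) :
    ∫⁻ q : ℝ × ℝ, ‖weightedCorrelation ν A α s q.1 q.2‖ₑ ^ 2 ≤
      ∫⁻ v, ENNReal.ofReal (α v) ^ 2 ∂ν := by
  have hm : ∀ κ, Measurable fun v => A v κ := fun κ =>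
    hA.comp (by fun_prop : Measurable fun v => (v, κ))
  have hm' : ∀ v, Measurable fun κ => A v κ := fun v =>
    hA.comp (by fun_prop : Measurable fun κ => (v, κ))
  have h1 : ∀ q : ℝ × ℝ, ‖weightedCorrelation ν A α s q.1 q.2‖ₑ ^ 2 ≤
      ∫⁻ v, ENNReal.ofReal (α v)⁻¹ ^ 2 * (‖A v q.1‖ₑ ^ 2 * ‖A v q.2‖ₑ ^ 2) ∂ν := by
    intro q
    have := hm q.1
    have := hm q.2
    refine (enorm_integral_sq_le_of_isProbabilityMeasure ?_).trans ?_
    · exact Measurable.aemeasurable (by fun_prop)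
    · refine lintegral_mono fun v => ?_
      simp only
      rw [enorm_mul, enorm_mul, enorm_mul, RCLike.enorm_conj, enorm_exp_ofReal_mul_I, mul_one,
        mul_pow, mul_pow, ← Complex.ofReal_inv, ← ofReal_norm, Complex.norm_real,
        Real.norm_of_nonneg (inv_nonneg.2 (hα0 v))]
  have hM : Measurable fun r : (ℝ × ℝ) × ℝ =>
      ENNReal.ofReal (α r.2)⁻¹ ^ 2 * (‖A r.2 r.1.1‖ₑ ^ 2 * ‖A r.2 r.1.2‖ₑ ^ 2) := by
    have h1 := hA.comp (by fun_prop : Measurable fun q : (ℝ × ℝ) × ℝ => (q.2, q.1.1))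
    have h2 := hA.comp (by fun_prop : Measurable fun q : (ℝ × ℝ) × ℝ => (q.2, q.1.2))
    exact Measurable.mul (by fun_prop) ((h1.enorm.pow_const 2).mul (h2.enorm.pow_const 2))
  refine (lintegral_mono h1).trans ?_
  rw [lintegral_lintegral_swap hM.aemeasurable]
  refine lintegral_mono fun v => ?_
  have := hm' v
  simp only
  rw [lintegral_const_mul' _ _ (by simp), Measure.volume_eq_prod,
    lintegral_prod_mul (f := fun κ => ‖A v κ‖ₑ ^ 2) (g := fun κ => ‖A v κ‖ₑ ^ 2) (by fun_prop)
      (by fun_prop), ← sq, ← mul_pow]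
  refine pow_le_pow_left' ((mul_le_mul_right (hAα v) _).trans (ofReal_inv_mul_sq_le _)) 2

/-- The function `A`, modulated by `e^{-2πiκvs}` and divided by the square root of a weight that
dominates its rows. -/
noncomputable def halfDensity (A : ℝ → ℝ → ℂ) (α : ℝ → ℝ) (s v κ : ℝ) : ℂ :=
  ((Real.sqrt (α v))⁻¹ : ℂ) * (A v κ * Complex.exp ((-(2 * Real.pi * (κ * v * s)) : ℝ) * Complex.I))

theorem measurable_halfDensity {A : ℝ → ℝ → ℂ} (hA : Measurable fun q : ℝ × ℝ => A q.1 q.2)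
    {α : ℝ → ℝ} (hα : Measurable α) (s : ℝ) :
    Measurable fun q : ℝ × ℝ => halfDensity A α s q.1 q.2 := by
  unfold halfDensity
  fun_prop

theorem lintegral_halfDensity_sq_le {A : ℝ → ℝ → ℂ} {α : ℝ → ℝ} (hα0 : ∀ v, 0 ≤ α v)
    (hAα : ∀ v, ∫⁻ κ, ‖A v κ‖ₑ ^ 2 ≤ ENNReal.ofReal (α v) ^ 2) (s v : ℝ) :
    ∫⁻ κ, ‖halfDensity A α s v κ‖ₑ ^ 2 ≤ ENNReal.ofReal (α v) := by
  simp only [halfDensity]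
  simp_rw [enorm_inv_sqrt_mul_sq (hα0 v), enorm_mul, enorm_exp_ofReal_mul_I, mul_one]
  rw [lintegral_const_mul' _ _ (by simp)]
  exact (mul_le_mul_right (hAα v) _).trans (ofReal_inv_mul_sq_le _)

theorem halfDensity_mul_conj {A : ℝ → ℝ → ℂ} {α : ℝ → ℝ} (hα0 : ∀ v, 0 ≤ α v) (s v κ κ' : ℝ) :
    halfDensity A α s v κ * (starRingEnd ℂ) (halfDensity A α s v κ') =
      ((α v)⁻¹ : ℂ) * (A v κ * (starRingEnd ℂ) (A v κ')) *
        Complex.exp ((-(2 * Real.pi * ((κ - κ') * v * s)) : ℝ) * Complex.I) := by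
  simp only [halfDensity, map_mul, map_inv₀, Complex.conj_ofReal, ← Complex.exp_conj,
    Complex.conj_I]
  have h1 : Complex.exp ((-(2 * Real.pi * ((κ - κ') * v * s)) : ℝ) * Complex.I) =
      Complex.exp ((-(2 * Real.pi * (κ * v * s)) : ℝ) * Complex.I) *
        Complex.exp ((-(2 * Real.pi * (κ' * v * s)) : ℝ) * -Complex.I) := by
    rw [← Complex.exp_add]
    congr 1
    push_cast
    ring
  have h2 : ((α v)⁻¹ : ℂ) = (Real.sqrt (α v) : ℂ)⁻¹ * (Real.sqrt (α v) : ℂ)⁻¹ := by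
    rw [← mul_inv, ← Complex.ofReal_mul, Real.mul_self_sqrt (hα0 v)]
  rw [h1, h2]
  ring

/-- Where the weight vanishes so does almost every value of `A`, so nothing is lost in passing to
half-densities. -/
theorem ae_sqrt_mul_halfDensity {A : ℝ → ℝ → ℂ} (hA : Measurable fun q : ℝ × ℝ => A q.1 q.2)
    {α : ℝ → ℝ} (hα0 : ∀ v, 0 ≤ α v)
    (hAα : ∀ v, ∫⁻ κ, ‖A v κ‖ₑ ^ 2 ≤ ENNReal.ofReal (α v) ^ 2) (s v : ℝ) :
    ∀ᵐ κ : ℝ, ((Real.sqrt (α v) : ℝ) : ℂ) * halfDensity A α s v κ =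
      A v κ * Complex.exp ((-(2 * Real.pi * (κ * v * s)) : ℝ) * Complex.I) := by
  have hm : Measurable fun κ => A v κ := hA.comp (by fun_prop : Measurable fun κ => (v, κ))
  rcases (hα0 v).eq_or_lt with h0 | h0
  · have h := hAα v
    rw [← h0] at h
    simp only [ENNReal.ofReal_zero, ne_eq, OfNat.ofNat_ne_zero, not_false_eq_true, zero_pow,
      nonpos_iff_eq_zero] at h
    rw [lintegral_eq_zero_iff (by fun_prop)] at h
    filter_upwards [h] with κ hκ
    have : A v κ = 0 := by simpa using hκ
    simp [halfDensity, this]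
  · refine Filter.Eventually.of_forall fun κ => ?_
    have : (Real.sqrt (α v) : ℂ) ≠ 0 := by
      exact_mod_cast (Real.sqrt_pos.2 h0).ne'
    rw [halfDensity, mul_inv_cancel_left₀ this]

theorem measurable_mul_swap {a b : ℝ → ℝ → ℂ} (ha : Measurable fun q : ℝ × ℝ => a q.1 q.2)
    (hb : Measurable fun q : ℝ × ℝ => b q.1 q.2) :
    Measurable fun q : (ℝ × ℝ) × ℝ => a q.1.2 q.2 * b q.1.1 q.2 := by
  have h1 : Measurable fun q : (ℝ × ℝ) × ℝ => a q.1.2 q.2 :=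
    ha.comp (g := fun q : ℝ × ℝ => a q.1 q.2)
      (by fun_prop : Measurable fun q : (ℝ × ℝ) × ℝ => (q.1.2, q.2))
  have h2 : Measurable fun q : (ℝ × ℝ) × ℝ => b q.1.1 q.2 :=
    hb.comp (g := fun q : ℝ × ℝ => b q.1 q.2)
      (by fun_prop : Measurable fun q : (ℝ × ℝ) × ℝ => (q.1.1, q.2))
  exact h1.mul h2

/-- The `TT*` inequality for `(u, v) ↦ ∫ a(v, κ) b(u, κ) dκ`, whose correlations factor. -/
theorem lintegral_enorm_integral_mul_sq_le {ν : Measure ℝ} [SFinite ν] {a b : ℝ → ℝ → ℂ}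
    (ha : Measurable fun q : ℝ × ℝ => a q.1 q.2) (hb : Measurable fun q : ℝ × ℝ => b q.1 q.2)
    (hai : ∫⁻ v, ∫⁻ κ, ‖a v κ‖ₑ ^ 2 ∂volume ∂ν ≠ ⊤)
    (hbi : ∫⁻ u, ∫⁻ κ, ‖b u κ‖ₑ ^ 2 ∂volume ∂ν ≠ ⊤) :
    ∫⁻ p : ℝ × ℝ, ‖∫ κ, a p.2 κ * b p.1 κ‖ₑ ^ 2 ∂(ν.prod ν) ≤
      ∫⁻ q : ℝ × ℝ, ‖∫ u, b u q.1 * (starRingEnd ℂ) (b u q.2) ∂ν‖ₑ *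
        ‖∫ v, a v q.1 * (starRingEnd ℂ) (a v q.2) ∂ν‖ₑ := by
  have hmf := measurable_mul_swap ha hb
  have hma' : ∀ v, Measurable fun κ => a v κ := fun v =>
    ha.comp (by fun_prop : Measurable fun κ => (v, κ))
  have hmb' : ∀ v, Measurable fun κ => b v κ := fun v =>
    hb.comp (by fun_prop : Measurable fun κ => (v, κ))
  have hint : Integrable (fun p : (ℝ × ℝ) × (ℝ × ℝ) => (a p.1.2 p.2.1 * b p.1.1 p.2.1) *
      (starRingEnd ℂ) (a p.1.2 p.2.2 * b p.1.1 p.2.2)) ((ν.prod ν).prod (volume.prod volume)) := by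
    have h1 : Measurable fun p : (ℝ × ℝ) × (ℝ × ℝ) => a p.1.2 p.2.1 * b p.1.1 p.2.1 :=
      hmf.comp (g := fun q : (ℝ × ℝ) × ℝ => a q.1.2 q.2 * b q.1.1 q.2)
        (by fun_prop : Measurable fun q : (ℝ × ℝ) × (ℝ × ℝ) => (q.1, q.2.1))
    have h2 : Measurable fun p : (ℝ × ℝ) × (ℝ × ℝ) => a p.1.2 p.2.2 * b p.1.1 p.2.2 :=
      hmf.comp (g := fun q : (ℝ × ℝ) × ℝ => a q.1.2 q.2 * b q.1.1 q.2)
        (by fun_prop : Measurable fun q : (ℝ × ℝ) × (ℝ × ℝ) => (q.1, q.2.2))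
    have hm : Measurable fun p : (ℝ × ℝ) × (ℝ × ℝ) => (a p.1.2 p.2.1 * b p.1.1 p.2.1) *
        (starRingEnd ℂ) (a p.1.2 p.2.2 * b p.1.1 p.2.2) :=
      h1.mul (Complex.continuous_conj.measurable.comp h2)
    refine ⟨hm.aestronglyMeasurable, ?_⟩
    rw [HasFiniteIntegral, lintegral_prod _ hm.enorm.aemeasurable]
    have h3 : ∀ p : ℝ × ℝ, ∫⁻ q : ℝ × ℝ, ‖(a p.2 q.1 * b p.1 q.1) *
        (starRingEnd ℂ) (a p.2 q.2 * b p.1 q.2)‖ₑ ∂volume.prod volume ≤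
        (∫⁻ κ, ‖b p.1 κ‖ₑ ^ 2) * ∫⁻ κ, ‖a p.2 κ‖ₑ ^ 2 := by
      intro p
      have := hma' p.2
      have := hmb' p.1
      simp_rw [enorm_mul, RCLike.enorm_conj, enorm_mul]
      rw [lintegral_prod_mul (f := fun κ => ‖a p.2 κ‖ₑ * ‖b p.1 κ‖ₑ)
        (g := fun κ => ‖a p.2 κ‖ₑ * ‖b p.1 κ‖ₑ) (by fun_prop) (by fun_prop), ← sq, mul_comm]
      exact lintegral_mul_sq_le (by fun_prop) (by fun_prop)
    refine (lintegral_mono h3).trans_lt ?_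
    rw [lintegral_prod_mul (f := fun u => ∫⁻ κ, ‖b u κ‖ₑ ^ 2) (g := fun v => ∫⁻ κ, ‖a v κ‖ₑ ^ 2)
      (hb.enorm.pow_const 2).lintegral_prod_right.aemeasurable
      (ha.enorm.pow_const 2).lintegral_prod_right.aemeasurable]
    exact ENNReal.mul_lt_top hbi.lt_top hai.lt_top
  refine (lintegral_enorm_integral_sq_le (μ := ν.prod ν) (ν := volume)
    (f := fun (p : ℝ × ℝ) κ => a p.2 κ * b p.1 κ) hint).trans (le_of_eq ?_)
  refine lintegral_congr fun q => ?_
  rw [← enorm_mul, ← integral_prod_mul (fun u => b u q.1 * (starRingEnd ℂ) (b u q.2))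
    (fun v => a v q.1 * (starRingEnd ℂ) (a v q.2))]
  congr 2
  funext p
  rw [map_mul]
  ring

/-- The integral of `A B` against a character, compared with that of half-densities. -/
theorem enorm_integral_mul_exp_le {A B : ℝ → ℝ → ℂ} (hA : Measurable fun q : ℝ × ℝ => A q.1 q.2)
    (hB : Measurable fun q : ℝ × ℝ => B q.1 q.2) {α β : ℝ → ℝ} (hα0 : ∀ v, 0 ≤ α v)
    (hβ0 : ∀ u, 0 ≤ β u)
    (hAα : ∀ v, ∫⁻ κ, ‖A v κ‖ₑ ^ 2 ≤ ENNReal.ofReal (α v) ^ 2)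
    (hBβ : ∀ u, ∫⁻ κ, ‖B u κ‖ₑ ^ 2 ≤ ENNReal.ofReal (β u) ^ 2) (s : ℝ) {ε : ℝ} (hε : 0 < ε)
    (u v : ℝ) :
    ‖∫ κ, A v κ * B u κ *
        Complex.exp ((2 * Real.pi * (κ * (u - s * v)) : ℝ) * Complex.I)‖ₑ ≤
      ENNReal.ofReal ε * (ENNReal.ofReal (α v) ^ 2 + ENNReal.ofReal (β u) ^ 2) +
      ENNReal.ofReal ε⁻¹ * ‖∫ κ, halfDensity A α s v κ * halfDensity B β (-1) u κ‖ₑ ^ 2 := by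
  have hJ : ∫ κ, A v κ * B u κ *
      Complex.exp ((2 * Real.pi * (κ * (u - s * v)) : ℝ) * Complex.I) =
      ((Real.sqrt (α v) * Real.sqrt (β u) : ℝ) : ℂ) *
        ∫ κ, halfDensity A α s v κ * halfDensity B β (-1) u κ := by
    rw [← integral_const_mul]
    refine integral_congr_ae ?_
    filter_upwards [ae_sqrt_mul_halfDensity hA hα0 hAα s v,
      ae_sqrt_mul_halfDensity hB hβ0 hBβ (-1) u] with κ h1 h2
    have he : Complex.exp ((2 * Real.pi * (κ * (u - s * v)) : ℝ) * Complex.I) =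
        Complex.exp ((-(2 * Real.pi * (κ * v * s)) : ℝ) * Complex.I) *
        Complex.exp ((-(2 * Real.pi * (κ * u * (-1))) : ℝ) * Complex.I) := by
      rw [← Complex.exp_add]
      congr 1
      push_cast
      ring
    rw [he, mul_mul_mul_comm, ← h1, ← h2]
    rw [Complex.ofReal_mul]
    ring
  rw [hJ, enorm_mul]
  refine (ENNReal.mul_le_ofReal_mul_sq_add hε _ _).trans ?_
  gcongr
  rw [← ofReal_norm, Complex.norm_real, Real.norm_of_nonneg (by positivity),
    ← ENNReal.ofReal_pow (by positivity), mul_pow, Real.sq_sqrt (hα0 v), Real.sq_sqrt (hβ0 u),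
    ENNReal.ofReal_mul (hα0 v)]
  simpa using ENNReal.mul_le_ofReal_mul_sq_add one_pos (ENNReal.ofReal (α v)) (ENNReal.ofReal (β u))

theorem lintegral_lintegral_add_add {ν : Measure ℝ} [IsProbabilityMeasure ν] {a b : ℝ → ENNReal}
    (ha : Measurable a) (hb : Measurable b) {J : ℝ × ℝ → ENNReal} (hJ : Measurable J)
    {c d : ENNReal} (hc : c ≠ ⊤) (hd : d ≠ ⊤) :
    ∫⁻ u, ∫⁻ v, (c * (a v + b u) + d * J (u, v)) ∂ν ∂ν =
      c * (∫⁻ v, a v ∂ν + ∫⁻ u, b u ∂ν) + d * ∫⁻ p, J p ∂(ν.prod ν) := by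
  rw [lintegral_prod _ hJ.aemeasurable]
  have h3 : ∀ u, ∫⁻ v, (c * (a v + b u) + d * J (u, v)) ∂ν =
      c * (∫⁻ v, a v ∂ν + b u) + d * ∫⁻ v, J (u, v) ∂ν := by
    intro u
    rw [lintegral_add_left (by fun_prop), lintegral_const_mul' _ _ hc,
      lintegral_const_mul' _ _ hd, lintegral_add_left ha]
    simp
  simp_rw [h3]
  rw [lintegral_add_left (by fun_prop), lintegral_const_mul' _ _ hc,
      lintegral_const_mul' _ _ hd, lintegral_add_left (by fun_prop)]
  simp

/-- The form `∫ A(v, κ) B(u, κ) e^{2πiκ(u - sv)} dκ` on the unit square, bounded through the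
correlations of `A` alone; `ε` and `η` are free parameters in two applications of the inequality
between arithmetic and geometric means. -/
theorem lintegral_bilinear_le {ν : Measure ℝ} [IsProbabilityMeasure ν]
    {A B : ℝ → ℝ → ℂ} (hA : Measurable fun q : ℝ × ℝ => A q.1 q.2)
    (hB : Measurable fun q : ℝ × ℝ => B q.1 q.2) {α β : ℝ → ℝ} (hα : Measurable α)
    (hβ : Measurable β) (hα0 : ∀ v, 0 ≤ α v) (hβ0 : ∀ u, 0 ≤ β u)
    (hαi : ∫⁻ v, ENNReal.ofReal (α v) ∂ν ≠ ⊤) (hβi : ∫⁻ u, ENNReal.ofReal (β u) ∂ν ≠ ⊤)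
    (hAα : ∀ v, ∫⁻ κ, ‖A v κ‖ₑ ^ 2 ≤ ENNReal.ofReal (α v) ^ 2)
    (hBβ : ∀ u, ∫⁻ κ, ‖B u κ‖ₑ ^ 2 ≤ ENNReal.ofReal (β u) ^ 2) (s : ℝ) {ε η : ℝ} (hε : 0 < ε)
    (hη : 0 < η) :
    ∫⁻ u, ∫⁻ v, ‖∫ κ, A v κ * B u κ *
        Complex.exp ((2 * Real.pi * (κ * (u - s * v)) : ℝ) * Complex.I)‖ₑ ∂ν ∂ν ≤
      ENNReal.ofReal ε * (∫⁻ v, ENNReal.ofReal (α v) ^ 2 ∂ν + ∫⁻ u, ENNReal.ofReal (β u) ^ 2 ∂ν) +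
      ENNReal.ofReal ε⁻¹ * (ENNReal.ofReal η⁻¹ *
        (∫⁻ q : ℝ × ℝ, ‖weightedCorrelation ν A α s q.1 q.2‖ₑ ^ 2) +
        ENNReal.ofReal η * ∫⁻ u, ENNReal.ofReal (β u) ^ 2 ∂ν) := by
  have hma := measurable_halfDensity hA hα s
  have hmb := measurable_halfDensity hB hβ (-1)
  have hna := lintegral_halfDensity_sq_le hα0 hAα s
  have hnb := lintegral_halfDensity_sq_le hβ0 hBβ (-1)
  have hTT := lintegral_enorm_integral_mul_sq_le hma hmb
    ((lintegral_mono hna).trans_lt hαi.lt_top).ne ((lintegral_mono hnb).trans_lt hβi.lt_top).ne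
  have hmf := measurable_mul_swap hma hmb
  have hpt := enorm_integral_mul_exp_le hA hB hα0 hβ0 hAα hBβ s hε
  have hJm : Measurable fun p : ℝ × ℝ =>
      ‖∫ κ, halfDensity A α s p.2 κ * halfDensity B β (-1) p.1 κ‖ₑ ^ 2 :=
    (hmf.stronglyMeasurable.integral_prod_right).measurable.enorm.pow_const 2
  refine (lintegral_mono fun u => lintegral_mono fun v => hpt u v).trans ?_
  rw [lintegral_lintegral_add_add (a := fun v => ENNReal.ofReal (α v) ^ 2)
    (b := fun u => ENNReal.ofReal (β u) ^ 2) (by fun_prop) (by fun_prop) hJm (by simp) (by simp)]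
  gcongr
  refine hTT.trans ?_
  simp_rw [halfDensity_mul_conj hα0, halfDensity_mul_conj hβ0]
  have hPm := measurable_weightedCorrelation (ν := ν) hA hα s
  have hAM : ∀ q : ℝ × ℝ, ‖weightedCorrelation ν B β (-1) q.1 q.2‖ₑ *
      ‖weightedCorrelation ν A α s q.1 q.2‖ₑ ≤
      ENNReal.ofReal η⁻¹ * ‖weightedCorrelation ν A α s q.1 q.2‖ₑ ^ 2 +
      ENNReal.ofReal η * ‖weightedCorrelation ν B β (-1) q.1 q.2‖ₑ ^ 2 := by
    intro q
    rw [add_comm]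
    exact ENNReal.mul_le_ofReal_mul_sq_add hη _ _
  refine (lintegral_mono hAM).trans ?_
  rw [lintegral_add_left (by fun_prop), lintegral_const_mul' _ _ (by simp),
    lintegral_const_mul' _ _ (by simp)]
  exact add_le_add le_rfl
    (mul_le_mul_right (lintegral_weightedCorrelation_sq_le (ν := ν) hB hβ hβ0 hBβ (-1)) _)

/-- On `[1/2, 2]` the change of variables `s = 1 / (2t)` is dominated by the Gaussian measure. -/
theorem lintegral_Icc_comp_inv_le {ψ : ℝ → ENNReal} :
    ∫⁻ t in Set.Icc (1 / 2 : ℝ) 2, ψ (1 / (2 * t)) ≤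
      ENNReal.ofReal (8 * Real.exp Real.pi) *
        ∫⁻ s, ENNReal.ofReal (Real.exp (-Real.pi * s ^ 2)) * ψ s := by
  set S := Set.Icc (1 / 2 : ℝ) 2 with hS
  have hpos : ∀ t ∈ S, 0 < t := fun t ht => lt_of_lt_of_le (by norm_num) ht.1
  have hd : ∀ t ∈ S, HasDerivWithinAt (fun t : ℝ => 1 / (2 * t)) (-(1 / (2 * t ^ 2))) S t := by
    intro t ht
    have h1 := ((hasDerivAt_id t).const_mul 2).inv (by simpa using (hpos t ht).ne')
    have h2 := h1.hasDerivWithinAt (s := S)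
    refine (h2.congr_of_mem (fun x _ => by simp) ht).congr_deriv ?_
    have := (hpos t ht).ne'
    simp only [id]
    field_simp
  have hinj : Set.InjOn (fun t : ℝ => 1 / (2 * t)) S := by
    intro t ht t' ht' h
    have h1 := (hpos t ht).ne'
    have h2 := (hpos t' ht').ne'
    simp only at h
    field_simp at h
    linarith
  have hcv := lintegral_image_eq_lintegral_abs_deriv_mul (s := S) measurableSet_Icc hd hinj
    (fun s => ENNReal.ofReal (Real.exp (-Real.pi * s ^ 2)) * ψ s)
  refine le_trans ?_ (mul_le_mul_right (setLIntegral_le_lintegral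
    ((fun t : ℝ => 1 / (2 * t)) '' S) _) _)
  rw [hcv, ← lintegral_const_mul' _ _ ENNReal.ofReal_ne_top]
  refine setLIntegral_mono' measurableSet_Icc fun t ht => ?_
  have ht0 := hpos t ht
  rw [← mul_assoc, ← mul_assoc, ← ENNReal.ofReal_mul (by positivity),
    ← ENNReal.ofReal_mul (by positivity)]
  refine le_mul_of_one_le_left zero_le ?_
  rw [ENNReal.one_le_ofReal, abs_neg, abs_of_pos (by positivity)]
  -- on this range `1 / (2 t²) ≥ 1 / 8` and `1 / (2 t) ≤ 1`
  have h1 : 1 ≤ 8 * (1 / (2 * t ^ 2)) := by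
    rw [mul_one_div, le_div_iff₀ (by positivity)]
    nlinarith [ht.2]
  have h2 : 1 ≤ Real.exp Real.pi * Real.exp (-Real.pi * (1 / (2 * t)) ^ 2) := by
    rw [← Real.exp_add, Real.one_le_exp_iff]
    have h3 : 1 / (2 * t) ≤ 1 := by
      rw [div_le_one (by positivity)]
      linarith [ht.1]
    have h4 : (1 / (2 * t)) ^ 2 ≤ 1 := pow_le_one₀ (by positivity) h3
    nlinarith [Real.pi_pos]
  calc (1 : ℝ) ≤ (8 * (1 / (2 * t ^ 2))) *
          (Real.exp Real.pi * Real.exp (-Real.pi * (1 / (2 * t)) ^ 2)) :=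
        one_le_mul_of_one_le_of_one_le h1 h2
    _ = _ := by ring

theorem lintegral_gaussian_pi : ∫⁻ s : ℝ, ENNReal.ofReal (Real.exp (-Real.pi * s ^ 2)) = 1 := by
  have := lintegral_gaussian_eq (one_ne_zero) 0
  simpa using this

/-- Correlations of a flat function, averaged over the slopes `1 / (2t)`. For frequencies at
distance more than `D`, the average over the slope is an oscillatory integral that gains `1 / D`;
the pairs at distance at most `D` carry little mass, since no frequency has more than the proportion
`D⁻²`. -/
theorem lintegral_Icc_weightedCorrelation_sq_le {ν : Measure ℝ} [IsProbabilityMeasure ν]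
    (hν : ν ≤ volume)
    {A : ℝ → ℝ → ℂ} (hA : Measurable fun q : ℝ × ℝ => A q.1 q.2) {α : ℝ → ℝ} (hα : Measurable α)
    (hα0 : ∀ v, 0 ≤ α v) (hαi : ∫⁻ v, ENNReal.ofReal (α v) ∂ν ≠ ⊤)
    (hAα : ∀ v, ∫⁻ κ, ‖A v κ‖ₑ ^ 2 ≤ ENNReal.ofReal (α v) ^ 2) {D : ℝ} (hD : 0 < D)
    (hflat : ∀ v κ, ‖A v κ‖ₑ ^ 2 ≤ ENNReal.ofReal (D ^ 2)⁻¹ * ENNReal.ofReal (α v) ^ 2) :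
    ∫⁻ t in Set.Icc (1 / 2 : ℝ) 2, ∫⁻ q : ℝ × ℝ,
        ‖weightedCorrelation ν A α (1 / (2 * t)) q.1 q.2‖ₑ ^ 2 ≤
      ENNReal.ofReal (8 * Real.exp Real.pi) * (ENNReal.ofReal (3 / D) *
        ∫⁻ v, ENNReal.ofReal (α v) ^ 2 ∂ν) := by
  have hm : ∀ κ, Measurable fun v => A v κ := fun κ =>
    hA.comp (by fun_prop : Measurable fun v => (v, κ))
  have hm' : ∀ v, Measurable fun κ => A v κ := fun v =>
    hA.comp (by fun_prop : Measurable fun κ => (v, κ))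
  refine (lintegral_Icc_comp_inv_le (ψ := fun s => ∫⁻ q : ℝ × ℝ,
        ‖weightedCorrelation ν A α s q.1 q.2‖ₑ ^ 2)).trans ?_
  refine mul_le_mul_right ?_ _
  have hwm : Measurable fun r : ℝ × (ℝ × ℝ) => weightedCorrelation ν A α r.1 r.2.1 r.2.2 := by
    have h1 : Measurable fun q : (ℝ × (ℝ × ℝ)) × ℝ => A q.2 q.1.2.1 :=
      hA.comp (g := fun q : ℝ × ℝ => A q.1 q.2)
        (by fun_prop : Measurable fun q : (ℝ × (ℝ × ℝ)) × ℝ => (q.2, q.1.2.1))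
    have h2 : Measurable fun q : (ℝ × (ℝ × ℝ)) × ℝ => A q.2 q.1.2.2 :=
      hA.comp (g := fun q : ℝ × ℝ => A q.1 q.2)
        (by fun_prop : Measurable fun q : (ℝ × (ℝ × ℝ)) × ℝ => (q.2, q.1.2.2))
    have h3 : Measurable fun q : (ℝ × (ℝ × ℝ)) × ℝ =>
      ((α q.2)⁻¹ : ℂ) * (A q.2 q.1.2.1 * (starRingEnd ℂ) (A q.2 q.1.2.2)) *
        Complex.exp ((-(2 * Real.pi * ((q.1.2.1 - q.1.2.2) * q.2 * q.1.1)) : ℝ) * Complex.I) := by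
      refine (Measurable.mul (by fun_prop) (h1.mul
        (Complex.continuous_conj.measurable.comp h2))).mul (by fun_prop)
    exact (h3.stronglyMeasurable.integral_prod_right (ν := ν)).measurable
  simp_rw [← lintegral_const_mul' _ _ (ENNReal.ofReal_ne_top)]
  rw [lintegral_lintegral_swap (Measurable.aemeasurable (by fun_prop))]
  set w : ℝ × ℝ → ENNReal := fun q =>
    (Set.Icc (q.1 - D) (q.1 + D)).indicator 1 q.2 + ENNReal.ofReal (1 / D) with hw
  set c : ℝ → ENNReal := fun v => ENNReal.ofReal (α v)⁻¹ ^ 2 with hc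
  have hφ : ∀ v (q : ℝ × ℝ), ‖((α v)⁻¹ : ℂ) * (A v q.1 * (starRingEnd ℂ) (A v q.2))‖ₑ ^ 2 =
      c v * (‖A v q.1‖ₑ ^ 2 * ‖A v q.2‖ₑ ^ 2) := by
    intro v q
    rw [enorm_mul, enorm_mul, RCLike.enorm_conj, mul_pow, mul_pow, ← Complex.ofReal_inv,
      ← ofReal_norm, Complex.norm_real, Real.norm_of_nonneg (inv_nonneg.2 (hα0 v))]
  have hH : Measurable fun r : (ℝ × ℝ) × ℝ =>
      c r.2 * (‖A r.2 r.1.1‖ₑ ^ 2 * ‖A r.2 r.1.2‖ₑ ^ 2) := by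
    have h1 : Measurable fun q : (ℝ × ℝ) × ℝ => A q.2 q.1.1 :=
      hA.comp (g := fun q : ℝ × ℝ => A q.1 q.2)
        (by fun_prop : Measurable fun q : (ℝ × ℝ) × ℝ => (q.2, q.1.1))
    have h2 : Measurable fun q : (ℝ × ℝ) × ℝ => A q.2 q.1.2 :=
      hA.comp (g := fun q : ℝ × ℝ => A q.1 q.2)
        (by fun_prop : Measurable fun q : (ℝ × ℝ) × ℝ => (q.2, q.1.2))
    exact Measurable.mul (by fun_prop) ((h1.enorm.pow_const 2).mul (h2.enorm.pow_const 2))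
  have hq : ∀ q : ℝ × ℝ, ∫⁻ s, ENNReal.ofReal (Real.exp (-Real.pi * s ^ 2)) *
        ‖weightedCorrelation ν A α s q.1 q.2‖ₑ ^ 2 ≤
      w q * ∫⁻ v, c v * (‖A v q.1‖ₑ ^ 2 * ‖A v q.2‖ₑ ^ 2) ∂ν := by
    intro q
    have hq1 := hm q.1
    have hq2 := hm q.2
    have hφm : Measurable fun v => ((α v)⁻¹ : ℂ) * (A v q.1 * (starRingEnd ℂ) (A v q.2)) := by
      fun_prop
    simp_rw [← hφ]
    -- close frequencies are estimated trivially, distant ones through the average over `s`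
    by_cases hqD : |q.1 - q.2| ≤ D
    · have h1 : ∀ s, ‖weightedCorrelation ν A α s q.1 q.2‖ₑ ^ 2 ≤
          ∫⁻ v, ‖((α v)⁻¹ : ℂ) * (A v q.1 * (starRingEnd ℂ) (A v q.2))‖ₑ ^ 2 ∂ν := by
        intro s
        refine (enorm_integral_sq_le_of_isProbabilityMeasure
          (Measurable.aemeasurable (by fun_prop))).trans (lintegral_mono fun v => ?_)
        simp only
        rw [enorm_mul _ (Complex.exp _), enorm_exp_ofReal_mul_I, mul_one]
      refine (lintegral_mono fun s => mul_le_mul_right (h1 s) _).trans ?_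
      rw [lintegral_mul_const _ (by fun_prop), lintegral_gaussian_pi]
      refine mul_le_mul_left ?_ _
      have h2 : q.2 ∈ Set.Icc (q.1 - D) (q.1 + D) := by
        rw [abs_le] at hqD
        exact ⟨by linarith, by linarith⟩
      simp only [hw, Set.indicator_of_mem h2, Pi.one_apply]
      exact le_self_add
    · push Not at hqD
      have hint : Integrable
          (fun v => ((α v)⁻¹ : ℂ) * (A v q.1 * (starRingEnd ℂ) (A v q.2))) ν := by
        refine ⟨hφm.aestronglyMeasurable, ?_⟩
        refine lt_of_le_of_lt (lintegral_mono (g := fun v => ENNReal.ofReal (D ^ 2)⁻¹ *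
          ENNReal.ofReal (α v)) fun v => ?_) ?_
        · have h1 : ‖A v q.1‖ₑ * ‖A v q.2‖ₑ ≤
              ENNReal.ofReal (D ^ 2)⁻¹ * ENNReal.ofReal (α v) ^ 2 := by
            have h2 := mul_le_mul' (hflat v q.1) (hflat v q.2)
            rw [← mul_pow, ← sq] at h2
            exact (ENNReal.pow_le_pow_left_iff two_ne_zero).1 h2
          simp only
          rw [enorm_mul, enorm_mul, RCLike.enorm_conj, ← Complex.ofReal_inv,
            ← ofReal_norm ((_ : ℝ) : ℂ), Complex.norm_real,
            Real.norm_of_nonneg (inv_nonneg.2 (hα0 v))]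
          refine (mul_le_mul_right h1 _).trans ?_
          rw [mul_left_comm]
          exact mul_le_mul_right (ofReal_inv_mul_sq_le _) _
        · rw [lintegral_const_mul' _ _ (by simp)]
          exact ENNReal.mul_lt_top (by simp) hαi.lt_top
      have hΔ : q.1 - q.2 ≠ 0 := by
        intro h
        rw [h, abs_zero] at hqD
        exact absurd hqD (not_lt.2 hD.le)
      refine (lintegral_gaussian_mul_fourier_sq_le hν hφm hint hΔ).trans ?_
      refine mul_le_mul_left ?_ _
      refine le_trans (ENNReal.ofReal_le_ofReal ?_) le_add_self
      exact one_div_le_one_div_of_le hD hqD.le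
  refine (lintegral_mono hq).trans ?_
  have hwm' : Measurable w := by
    have : w = fun q : ℝ × ℝ => {q : ℝ × ℝ | q.1 - D ≤ q.2 ∧ q.2 ≤ q.1 + D}.indicator 1 q +
      ENNReal.ofReal (1 / D) := rfl
    have h1 : MeasurableSet {q : ℝ × ℝ | q.1 - D ≤ q.2} :=
      measurableSet_le (by fun_prop) (by fun_prop)
    have h2 : MeasurableSet {q : ℝ × ℝ | q.2 ≤ q.1 + D} :=
      measurableSet_le (by fun_prop) (by fun_prop)
    rw [this]
    exact Measurable.add (measurable_one.indicator (h1.inter h2)) measurable_const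
  have hHq : ∀ q : ℝ × ℝ, Measurable fun v => c v * (‖A v q.1‖ₑ ^ 2 * ‖A v q.2‖ₑ ^ 2) := by
    intro q
    have := hm q.1
    have := hm q.2
    fun_prop
  simp_rw [← lintegral_const_mul _ (hHq _)]
  have hwH : Measurable fun r : (ℝ × ℝ) × ℝ =>
      w r.1 * (c r.2 * (‖A r.2 r.1.1‖ₑ ^ 2 * ‖A r.2 r.1.2‖ₑ ^ 2)) :=
    (hwm'.comp measurable_fst).mul hH
  have hsw : AEMeasurable (Function.uncurry fun (q : ℝ × ℝ) v =>
      w q * (c v * (‖A v q.1‖ₑ ^ 2 * ‖A v q.2‖ₑ ^ 2))) (volume.prod ν) := hwH.aemeasurable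
  rw [lintegral_lintegral_swap hsw]
  refine lintegral_mono fun v => ?_
  have hv := hm' v
  rw [Measure.volume_eq_prod, lintegral_prod _ (Measurable.aemeasurable (by fun_prop))]
  have h1 : ∀ κ, ∫⁻ κ', w (κ, κ') * (c v * (‖A v κ‖ₑ ^ 2 * ‖A v κ'‖ₑ ^ 2)) ≤
      ENNReal.ofReal (3 / D) * (c v * ENNReal.ofReal (α v) ^ 2) * ‖A v κ‖ₑ ^ 2 := by
    intro κ
    have h2 : ∀ κ', w (κ, κ') * (c v * (‖A v κ‖ₑ ^ 2 * ‖A v κ'‖ₑ ^ 2)) =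
        c v * ‖A v κ‖ₑ ^ 2 * ((Set.Icc (κ - D) (κ + D)).indicator (fun κ' => ‖A v κ'‖ₑ ^ 2) κ' +
          ENNReal.ofReal (1 / D) * ‖A v κ'‖ₑ ^ 2) := by
      intro κ'
      simp only [hw]
      by_cases h : κ' ∈ Set.Icc (κ - D) (κ + D)
      · simp only [Set.indicator_of_mem h, Pi.one_apply]
        ring
      · simp only [Set.indicator_of_notMem h]
        ring
    have h3 : ∫⁻ κ' in Set.Icc (κ - D) (κ + D), ‖A v κ'‖ₑ ^ 2 ≤
        ENNReal.ofReal (2 / D) * ENNReal.ofReal (α v) ^ 2 := by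
      refine (lintegral_mono fun κ' => hflat v κ').trans ?_
      rw [lintegral_const, Measure.restrict_apply_univ, Real.volume_Icc, mul_right_comm,
        ← ENNReal.ofReal_mul (by positivity)]
      refine le_of_eq ?_
      congr 2
      field_simp
      ring
    simp_rw [h2]
    rw [lintegral_const_mul _ (by
        exact (Measurable.indicator (by fun_prop) measurableSet_Icc).add (by fun_prop)),
      lintegral_add_right _ (by fun_prop), lintegral_indicator measurableSet_Icc,
      lintegral_const_mul _ (by fun_prop)]
    refine (mul_le_mul_right (add_le_add h3 (mul_le_mul_right (hAα v) _)) _).trans (le_of_eq ?_)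
    rw [← add_mul, ← ENNReal.ofReal_add (by positivity) (by positivity),
      show 2 / D + 1 / D = 3 / D by ring]
    ring
  refine (lintegral_mono h1).trans ?_
  rw [lintegral_const_mul _ (by fun_prop)]
  refine (mul_le_mul_right (hAα v) _).trans ?_
  rw [mul_assoc]
  refine mul_le_mul_right ?_ _
  calc c v * ENNReal.ofReal (α v) ^ 2 * ENNReal.ofReal (α v) ^ 2
      = (ENNReal.ofReal (α v)⁻¹ * ENNReal.ofReal (α v) ^ 2) ^ 2 := by ring
    _ ≤ _ := pow_le_pow_left' (ofReal_inv_mul_sq_le _) 2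

theorem lintegral_comp_div {c : ℝ} (hc : 0 < c) {f : ℝ → ENNReal} (hf : Measurable f) :
    ∫⁻ x, f (x / c) = ENNReal.ofReal c * ∫⁻ x, f x := by
  have h1 : ∀ x, x / c = c⁻¹ * x := fun x => by rw [div_eq_inv_mul]
  simp_rw [h1]
  rw [← lintegral_map (g := fun x => c⁻¹ * x) hf (by fun_prop),
    Real.map_volume_mul_left (inv_ne_zero hc.ne'), inv_inv, abs_of_pos hc, lintegral_smul_measure,
    smul_eq_mul]

theorem lintegral_three_linear {μ₁ μ₂ μ₃ : Measure ℝ} [SFinite μ₁] [SFinite μ₂] [SFinite μ₃]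
    {A B P : ℝ × ℝ × ℝ → ENNReal} (hA : Measurable A) (hB : Measurable B) (hP : Measurable P)
    (a b p : ENNReal) :
    ∫⁻ t, ∫⁻ x, ∫⁻ y, (a * A (t, x, y) + (b * B (t, x, y) + p * P (t, x, y))) ∂μ₃ ∂μ₂ ∂μ₁ =
      a * ∫⁻ t, ∫⁻ x, ∫⁻ y, A (t, x, y) ∂μ₃ ∂μ₂ ∂μ₁ +
      (b * ∫⁻ t, ∫⁻ x, ∫⁻ y, B (t, x, y) ∂μ₃ ∂μ₂ ∂μ₁ +
      p * ∫⁻ t, ∫⁻ x, ∫⁻ y, P (t, x, y) ∂μ₃ ∂μ₂ ∂μ₁) := by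
  have h : ∀ {c : ENNReal} {F : ℝ × ℝ × ℝ → ENNReal}, Measurable F →
      ∫⁻ t, ∫⁻ x, ∫⁻ y, c * F (t, x, y) ∂μ₃ ∂μ₂ ∂μ₁ =
        c * ∫⁻ t, ∫⁻ x, ∫⁻ y, F (t, x, y) ∂μ₃ ∂μ₂ ∂μ₁ := by
    intro c F hF
    rw [← lintegral_const_mul _ (by fun_prop)]
    refine lintegral_congr fun t => ?_
    rw [← lintegral_const_mul _ (by fun_prop)]
    refine lintegral_congr fun x => ?_
    rw [← lintegral_const_mul _ (by fun_prop)]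
  have h2 : ∀ {F G : ℝ × ℝ × ℝ → ENNReal}, Measurable F → Measurable G →
      ∫⁻ t, ∫⁻ x, ∫⁻ y, (F (t, x, y) + G (t, x, y)) ∂μ₃ ∂μ₂ ∂μ₁ =
        ∫⁻ t, ∫⁻ x, ∫⁻ y, F (t, x, y) ∂μ₃ ∂μ₂ ∂μ₁ +
        ∫⁻ t, ∫⁻ x, ∫⁻ y, G (t, x, y) ∂μ₃ ∂μ₂ ∂μ₁ := by
    intro F G hF hG
    rw [← lintegral_add_left (by fun_prop)]
    refine lintegral_congr fun t => ?_
    rw [← lintegral_add_left (by fun_prop)]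
    refine lintegral_congr fun x => ?_
    rw [← lintegral_add_left (by fun_prop)]
  rw [h2 (F := fun r => a * A r) (G := fun r => b * B r + p * P r) (by fun_prop) (by fun_prop),
    h2 (F := fun r => b * B r) (G := fun r => p * P r) (by fun_prop) (by fun_prop), h hA, h hB,
    h hP]

theorem lintegral_average_translate_snd {F : ℝ × ℝ → ENNReal} (hF : Measurable F) (δ t : ℝ)
    {ν : Measure ℝ} [IsProbabilityMeasure ν] :
    ∫⁻ x, ∫⁻ y, ∫⁻ v, F (x + t, y + δ * v) ∂ν = ∫⁻ x, ∫⁻ y, F (x, y) := by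
  rw [lintegral_add_right_eq_self (fun x => ∫⁻ y, ∫⁻ v, F (x, y + δ * v) ∂ν) t]
  refine lintegral_congr fun x => ?_
  rw [lintegral_lintegral_swap (Measurable.aemeasurable (by fun_prop))]
  have h : ∀ v, ∫⁻ y, F (x, y + δ * v) = ∫⁻ y, F (x, y) := fun v =>
    lintegral_add_right_eq_self (fun y => F (x, y)) (δ * v)
  simp [h]

theorem lintegral_average_translate_fst {F : ℝ × ℝ → ENNReal} (hF : Measurable F) (δ t : ℝ)
    {ν : Measure ℝ} [IsProbabilityMeasure ν] :
    ∫⁻ x, ∫⁻ y, ∫⁻ u, F (x + δ * u, y + t) ∂ν = ∫⁻ x, ∫⁻ y, F (x, y) := by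
  have h0 : ∀ x, ∫⁻ y, ∫⁻ u, F (x + δ * u, y + t) ∂ν = ∫⁻ y, ∫⁻ u, F (x + δ * u, y) ∂ν := fun x =>
    lintegral_add_right_eq_self (fun y => ∫⁻ u, F (x + δ * u, y) ∂ν) t
  simp_rw [h0]
  rw [lintegral_lintegral_swap (Measurable.aemeasurable (by fun_prop)),
    lintegral_lintegral_swap (f := fun x y => F (x, y)) (Measurable.aemeasurable (by fun_prop))]
  refine lintegral_congr fun y => ?_
  rw [lintegral_lintegral_swap (Measurable.aemeasurable (by fun_prop))]
  have h : ∀ u, ∫⁻ x, F (x + δ * u, y) = ∫⁻ x, F (x, y) := fun u =>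
    lintegral_add_right_eq_self (fun x => F (x, y)) (δ * u)
  simp [h]

/-- The bilinear form with a function `a` that is flat in frequency: no frequency carries more than
the proportion `d⁻⁸` of the mass of `a(X, y, ·)`. -/
theorem exists_bound_flat : ∃ C : ℝ, 0 < C ∧ ∀ (δ d : ℝ) (_ : 0 < d) (a b : ℝ × ℝ × ℝ → ℂ)
    (α β : ℝ × ℝ → ℝ), Measurable a → Measurable b → Continuous α → Continuous β → (∀ p, 0 ≤ α p) →
    (∀ p, 0 ≤ β p) → (∀ x y, ∫⁻ κ, ‖a (x, y, κ)‖ₑ ^ 2 ≤ ENNReal.ofReal (α (x, y)) ^ 2) →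
    (∀ x y, ∫⁻ κ, ‖b (x, y, κ)‖ₑ ^ 2 ≤ ENNReal.ofReal (β (x, y)) ^ 2) →
    (∀ x y κ, ‖a (x, y, κ)‖ₑ ^ 2 ≤
      ENNReal.ofReal (d ^ 8)⁻¹ * ENNReal.ofReal (α (x, y)) ^ 2) →
    ∫⁻ t in Set.Icc (1 / 2 : ℝ) 2, ∫⁻ x, ∫⁻ y, ∫⁻ u in Set.Icc (0 : ℝ) 1, ∫⁻ v in Set.Icc (0 : ℝ) 1,
      ‖∫ κ, a (x + t, y + δ * v, κ) * b (x + δ * u, y + t ^ 2, κ / (2 * t)) *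
        Complex.exp ((2 * Real.pi * (κ * (u - 1 / (2 * t) * v)) : ℝ) * Complex.I)‖ₑ ≤
    ENNReal.ofReal (C / d) * ((∫⁻ x, ∫⁻ y, ENNReal.ofReal (α (x, y)) ^ 2) +
      ∫⁻ x, ∫⁻ y, ENNReal.ofReal (β (x, y)) ^ 2) := by
  refine ⟨12 + 24 * Real.exp Real.pi, by positivity, ?_⟩
  intro δ d hd a b α β ha hb hα hβ hα0 hβ0 haα hbβ hflat
  set ν : Measure ℝ := volume.restrict (Set.Icc (0 : ℝ) 1) with hν
  have hνp : IsProbabilityMeasure ν := ⟨by simp [hν]⟩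
  have hαm := hα.measurable
  have hβm := hβ.measurable
  have hfin : ∀ {h : ℝ → ℝ}, Continuous h → ∫⁻ v, ENNReal.ofReal (h v) ∂ν ≠ ⊤ := by
    intro h hh
    have h1 : IntegrableOn h (Set.Icc 0 1) := hh.continuousOn.integrableOn_Icc
    exact h1.lintegral_lt_top.ne
  set P : ℝ × ℝ × ℝ → ENNReal := fun r => ∫⁻ q : ℝ × ℝ,
    ‖weightedCorrelation ν (fun v κ => a (r.2.1, r.2.2 + δ * v, κ))
      (fun v => α (r.2.1, r.2.2 + δ * v)) (1 / (2 * r.1)) q.1 q.2‖ₑ ^ 2 with hP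
  have hPm : Measurable P := by
    have h3 : Measurable fun r : ((ℝ × ℝ × ℝ) × (ℝ × ℝ)) × ℝ =>
      ((α (r.1.1.2.1, r.1.1.2.2 + δ * r.2))⁻¹ : ℂ) * (a (r.1.1.2.1, r.1.1.2.2 + δ * r.2, r.1.2.1) *
        (starRingEnd ℂ) (a (r.1.1.2.1, r.1.1.2.2 + δ * r.2, r.1.2.2))) *
        Complex.exp ((-(2 * Real.pi * ((r.1.2.1 - r.1.2.2) * r.2 * (1 / (2 * r.1.1.1)))) : ℝ) *
          Complex.I) := by
      fun_prop
    have h4 := (h3.stronglyMeasurable.integral_prod_right' (ν := ν)).measurable.enorm.pow_const 2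
    exact h4.lintegral_prod_right
  set A : ℝ × ℝ × ℝ → ENNReal := fun r =>
    ∫⁻ v, ENNReal.ofReal (α (r.2.1 + r.1, r.2.2 + δ * v)) ^ 2 ∂ν with hA
  set B : ℝ × ℝ × ℝ → ENNReal := fun r =>
    ∫⁻ u, ENNReal.ofReal (β (r.2.1 + δ * u, r.2.2 + r.1 ^ 2)) ^ 2 ∂ν with hB
  have hAm : Measurable A := by fun_prop
  have hBm : Measurable B := by fun_prop
  set e : ENNReal := ENNReal.ofReal d⁻¹ with he
  set S := Set.Icc (1 / 2 : ℝ) 2 with hS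
  have hpt : ∀ t ∈ S, ∀ x y, ∫⁻ u, ∫⁻ v,
      ‖∫ κ, a (x + t, y + δ * v, κ) * b (x + δ * u, y + t ^ 2, κ / (2 * t)) *
        Complex.exp ((2 * Real.pi * (κ * (u - 1 / (2 * t) * v)) : ℝ) * Complex.I)‖ₑ ∂ν ∂ν ≤
      e * A (t, x, y) + (8 * e * B (t, x, y) + ENNReal.ofReal (d ^ 3) * P (t, x + t, y)) := by
    intro t ht x y
    have ht0 : 0 < t := lt_of_lt_of_le (by norm_num) ht.1
    -- the losses are `ε` and `ε⁻¹ (η⁻¹ d⁻⁴ + η)`, all equal to `d⁻¹` for this choice; doubling `β`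
    -- pays for the dilation `κ / (2t)`
    have h1 := lintegral_bilinear_le (ν := ν) (A := fun v κ => a (x + t, y + δ * v, κ))
      (B := fun u κ => b (x + δ * u, y + t ^ 2, κ / (2 * t)))
      (α := fun v => α (x + t, y + δ * v)) (β := fun u => 2 * β (x + δ * u, y + t ^ 2))
      (by fun_prop) (by fun_prop) (by fun_prop) (by fun_prop) (fun v => hα0 _)
      (fun u => mul_nonneg zero_le_two (hβ0 _)) (hfin (by fun_prop)) (hfin (by fun_prop))
      (fun v => haα _ _) (fun u => ?_) (1 / (2 * t)) (ε := d⁻¹) (η := (d ^ 2)⁻¹)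
      (by positivity) (by positivity)
    · refine h1.trans (le_of_eq ?_)
      have h4 : ∀ u, ENNReal.ofReal (2 * β (x + δ * u, y + t ^ 2)) ^ 2 =
          4 * ENNReal.ofReal (β (x + δ * u, y + t ^ 2)) ^ 2 := by
        intro u
        rw [ENNReal.ofReal_mul zero_le_two, mul_pow]
        norm_num
      simp_rw [h4]
      rw [lintegral_const_mul' _ _ (by simp)]
      have h5 : ENNReal.ofReal d⁻¹⁻¹ * ENNReal.ofReal (d ^ 2)⁻¹⁻¹ = ENNReal.ofReal (d ^ 3) := by
        rw [← ENNReal.ofReal_mul (by positivity)]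
        congr 1
        rw [inv_inv, inv_inv]
        ring
      have h6 : ENNReal.ofReal d⁻¹⁻¹ * ENNReal.ofReal (d ^ 2)⁻¹ = e := by
        rw [← ENNReal.ofReal_mul (by positivity)]
        congr 1
        field_simp
      rw [mul_add (ENNReal.ofReal d⁻¹⁻¹), ← mul_assoc, ← mul_assoc, h5, h6]
      simp only [hA, hB, hP]
      ring
    · have h2 : ∫⁻ κ, ‖b (x + δ * u, y + t ^ 2, κ / (2 * t))‖ₑ ^ 2 =
          ENNReal.ofReal (2 * t) * ∫⁻ κ, ‖b (x + δ * u, y + t ^ 2, κ)‖ₑ ^ 2 := by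
        exact lintegral_comp_div (c := 2 * t) (by positivity)
          (f := fun κ => ‖b (x + δ * u, y + t ^ 2, κ)‖ₑ ^ 2) (by fun_prop)
      rw [h2, ENNReal.ofReal_mul zero_le_two (q := β _), mul_pow, ← ENNReal.ofReal_pow zero_le_two]
      refine mul_le_mul' (ENNReal.ofReal_le_ofReal ?_) (hbβ _ _)
      linarith [ht.2]
  have hPsum : ∫⁻ t in S, ∫⁻ x, ∫⁻ y, P (t, x + t, y) ≤
      ENNReal.ofReal (8 * Real.exp Real.pi) * (ENNReal.ofReal (3 / d ^ 4) *
        ∫⁻ x, ∫⁻ y, ENNReal.ofReal (α (x, y)) ^ 2) := by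
    have h1 : ∀ t, ∫⁻ x, ∫⁻ y, P (t, x + t, y) = ∫⁻ x, ∫⁻ y, P (t, x, y) := fun t =>
      lintegral_add_right_eq_self (fun x => ∫⁻ y, P (t, x, y)) t
    simp_rw [h1]
    rw [lintegral_lintegral_swap (Measurable.aemeasurable (by fun_prop))]
    have h2 : ∀ x, ∫⁻ t in S, ∫⁻ y, P (t, x, y) ≤ ENNReal.ofReal (8 * Real.exp Real.pi) *
        (ENNReal.ofReal (3 / d ^ 4) * ∫⁻ y, ENNReal.ofReal (α (x, y)) ^ 2) := by
      intro x
      rw [lintegral_lintegral_swap (Measurable.aemeasurable (by fun_prop))]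
      refine (lintegral_mono fun y => lintegral_Icc_weightedCorrelation_sq_le (ν := ν)
        Measure.restrict_le_self (A := fun v κ => a (x, y + δ * v, κ))
        (α := fun v => α (x, y + δ * v)) (by fun_prop) (by fun_prop) (fun v => hα0 _)
        (hfin (by fun_prop)) (fun v => haα _ _) (D := d ^ 4) (by positivity) ?_).trans ?_
      · intro v κ
        rw [← pow_mul]
        exact hflat _ _ _
      · rw [lintegral_const_mul' _ _ ENNReal.ofReal_ne_top,
          lintegral_const_mul' _ _ ENNReal.ofReal_ne_top,
          lintegral_lintegral_swap (Measurable.aemeasurable (by fun_prop))]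
        have h : ∀ v, ∫⁻ y, ENNReal.ofReal (α (x, y + δ * v)) ^ 2 =
            ∫⁻ y, ENNReal.ofReal (α (x, y)) ^ 2 := fun v =>
          lintegral_add_right_eq_self (fun y => ENNReal.ofReal (α (x, y)) ^ 2) (δ * v)
        simp [h]
    refine (lintegral_mono h2).trans ?_
    rw [lintegral_const_mul' _ _ ENNReal.ofReal_ne_top,
      lintegral_const_mul' _ _ ENNReal.ofReal_ne_top]
  have hAsum : ∫⁻ t in S, ∫⁻ x, ∫⁻ y, A (t, x, y) =
      ENNReal.ofReal (3 / 2) * ∫⁻ x, ∫⁻ y, ENNReal.ofReal (α (x, y)) ^ 2 := by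
    simp only [hA]
    simp_rw [fun t => lintegral_average_translate_snd (ν := ν)
      (F := fun p => ENNReal.ofReal (α p) ^ 2) (by fun_prop) δ t]
    rw [lintegral_const, Measure.restrict_apply_univ, hS, Real.volume_Icc, mul_comm]
    norm_num
  have hBsum : ∫⁻ t in S, ∫⁻ x, ∫⁻ y, B (t, x, y) =
      ENNReal.ofReal (3 / 2) * ∫⁻ x, ∫⁻ y, ENNReal.ofReal (β (x, y)) ^ 2 := by
    simp only [hB]
    simp_rw [fun t : ℝ => lintegral_average_translate_fst (ν := ν)
      (F := fun p => ENNReal.ofReal (β p) ^ 2) (by fun_prop) δ (t ^ 2)]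
    rw [lintegral_const, Measure.restrict_apply_univ, hS, Real.volume_Icc, mul_comm]
    norm_num
  refine (setLIntegral_mono' measurableSet_Icc fun t ht => lintegral_mono fun x =>
    lintegral_mono fun y => hpt t ht x y).trans ?_
  rw [lintegral_three_linear (μ₂ := volume) (μ₃ := volume) hAm hBm
    (P := fun r => P (r.1, r.2.1 + r.1, r.2.2)) (by fun_prop), hAsum, hBsum]
  refine (add_le_add le_rfl (add_le_add le_rfl (mul_le_mul_right hPsum _))).trans ?_
  set IA := ∫⁻ x, ∫⁻ y, ENNReal.ofReal (α (x, y)) ^ 2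
  set IB := ∫⁻ x, ∫⁻ y, ENNReal.ofReal (β (x, y)) ^ 2
  have h8 : (8 : ENNReal) = ENNReal.ofReal 8 := by norm_num
  have e1 : ENNReal.ofReal (d ^ 3) * (ENNReal.ofReal (8 * Real.exp Real.pi) *
      (ENNReal.ofReal (3 / d ^ 4) * IA)) = ENNReal.ofReal (24 * Real.exp Real.pi / d) * IA := by
    rw [← mul_assoc, ← mul_assoc, ← ENNReal.ofReal_mul (by positivity),
      ← ENNReal.ofReal_mul (by positivity)]
    congr 2
    field_simp
    ring
  rw [e1, h8, he, ← mul_assoc, ← mul_assoc, ← ENNReal.ofReal_mul (by positivity),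
    ← ENNReal.ofReal_mul (by positivity), ← ENNReal.ofReal_mul (by positivity)]
  have e2 : ∀ I J : ENNReal, ENNReal.ofReal (d⁻¹ * (3 / 2)) * I +
      (ENNReal.ofReal (8 * d⁻¹ * (3 / 2)) * J + ENNReal.ofReal (24 * Real.exp Real.pi / d) * I) =
      ENNReal.ofReal (d⁻¹ * (3 / 2) + 24 * Real.exp Real.pi / d) * I +
      ENNReal.ofReal (8 * d⁻¹ * (3 / 2)) * J := by
    intro I J
    rw [ENNReal.ofReal_add (by positivity) (by positivity)]
    ring
  rw [e2, mul_add]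
  have hexp := Real.exp_pos Real.pi
  refine add_le_add (mul_le_mul_left (ENNReal.ofReal_le_ofReal ?_) _)
    (mul_le_mul_left (ENNReal.ofReal_le_ofReal ?_) _)
  · rw [le_div_iff₀ hd, add_mul, div_mul_cancel₀ _ hd.ne', mul_right_comm, inv_mul_cancel₀ hd.ne']
    linarith
  · rw [le_div_iff₀ hd, mul_right_comm, mul_assoc 8, inv_mul_cancel₀ hd.ne']
    linarith

/-! ### Averages along tangents to the parabola -/

theorem integral_mul_integral_mul_swap {f g : ℝ → ℂ} (hf : Integrable f) (hg : Integrable g)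
    {K : ℝ → ℝ → ℂ} (hK : Continuous fun q : ℝ × ℝ => K q.1 q.2) {c : ℝ}
    (hc : ∀ p τ, ‖K p τ‖ ≤ c) :
    ∫ p, f p * ∫ τ, g τ * K p τ = ∫ τ, g τ * ∫ p, f p * K p τ := by
  simp_rw [← integral_const_mul]
  rw [integral_integral_swap]
  · refine integral_congr_ae (Filter.Eventually.of_forall fun τ => ?_)
    refine integral_congr_ae (Filter.Eventually.of_forall fun p => ?_)
    simp only
    ring
  · refine ((hf.mul_prod hg).bdd_mul (c := c) hK.aestronglyMeasurable
      (Filter.Eventually.of_forall fun q => hc q.1 q.2)).congr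
      (Filter.Eventually.of_forall fun q => ?_)
    simp only [Function.uncurry]
    ring

/-- The `L²` norm of `p ↦ χ(p) h(X + δp, y)`, which by Plancherel is that of the local Fourier
transform. -/
noncomputable def localMass (χ : ℝ → ℝ) (δ : ℝ) (h : ℝ × ℝ → ℂ) (r : ℝ × ℝ) : ℝ :=
  Real.sqrt (∫ p, χ p ^ 2 * ‖h (r.1 + δ * p, r.2)‖ ^ 2)

theorem continuous_localMass {χ : ℝ → ℝ} {h : ℝ × ℝ → ℂ} (hχ : Continuous χ)
    (hχc : HasCompactSupport χ) (hh : Continuous h) (δ : ℝ) : Continuous (localMass χ δ h) := by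
  refine Real.continuous_sqrt.comp ?_
  have h2 : Continuous fun r : ℝ × ℝ =>
      ∫ p in tsupport χ, χ p ^ 2 * ‖h (r.1 + δ * p, r.2)‖ ^ 2 := by
    refine continuous_parametric_integral_of_continuous ?_ hχc
    simp only [Function.uncurry_def]
    fun_prop
  refine h2.congr fun q => setIntegral_eq_integral_of_forall_compl_eq_zero fun p hp => ?_
  simp [image_eq_zero_of_notMem_tsupport hp]

theorem localMass_nonneg (χ : ℝ → ℝ) (δ : ℝ) (h : ℝ × ℝ → ℂ) (r : ℝ × ℝ) :
    0 ≤ localMass χ δ h r := Real.sqrt_nonneg _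

theorem lintegral_localFourier_sq_eq_localMass {χ : ℝ → ℝ} {h : ℝ × ℝ → ℂ} (hχ : ContDiff ℝ ∞ χ)
    (hχc : HasCompactSupport χ) (hh : Continuous h) (hs : ∀ y, ContDiff ℝ ∞ fun x => h (x, y))
    (δ X y : ℝ) :
    ∫⁻ κ, ‖localFourier χ δ h (X, y, κ)‖ₑ ^ 2 = ENNReal.ofReal (localMass χ δ h (X, y)) ^ 2 := by
  have h0 : ∀ p, 0 ≤ χ p ^ 2 * ‖h (X + δ * p, y)‖ ^ 2 := fun p => by positivity
  have hc : Continuous χ := hχ.continuous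
  have hi : Integrable fun p => χ p ^ 2 * ‖h (X + δ * p, y)‖ ^ 2 := by
    refine Continuous.integrable_of_hasCompactSupport (by fun_prop) ?_
    exact (hχc.comp_left (g := fun x : ℝ => x ^ 2) (by simp)).mul_right
  rw [lintegral_localFourier_sq hχ hχc hs, localMass, ← ENNReal.ofReal_pow (Real.sqrt_nonneg _),
    Real.sq_sqrt (integral_nonneg h0), ofReal_integral_eq_lintegral_ofReal hi
    (Filter.Eventually.of_forall h0)]
  refine lintegral_congr fun p => ?_
  rw [ENNReal.ofReal_mul (by positivity), ENNReal.ofReal_pow (norm_nonneg _), ofReal_norm,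
    ← sq_abs, ENNReal.ofReal_pow (abs_nonneg _), ← Real.norm_eq_abs, ofReal_norm]

theorem exists_norm_localFourier_le {χ : ℝ → ℝ} (h : ℝ × ℝ → ℂ) (δ X y : ℝ) :
    ∃ c, ∀ κ, ‖localFourier χ δ h (X, y, κ)‖ ≤ c := by
  refine ⟨∫ p, ‖(χ p : ℂ) * h (X + δ * p, y)‖, fun κ => ?_⟩
  rw [localFourier_eq_integral]
  refine (norm_integral_le_integral_norm _).trans (le_of_eq ?_)
  refine integral_congr_ae (Filter.Eventually.of_forall fun p => ?_)
  simp only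
  rw [norm_mul, Complex.norm_exp_ofReal_mul_I, one_mul]

/-- The average of `F(x + t + s/(2t), y) G(x, y + t² + s)` over `s = δq`, with weight `χ(q)`: along
these steps the parabola agrees with its tangent. -/
noncomputable def tangentAverage (χ : ℝ → ℝ) (δ : ℝ) (F G : ℝ × ℝ → ℂ) (t : ℝ) (r : ℝ × ℝ) : ℂ :=
  ∫ q, (χ q : ℂ) * (F (r.1 + t + δ * (q / (2 * t)), r.2) * G (r.1, r.2 + t ^ 2 + δ * q))

section

variable {χ χ₁ : ℝ → ℝ} {F G : ℝ × ℝ → ℂ}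

/-- A tangential average pairs the frequency `κ` of `F` in the first variable with the frequency
`κ / (2t)` of `G` in the second, because the tangent to the parabola at `t` has slope `2t`. The
window `χ₁` is `1` wherever `u + q / (2t)` may lie. -/
theorem tangentAverage_eq_integral_localFourier (hχ : ContDiff ℝ ∞ χ) (hχc : HasCompactSupport χ)
    (hχs : tsupport χ ⊆ Set.Icc (-1) 1) (hχ₁ : ContDiff ℝ ∞ χ₁) (hχ₁c : HasCompactSupport χ₁)
    (hχ₁1 : ∀ p ∈ Set.Icc (-2 : ℝ) 2, χ₁ p = 1) (hF : ∀ y, ContDiff ℝ ∞ fun x => F (x, y))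
    (hG : Continuous G) (δ x y : ℝ) {t u : ℝ} (ht : t ∈ Set.Icc (1 / 2 : ℝ) 2)
    (hu : u ∈ Set.Icc (0 : ℝ) 1) :
    tangentAverage χ δ F G t (x + δ * u, y) =
      ∫ κ, localFourier χ₁ δ F (x + t, y, κ) *
        (Complex.exp ((2 * Real.pi * (κ * u) : ℝ) * Complex.I) *
        localFourier χ δ (fun r => G r.swap) (y + t ^ 2, x + δ * u, -(κ / (2 * t)))) := by
  have ht0 : 1 ≤ 2 * t := by linarith [ht.1]
  have hχ0 : Continuous χ := hχ.continuous
  set f : ℝ → ℂ := fun q => (χ q : ℂ) * G (x + δ * u, y + t ^ 2 + δ * q) with hf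
  have hfi : Integrable f := by
    refine Continuous.integrable_of_hasCompactSupport (by fun_prop) ?_
    exact (hχc.comp_left (g := fun x : ℝ => (x : ℂ)) (by simp)).mul_right
  have hgi := integrable_localFourier hχ₁ hχ₁c hF δ (x + t) y
  have h1 : tangentAverage χ δ F G t (x + δ * u, y) = ∫ q, f q *
      ∫ κ, localFourier χ₁ δ F (x + t, y, κ) *
        Complex.exp ((2 * Real.pi * (κ * (u + q / (2 * t))) : ℝ) * Complex.I) := by
    refine integral_congr_ae (Filter.Eventually.of_forall fun q => ?_)
    simp only [hf]
    by_cases hq : q ∈ tsupport χ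
    · have hq1 := hχs hq
      have h2 : |q / (2 * t)| ≤ 1 := by
        rw [abs_div, abs_of_pos (by linarith : 0 < 2 * t), div_le_one (by linarith)]
        exact (abs_le.2 hq1).trans ht0
      rw [abs_le] at h2
      have h3 := mul_eq_integral_localFourier hχ₁ hχ₁c hF δ (x + t) y (u + q / (2 * t))
      rw [hχ₁1 _ ⟨by linarith [hu.1, h2.1], by linarith [hu.2, h2.2]⟩, Complex.ofReal_one,
        one_mul] at h3
      have h4 : x + δ * u + t + δ * (q / (2 * t)) = x + t + δ * (u + q / (2 * t)) := by ring
      rw [h4, h3]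
      simp_rw [mul_comm (Complex.exp _)]
      ring
    · simp [image_eq_zero_of_notMem_tsupport hq]
  rw [h1, integral_mul_integral_mul_swap hfi hgi (c := 1) (by fun_prop)
    (fun p τ => (Complex.norm_exp_ofReal_mul_I _).le)]
  refine integral_congr_ae (Filter.Eventually.of_forall fun κ => ?_)
  simp only
  congr 1
  rw [localFourier_eq_integral, ← integral_const_mul]
  refine integral_congr_ae (Filter.Eventually.of_forall fun q => ?_)
  simp only [hf, Prod.swap_prod_mk]
  have h5 : Complex.exp ((2 * Real.pi * (κ * (u + q / (2 * t))) : ℝ) * Complex.I) =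
      Complex.exp ((2 * Real.pi * (κ * u) : ℝ) * Complex.I) *
      Complex.exp ((-(2 * Real.pi * (q * -(κ / (2 * t)))) : ℝ) * Complex.I) := by
    rw [← Complex.exp_add]
    congr 1
    push_cast
    ring
  rw [h5]
  ring

/-- Moving the window `χ` by `v` is superposing modulations of a wider window. -/
theorem localFourier_translate_eq_integral {h : ℝ × ℝ → ℂ} (hχ : ContDiff ℝ ∞ χ)
    (hχc : HasCompactSupport χ)
    (hχs : tsupport χ ⊆ Set.Icc (-1) 1) (hχ₁ : ContDiff ℝ ∞ χ₁) (hχ₁c : HasCompactSupport χ₁)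
    (hχ₁1 : ∀ p ∈ Set.Icc (-2 : ℝ) 2, χ₁ p = 1) (hh : Continuous h)
    (δ Y x μ : ℝ) {v : ℝ} (hv : v ∈ Set.Icc (0 : ℝ) 1) :
    localFourier χ δ h (Y + δ * v, x, -μ) =
      ∫ τ, FourierTransform.fourier (fun p => (χ p : ℂ)) τ *
        (Complex.exp ((-(2 * Real.pi * ((μ + τ) * v)) : ℝ) * Complex.I) *
          localFourier χ₁ δ h (Y, x, -(μ + τ))) := by
  have hχ0 : Continuous χ₁ := hχ₁.continuous
  set f : ℝ → ℂ := fun q => (χ₁ q : ℂ) * h (Y + δ * q, x) with hf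
  have hfi : Integrable f := by
    refine Continuous.integrable_of_hasCompactSupport (by fun_prop) ?_
    exact (hχ₁c.comp_left (g := fun x : ℝ => (x : ℂ)) (by simp)).mul_right
  have hχC : ContDiff ℝ ∞ fun p => (χ p : ℂ) := Complex.ofRealCLM.contDiff.comp hχ
  have hχCc : HasCompactSupport fun p => (χ p : ℂ) :=
    hχc.comp_left (g := fun x : ℝ => (x : ℂ)) (by simp)
  have hgi := integrable_fourier_of_hasCompactSupport hχC hχCc
  have h1 : localFourier χ δ h (Y + δ * v, x, -μ) = ∫ p, f p *
      ∫ τ, FourierTransform.fourier (fun p => (χ p : ℂ)) τ *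
        Complex.exp ((2 * Real.pi * ((μ + τ) * (p - v)) : ℝ) * Complex.I) := by
    rw [localFourier_eq_integral, ← integral_sub_right_eq_self _ v]
    refine integral_congr_ae (Filter.Eventually.of_forall fun p => ?_)
    simp only [hf]
    have h2 := eq_integral_fourier_of_hasCompactSupport hχC hχCc (p - v)
    have h3 : ∫ τ, FourierTransform.fourier (fun p => (χ p : ℂ)) τ *
        Complex.exp ((2 * Real.pi * ((μ + τ) * (p - v)) : ℝ) * Complex.I) =
        Complex.exp ((2 * Real.pi * (μ * (p - v)) : ℝ) * Complex.I) * (χ (p - v) : ℂ) := by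
      rw [h2, ← integral_const_mul]
      refine integral_congr_ae (Filter.Eventually.of_forall fun τ => ?_)
      simp only
      have : Complex.exp ((2 * Real.pi * ((μ + τ) * (p - v)) : ℝ) * Complex.I) =
          Complex.exp ((2 * Real.pi * (μ * (p - v)) : ℝ) * Complex.I) *
          Complex.exp ((2 * Real.pi * (τ * (p - v)) : ℝ) * Complex.I) := by
        rw [← Complex.exp_add]
        congr 1
        push_cast
        ring
      rw [this]
      ring
    rw [h3]
    by_cases hq : p - v ∈ tsupport χ
    · have hq1 := hχs hq
      rw [hχ₁1 p ⟨by linarith [hv.1, hq1.1], by linarith [hv.2, hq1.2]⟩,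
        show Y + δ * v + δ * (p - v) = Y + δ * p by ring,
        show -(2 * Real.pi * ((p - v) * -μ)) = 2 * Real.pi * (μ * (p - v)) by ring]
      push_cast
      ring
    · simp [image_eq_zero_of_notMem_tsupport hq]
  rw [h1, integral_mul_integral_mul_swap hfi hgi (c := 1) (by fun_prop)
    (fun p τ => (Complex.norm_exp_ofReal_mul_I _).le)]
  refine integral_congr_ae (Filter.Eventually.of_forall fun τ => ?_)
  simp only
  congr 1
  rw [localFourier_eq_integral, ← integral_const_mul]
  refine integral_congr_ae (Filter.Eventually.of_forall fun q => ?_)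
  simp only [hf]
  have h5 : Complex.exp ((2 * Real.pi * ((μ + τ) * (q - v)) : ℝ) * Complex.I) =
      Complex.exp ((-(2 * Real.pi * ((μ + τ) * v)) : ℝ) * Complex.I) *
      Complex.exp ((-(2 * Real.pi * (q * -(μ + τ))) : ℝ) * Complex.I) := by
    rw [← Complex.exp_add]
    congr 1
    push_cast
    ring
  rw [h5]
  ring

end

/-! ### Flat and peaked parts of the local Fourier transform -/

theorem lintegral_rotate {μ₁ μ₂ μ₃ μ₄ : Measure ℝ} [SFinite μ₁] [SFinite μ₂] [SFinite μ₃]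
    [SFinite μ₄] {Φ : ℝ × ℝ × ℝ × ℝ → ENNReal} (hΦ : Measurable Φ) :
    ∫⁻ w, ∫⁻ t, ∫⁻ x, ∫⁻ y, Φ (w, t, x, y) ∂μ₃ ∂μ₂ ∂μ₁ ∂μ₄ =
      ∫⁻ t, ∫⁻ x, ∫⁻ y, ∫⁻ w, Φ (w, t, x, y) ∂μ₄ ∂μ₃ ∂μ₂ ∂μ₁ := by
  rw [lintegral_lintegral_swap (Measurable.aemeasurable (by fun_prop))]
  refine lintegral_congr fun t => ?_
  rw [lintegral_lintegral_swap (Measurable.aemeasurable (by fun_prop))]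
  refine lintegral_congr fun x => ?_
  rw [lintegral_lintegral_swap (Measurable.aemeasurable (by fun_prop))]

/-- The bound that uses no cancellation in the form pairing `κ` with `κ / (2t)`. -/
theorem lintegral_curve_form_le {a c : ℝ × ℝ × ℝ → ENNReal} (ha : Measurable a)
    (hc : Measurable c) {ε : ℝ} (hε : 0 < ε) :
    ∫⁻ t in Set.Icc (1 / 2 : ℝ) 2, ∫⁻ x, ∫⁻ y, ∫⁻ κ,
      a (x + t, y, κ) * c (x, y + t ^ 2, κ / (2 * t)) ≤
    ENNReal.ofReal (3 / 2 * ε⁻¹) * (∫⁻ x, ∫⁻ y, ∫⁻ κ, a (x, y, κ) ^ 2) +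
      ENNReal.ofReal (6 * ε) * ∫⁻ x, ∫⁻ y, ∫⁻ κ, c (x, y, κ) ^ 2 := by
  have h1 : ∀ t ∈ Set.Icc (1 / 2 : ℝ) 2, ∫⁻ x, ∫⁻ y, ∫⁻ κ,
      a (x + t, y, κ) * c (x, y + t ^ 2, κ / (2 * t)) ≤
      ENNReal.ofReal ε⁻¹ * (∫⁻ x, ∫⁻ y, ∫⁻ κ, a (x, y, κ) ^ 2) +
        ENNReal.ofReal (4 * ε) * ∫⁻ x, ∫⁻ y, ∫⁻ κ, c (x, y, κ) ^ 2 := by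
    intro t ht
    have ht0 : 0 < 2 * t := by linarith [ht.1]
    have h2 : ∀ x y, ∫⁻ κ, a (x + t, y, κ) * c (x, y + t ^ 2, κ / (2 * t)) ≤
        ENNReal.ofReal ε⁻¹ * (∫⁻ κ, a (x + t, y, κ) ^ 2) +
          ENNReal.ofReal (4 * ε) * ∫⁻ κ, c (x, y + t ^ 2, κ) ^ 2 := by
      intro x y
      refine (lintegral_mono fun κ => ENNReal.mul_le_ofReal_mul_sq_add (inv_pos.2 hε) _ _).trans ?_
      rw [lintegral_add_left (by fun_prop), lintegral_const_mul _ (by fun_prop),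
        lintegral_const_mul _ (by fun_prop), inv_inv,
        lintegral_comp_div ht0 (f := fun κ => c (x, y + t ^ 2, κ) ^ 2) (by fun_prop), ← mul_assoc,
        ← ENNReal.ofReal_mul hε.le]
      refine add_le_add le_rfl (mul_le_mul_left (ENNReal.ofReal_le_ofReal ?_) _)
      nlinarith [ht.2]
    refine (lintegral_mono fun x => lintegral_mono fun y => h2 x y).trans (le_of_eq ?_)
    have h3 : ∀ x, ∫⁻ y, (ENNReal.ofReal ε⁻¹ * (∫⁻ κ, a (x + t, y, κ) ^ 2) +
          ENNReal.ofReal (4 * ε) * ∫⁻ κ, c (x, y + t ^ 2, κ) ^ 2) =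
        ENNReal.ofReal ε⁻¹ * (∫⁻ y, ∫⁻ κ, a (x + t, y, κ) ^ 2) +
          ENNReal.ofReal (4 * ε) * ∫⁻ y, ∫⁻ κ, c (x, y, κ) ^ 2 := by
      intro x
      rw [lintegral_add_left (by fun_prop), lintegral_const_mul _ (by fun_prop),
        lintegral_const_mul _ (by fun_prop),
        lintegral_add_right_eq_self (fun y => ∫⁻ κ, c (x, y, κ) ^ 2)]
    simp_rw [h3]
    rw [lintegral_add_left (by fun_prop), lintegral_const_mul _ (by fun_prop),
        lintegral_const_mul _ (by fun_prop),
        lintegral_add_right_eq_self (fun x => ∫⁻ y, ∫⁻ κ, a (x, y, κ) ^ 2)]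
  refine (setLIntegral_mono' measurableSet_Icc h1).trans (le_of_eq ?_)
  rw [lintegral_const, Measure.restrict_apply_univ, Real.volume_Icc, mul_comm, mul_add, ← mul_assoc,
    ← mul_assoc, ← ENNReal.ofReal_mul (by norm_num), ← ENNReal.ofReal_mul (by norm_num)]
  congr 3 <;> ring_nf

/-- The part of the local Fourier transform where it is small relative to its `L²` norm: the density
of its square is at most the proportion `d⁻⁸` of the total. -/
noncomputable def flatPart (χ : ℝ → ℝ) (δ d : ℝ) (h : ℝ × ℝ → ℂ) (q : ℝ × ℝ × ℝ) : ℂ :=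
  {q : ℝ × ℝ × ℝ | ‖localFourier χ δ h q‖ₑ ^ 2 ≤
    ENNReal.ofReal (d ^ 8)⁻¹ * ENNReal.ofReal (localMass χ δ h (q.1, q.2.1)) ^ 2}.indicator
    (localFourier χ δ h) q

/-- The part of the local Fourier transform where it is large relative to its `L²` norm: the
complement of the region defining `flatPart`. -/
noncomputable def peakPart (χ : ℝ → ℝ) (δ d : ℝ) (h : ℝ × ℝ → ℂ) (q : ℝ × ℝ × ℝ) : ℂ :=
  {q : ℝ × ℝ × ℝ | ‖localFourier χ δ h q‖ₑ ^ 2 ≤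
    ENNReal.ofReal (d ^ 8)⁻¹ * ENNReal.ofReal (localMass χ δ h (q.1, q.2.1)) ^ 2}ᶜ.indicator
    (localFourier χ δ h) q

section

variable {χ χ₁ : ℝ → ℝ} {h : ℝ × ℝ → ℂ}

theorem flatPart_add_peakPart (χ : ℝ → ℝ) (δ d : ℝ) (h : ℝ × ℝ → ℂ) (q : ℝ × ℝ × ℝ) :
    flatPart χ δ d h q + peakPart χ δ d h q = localFourier χ δ h q :=
  Set.indicator_self_add_compl_apply _ _ _

theorem enorm_flatPart_le (χ : ℝ → ℝ) (δ d : ℝ) (h : ℝ × ℝ → ℂ) (q : ℝ × ℝ × ℝ) :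
    ‖flatPart χ δ d h q‖ₑ ≤ ‖localFourier χ δ h q‖ₑ :=
  enorm_indicator_le_enorm_self _ _

theorem enorm_peakPart_le (χ : ℝ → ℝ) (δ d : ℝ) (h : ℝ × ℝ → ℂ) (q : ℝ × ℝ × ℝ) :
    ‖peakPart χ δ d h q‖ₑ ≤ ‖localFourier χ δ h q‖ₑ :=
  enorm_indicator_le_enorm_self _ _

theorem enorm_flatPart_sq_le (χ : ℝ → ℝ) (δ d : ℝ) (h : ℝ × ℝ → ℂ) (x y κ : ℝ) :
    ‖flatPart χ δ d h (x, y, κ)‖ₑ ^ 2 ≤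
      ENNReal.ofReal (d ^ 8)⁻¹ * ENNReal.ofReal (localMass χ δ h (x, y)) ^ 2 := by
  unfold flatPart
  by_cases hq : (x, y, κ) ∈ {q : ℝ × ℝ × ℝ | ‖localFourier χ δ h q‖ₑ ^ 2 ≤
    ENNReal.ofReal (d ^ 8)⁻¹ * ENNReal.ofReal (localMass χ δ h (q.1, q.2.1)) ^ 2}
  · rw [Set.indicator_of_mem hq]
    exact hq
  · rw [Set.indicator_of_notMem hq]
    simp

theorem measurableSet_flat (hχ : Continuous χ) (hχc : HasCompactSupport χ) (hh : Continuous h)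
    (δ d : ℝ) : MeasurableSet {q : ℝ × ℝ × ℝ | ‖localFourier χ δ h q‖ₑ ^ 2 ≤
    ENNReal.ofReal (d ^ 8)⁻¹ * ENNReal.ofReal (localMass χ δ h (q.1, q.2.1)) ^ 2} := by
  have h1 := (continuous_localFourier hχ hχc hh δ).measurable
  have h2 := (continuous_localMass hχ hχc hh δ).measurable
  exact measurableSet_le (by fun_prop) (by fun_prop)

theorem measurable_flatPart (hχ : Continuous χ) (hχc : HasCompactSupport χ) (hh : Continuous h)
    (δ d : ℝ) : Measurable (flatPart χ δ d h) :=
  (continuous_localFourier hχ hχc hh δ).measurable.indicator (measurableSet_flat hχ hχc hh δ d)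

theorem measurable_peakPart (hχ : Continuous χ) (hχc : HasCompactSupport χ) (hh : Continuous h)
    (δ d : ℝ) : Measurable (peakPart χ δ d h) :=
  (continuous_localFourier hχ hχc hh δ).measurable.indicator
    (measurableSet_flat hχ hχc hh δ d).compl

/-- Chebyshev's inequality: few frequencies carry a large proportion of the mass. -/
theorem volume_peakPart_ne_zero_le (hχ : ContDiff ℝ ∞ χ) (hχc : HasCompactSupport χ)
    (hh : Continuous h) (hs : ∀ y, ContDiff ℝ ∞ fun x => h (x, y)) (δ : ℝ) {d : ℝ} (hd : 0 < d)
    (x y : ℝ) : volume {κ | peakPart χ δ d h (x, y, κ) ≠ 0} ≤ ENNReal.ofReal (d ^ 8) := by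
  set m := ENNReal.ofReal (localMass χ δ h (x, y)) ^ 2 with hm
  have hmt : m ≠ ⊤ := by simp [hm]
  have hcont := continuous_localFourier hχ.continuous hχc hh δ
  have hmκ : Measurable fun κ => ‖localFourier χ δ h (x, y, κ)‖ₑ ^ 2 :=
    (hcont.measurable.comp (by fun_prop : Measurable fun κ : ℝ => (x, y, κ))).enorm.pow_const 2
  have hI := lintegral_localFourier_sq_eq_localMass hχ hχc hh hs δ x y
  have hsub : {κ | peakPart χ δ d h (x, y, κ) ≠ 0} ⊆
      {κ | ENNReal.ofReal (d ^ 8)⁻¹ * m < ‖localFourier χ δ h (x, y, κ)‖ₑ ^ 2} := by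
    intro κ hκ
    have h1 := Set.mem_of_indicator_ne_zero hκ
    simpa using h1
  refine (measure_mono hsub).trans ?_
  by_cases hm0 : m = 0
  · rw [← hm, hm0, lintegral_eq_zero_iff hmκ] at hI
    rw [hm0, mul_zero]
    refine le_trans (le_of_eq ?_) zero_le
    refine measure_mono_null ?_ (ae_iff.1 hI)
    intro κ hκ
    simp only [Set.mem_ofPred_eq] at hκ ⊢
    exact hκ.ne'
  · have h1 := meas_ge_le_lintegral_div (μ := volume)
      (f := fun κ => ‖localFourier χ δ h (x, y, κ)‖ₑ ^ 2) hmκ.aemeasurable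
      (ε := ENNReal.ofReal (d ^ 8)⁻¹ * m)
      (mul_ne_zero (by simp; positivity) hm0) (ENNReal.mul_ne_top (by simp) hmt)
    refine (measure_mono (t := {κ | ENNReal.ofReal (d ^ 8)⁻¹ * m ≤
      ‖localFourier χ δ h (x, y, κ)‖ₑ ^ 2}) fun κ hκ => by
        simp only [Set.mem_ofPred_eq] at hκ ⊢
        exact hκ.le).trans (h1.trans (le_of_eq ?_))
    rw [hI, ← hm, ENNReal.ofReal_inv_of_pos (by positivity),
      ENNReal.div_eq_inv_mul, ENNReal.mul_inv (Or.inr hmt) (Or.inr hm0), inv_inv, mul_assoc,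
      ENNReal.inv_mul_cancel hm0 hmt, mul_one]

/-- The flat part is kept as an oscillating integral; for the peak part absolute values suffice. -/
theorem enorm_tangentAverage_le {F G : ℝ × ℝ → ℂ} (hχ : ContDiff ℝ ∞ χ) (hχc : HasCompactSupport χ)
    (hχs : tsupport χ ⊆ Set.Icc (-1) 1) (hχ₁ : ContDiff ℝ ∞ χ₁) (hχ₁c : HasCompactSupport χ₁)
    (hχ₁1 : ∀ p ∈ Set.Icc (-2 : ℝ) 2, χ₁ p = 1) (hFc : Continuous F)
    (hF : ∀ y, ContDiff ℝ ∞ fun x => F (x, y))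
    (hG : Continuous G) (δ d x y : ℝ) {t u : ℝ} (ht : t ∈ Set.Icc (1 / 2 : ℝ) 2)
    (hu : u ∈ Set.Icc (0 : ℝ) 1) :
    ‖tangentAverage χ δ F G t (x + δ * u, y)‖ₑ ≤
      ‖∫ κ, flatPart χ₁ δ d F (x + t, y, κ) *
        (Complex.exp ((2 * Real.pi * (κ * u) : ℝ) * Complex.I) *
        localFourier χ δ (fun r => G r.swap) (y + t ^ 2, x + δ * u, -(κ / (2 * t))))‖ₑ +
      ∫⁻ κ, ‖peakPart χ₁ δ d F (x + t, y, κ)‖ₑ *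
        ‖localFourier χ δ (fun r => G r.swap) (y + t ^ 2, x + δ * u, -(κ / (2 * t)))‖ₑ := by
  set K : ℝ → ℂ := fun κ => Complex.exp ((2 * Real.pi * (κ * u) : ℝ) * Complex.I) *
        localFourier χ δ (fun r => G r.swap) (y + t ^ 2, x + δ * u, -(κ / (2 * t))) with hK
  have hcontG := continuous_localFourier hχ.continuous hχc
    (by fun_prop : Continuous fun r : ℝ × ℝ => G r.swap) δ
  have hKc : Continuous K := by fun_prop
  obtain ⟨c, hc⟩ := exists_norm_localFourier_le (χ := χ) (fun r => G r.swap) δ (y + t ^ 2)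
    (x + δ * u)
  have hKb : ∀ κ, ‖K κ‖ ≤ c := by
    intro κ
    rw [hK]
    simp only
    rw [norm_mul, Complex.norm_exp_ofReal_mul_I, one_mul]
    exact hc _
  have hLi := integrable_localFourier hχ₁ hχ₁c hF δ (x + t) y
  have hfm := measurable_flatPart hχ₁.continuous hχ₁c hFc δ d
  have hpm := measurable_peakPart hχ₁.continuous hχ₁c hFc δ d
  have hfi : Integrable fun κ => flatPart χ₁ δ d F (x + t, y, κ) :=
    hLi.mono (Measurable.aestronglyMeasurable (by fun_prop))
      (Filter.Eventually.of_forall fun κ => by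
        simpa [enorm_le_iff_norm_le] using enorm_flatPart_le χ₁ δ d F (x + t, y, κ))
  have hpi : Integrable fun κ => peakPart χ₁ δ d F (x + t, y, κ) :=
    hLi.mono (Measurable.aestronglyMeasurable (by fun_prop))
      (Filter.Eventually.of_forall fun κ => by
        simpa [enorm_le_iff_norm_le] using enorm_peakPart_le χ₁ δ d F (x + t, y, κ))
  have h1 : tangentAverage χ δ F G t (x + δ * u, y) =
      (∫ κ, flatPart χ₁ δ d F (x + t, y, κ) * K κ) +
        ∫ κ, peakPart χ₁ δ d F (x + t, y, κ) * K κ := by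
    rw [tangentAverage_eq_integral_localFourier hχ hχc hχs hχ₁ hχ₁c hχ₁1 hF hG δ x y ht hu,
      ← integral_add (hfi.mul_bdd (c := c) hKc.aestronglyMeasurable
          (Filter.Eventually.of_forall hKb))
        (hpi.mul_bdd (c := c) hKc.aestronglyMeasurable (Filter.Eventually.of_forall hKb))]
    refine integral_congr_ae (Filter.Eventually.of_forall fun κ => ?_)
    simp only
    rw [← flatPart_add_peakPart χ₁ δ d, add_mul]
  rw [h1]
  refine (enorm_add_le _ _).trans (add_le_add le_rfl ((enorm_integral_le_lintegral_enorm _).trans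
    (le_of_eq (lintegral_congr fun κ => ?_))))
  simp only [hK]
  rw [enorm_mul, enorm_mul, enorm_exp_ofReal_mul_I, one_mul]

end

section

variable {χ χ₁ : ℝ → ℝ}

/-- The flat part of the tangential average, with the window of `G` recentred: an absolutely
convergent superposition of the forms controlled by flatness. -/
theorem enorm_integral_flatPart_le {F G : ℝ × ℝ → ℂ} (hχ : ContDiff ℝ ∞ χ)
    (hχc : HasCompactSupport χ)
    (hχs : tsupport χ ⊆ Set.Icc (-1) 1) (hχ₁ : ContDiff ℝ ∞ χ₁) (hχ₁c : HasCompactSupport χ₁)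
    (hχ₁1 : ∀ p ∈ Set.Icc (-2 : ℝ) 2, χ₁ p = 1) (hFc : Continuous F)
    (hF : ∀ y, ContDiff ℝ ∞ fun x => F (x, y))
    (hG : Continuous G) (δ d x y t u : ℝ) {v : ℝ} (hv : v ∈ Set.Icc (0 : ℝ) 1) :
    ‖∫ κ, flatPart χ₁ δ d F (x + t, y + δ * v, κ) *
        (Complex.exp ((2 * Real.pi * (κ * u) : ℝ) * Complex.I) *
        localFourier χ δ (fun r => G r.swap)
          (y + δ * v + t ^ 2, x + δ * u, -(κ / (2 * t))))‖ₑ ≤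
      ∫⁻ τ, ‖FourierTransform.fourier (fun p => (χ p : ℂ)) τ‖ₑ *
        ‖∫ κ, flatPart χ₁ δ d F (x + t, y + δ * v, κ) *
          localFourier χ₁ δ (fun r => G r.swap) (y + t ^ 2, x + δ * u, -(κ / (2 * t) + τ)) *
          Complex.exp ((2 * Real.pi * (κ * (u - 1 / (2 * t) * v)) : ℝ) * Complex.I)‖ₑ := by
  have hGs : Continuous fun r : ℝ × ℝ => G r.swap := by fun_prop
  have hcontG := continuous_localFourier hχ₁.continuous hχ₁c hGs δ
  obtain ⟨c, hc⟩ := exists_norm_localFourier_le (χ := χ₁) (fun r => G r.swap) δ (y + t ^ 2)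
    (x + δ * u)
  have hLi := integrable_localFourier hχ₁ hχ₁c hF δ (x + t) (y + δ * v)
  have hfm := measurable_flatPart hχ₁.continuous hχ₁c hFc δ d
  have hfi : Integrable fun κ => flatPart χ₁ δ d F (x + t, y + δ * v, κ) :=
    hLi.mono (Measurable.aestronglyMeasurable (by fun_prop))
      (Filter.Eventually.of_forall fun κ => by
        simpa [enorm_le_iff_norm_le] using enorm_flatPart_le χ₁ δ d F (x + t, y + δ * v, κ))
  have hχC : ContDiff ℝ ∞ fun p => (χ p : ℂ) := Complex.ofRealCLM.contDiff.comp hχ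
  have hχCc : HasCompactSupport fun p => (χ p : ℂ) :=
    hχc.comp_left (g := fun x : ℝ => (x : ℂ)) (by simp)
  have hgi := integrable_fourier_of_hasCompactSupport hχC hχCc
  set K : ℝ → ℝ → ℂ := fun κ τ => Complex.exp ((2 * Real.pi * (κ * u) : ℝ) * Complex.I) *
    (Complex.exp ((-(2 * Real.pi * ((κ / (2 * t) + τ) * v)) : ℝ) * Complex.I) *
      localFourier χ₁ δ (fun r => G r.swap) (y + t ^ 2, x + δ * u, -(κ / (2 * t) + τ))) with hK
  have hKc : Continuous fun q : ℝ × ℝ => K q.1 q.2 := by fun_prop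
  have hKb : ∀ κ τ, ‖K κ τ‖ ≤ c := by
    intro κ τ
    rw [hK]
    simp only
    rw [norm_mul, norm_mul, Complex.norm_exp_ofReal_mul_I, Complex.norm_exp_ofReal_mul_I, one_mul,
      one_mul]
    exact hc _
  have h1 : ∫ κ, flatPart χ₁ δ d F (x + t, y + δ * v, κ) *
        (Complex.exp ((2 * Real.pi * (κ * u) : ℝ) * Complex.I) *
        localFourier χ δ (fun r => G r.swap)
          (y + δ * v + t ^ 2, x + δ * u, -(κ / (2 * t)))) =
      ∫ κ, flatPart χ₁ δ d F (x + t, y + δ * v, κ) *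
        ∫ τ, FourierTransform.fourier (fun p => (χ p : ℂ)) τ * K κ τ := by
    refine integral_congr_ae (Filter.Eventually.of_forall fun κ => ?_)
    simp only
    rw [show y + δ * v + t ^ 2 = y + t ^ 2 + δ * v by ring,
      localFourier_translate_eq_integral hχ hχc hχs hχ₁ hχ₁c hχ₁1 hGs δ (y + t ^ 2) (x + δ * u)
        (κ / (2 * t)) hv, ← integral_const_mul]
    congr 1
    refine integral_congr_ae (Filter.Eventually.of_forall fun τ => ?_)
    simp only [hK]
    ring
  rw [h1, integral_mul_integral_mul_swap hfi hgi hKc hKb]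
  refine (enorm_integral_le_lintegral_enorm _).trans (le_of_eq (lintegral_congr fun τ => ?_))
  rw [enorm_mul]
  congr 1
  have h2 : ∫ κ, flatPart χ₁ δ d F (x + t, y + δ * v, κ) * K κ τ =
      Complex.exp ((-(2 * Real.pi * (τ * v)) : ℝ) * Complex.I) *
      ∫ κ, flatPart χ₁ δ d F (x + t, y + δ * v, κ) *
          localFourier χ₁ δ (fun r => G r.swap) (y + t ^ 2, x + δ * u, -(κ / (2 * t) + τ)) *
          Complex.exp ((2 * Real.pi * (κ * (u - 1 / (2 * t) * v)) : ℝ) * Complex.I) := by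
    rw [← integral_const_mul]
    refine integral_congr_ae (Filter.Eventually.of_forall fun κ => ?_)
    simp only [hK]
    have : Complex.exp ((2 * Real.pi * (κ * u) : ℝ) * Complex.I) *
        Complex.exp ((-(2 * Real.pi * ((κ / (2 * t) + τ) * v)) : ℝ) * Complex.I) =
        Complex.exp ((-(2 * Real.pi * (τ * v)) : ℝ) * Complex.I) *
        Complex.exp ((2 * Real.pi * (κ * (u - 1 / (2 * t) * v)) : ℝ) * Complex.I) := by
      rw [← Complex.exp_add, ← Complex.exp_add]
      congr 1
      push_cast
      ring
    rw [← mul_assoc (Complex.exp _) (Complex.exp _), this]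
    ring
  rw [h2, enorm_mul, enorm_exp_ofReal_mul_I, one_mul]

theorem lintegral_enorm_sq_eq_ofReal (hχ : Continuous χ) (hχc : HasCompactSupport χ) :
    ∫⁻ p, ‖χ p‖ₑ ^ 2 = ENNReal.ofReal (∫ p, χ p ^ 2) := by
  have hi : Integrable fun p => χ p ^ 2 := Continuous.integrable_of_hasCompactSupport (by fun_prop)
    (hχc.comp_left (g := fun x : ℝ => x ^ 2) (by simp))
  rw [ofReal_integral_eq_lintegral_ofReal hi (Filter.Eventually.of_forall fun p => sq_nonneg _)]
  refine lintegral_congr fun p => ?_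
  rw [← sq_abs, ENNReal.ofReal_pow (abs_nonneg _), ← Real.norm_eq_abs, ofReal_norm]

theorem lintegral_localMass_sq {h : ℝ × ℝ → ℂ} (hχ : ContDiff ℝ ∞ χ)
    (hχc : HasCompactSupport χ) (hh : Continuous h) (hs : ∀ y, ContDiff ℝ ∞ fun x => h (x, y))
    (δ : ℝ) : ∫⁻ x, ∫⁻ y, ENNReal.ofReal (localMass χ δ h (x, y)) ^ 2 =
      (∫⁻ p, ‖χ p‖ₑ ^ 2) * ∫⁻ x, ∫⁻ y, ‖h (x, y)‖ₑ ^ 2 := by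
  rw [← lintegral_lintegral_localFourier_sq hχ hχc hh hs δ]
  simp_rw [lintegral_localFourier_sq_eq_localMass hχ hχc hh hs]

theorem lintegral_swap_sq {G : ℝ × ℝ → ℂ} (hG : Continuous G) :
    ∫⁻ x, ∫⁻ y, ‖G (y, x)‖ₑ ^ 2 = ∫⁻ x, ∫⁻ y, ‖G (x, y)‖ₑ ^ 2 := by
  have := hG.measurable
  rw [lintegral_lintegral_swap (Measurable.aemeasurable (by fun_prop))]

theorem lintegral_reorder {ν σ μ : Measure ℝ} [SFinite ν] [SFinite σ] [SFinite μ]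
    {Φ : ℝ × ℝ × ℝ × ℝ × ℝ × ℝ → ENNReal} (hΦ : Measurable Φ) :
    ∫⁻ v, ∫⁻ u, ∫⁻ t, ∫⁻ x, ∫⁻ y, ∫⁻ τ, Φ (τ, v, u, t, x, y) ∂μ ∂μ ∂μ ∂σ ∂ν ∂ν =
      ∫⁻ τ, ∫⁻ t, ∫⁻ x, ∫⁻ y, ∫⁻ u, ∫⁻ v, Φ (τ, v, u, t, x, y) ∂ν ∂ν ∂μ ∂μ ∂σ ∂μ := by
  have h1 : ∀ v u, ∫⁻ t, ∫⁻ x, ∫⁻ y, ∫⁻ τ, Φ (τ, v, u, t, x, y) ∂μ ∂μ ∂μ ∂σ =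
      ∫⁻ τ, ∫⁻ t, ∫⁻ x, ∫⁻ y, Φ (τ, v, u, t, x, y) ∂μ ∂μ ∂σ ∂μ := fun v u =>
    (lintegral_rotate (Φ := fun w => Φ (w.1, v, u, w.2.1, w.2.2.1, w.2.2.2)) (by fun_prop)).symm
  have h2 : ∀ v, ∫⁻ u, ∫⁻ τ, ∫⁻ t, ∫⁻ x, ∫⁻ y, Φ (τ, v, u, t, x, y) ∂μ ∂μ ∂σ ∂μ ∂ν =
      ∫⁻ τ, ∫⁻ u, ∫⁻ t, ∫⁻ x, ∫⁻ y, Φ (τ, v, u, t, x, y) ∂μ ∂μ ∂σ ∂ν ∂μ := fun v =>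
    lintegral_lintegral_swap (Measurable.aemeasurable (by fun_prop))
  have h3 : ∀ τ v, ∫⁻ u, ∫⁻ t, ∫⁻ x, ∫⁻ y, Φ (τ, v, u, t, x, y) ∂μ ∂μ ∂σ ∂ν =
      ∫⁻ t, ∫⁻ x, ∫⁻ y, ∫⁻ u, Φ (τ, v, u, t, x, y) ∂ν ∂μ ∂μ ∂σ := fun τ v =>
    lintegral_rotate (Φ := fun w => Φ (τ, v, w)) (by fun_prop)
  simp_rw [h1, h2]
  rw [lintegral_lintegral_swap (Measurable.aemeasurable (by fun_prop))]
  simp_rw [h3]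
  refine lintegral_congr fun τ => ?_
  refine (lintegral_rotate (Φ := fun w => ∫⁻ u, Φ (τ, w.1, u, w.2.1, w.2.2.1, w.2.2.2) ∂ν)
    (by fun_prop)).trans ?_
  refine lintegral_congr fun t => lintegral_congr fun x => lintegral_congr fun y => ?_
  exact lintegral_lintegral_swap (Measurable.aemeasurable (by fun_prop))

/-- The flat part of the tangential averages gains `1 / d`. -/
theorem exists_bound_integral_flatPart (hχ : ContDiff ℝ ∞ χ)
    (hχc : HasCompactSupport χ)
    (hχs : tsupport χ ⊆ Set.Icc (-1) 1) (hχ₁ : ContDiff ℝ ∞ χ₁) (hχ₁c : HasCompactSupport χ₁)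
    (hχ₁1 : ∀ p ∈ Set.Icc (-2 : ℝ) 2, χ₁ p = 1) : ∃ C : ℝ, 0 < C ∧ ∀ {F G : ℝ × ℝ → ℂ}
    (_ : Continuous F) (_ : ∀ y, ContDiff ℝ ∞ fun x => F (x, y))
    (_ : Continuous G) (_ : ∀ x, ContDiff ℝ ∞ fun y => G (x, y)) (δ : ℝ) {d : ℝ} (_ : 0 < d),
    ∫⁻ u in Set.Icc (0 : ℝ) 1, ∫⁻ t in Set.Icc (1 / 2 : ℝ) 2, ∫⁻ x, ∫⁻ y,
      ‖∫ κ, flatPart χ₁ δ d F (x + t, y, κ) *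
        (Complex.exp ((2 * Real.pi * (κ * u) : ℝ) * Complex.I) *
        localFourier χ δ (fun r => G r.swap) (y + t ^ 2, x + δ * u, -(κ / (2 * t))))‖ₑ ≤
    ENNReal.ofReal (C / d) * ((∫⁻ x, ∫⁻ y, ‖F (x, y)‖ₑ ^ 2) + ∫⁻ x, ∫⁻ y, ‖G (x, y)‖ₑ ^ 2) := by
  obtain ⟨C, hC, hflat⟩ := exists_bound_flat
  have hχC : ContDiff ℝ ∞ fun p => (χ p : ℂ) := Complex.ofRealCLM.contDiff.comp hχ
  have hχCc : HasCompactSupport fun p => (χ p : ℂ) :=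
    hχc.comp_left (g := fun x : ℝ => (x : ℂ)) (by simp)
  have hgi := integrable_fourier_of_hasCompactSupport hχC hχCc
  set g := FourierTransform.fourier (fun p => (χ p : ℂ)) with hg
  have hgc : Continuous g := by
    have h1 := (continuous_localFourier hχ.continuous hχc
      (continuous_const (y := (1 : ℂ)) : Continuous fun _ : ℝ × ℝ => (1 : ℂ)) 1).comp
      (by fun_prop : Continuous fun κ : ℝ => ((0 : ℝ), (0 : ℝ), κ))
    refine h1.congr fun κ => ?_
    simp only [Function.comp, localFourier, mul_one, hg]
  set A : ℝ := ∫ τ, ‖g τ‖ with hA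
  have hA0 : 0 ≤ A := integral_nonneg fun τ => norm_nonneg _
  have hAI : ∫⁻ τ, ‖g τ‖ₑ = ENNReal.ofReal A := by
    rw [hA, ofReal_integral_norm_eq_lintegral_enorm hgi]
  have hχ₁0 : Continuous χ₁ := hχ₁.continuous
  set B : ℝ := ∫ p, χ₁ p ^ 2 with hB
  have hB0 : 0 ≤ B := integral_nonneg fun p => sq_nonneg _
  have hBI : ∫⁻ p, ‖χ₁ p‖ₑ ^ 2 = ENNReal.ofReal B := lintegral_enorm_sq_eq_ofReal hχ₁0 hχ₁c
  refine ⟨A * C * B + 1, by positivity, ?_⟩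
  intro F G hFc hF hG hGs δ d hd
  set J : ℝ × ℝ × ℝ × ℝ × ℝ × ℝ → ENNReal := fun r =>
    ‖∫ κ, flatPart χ₁ δ d F (r.2.2.2.2.1 + r.2.2.2.1, r.2.2.2.2.2 + δ * r.2.1, κ) *
          localFourier χ₁ δ (fun r => G r.swap) (r.2.2.2.2.2 + r.2.2.2.1 ^ 2,
            r.2.2.2.2.1 + δ * r.2.2.1, -(κ / (2 * r.2.2.2.1) + r.1)) *
          Complex.exp ((2 * Real.pi * (κ * (r.2.2.1 - 1 / (2 * r.2.2.2.1) * r.2.1)) : ℝ) *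
            Complex.I)‖ₑ with hJ
  have hGsc : Continuous fun r : ℝ × ℝ => G r.swap := by fun_prop
  have hGss : ∀ y, ContDiff ℝ ∞ fun x => (fun r : ℝ × ℝ => G r.swap) (x, y) := fun y => hGs y
  have hfm := measurable_flatPart hχ₁0 hχ₁c hFc δ d
  have hlm := (continuous_localFourier hχ₁0 hχ₁c hGsc δ).measurable
  have hJm : Measurable J := by
    have h3 : Measurable fun r : (ℝ × ℝ × ℝ × ℝ × ℝ × ℝ) × ℝ =>
      flatPart χ₁ δ d F (r.1.2.2.2.2.1 + r.1.2.2.2.1, r.1.2.2.2.2.2 + δ * r.1.2.1, r.2) *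
          localFourier χ₁ δ (fun r => G r.swap) (r.1.2.2.2.2.2 + r.1.2.2.2.1 ^ 2,
            r.1.2.2.2.2.1 + δ * r.1.2.2.1, -(r.2 / (2 * r.1.2.2.2.1) + r.1.1)) *
          Complex.exp ((2 * Real.pi * (r.2 * (r.1.2.2.1 - 1 / (2 * r.1.2.2.2.1) * r.1.2.1)) : ℝ) *
            Complex.I) := by
      fun_prop
    exact h3.stronglyMeasurable.integral_prod_right'.measurable.enorm
  set N : ℝ → ℝ → ℝ → ℝ → ENNReal := fun u t x y => ‖∫ κ, flatPart χ₁ δ d F (x + t, y, κ) *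
        (Complex.exp ((2 * Real.pi * (κ * u) : ℝ) * Complex.I) *
        localFourier χ δ (fun r => G r.swap) (y + t ^ 2, x + δ * u, -(κ / (2 * t))))‖ₑ with hN
  -- by translation invariance the norm may also be averaged over shifts of `y` by `δv`
  have hshift : ∀ v, ∫⁻ u in Set.Icc (0 : ℝ) 1, ∫⁻ t in Set.Icc (1 / 2 : ℝ) 2, ∫⁻ x, ∫⁻ y,
      N u t x (y + δ * v) =
      ∫⁻ u in Set.Icc (0 : ℝ) 1, ∫⁻ t in Set.Icc (1 / 2 : ℝ) 2, ∫⁻ x, ∫⁻ y, N u t x y := fun v =>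
    lintegral_congr fun u => lintegral_congr fun t => lintegral_congr fun x =>
      lintegral_add_right_eq_self (fun y => N u t x y) (δ * v)
  have hav : ∫⁻ u in Set.Icc (0 : ℝ) 1, ∫⁻ t in Set.Icc (1 / 2 : ℝ) 2, ∫⁻ x, ∫⁻ y, N u t x y =
      ∫⁻ v in Set.Icc (0 : ℝ) 1, ∫⁻ u in Set.Icc (0 : ℝ) 1, ∫⁻ t in Set.Icc (1 / 2 : ℝ) 2,
      ∫⁻ x, ∫⁻ y, N u t x (y + δ * v) := by
    simp_rw [hshift]
    simp
  rw [hav]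
  refine (setLIntegral_mono' measurableSet_Icc fun v hv => lintegral_mono fun u => lintegral_mono
    fun t => lintegral_mono fun x => lintegral_mono fun y => enorm_integral_flatPart_le hχ hχc hχs
      hχ₁ hχ₁c hχ₁1 hFc hF hG δ d x y t u hv).trans ?_
  refine (lintegral_reorder (Φ := fun r => ‖g r.1‖ₑ * J r)
    ((hgc.measurable.comp measurable_fst).enorm.mul hJm)).le.trans ?_
  have hτ : ∀ τ, ∫⁻ t in Set.Icc (1 / 2 : ℝ) 2, ∫⁻ x, ∫⁻ y, ∫⁻ u in Set.Icc (0 : ℝ) 1,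
      ∫⁻ v in Set.Icc (0 : ℝ) 1, ‖g τ‖ₑ * J (τ, v, u, t, x, y) ≤
      ‖g τ‖ₑ * (ENNReal.ofReal (C / d) * (ENNReal.ofReal B *
        ((∫⁻ x, ∫⁻ y, ‖F (x, y)‖ₑ ^ 2) + ∫⁻ x, ∫⁻ y, ‖G (x, y)‖ₑ ^ 2))) := by
    intro τ
    simp_rw [fun f : ℝ → ENNReal => lintegral_const_mul' (μ := volume.restrict (Set.Icc (0 : ℝ) 1))
      ‖g τ‖ₑ f enorm_ne_top, fun f : ℝ → ENNReal => lintegral_const_mul' (μ := volume)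
      ‖g τ‖ₑ f enorm_ne_top]
    rw [lintegral_const_mul' _ _ enorm_ne_top]
    refine mul_le_mul_right ?_ _
    have h1 := hflat δ d hd (flatPart χ₁ δ d F)
      (fun q => localFourier χ₁ δ (fun r => G r.swap) (q.2.1, q.1, -(q.2.2 + τ)))
      (localMass χ₁ δ F) (fun r => localMass χ₁ δ (fun r => G r.swap) (r.2, r.1)) hfm (by fun_prop)
      (continuous_localMass hχ₁0 hχ₁c hFc δ)
      ((continuous_localMass hχ₁0 hχ₁c hGsc δ).comp
        (by fun_prop : Continuous fun r : ℝ × ℝ => (r.2, r.1)))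
      (localMass_nonneg _ _ _) (fun r => localMass_nonneg _ _ _ _) (fun x y => ?_) (fun x y => ?_)
      (enorm_flatPart_sq_le _ _ _ _)
    · refine h1.trans (mul_le_mul_right ?_ _)
      rw [lintegral_localMass_sq hχ₁ hχ₁c hFc hF, hBI, mul_add]
      refine add_le_add le_rfl (le_of_eq ?_)
      rw [← lintegral_swap_sq hG, ← hBI]
      refine Eq.trans ?_ (lintegral_localMass_sq hχ₁ hχ₁c hGsc hGss δ)
      have := (continuous_localMass hχ₁0 hχ₁c hGsc δ).measurable
      exact lintegral_lintegral_swap (Measurable.aemeasurable (by fun_prop))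
    · rw [← lintegral_localFourier_sq_eq_localMass hχ₁ hχ₁c hFc hF]
      exact lintegral_mono fun κ => pow_le_pow_left' (enorm_flatPart_le _ _ _ _ _) 2
    · rw [← lintegral_localFourier_sq_eq_localMass hχ₁ hχ₁c hGsc hGss]
      refine le_of_eq ?_
      have h2 := lintegral_sub_left_eq_self (μ := (volume : Measure ℝ))
        (fun κ => ‖localFourier χ₁ δ (fun r => G r.swap) (y, x, κ)‖ₑ ^ 2) (-τ)
      rw [← h2]
      refine lintegral_congr fun κ => ?_
      simp only
      rw [show -(κ + τ) = -τ - κ by ring]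
  refine (lintegral_mono hτ).trans ?_
  rw [lintegral_mul_const _ hgc.measurable.enorm, hAI, ← mul_assoc, ← mul_assoc,
    ← ENNReal.ofReal_mul hA0, ← ENNReal.ofReal_mul (by positivity)]
  refine mul_le_mul_left (ENNReal.ofReal_le_ofReal ?_) _
  rw [le_div_iff₀ hd]
  have : A * (C / d) * B * d = A * C * B := by field_simp
  rw [this]
  linarith

end

theorem lintegral_four_add_right {μ₁ μ₂ μ₃ μ₄ : Measure ℝ} [SFinite μ₁] [SFinite μ₂] [SFinite μ₃]
    [SFinite μ₄] {N : ℝ → ℝ → ℝ → ℝ → ENNReal} {Q : ℝ × ℝ × ℝ × ℝ → ENNReal} (hQ : Measurable Q) :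
    ∫⁻ u, ∫⁻ t, ∫⁻ x, ∫⁻ y, (N u t x y + Q (u, t, x, y)) ∂μ₄ ∂μ₃ ∂μ₂ ∂μ₁ =
      (∫⁻ u, ∫⁻ t, ∫⁻ x, ∫⁻ y, N u t x y ∂μ₄ ∂μ₃ ∂μ₂ ∂μ₁) +
        ∫⁻ u, ∫⁻ t, ∫⁻ x, ∫⁻ y, Q (u, t, x, y) ∂μ₄ ∂μ₃ ∂μ₂ ∂μ₁ := by
  rw [← lintegral_add_right _ (by fun_prop)]
  refine lintegral_congr fun u => ?_
  rw [← lintegral_add_right _ (by fun_prop)]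
  refine lintegral_congr fun t => ?_
  rw [← lintegral_add_right _ (by fun_prop)]
  refine lintegral_congr fun x => ?_
  rw [← lintegral_add_right _ (by fun_prop)]

section

variable {χ χ₁ : ℝ → ℝ}

theorem lintegral_localFourier_swap_sq {G : ℝ × ℝ → ℂ} (hχ : ContDiff ℝ ∞ χ)
    (hχc : HasCompactSupport χ) (hG : Continuous G) (hGs : ∀ x, ContDiff ℝ ∞ fun y => G (x, y))
    (δ s : ℝ) :
    ∫⁻ x, ∫⁻ y, ∫⁻ κ, ‖localFourier χ δ (fun r => G r.swap) (y, x + s, -κ)‖ₑ ^ 2 =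
      (∫⁻ p, ‖χ p‖ₑ ^ 2) * ∫⁻ x, ∫⁻ y, ‖G (x, y)‖ₑ ^ 2 := by
  have hGsc : Continuous fun r : ℝ × ℝ => G r.swap := by fun_prop
  have hGss : ∀ y, ContDiff ℝ ∞ fun x => (fun r : ℝ × ℝ => G r.swap) (x, y) := fun y => hGs y
  have hm := (continuous_localFourier hχ.continuous hχc hGsc δ).measurable
  have h1 : ∀ x y, ∫⁻ κ, ‖localFourier χ δ (fun r => G r.swap) (y, x, -κ)‖ₑ ^ 2 =
      ∫⁻ κ, ‖localFourier χ δ (fun r => G r.swap) (y, x, κ)‖ₑ ^ 2 := by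
    intro x y
    have h2 := lintegral_sub_left_eq_self (μ := (volume : Measure ℝ))
      (fun κ => ‖localFourier χ δ (fun r => G r.swap) (y, x, κ)‖ₑ ^ 2) 0
    simpa using h2
  rw [lintegral_add_right_eq_self (fun x => ∫⁻ y, ∫⁻ κ,
    ‖localFourier χ δ (fun r => G r.swap) (y, x, -κ)‖ₑ ^ 2) s]
  simp_rw [h1]
  rw [lintegral_lintegral_swap (Measurable.aemeasurable (by fun_prop)), ← lintegral_swap_sq hG]
  exact lintegral_lintegral_localFourier_sq hχ hχc hGsc hGss δ

/-- Low frequencies: they carry little of the mass of `F`, which is a derivative of `H / L`. -/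
theorem exists_bound_peakPart_low (hχ : ContDiff ℝ ∞ χ) (hχc : HasCompactSupport χ)
    (hχ₁ : ContDiff ℝ ∞ χ₁) (hχ₁c : HasCompactSupport χ₁) : ∃ C : ℝ, 0 < C ∧
    ∀ {F H G : ℝ × ℝ → ℂ} (_ : Continuous F) (_ : ∀ y, ContDiff ℝ ∞ fun x => F (x, y))
    (_ : Continuous H) (_ : ∀ y, ContDiff ℝ ∞ fun x => H (x, y))
    (_ : Continuous G) (_ : ∀ x, ContDiff ℝ ∞ fun y => G (x, y)) {L : ℝ}
    (_ : ∀ x y, HasDerivAt (fun x => H (x, y)) (L * F (x, y)) x) {δ R : ℝ} (d u : ℝ)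
    (_ : 0 < L * δ) (_ : 1 ≤ R),
    ∫⁻ t in Set.Icc (1 / 2 : ℝ) 2, ∫⁻ x, ∫⁻ y, ∫⁻ κ,
      (Set.Icc (-R) R).indicator (fun κ => ‖peakPart χ₁ δ d F (x + t, y, κ)‖ₑ) κ *
        ‖localFourier χ δ (fun r => G r.swap) (y + t ^ 2, x + δ * u, -(κ / (2 * t)))‖ₑ ≤
    ENNReal.ofReal (C * (R / (L * δ))) *
      ((∫⁻ x, ∫⁻ y, ‖H (x, y)‖ₑ ^ 2) + ∫⁻ x, ∫⁻ y, ‖G (x, y)‖ₑ ^ 2) := by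
  have hχ₁0 := hχ₁.continuous
  have hd1 : Continuous (deriv χ₁) := hχ₁.continuous_deriv (by simp)
  set k : ℝ := (∫ p, χ p ^ 2) + ((∫ p, χ₁ p ^ 2) + ∫ p, deriv χ₁ p ^ 2) with hk
  have hk1 : 0 ≤ ∫ p, χ p ^ 2 := integral_nonneg fun p => sq_nonneg _
  have hk2 : 0 ≤ ∫ p, χ₁ p ^ 2 := integral_nonneg fun p => sq_nonneg _
  have hk3 : 0 ≤ ∫ p, deriv χ₁ p ^ 2 := integral_nonneg fun p => sq_nonneg _
  have hkχ : ∫⁻ p, ‖χ p‖ₑ ^ 2 ≤ ENNReal.ofReal k := by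
    rw [lintegral_enorm_sq_eq_ofReal hχ.continuous hχc]
    exact ENNReal.ofReal_le_ofReal (by linarith)
  have hkχ₁ : (∫⁻ p, ‖χ₁ p‖ₑ ^ 2) + ∫⁻ p, ‖deriv χ₁ p‖ₑ ^ 2 ≤ ENNReal.ofReal k := by
    rw [lintegral_enorm_sq_eq_ofReal hχ₁.continuous hχ₁c,
      lintegral_enorm_sq_eq_ofReal hd1 hχ₁c.deriv, ← ENNReal.ofReal_add hk2 hk3]
    exact ENNReal.ofReal_le_ofReal (by linarith)
  have hk0 : 0 ≤ k := by linarith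
  refine ⟨120 * k + 1, by positivity, ?_⟩
  intro F H G hFc hF hHc hH hG hGs L hHF δ R d u hLδ hR
  -- the squared mass of the low frequencies is of order `ε²`
  set ε := R / (L * δ) with hε
  have hε0 : 0 < ε := by positivity
  have hGsc : Continuous fun r : ℝ × ℝ => G r.swap := by fun_prop
  have hGm := (continuous_localFourier hχ.continuous hχc hGsc δ).measurable
  have hpm := measurable_peakPart hχ₁0 hχ₁c hFc δ d
  have ham : Measurable fun q : ℝ × ℝ × ℝ =>
      (Set.Icc (-R) R).indicator (fun κ => ‖peakPart χ₁ δ d F (q.1, q.2.1, κ)‖ₑ) q.2.2 := by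
    have h1 : MeasurableSet {q : ℝ × ℝ × ℝ | q.2.2 ∈ Set.Icc (-R) R} :=
      measurableSet_Icc.preimage (by fun_prop)
    exact (hpm.enorm.indicator h1)
  have h1 := lintegral_curve_form_le (a := fun q =>
      (Set.Icc (-R) R).indicator (fun κ => ‖peakPart χ₁ δ d F (q.1, q.2.1, κ)‖ₑ) q.2.2)
    (c := fun q => ‖localFourier χ δ (fun r => G r.swap) (q.2.1, q.1 + δ * u, -q.2.2)‖ₑ)
    ham (by fun_prop) hε0
  refine h1.trans ?_
  simp only
  have hlow : ∫⁻ x, ∫⁻ y, ∫⁻ κ,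
      ((Set.Icc (-R) R).indicator (fun κ => ‖peakPart χ₁ δ d F (x, y, κ)‖ₑ) κ) ^ 2 ≤
      ENNReal.ofReal (80 * ε ^ 2) * (ENNReal.ofReal k * ∫⁻ x, ∫⁻ y, ‖H (x, y)‖ₑ ^ 2) := by
    refine le_trans ?_ ((lintegral_localFourier_low_le hχ₁ hχ₁c hF hHc hH hHF hLδ hR).trans
      (mul_le_mul_right (mul_le_mul_left hkχ₁ _) _))
    refine lintegral_mono fun x => lintegral_mono fun y => ?_
    rw [← lintegral_indicator measurableSet_Icc]
    refine lintegral_mono fun κ => ?_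
    by_cases hκ : κ ∈ Set.Icc (-R) R
    · simp only [Set.indicator_of_mem hκ]
      exact pow_le_pow_left' (enorm_peakPart_le _ _ _ _ _) 2
    · simp [Set.indicator_of_notMem hκ]
  rw [lintegral_localFourier_swap_sq hχ hχc hG hGs δ (δ * u), mul_add]
  refine add_le_add ((mul_le_mul_right hlow _).trans ?_)
    ((mul_le_mul_right (mul_le_mul_left hkχ _) _).trans ?_)
  · rw [← mul_assoc, ← mul_assoc, ← ENNReal.ofReal_mul (by positivity),
      ← ENNReal.ofReal_mul (by positivity)]
    refine mul_le_mul_left (ENNReal.ofReal_le_ofReal ?_) _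
    have : 3 / 2 * ε⁻¹ * (80 * ε ^ 2) * k = 120 * k * ε := by
      field_simp
      ring
    rw [this]
    nlinarith
  · rw [← mul_assoc, ← ENNReal.ofReal_mul (by positivity)]
    refine mul_le_mul_left (ENNReal.ofReal_le_ofReal ?_) _
    nlinarith [mul_nonneg hk0 hε0.le]

/-- High frequencies at which the local Fourier transform is large: they are few, so that the
estimate for functions with sparse fibres applies. -/
theorem exists_bound_peakPart_high (hχ : ContDiff ℝ ∞ χ) (hχc : HasCompactSupport χ)
    (hχ₁ : ContDiff ℝ ∞ χ₁) (hχ₁c : HasCompactSupport χ₁) : ∃ C : ℝ, 0 < C ∧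
    ∀ {F G : ℝ × ℝ → ℂ} (_ : Continuous F) (_ : ∀ y, ContDiff ℝ ∞ fun x => F (x, y))
    (_ : Continuous G) (_ : ∀ x, ContDiff ℝ ∞ fun y => G (x, y)) {R d : ℝ} (δ u : ℝ)
    (_ : 1 ≤ R) (_ : 0 < d),
    ∫⁻ t in Set.Icc (1 / 2 : ℝ) 2, ∫⁻ x, ∫⁻ y, ∫⁻ κ,
      (Set.Icc (-R) R)ᶜ.indicator (fun κ => ‖peakPart χ₁ δ d F (x + t, y, κ)‖ₑ) κ *
        ‖localFourier χ δ (fun r => G r.swap) (y + t ^ 2, x + δ * u, -(κ / (2 * t)))‖ₑ ≤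
    ENNReal.ofReal (C * (d ^ 8 / R) ^ (1 / 10 : ℝ)) *
      ((∫⁻ x, ∫⁻ y, ‖F (x, y)‖ₑ ^ 2) + ∫⁻ x, ∫⁻ y, ‖G (x, y)‖ₑ ^ 2) := by
  obtain ⟨C, hC, hsparse⟩ := exists_bound_sparse
  have hχ₁0 := hχ₁.continuous
  set k : ℝ := (∫ p, χ p ^ 2) + ∫ p, χ₁ p ^ 2 with hk
  have hk1 : 0 ≤ ∫ p, χ p ^ 2 := integral_nonneg fun p => sq_nonneg _
  have hk2 : 0 ≤ ∫ p, χ₁ p ^ 2 := integral_nonneg fun p => sq_nonneg _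
  have hkχ : ∫⁻ p, ‖χ p‖ₑ ^ 2 ≤ ENNReal.ofReal k := by
    rw [lintegral_enorm_sq_eq_ofReal hχ.continuous hχc]
    exact ENNReal.ofReal_le_ofReal (by linarith)
  have hkχ₁ : (∫⁻ p, ‖χ₁ p‖ₑ ^ 2) ≤ ENNReal.ofReal k := by
    rw [lintegral_enorm_sq_eq_ofReal hχ₁.continuous hχ₁c]
    exact ENNReal.ofReal_le_ofReal (by linarith)
  have hk0 : 0 ≤ k := by linarith
  refine ⟨C * k + 1, by positivity, ?_⟩
  intro F G hFc hF hG hGs R d δ u hR hd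
  have hGsc : Continuous fun r : ℝ × ℝ => G r.swap := by fun_prop
  have hGm := (continuous_localFourier hχ.continuous hχc hGsc δ).measurable
  have hpm := measurable_peakPart hχ₁0 hχ₁c hFc δ d
  have ham : Measurable fun q : ℝ × ℝ × ℝ =>
      (Set.Icc (-R) R)ᶜ.indicator (fun κ => ‖peakPart χ₁ δ d F (q.1, q.2.1, κ)‖ₑ) q.2.2 := by
    have h1 : MeasurableSet {q : ℝ × ℝ × ℝ | q.2.2 ∈ (Set.Icc (-R) R)ᶜ} :=
      measurableSet_Icc.compl.preimage (by fun_prop)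
    exact (hpm.enorm.indicator h1)
  have h1 := hsparse (fun q =>
      (Set.Icc (-R) R)ᶜ.indicator (fun κ => ‖peakPart χ₁ δ d F (q.1, q.2.1, κ)‖ₑ) q.2.2)
    (fun q => ‖localFourier χ δ (fun r => G r.swap) (q.2.1, q.1 + δ * u, -q.2.2)‖ₑ)
    ham (by fun_prop) (d ^ 8) R (by positivity) (by linarith) (fun x y κ h => ?_) (fun x y => ?_)
  · refine h1.trans ?_
    simp only
    rw [lintegral_localFourier_swap_sq hχ hχc hG hGs δ (δ * u)]
    have hhigh : ∫⁻ x, ∫⁻ y, ∫⁻ κ,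
        ((Set.Icc (-R) R)ᶜ.indicator (fun κ => ‖peakPart χ₁ δ d F (x, y, κ)‖ₑ) κ) ^ 2 ≤
        ENNReal.ofReal k * ∫⁻ x, ∫⁻ y, ‖F (x, y)‖ₑ ^ 2 := by
      refine le_trans ?_ ((lintegral_lintegral_localFourier_sq hχ₁ hχ₁c hFc hF δ).le.trans
        (mul_le_mul_left hkχ₁ _))
      refine lintegral_mono fun x => lintegral_mono fun y => lintegral_mono fun κ => ?_
      exact pow_le_pow_left' ((Set.indicator_le_self (Set.Icc (-R) R)ᶜ
        (fun κ => ‖peakPart χ₁ δ d F (x, y, κ)‖ₑ) κ).trans (enorm_peakPart_le _ _ _ _ _)) 2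
    refine (mul_le_mul_right (add_le_add hhigh (mul_le_mul_left hkχ _)) _).trans ?_
    have hp : 0 ≤ (d ^ 8 / R) ^ (1 / 10 : ℝ) := by positivity
    rw [← mul_add, ← mul_assoc, ← ENNReal.ofReal_mul (by positivity)]
    refine mul_le_mul_left (ENNReal.ofReal_le_ofReal ?_) _
    nlinarith
  · have h2 := Set.mem_of_indicator_ne_zero h
    by_contra hle
    exact h2 (abs_le.1 (not_lt.1 hle))
  · refine (measure_mono fun κ hκ => ?_).trans
      (volume_peakPart_ne_zero_le hχ₁ hχ₁c hFc hF δ hd x y)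
    simp only [Set.mem_ofPred_eq] at hκ ⊢
    intro h0
    apply hκ
    by_cases h : κ ∈ (Set.Icc (-R) R)ᶜ
    · rw [Set.indicator_of_mem h, h0, enorm_zero]
    · rw [Set.indicator_of_notMem h]

/-- The bound for tangential averages: the frequencies of `F` are split into a flat part, a part
with few frequencies, and low frequencies. -/
theorem exists_bound_tangentAverage (hχ : ContDiff ℝ ∞ χ)
    (hχc : HasCompactSupport χ)
    (hχs : tsupport χ ⊆ Set.Icc (-1) 1) (hχ₁ : ContDiff ℝ ∞ χ₁) (hχ₁c : HasCompactSupport χ₁)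
    (hχ₁1 : ∀ p ∈ Set.Icc (-2 : ℝ) 2, χ₁ p = 1) : ∃ C : ℝ, 0 < C ∧
    ∀ {F H G : ℝ × ℝ → ℂ} (_ : Continuous F) (_ : ∀ y, ContDiff ℝ ∞ fun x => F (x, y))
    (_ : Continuous H) (_ : ∀ y, ContDiff ℝ ∞ fun x => H (x, y))
    (_ : Continuous G) (_ : ∀ x, ContDiff ℝ ∞ fun y => G (x, y)) {L : ℝ}
    (_ : ∀ x y, HasDerivAt (fun x => H (x, y)) (L * F (x, y)) x) {δ R d : ℝ}
    (_ : 0 < L * δ) (_ : 1 ≤ R) (_ : 0 < d),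
    ∫⁻ t in Set.Icc (1 / 2 : ℝ) 2, ∫⁻ x, ∫⁻ y, ‖tangentAverage χ δ F G t (x, y)‖ₑ ≤
    ENNReal.ofReal (C * (1 / d + R / (L * δ) + (d ^ 8 / R) ^ (1 / 10 : ℝ))) *
      ((∫⁻ x, ∫⁻ y, ‖F (x, y)‖ₑ ^ 2) + (∫⁻ x, ∫⁻ y, ‖H (x, y)‖ₑ ^ 2) +
        ∫⁻ x, ∫⁻ y, ‖G (x, y)‖ₑ ^ 2) := by
  obtain ⟨C₁, hC₁, hflat⟩ := exists_bound_integral_flatPart hχ hχc hχs hχ₁ hχ₁c hχ₁1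
  obtain ⟨C₂, hC₂, hlow⟩ := exists_bound_peakPart_low hχ hχc hχ₁ hχ₁c
  obtain ⟨C₃, hC₃, hhigh⟩ := exists_bound_peakPart_high hχ hχc hχ₁ hχ₁c
  refine ⟨C₁ + C₂ + C₃, by positivity, ?_⟩
  intro F H G hFc hF hHc hH hG hGs L hHF δ R d hLδ hR hd
  have hGsc : Continuous fun r : ℝ × ℝ => G r.swap := by fun_prop
  have hGm := (continuous_localFourier hχ.continuous hχc hGsc δ).measurable
  have hpm := measurable_peakPart hχ₁.continuous hχ₁c hFc δ d
  set S := Set.Icc (1 / 2 : ℝ) 2 with hS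
  set I := Set.Icc (0 : ℝ) 1 with hI
  set K : Set ℝ := Set.Icc (-R) R with hK
  -- by translation invariance the norm may be averaged over shifts of `x` by `δu`
  have hav : ∫⁻ t in S, ∫⁻ x, ∫⁻ y, ‖tangentAverage χ δ F G t (x, y)‖ₑ =
      ∫⁻ u in I, ∫⁻ t in S, ∫⁻ x, ∫⁻ y, ‖tangentAverage χ δ F G t (x + δ * u, y)‖ₑ := by
    have h1 : ∀ u, ∫⁻ t in S, ∫⁻ x, ∫⁻ y, ‖tangentAverage χ δ F G t (x + δ * u, y)‖ₑ =
        ∫⁻ t in S, ∫⁻ x, ∫⁻ y, ‖tangentAverage χ δ F G t (x, y)‖ₑ := fun u =>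
      lintegral_congr fun t =>
        lintegral_add_right_eq_self (fun x => ∫⁻ y, ‖tangentAverage χ δ F G t (x, y)‖ₑ) (δ * u)
    simp_rw [h1]
    simp [hI]
  rw [hav]
  set N : ℝ → ℝ → ℝ → ℝ → ENNReal := fun u t x y => ‖∫ κ, flatPart χ₁ δ d F (x + t, y, κ) *
        (Complex.exp ((2 * Real.pi * (κ * u) : ℝ) * Complex.I) *
        localFourier χ δ (fun r => G r.swap) (y + t ^ 2, x + δ * u, -(κ / (2 * t))))‖ₑ with hN
  set P : Set ℝ → ℝ × ℝ × ℝ × ℝ → ENNReal := fun E r => ∫⁻ κ,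
      E.indicator (fun κ => ‖peakPart χ₁ δ d F (r.2.2.1 + r.2.1, r.2.2.2, κ)‖ₑ) κ *
        ‖localFourier χ δ (fun r => G r.swap) (r.2.2.2 + r.2.1 ^ 2, r.2.2.1 + δ * r.1,
          -(κ / (2 * r.2.1)))‖ₑ with hP
  have hPm : ∀ E, MeasurableSet E → Measurable (P E) := by
    intro E hE
    have h1 : Measurable fun r : (ℝ × ℝ × ℝ × ℝ) × ℝ =>
      {r : (ℝ × ℝ × ℝ × ℝ) × ℝ | r.2 ∈ E}.indicator
        (fun r => ‖peakPart χ₁ δ d F (r.1.2.2.1 + r.1.2.1, r.1.2.2.2, r.2)‖ₑ) r *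
        ‖localFourier χ δ (fun r => G r.swap) (r.1.2.2.2 + r.1.2.1 ^ 2, r.1.2.2.1 + δ * r.1.1,
          -(r.2 / (2 * r.1.2.1)))‖ₑ :=
      (Measurable.indicator (by fun_prop) (hE.preimage (by fun_prop))).mul (by fun_prop)
    exact h1.lintegral_prod_right
  have hPK := hPm K measurableSet_Icc
  have hPK' := hPm Kᶜ measurableSet_Icc.compl
  have hpt : ∀ u ∈ I, ∀ t ∈ S, ∀ x y, ‖tangentAverage χ δ F G t (x + δ * u, y)‖ₑ ≤
      N u t x y + (P K (u, t, x, y) + P Kᶜ (u, t, x, y)) := by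
    intro u hu t ht x y
    refine (enorm_tangentAverage_le hχ hχc hχs hχ₁ hχ₁c hχ₁1 hFc hF hG δ d x y ht hu).trans
      (add_le_add le_rfl (le_of_eq ?_))
    simp only [hP]
    rw [← lintegral_add_left]
    · refine lintegral_congr fun κ => ?_
      rw [← add_mul, Set.indicator_self_add_compl_apply]
    · exact Measurable.mul (Measurable.indicator (by fun_prop) measurableSet_Icc) (by fun_prop)
  refine (setLIntegral_mono' measurableSet_Icc fun u hu => setLIntegral_mono' measurableSet_Icc
    fun t ht => lintegral_mono fun x => lintegral_mono fun y => hpt u hu t ht x y).trans ?_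
  have hsplit : ∫⁻ u in I, ∫⁻ t in S, ∫⁻ x, ∫⁻ y,
      (N u t x y + (P K (u, t, x, y) + P Kᶜ (u, t, x, y))) =
      (∫⁻ u in I, ∫⁻ t in S, ∫⁻ x, ∫⁻ y, N u t x y) +
      ((∫⁻ u in I, ∫⁻ t in S, ∫⁻ x, ∫⁻ y, P K (u, t, x, y)) +
        ∫⁻ u in I, ∫⁻ t in S, ∫⁻ x, ∫⁻ y, P Kᶜ (u, t, x, y)) := by
    rw [lintegral_four_add_right (Q := fun r => P K r + P Kᶜ r) (hPK.add hPK'),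
      lintegral_four_add_right (N := fun u t x y => P K (u, t, x, y)) hPK']
  rw [hsplit]
  set NF := ∫⁻ x, ∫⁻ y, ‖F (x, y)‖ₑ ^ 2
  set NH := ∫⁻ x, ∫⁻ y, ‖H (x, y)‖ₑ ^ 2
  set NG := ∫⁻ x, ∫⁻ y, ‖G (x, y)‖ₑ ^ 2
  have e1 := hflat hFc hF hG hGs δ hd
  have e2 : ∫⁻ u in I, ∫⁻ t in S, ∫⁻ x, ∫⁻ y, P K (u, t, x, y) ≤
      ENNReal.ofReal (C₂ * (R / (L * δ))) * (NH + NG) := by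
    refine (lintegral_mono fun u => hlow hFc hF hHc hH hG hGs hHF d u hLδ hR).trans ?_
    simp [hI, NH, NG]
  have e3 : ∫⁻ u in I, ∫⁻ t in S, ∫⁻ x, ∫⁻ y, P Kᶜ (u, t, x, y) ≤
      ENNReal.ofReal (C₃ * (d ^ 8 / R) ^ (1 / 10 : ℝ)) * (NF + NG) := by
    refine (lintegral_mono fun u => hhigh hFc hF hG hGs δ u hR hd).trans ?_
    simp [hI, NF, NG]
  have hp : 0 ≤ (d ^ 8 / R) ^ (1 / 10 : ℝ) := by positivity
  have hε : 0 < R / (L * δ) := by positivity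
  have hd' : 0 < 1 / d := by positivity
  calc _ ≤ ENNReal.ofReal (C₁ / d) * (NF + NH + NG) +
        (ENNReal.ofReal (C₂ * (R / (L * δ))) * (NF + NH + NG) +
          ENNReal.ofReal (C₃ * (d ^ 8 / R) ^ (1 / 10 : ℝ)) * (NF + NH + NG)) := by
        refine add_le_add (e1.trans (mul_le_mul_right ?_ _))
          (add_le_add (e2.trans (mul_le_mul_right ?_ _)) (e3.trans (mul_le_mul_right ?_ _)))
        · exact add_le_add le_self_add le_rfl
        · exact add_le_add le_add_self le_rfl
        · exact add_le_add le_self_add le_rfl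
    _ = ENNReal.ofReal (C₁ / d + (C₂ * (R / (L * δ)) + C₃ * (d ^ 8 / R) ^ (1 / 10 : ℝ))) *
        (NF + NH + NG) := by
        rw [ENNReal.ofReal_add (by positivity) (by positivity),
          ENNReal.ofReal_add (by positivity) (by positivity), add_mul, add_mul]
    _ ≤ _ := by
        refine mul_le_mul_left (ENNReal.ofReal_le_ofReal ?_) _
        rw [div_eq_mul_one_div C₁]
        set p := (d ^ 8 / R) ^ (1 / 10 : ℝ)
        set q := R / (L * δ)
        set r := 1 / d
        nlinarith [mul_nonneg hC₁.le hp, mul_nonneg hC₁.le hε.le, mul_nonneg hC₂.le hp,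
          mul_nonneg hC₂.le hd'.le, mul_nonneg hC₃.le hε.le, mul_nonneg hC₃.le hd'.le]

end

/-! ### Replacing the parabola by its tangents -/

theorem lintegral_mul_translate_le {F G : ℝ × ℝ → ENNReal} (hF : Measurable F) (hG : Measurable G)
    {ε : ℝ} (hε : 0 < ε) (a : ℝ) :
    ∫⁻ x, ∫⁻ y, F (x + a, y) * G (x, y) ≤
      ENNReal.ofReal ε * (∫⁻ x, ∫⁻ y, F (x, y) ^ 2) +
        ENNReal.ofReal ε⁻¹ * ∫⁻ x, ∫⁻ y, G (x, y) ^ 2 := by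
  refine (lintegral_mono fun x => lintegral_mono fun y =>
    ENNReal.mul_le_ofReal_mul_sq_add hε _ _).trans (le_of_eq ?_)
  have h1 : ∀ x, ∫⁻ y, (ENNReal.ofReal ε * F (x + a, y) ^ 2 + ENNReal.ofReal ε⁻¹ * G (x, y) ^ 2) =
      ENNReal.ofReal ε * (∫⁻ y, F (x + a, y) ^ 2) + ENNReal.ofReal ε⁻¹ * ∫⁻ y, G (x, y) ^ 2 := by
    intro x
    rw [lintegral_add_left (by fun_prop), lintegral_const_mul _ (by fun_prop),
      lintegral_const_mul _ (by fun_prop)]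
  simp_rw [h1]
  rw [lintegral_add_left (by fun_prop), lintegral_const_mul _ (by fun_prop),
    lintegral_const_mul _ (by fun_prop),
    lintegral_add_right_eq_self (fun x => ∫⁻ y, F (x, y) ^ 2) a]

/-- A translation by `h` moves a function of frequency about `L` by at most `Lh` in `L²`. -/
theorem lintegral_sub_translate_sq_le {G G₁ : ℝ × ℝ → ℂ} (hG₁ : Continuous G₁)
    {L : ℝ} (hL : 0 ≤ L) (hd : ∀ x y, HasDerivAt (fun y => G (x, y)) (L * G₁ (x, y)) y) (b : ℝ)
    {h : ℝ} (hh : 0 ≤ h) :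
    ∫⁻ x, ∫⁻ y, ‖G (x, y + b + h) - G (x, y + b)‖ₑ ^ 2 ≤
      ENNReal.ofReal ((L * h) ^ 2) * ∫⁻ x, ∫⁻ y, ‖G₁ (x, y)‖ₑ ^ 2 := by
  have hG₁m := hG₁.measurable
  have h1 : ∀ x y, ‖G (x, y + h) - G (x, y)‖ₑ ^ 2 ≤
      ENNReal.ofReal (L ^ 2 * h) * ∫⁻ s in Set.Ioc 0 h, ‖G₁ (x, y + s)‖ₑ ^ 2 := by
    intro x y
    have h2 : ∀ s ∈ Set.uIcc 0 h, HasDerivAt (fun s => G (x, y + s)) (L * G₁ (x, y + s)) s := by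
      intro s _
      exact (hd x (y + s)).comp_const_add y s
    have h3 := intervalIntegral.integral_eq_sub_of_hasDerivAt h2
      (Continuous.intervalIntegrable (by fun_prop) _ _)
    rw [add_zero, intervalIntegral.integral_of_le hh, integral_const_mul] at h3
    rw [← h3, enorm_mul, mul_pow]
    have h4 : ‖(L : ℂ)‖ₑ ^ 2 = ENNReal.ofReal (L ^ 2) := by
      rw [← ofReal_norm, Complex.norm_real, Real.norm_of_nonneg hL, ENNReal.ofReal_pow hL]
    rw [h4, ENNReal.ofReal_mul (by positivity), mul_assoc]
    refine mul_le_mul_right ?_ _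
    have h5 := lintegral_mul_sq_le (μ := volume.restrict (Set.Ioc 0 h)) (f := fun _ => 1)
      (g := fun s => ‖G₁ (x, y + s)‖ₑ) aemeasurable_const (Measurable.aemeasurable (by fun_prop))
    simp only [one_mul, one_pow, lintegral_const, Measure.restrict_apply_univ, Real.volume_Ioc,
      sub_zero] at h5
    exact (pow_le_pow_left' (enorm_integral_le_lintegral_enorm _) 2).trans h5
  have hb : ∀ x, ∫⁻ y, ‖G (x, y + b + h) - G (x, y + b)‖ₑ ^ 2 =
      ∫⁻ y, ‖G (x, y + h) - G (x, y)‖ₑ ^ 2 := fun x =>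
    lintegral_add_right_eq_self (fun y => ‖G (x, y + h) - G (x, y)‖ₑ ^ 2) b
  simp_rw [hb]
  refine (lintegral_mono fun x => lintegral_mono fun y => h1 x y).trans (le_of_eq ?_)
  have h6 : ∀ x, ∫⁻ y, ENNReal.ofReal (L ^ 2 * h) * ∫⁻ s in Set.Ioc 0 h, ‖G₁ (x, y + s)‖ₑ ^ 2 =
      ENNReal.ofReal ((L * h) ^ 2) * ∫⁻ y, ‖G₁ (x, y)‖ₑ ^ 2 := by
    intro x
    rw [lintegral_const_mul _ (by fun_prop),
      lintegral_lintegral_swap (Measurable.aemeasurable (by fun_prop))]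
    have h7 : ∀ s, ∫⁻ y, ‖G₁ (x, y + s)‖ₑ ^ 2 = ∫⁻ y, ‖G₁ (x, y)‖ₑ ^ 2 := fun s =>
      lintegral_add_right_eq_self (fun y => ‖G₁ (x, y)‖ₑ ^ 2) s
    simp_rw [h7]
    rw [lintegral_const, Measure.restrict_apply_univ, Real.volume_Ioc, sub_zero, mul_comm (∫⁻ y, _),
      ← mul_assoc, ← ENNReal.ofReal_mul (by positivity)]
    congr 2
    ring
  simp_rw [h6]
  rw [lintegral_const_mul _ (by fun_prop)]

/-- The joint density of `t` and of the relative position `σ` on the tangent line at `t`. -/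
noncomputable def tangentWeight (ρ : ℝ → ℂ) (χ : ℝ → ℝ) (r : ℝ × ℝ) : ℂ :=
  ρ r.1 * ((2 * r.1 * χ (2 * r.1 * r.2) : ℝ) : ℂ)

section

variable {ρ : ℝ → ℂ} {χ : ℝ → ℝ}

theorem tangentWeight_eq_zero (hρs : tsupport ρ ⊆ Set.Icc (1 / 2) 2)
    (hχs : tsupport χ ⊆ Set.Icc (-1) 1) {t σ : ℝ}
    (h : ¬(t ∈ Set.Icc (1 / 2 : ℝ) 2 ∧ σ ∈ Set.Icc (-1 : ℝ) 1)) : tangentWeight ρ χ (t, σ) = 0 := by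
  by_contra h0
  apply h
  unfold tangentWeight at h0
  have h1 : t ∈ Set.Icc (1 / 2 : ℝ) 2 := by
    by_contra h2
    exact h0 (by simp [image_eq_zero_of_notMem_tsupport fun h3 => h2 (hρs h3)])
  have h3 : 2 * t * σ ∈ Set.Icc (-1 : ℝ) 1 := by
    by_contra h2
    exact h0 (by simp [image_eq_zero_of_notMem_tsupport fun h3 => h2 (hχs h3)])
  refine ⟨h1, ?_⟩
  have h4 : 1 ≤ 2 * t := by linarith [h1.1]
  constructor
  · by_contra h5
    push Not at h5
    nlinarith [h3.1]
  · by_contra h5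
    push Not at h5
    nlinarith [h3.2]

theorem contDiff_tangentWeight (hρ : ContDiff ℝ ∞ ρ) (hχ : ContDiff ℝ ∞ χ) :
    ContDiff ℝ ∞ (tangentWeight ρ χ) := by
  refine (hρ.comp contDiff_fst).mul (Complex.ofRealCLM.contDiff.comp ?_)
  exact (contDiff_const.mul contDiff_fst).mul
    (hχ.comp ((contDiff_const.mul contDiff_fst).mul contDiff_snd))

theorem hasCompactSupport_tangentWeight (hρs : tsupport ρ ⊆ Set.Icc (1 / 2) 2)
    (hχs : tsupport χ ⊆ Set.Icc (-1) 1) : HasCompactSupport (tangentWeight ρ χ) :=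
  HasCompactSupport.intro (isCompact_Icc.prod isCompact_Icc) fun r hr =>
    tangentWeight_eq_zero (t := r.1) (σ := r.2) hρs hχs hr

/-- The weight is bounded and Lipschitz in `t`, and vanishes off a fixed rectangle. -/
theorem exists_bound_tangentWeight (hρ : ContDiff ℝ ∞ ρ) (hχ : ContDiff ℝ ∞ χ)
    (hρs : tsupport ρ ⊆ Set.Icc (1 / 2) 2) (hχs : tsupport χ ⊆ Set.Icc (-1) 1) :
    ∃ K : ℝ, 0 < K ∧ ∀ {δ : ℝ}, 0 < δ → δ ≤ 1 → ∀ t σ,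
      ‖tangentWeight ρ χ (t, σ)‖ₑ ≤ (Set.Icc (-1 : ℝ) 1 ×ˢ Set.Icc (-1 : ℝ) 3).indicator
        (fun _ => ENNReal.ofReal K) (σ, t) ∧
      ‖tangentWeight ρ χ (t + δ * σ, σ) - tangentWeight ρ χ (t, σ)‖ₑ ≤
        (Set.Icc (-1 : ℝ) 1 ×ˢ Set.Icc (-1 : ℝ) 3).indicator
        (fun _ => ENNReal.ofReal (K * δ)) (σ, t) := by
  have hc := hasCompactSupport_tangentWeight hρs hχs
  have hd := contDiff_tangentWeight hρ hχ
  obtain ⟨K₁, hK₁⟩ := hc.exists_bound_of_continuous hd.continuous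
  obtain ⟨K₂, hK₂⟩ := ContDiff.lipschitzWith_of_hasCompactSupport hc hd (by simp)
  have hK₁0 : 0 ≤ K₁ := (norm_nonneg _).trans (hK₁ 0)
  refine ⟨K₁ + K₂ + 1, by positivity, fun {δ} hδ hδ1 t σ => ?_⟩
  by_cases hB : (σ, t) ∈ Set.Icc (-1 : ℝ) 1 ×ˢ Set.Icc (-1 : ℝ) 3
  · rw [Set.indicator_of_mem hB, Set.indicator_of_mem hB]
    constructor
    · rw [← ofReal_norm]
      refine ENNReal.ofReal_le_ofReal ((hK₁ _).trans ?_)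
      linarith [K₂.2]
    · rw [← ofReal_norm]
      refine ENNReal.ofReal_le_ofReal ?_
      have h1 := hK₂.dist_le_mul (t + δ * σ, σ) (t, σ)
      have h2 : dist (t + δ * σ, σ) (t, σ) ≤ δ := by
        rw [Prod.dist_eq, dist_self, Real.dist_eq]
        simp only [add_sub_cancel_left]
        refine max_le ?_ hδ.le
        rw [abs_mul, abs_of_pos hδ]
        exact mul_le_of_le_one_right hδ.le (abs_le.2 hB.1)
      rw [← dist_eq_norm]
      have h3 : (K₂ : ℝ) * dist (t + δ * σ, σ) (t, σ) ≤ K₂ * δ := mul_le_mul_of_nonneg_left h2 K₂.2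
      nlinarith
  · have hz1 : tangentWeight ρ χ (t, σ) = 0 := by
      refine tangentWeight_eq_zero hρs hχs fun h => hB ⟨h.2, ?_⟩
      exact ⟨by linarith [h.1.1], by linarith [h.1.2]⟩
    have hz2 : tangentWeight ρ χ (t + δ * σ, σ) = 0 := by
      refine tangentWeight_eq_zero hρs hχs fun h => hB ⟨h.2, ?_⟩
      obtain ⟨⟨h1, h2⟩, h3, h4⟩ := h
      constructor
      · show -1 ≤ t
        nlinarith
      · show t ≤ 3
        nlinarith
    simp [hz1, hz2]

/-- The average over the parabola, smeared by translations of size at most `δ` in `t`. -/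
theorem integral_curve_eq_integral_tangentWeight {F G : ℝ × ℝ → ℂ} (hρ : ContDiff ℝ ∞ ρ)
    (hχ : ContDiff ℝ ∞ χ) (hρs : tsupport ρ ⊆ Set.Icc (1 / 2) 2)
    (hχs : tsupport χ ⊆ Set.Icc (-1) 1) (hχ1 : ∫ q, χ q = 1) (hF : Continuous F) (hG : Continuous G)
    (δ x y : ℝ) :
    ∫ t, ρ t * (F (x + t, y) * G (x, y + t ^ 2)) =
      ∫ σ, ∫ t, tangentWeight ρ χ (t + δ * σ, σ) *
        (F (x + (t + δ * σ), y) * G (x, y + (t + δ * σ) ^ 2)) := by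
  have hW := (contDiff_tangentWeight hρ hχ).continuous
  have hWc := hasCompactSupport_tangentWeight (ρ := ρ) hρs hχs
  have h1 : ∀ σ, ∫ t, tangentWeight ρ χ (t + δ * σ, σ) *
        (F (x + (t + δ * σ), y) * G (x, y + (t + δ * σ) ^ 2)) =
      ∫ t, tangentWeight ρ χ (t, σ) * (F (x + t, y) * G (x, y + t ^ 2)) := fun σ =>
    integral_add_right_eq_self
      (fun t => tangentWeight ρ χ (t, σ) * (F (x + t, y) * G (x, y + t ^ 2))) (δ * σ)
  simp_rw [h1]
  rw [← integral_integral_swap_of_hasCompactSupport]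
  · refine integral_congr_ae (Filter.Eventually.of_forall fun t => ?_)
    simp only [tangentWeight]
    rw [integral_mul_const, integral_const_mul]
    congr 1
    by_cases ht : t ∈ tsupport ρ
    · have ht0 : 0 < 2 * t := by linarith [(hρs ht).1]
      have h2 : ∫ σ, ((2 * t * χ (2 * t * σ) : ℝ) : ℂ) = 1 := by
        rw [integral_complex_ofReal, integral_const_mul,
          Measure.integral_comp_mul_left (fun q => χ q), hχ1, abs_of_pos (inv_pos.2 ht0),
          smul_eq_mul, mul_one, mul_inv_cancel₀ ht0.ne', Complex.ofReal_one]
      rw [h2, mul_one]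
    · simp [image_eq_zero_of_notMem_tsupport ht]
  · simp only [Function.uncurry_def]
    fun_prop
  · exact hWc.mul_right

/-- The same smearing, along the tangent in place of the parabola: the two integrands differ by the
displacement `δ² σ²` in the second variable and by a translation of the weight. -/
theorem integral_tangentAverage_eq_integral_tangentWeight {F G : ℝ × ℝ → ℂ} (hρ : ContDiff ℝ ∞ ρ)
    (hχ : ContDiff ℝ ∞ χ) (hρs : tsupport ρ ⊆ Set.Icc (1 / 2) 2)
    (hχs : tsupport χ ⊆ Set.Icc (-1) 1) (hF : Continuous F) (hG : Continuous G) (δ x y : ℝ) :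
    ∫ t, ρ t * tangentAverage χ δ F G t (x, y) =
      ∫ σ, ∫ t, tangentWeight ρ χ (t, σ) *
        (F (x + (t + δ * σ), y) * G (x, y + t ^ 2 + 2 * t * δ * σ)) := by
  have hW := (contDiff_tangentWeight hρ hχ).continuous
  have hWc := hasCompactSupport_tangentWeight (ρ := ρ) hρs hχs
  rw [← integral_integral_swap_of_hasCompactSupport]
  · refine integral_congr_ae (Filter.Eventually.of_forall fun t => ?_)
    simp only [tangentWeight]
    by_cases ht : t ∈ tsupport ρ
    · have ht0 : 0 < 2 * t := by linarith [(hρs ht).1]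
      have ht1 : t ≠ 0 := by
        rintro rfl
        simp at ht0
      have h2 := Measure.integral_comp_mul_left (fun q => (χ q : ℂ) *
        (F (x + t + δ * (q / (2 * t)), y) * G (x, y + t ^ 2 + δ * q))) (2 * t)
      rw [tangentAverage]
      simp only at h2 ⊢
      have h3 : ∀ σ, ρ t * ((2 * t * χ (2 * t * σ) : ℝ) : ℂ) *
          (F (x + (t + δ * σ), y) * G (x, y + t ^ 2 + 2 * t * δ * σ)) =
          ρ t * ((2 * t : ℝ) : ℂ) * ((χ (2 * t * σ) : ℂ) *
          (F (x + t + δ * (2 * t * σ / (2 * t)), y) * G (x, y + t ^ 2 + δ * (2 * t * σ)))) := by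
        intro σ
        rw [mul_div_cancel_left₀ _ ht0.ne', show x + (t + δ * σ) = x + t + δ * σ by ring,
          show y + t ^ 2 + 2 * t * δ * σ = y + t ^ 2 + δ * (2 * t * σ) by ring]
        push_cast
        ring
      simp_rw [h3]
      rw [integral_const_mul, h2, abs_of_pos (inv_pos.2 ht0), mul_assoc, Complex.real_smul,
        ← mul_assoc ((2 * t : ℝ) : ℂ), ← Complex.ofReal_mul, mul_inv_cancel₀ ht0.ne',
        Complex.ofReal_one, one_mul]
    · simp [image_eq_zero_of_notMem_tsupport ht]
  · simp only [Function.uncurry_def]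
    fun_prop
  · exact hWc.mul_right

end

theorem lintegral_rotate_three {μ₁ μ₂ μ₃ : Measure ℝ} [SFinite μ₁] [SFinite μ₂] [SFinite μ₃]
    {Φ : ℝ × ℝ × ℝ → ENNReal} (hΦ : Measurable Φ) :
    ∫⁻ x, ∫⁻ y, ∫⁻ t, Φ (x, y, t) ∂μ₃ ∂μ₂ ∂μ₁ = ∫⁻ t, ∫⁻ x, ∫⁻ y, Φ (x, y, t) ∂μ₂ ∂μ₁ ∂μ₃ := by
  have h1 : ∀ x, ∫⁻ y, ∫⁻ t, Φ (x, y, t) ∂μ₃ ∂μ₂ = ∫⁻ t, ∫⁻ y, Φ (x, y, t) ∂μ₂ ∂μ₃ := fun x =>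
    lintegral_lintegral_swap (Measurable.aemeasurable (by fun_prop))
  simp_rw [h1]
  exact lintegral_lintegral_swap (Measurable.aemeasurable (by fun_prop))

section

variable {ρ : ℝ → ℂ} {χ : ℝ → ℝ}

/-- On pieces of length `δ` the parabola may be replaced by its tangent: moving along the curve
costs `δ`, and the distance `δ²` from the tangent is measured against the frequency `L` of `G`. -/
theorem exists_bound_sub_tangentAverage (hρ : ContDiff ℝ ∞ ρ)
    (hχ : ContDiff ℝ ∞ χ) (hρs : tsupport ρ ⊆ Set.Icc (1 / 2) 2)
    (hχs : tsupport χ ⊆ Set.Icc (-1) 1) (hχ1 : ∫ q, χ q = 1) : ∃ C : ℝ, 0 < C ∧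
    ∀ {F G G₁ : ℝ × ℝ → ℂ} (_ : Continuous F) (_ : Continuous G) (_ : Continuous G₁) {L : ℝ}
    (_ : 0 < L) (_ : ∀ x y, HasDerivAt (fun y => G (x, y)) (L * G₁ (x, y)) y) {δ : ℝ}
    (_ : 0 < δ) (_ : δ ≤ 1),
    ∫⁻ x, ∫⁻ y, ‖(∫ t, ρ t * (F (x + t, y) * G (x, y + t ^ 2))) -
      ∫ t, ρ t * tangentAverage χ δ F G t (x, y)‖ₑ ≤
    ENNReal.ofReal (C * (δ + L * δ ^ 2)) * ((∫⁻ x, ∫⁻ y, ‖F (x, y)‖ₑ ^ 2) +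
      (∫⁻ x, ∫⁻ y, ‖G (x, y)‖ₑ ^ 2) + ∫⁻ x, ∫⁻ y, ‖G₁ (x, y)‖ₑ ^ 2) := by
  obtain ⟨K, hK, hW⟩ := exists_bound_tangentWeight hρ hχ hρs hχs
  refine ⟨8 * K, by positivity, ?_⟩
  intro F G G₁ hF hG hG₁ L hL hd δ hδ hδ1
  have hFm := hF.measurable
  have hGm := hG.measurable
  have hWc := (contDiff_tangentWeight hρ hχ).continuous
  have hWs := hasCompactSupport_tangentWeight (ρ := ρ) hρs hχs
  set B : Set (ℝ × ℝ) := Set.Icc (-1 : ℝ) 1 ×ˢ Set.Icc (-1 : ℝ) 3 with hB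
  set Φ : ℝ × ℝ × ℝ × ℝ → ENNReal := fun r =>
    ENNReal.ofReal (K * δ) * (‖F (r.2.2.1 + (r.2.1 + δ * r.1), r.2.2.2)‖ₑ *
      ‖G (r.2.2.1, r.2.2.2 + (r.2.1 + δ * r.1) ^ 2)‖ₑ) +
    ENNReal.ofReal K * (‖F (r.2.2.1 + (r.2.1 + δ * r.1), r.2.2.2)‖ₑ *
      ‖G (r.2.2.1, r.2.2.2 + (r.2.1 ^ 2 + 2 * r.2.1 * δ * r.1) + δ ^ 2 * r.1 ^ 2) -
        G (r.2.2.1, r.2.2.2 + (r.2.1 ^ 2 + 2 * r.2.1 * δ * r.1))‖ₑ) with hΦ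
  have hΦm : Measurable Φ := by fun_prop
  have hpt : ∀ x y, ‖(∫ t, ρ t * (F (x + t, y) * G (x, y + t ^ 2))) -
      ∫ t, ρ t * tangentAverage χ δ F G t (x, y)‖ₑ ≤
      ∫⁻ σ in Set.Icc (-1 : ℝ) 1, ∫⁻ t in Set.Icc (-1 : ℝ) 3, Φ (σ, t, x, y) := by
    intro x y
    set P₁ : ℝ × ℝ → ℂ := fun r => tangentWeight ρ χ (r.2 + δ * r.1, r.1) *
        (F (x + (r.2 + δ * r.1), y) * G (x, y + (r.2 + δ * r.1) ^ 2)) with hP₁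
    set P₂ : ℝ × ℝ → ℂ := fun r => tangentWeight ρ χ (r.2, r.1) *
        (F (x + (r.2 + δ * r.1), y) * G (x, y + r.2 ^ 2 + 2 * r.2 * δ * r.1)) with hP₂
    have hvan : ∀ r ∉ B, tangentWeight ρ χ (r.2 + δ * r.1, r.1) = 0 ∧
        tangentWeight ρ χ (r.2, r.1) = 0 := by
      intro r hr
      have h1 := hW hδ hδ1 r.2 r.1
      rw [Set.indicator_of_notMem hr, Set.indicator_of_notMem hr] at h1
      have h2 : tangentWeight ρ χ (r.2, r.1) = 0 := by simpa using h1.1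
      refine ⟨?_, h2⟩
      simpa [h2] using h1.2
    have hBc : IsCompact B := isCompact_Icc.prod isCompact_Icc
    have hi₁ : Integrable P₁ (volume.prod volume) := by
      refine Continuous.integrable_of_hasCompactSupport (by fun_prop)
        (HasCompactSupport.intro hBc fun r hr => ?_)
      simp [hP₁, (hvan r hr).1]
    have hi₂ : Integrable P₂ (volume.prod volume) := by
      refine Continuous.integrable_of_hasCompactSupport (by fun_prop)
        (HasCompactSupport.intro hBc fun r hr => ?_)
      simp [hP₂, (hvan r hr).2]
    have hm : Measurable fun r => P₁ r - P₂ r :=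
      (Continuous.measurable (by fun_prop))
    rw [integral_curve_eq_integral_tangentWeight hρ hχ hρs hχs hχ1 hF hG δ x y,
      integral_tangentAverage_eq_integral_tangentWeight hρ hχ hρs hχs hF hG δ x y,
      integral_integral (f := fun σ t => tangentWeight ρ χ (t + δ * σ, σ) *
        (F (x + (t + δ * σ), y) * G (x, y + (t + δ * σ) ^ 2))) hi₁,
      integral_integral (f := fun σ t => tangentWeight ρ χ (t, σ) *
        (F (x + (t + δ * σ), y) * G (x, y + t ^ 2 + 2 * t * δ * σ))) hi₂,
      ← integral_sub hi₁ hi₂]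
    refine (enorm_integral_le_lintegral_enorm _).trans ?_
    have h3 : ∀ r : ℝ × ℝ, ‖P₁ r - P₂ r‖ₑ ≤ B.indicator (fun r => Φ (r.1, r.2, x, y)) r := by
      intro r
      by_cases hr : r ∈ B
      · have h1 := hW hδ hδ1 r.2 r.1
        rw [Set.indicator_of_mem hr, Set.indicator_of_mem hr] at h1
        rw [Set.indicator_of_mem hr]
        have h4 : P₁ r - P₂ r =
            (tangentWeight ρ χ (r.2 + δ * r.1, r.1) - tangentWeight ρ χ (r.2, r.1)) *
            (F (x + (r.2 + δ * r.1), y) * G (x, y + (r.2 + δ * r.1) ^ 2)) +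
            tangentWeight ρ χ (r.2, r.1) * (F (x + (r.2 + δ * r.1), y) *
              (G (x, y + (r.2 ^ 2 + 2 * r.2 * δ * r.1) + δ ^ 2 * r.1 ^ 2) -
                G (x, y + (r.2 ^ 2 + 2 * r.2 * δ * r.1)))) := by
          simp only [hP₁, hP₂]
          rw [show y + (r.2 ^ 2 + 2 * r.2 * δ * r.1) + δ ^ 2 * r.1 ^ 2 = y + (r.2 + δ * r.1) ^ 2 by
            ring, show y + (r.2 ^ 2 + 2 * r.2 * δ * r.1) = y + r.2 ^ 2 + 2 * r.2 * δ * r.1 by ring]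
          ring
        rw [h4]
        refine (enorm_add_le _ _).trans ?_
        rw [enorm_mul, enorm_mul (tangentWeight ρ χ (r.2, r.1)), enorm_mul, enorm_mul]
        exact add_le_add (mul_le_mul_left h1.2 _) (mul_le_mul_left h1.1 _)
      · rw [Set.indicator_of_notMem hr]
        simp [hP₁, hP₂, (hvan r hr).1, (hvan r hr).2]
    refine (lintegral_mono h3).trans (le_of_eq ?_)
    rw [lintegral_indicator (measurableSet_Icc.prod measurableSet_Icc),
      ← Measure.prod_restrict, lintegral_prod _ (Measurable.aemeasurable (by fun_prop))]
  refine (lintegral_mono fun x => lintegral_mono fun y => hpt x y).trans ?_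
  have hswap : ∫⁻ x, ∫⁻ y, ∫⁻ σ in Set.Icc (-1 : ℝ) 1, ∫⁻ t in Set.Icc (-1 : ℝ) 3, Φ (σ, t, x, y) =
      ∫⁻ σ in Set.Icc (-1 : ℝ) 1, ∫⁻ t in Set.Icc (-1 : ℝ) 3, ∫⁻ x, ∫⁻ y, Φ (σ, t, x, y) := by
    have h1 : ∀ x, ∫⁻ y, ∫⁻ σ in Set.Icc (-1 : ℝ) 1, ∫⁻ t in Set.Icc (-1 : ℝ) 3, Φ (σ, t, x, y) =
        ∫⁻ σ in Set.Icc (-1 : ℝ) 1, ∫⁻ t in Set.Icc (-1 : ℝ) 3, ∫⁻ y, Φ (σ, t, x, y) := by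
      intro x
      rw [lintegral_lintegral_swap (Measurable.aemeasurable (by fun_prop))]
      exact lintegral_congr fun σ =>
        lintegral_lintegral_swap (Measurable.aemeasurable (by fun_prop))
    simp_rw [h1]
    rw [lintegral_lintegral_swap (Measurable.aemeasurable (by fun_prop))]
    exact lintegral_congr fun σ => lintegral_lintegral_swap (Measurable.aemeasurable (by fun_prop))
  rw [hswap]
  set NF := ∫⁻ x, ∫⁻ y, ‖F (x, y)‖ₑ ^ 2
  set NG := ∫⁻ x, ∫⁻ y, ‖G (x, y)‖ₑ ^ 2
  set NG₁ := ∫⁻ x, ∫⁻ y, ‖G₁ (x, y)‖ₑ ^ 2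
  have hε : 0 < L * δ ^ 2 := by positivity
  have hbound : ∀ σ ∈ Set.Icc (-1 : ℝ) 1, ∀ t, ∫⁻ x, ∫⁻ y, Φ (σ, t, x, y) ≤
      ENNReal.ofReal (K * (δ + L * δ ^ 2)) * (NF + NG + NG₁) := by
    intro σ hσ t
    have e1 : ∫⁻ x, ∫⁻ y, ‖F (x + (t + δ * σ), y)‖ₑ * ‖G (x, y + (t + δ * σ) ^ 2)‖ₑ ≤ NF + NG := by
      refine (lintegral_mul_translate_le (F := fun r => ‖F r‖ₑ)
        (G := fun r => ‖G (r.1, r.2 + (t + δ * σ) ^ 2)‖ₑ) (by fun_prop) (by fun_prop) one_pos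
        _).trans ?_
      simp only [inv_one, ENNReal.ofReal_one, one_mul]
      refine add_le_add le_rfl (lintegral_mono fun x => ?_)
      exact (lintegral_add_right_eq_self (fun y => ‖G (x, y)‖ₑ ^ 2) _).le
    have e2 : ∫⁻ x, ∫⁻ y, ‖F (x + (t + δ * σ), y)‖ₑ *
        ‖G (x, y + (t ^ 2 + 2 * t * δ * σ) + δ ^ 2 * σ ^ 2) - G (x, y + (t ^ 2 + 2 * t * δ * σ))‖ₑ ≤
        ENNReal.ofReal (L * δ ^ 2) * (NF + NG₁) := by
      refine (lintegral_mul_translate_le (F := fun r => ‖F r‖ₑ)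
        (G := fun r => ‖G (r.1, r.2 + (t ^ 2 + 2 * t * δ * σ) + δ ^ 2 * σ ^ 2) -
          G (r.1, r.2 + (t ^ 2 + 2 * t * δ * σ))‖ₑ) (by fun_prop) (by fun_prop) hε _).trans ?_
      rw [mul_add]
      refine add_le_add le_rfl ?_
      have h1 := lintegral_sub_translate_sq_le hG₁ hL.le hd (t ^ 2 + 2 * t * δ * σ)
        (h := δ ^ 2 * σ ^ 2) (by positivity)
      refine (mul_le_mul_right h1 _).trans ?_
      rw [← mul_assoc, ← ENNReal.ofReal_mul (by positivity)]
      refine mul_le_mul_left (ENNReal.ofReal_le_ofReal ?_) _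
      have h2 : σ ^ 2 ≤ 1 := by
        rw [sq_le_one_iff_abs_le_one]
        exact abs_le.2 hσ
      have h3 : (L * (δ ^ 2 * σ ^ 2)) ^ 2 ≤ (L * δ ^ 2) ^ 2 := by
        refine pow_le_pow_left₀ (by positivity) ?_ 2
        rw [← mul_assoc]
        exact mul_le_of_le_one_right hε.le h2
      calc (L * δ ^ 2)⁻¹ * (L * (δ ^ 2 * σ ^ 2)) ^ 2 ≤ (L * δ ^ 2)⁻¹ * (L * δ ^ 2) ^ 2 :=
            mul_le_mul_of_nonneg_left h3 (by positivity)
        _ = L * δ ^ 2 := by field_simp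
    have h4 : ∫⁻ x, ∫⁻ y, Φ (σ, t, x, y) =
        ENNReal.ofReal (K * δ) * (∫⁻ x, ∫⁻ y, ‖F (x + (t + δ * σ), y)‖ₑ *
          ‖G (x, y + (t + δ * σ) ^ 2)‖ₑ) +
        ENNReal.ofReal K * ∫⁻ x, ∫⁻ y, ‖F (x + (t + δ * σ), y)‖ₑ *
        ‖G (x, y + (t ^ 2 + 2 * t * δ * σ) + δ ^ 2 * σ ^ 2) -
          G (x, y + (t ^ 2 + 2 * t * δ * σ))‖ₑ := by
      rw [← lintegral_const_mul _ (by fun_prop), ← lintegral_const_mul _ (by fun_prop),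
        ← lintegral_add_left (by fun_prop)]
      refine lintegral_congr fun x => ?_
      rw [← lintegral_const_mul _ (by fun_prop), ← lintegral_const_mul _ (by fun_prop),
        ← lintegral_add_left (by fun_prop)]
    rw [h4]
    calc _ ≤ ENNReal.ofReal (K * δ) * (NF + NG + NG₁) +
          ENNReal.ofReal K * (ENNReal.ofReal (L * δ ^ 2) * (NF + NG + NG₁)) := by
          refine add_le_add (mul_le_mul_right (e1.trans le_self_add) _)
            (mul_le_mul_right (e2.trans (mul_le_mul_right ?_ _)) _)
          exact add_le_add le_self_add le_rfl
      _ = _ := by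
          rw [← mul_assoc, ← ENNReal.ofReal_mul hK.le, ← add_mul, ← ENNReal.ofReal_add
            (by positivity) (by positivity), mul_add K]
  refine (setLIntegral_mono' measurableSet_Icc fun σ hσ => lintegral_mono fun t =>
    hbound σ hσ t).trans (le_of_eq ?_)
  have hc : ∀ a b c e : ENNReal, a * b * c * e = a * c * e * b := by
    intros
    ring
  rw [lintegral_const, lintegral_const, Measure.restrict_apply_univ, Measure.restrict_apply_univ,
    Real.volume_Icc, Real.volume_Icc, hc, ← ENNReal.ofReal_mul (by positivity),
    ← ENNReal.ofReal_mul (by positivity)]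
  congr 2
  ring

/-- A normalized window `χ` and a wider one that is `1` on all the translates of `χ` in use. -/
theorem exists_window : ∃ χ χ₁ : ℝ → ℝ, ContDiff ℝ ∞ χ ∧ HasCompactSupport χ ∧
    tsupport χ ⊆ Set.Icc (-1) 1 ∧ ∫ q, χ q = 1 ∧ ContDiff ℝ ∞ χ₁ ∧ HasCompactSupport χ₁ ∧
    ∀ p ∈ Set.Icc (-2 : ℝ) 2, χ₁ p = 1 := by
  obtain ⟨w, hw, hwc, hw1, hws, hw01⟩ := exists_contDiff_eq_one_of_mem_Icc (a := -(1 / 2))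
    (b := 1 / 2) (-1) 1 (by norm_num) (by norm_num)
  obtain ⟨χ₁, h₁, h₁c, h₁1, -, -⟩ := exists_contDiff_eq_one_of_mem_Icc (a := -2)
    (b := 2) (-3) 3 (by norm_num) (by norm_num)
  have hpos : 0 < ∫ q, w q := by
    refine hw.continuous.integral_pos_of_hasCompactSupport_nonneg_nonzero hwc
      (fun q => (hw01 q).1) (x := 0) ?_
    rw [hw1 0 ⟨by norm_num, by norm_num⟩]
    norm_num
  refine ⟨fun q => (∫ q, w q)⁻¹ * w q, χ₁, contDiff_const.mul hw, hwc.mul_left, ?_, ?_, h₁, h₁c,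
    h₁1⟩
  · exact (tsupport_mul_subset_right (f := fun _ => (∫ q, w q)⁻¹)).trans hws
  · rw [integral_const_mul, inv_mul_cancel₀ hpos.ne']

theorem lintegral_enorm_le_lintegral_sub_add {T U : ℝ × ℝ → ℂ} (hU : Measurable U) :
    ∫⁻ x, ∫⁻ y, ‖T (x, y)‖ₑ ≤
      (∫⁻ x, ∫⁻ y, ‖T (x, y) - U (x, y)‖ₑ) + ∫⁻ x, ∫⁻ y, ‖U (x, y)‖ₑ := by
  rw [← lintegral_add_right _ (by fun_prop)]
  refine lintegral_mono fun x => ?_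
  rw [← lintegral_add_right _ (by fun_prop)]
  refine lintegral_mono fun y => ?_
  refine le_trans (le_of_eq ?_) (enorm_add_le _ _)
  rw [sub_add_cancel]

theorem measurable_tangentAverage {F G : ℝ × ℝ → ℂ} (hχ : Continuous χ) (hF : Continuous F)
    (hG : Continuous G) (δ : ℝ) :
    Measurable fun r : ℝ × ℝ × ℝ => tangentAverage χ δ F G r.2.2 (r.1, r.2.1) := by
  have hFm := hF.measurable
  have hGm := hG.measurable
  have h3 : Measurable fun r : (ℝ × ℝ × ℝ) × ℝ => (χ r.2 : ℂ) *
      (F (r.1.1 + r.1.2.2 + δ * (r.2 / (2 * r.1.2.2)), r.1.2.1) *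
        G (r.1.1, r.1.2.1 + r.1.2.2 ^ 2 + δ * r.2)) := by
    fun_prop
  exact h3.stronglyMeasurable.integral_prod_right'.measurable

theorem Measurable.integral_mul_snd {Θ : ℝ × ℝ × ℝ → ℂ} (hΘ : Measurable Θ) (hρ : Measurable ρ) :
    Measurable fun r : ℝ × ℝ => ∫ t, ρ t * Θ (r.1, r.2, t) := by
  have h3 : Measurable fun r : (ℝ × ℝ) × ℝ => ρ r.2 * Θ (r.1.1, r.1.2, r.2) := by
    fun_prop
  exact h3.stronglyMeasurable.integral_prod_right'.measurable

theorem measurable_integral_tangentAverage {F G : ℝ × ℝ → ℂ} (hρ : Continuous ρ)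
    (hχ : Continuous χ) (hF : Continuous F) (hG : Continuous G) (δ : ℝ) :
    Measurable fun r : ℝ × ℝ => ∫ t, ρ t * tangentAverage χ δ F G t r :=
  (measurable_tangentAverage hχ hF hG δ).integral_mul_snd hρ.measurable

theorem exists_bound_integral_tangentAverage (hρ : Continuous ρ)
    (hρs : tsupport ρ ⊆ Set.Icc (1 / 2) 2) (hχ : Continuous χ) : ∃ K : ℝ, 0 ≤ K ∧
    ∀ {F G : ℝ × ℝ → ℂ} (_ : Continuous F) (_ : Continuous G) (δ : ℝ),
    ∫⁻ x, ∫⁻ y, ‖∫ t, ρ t * tangentAverage χ δ F G t (x, y)‖ₑ ≤ ENNReal.ofReal K *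
      (∫⁻ t in Set.Icc (1 / 2 : ℝ) 2, ∫⁻ x, ∫⁻ y, ‖tangentAverage χ δ F G t (x, y)‖ₑ) := by
  have hρc : HasCompactSupport ρ := HasCompactSupport.of_support_subset_isCompact isCompact_Icc
    ((subset_tsupport _).trans hρs)
  obtain ⟨K, hK⟩ := hρc.exists_bound_of_continuous hρ
  refine ⟨K, (norm_nonneg _).trans (hK 0), fun {F G} hF hG δ => ?_⟩
  have h1 : ∀ x y, ‖∫ t, ρ t * tangentAverage χ δ F G t (x, y)‖ₑ ≤ ENNReal.ofReal K *
      ∫⁻ t in Set.Icc (1 / 2 : ℝ) 2, ‖tangentAverage χ δ F G t (x, y)‖ₑ := by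
    intro x y
    refine (enorm_integral_le_lintegral_enorm _).trans ?_
    rw [← lintegral_const_mul' _ _ ENNReal.ofReal_ne_top, ← lintegral_indicator measurableSet_Icc]
    refine lintegral_mono fun t => ?_
    by_cases ht : t ∈ Set.Icc (1 / 2 : ℝ) 2
    · rw [Set.indicator_of_mem ht, enorm_mul]
      refine mul_le_mul_left ?_ _
      rw [← ofReal_norm]
      exact ENNReal.ofReal_le_ofReal (hK t)
    · simp [image_eq_zero_of_notMem_tsupport fun h => ht (hρs h)]
  refine (lintegral_mono fun x => lintegral_mono fun y => h1 x y).trans (le_of_eq ?_)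
  have h3 : ∀ x, ∫⁻ y, ENNReal.ofReal K * ∫⁻ t in Set.Icc (1 / 2 : ℝ) 2,
      ‖tangentAverage χ δ F G t (x, y)‖ₑ = ENNReal.ofReal K *
      ∫⁻ y, ∫⁻ t in Set.Icc (1 / 2 : ℝ) 2, ‖tangentAverage χ δ F G t (x, y)‖ₑ := fun x =>
    lintegral_const_mul' _ _ ENNReal.ofReal_ne_top
  simp_rw [h3]
  rw [lintegral_const_mul' _ _ ENNReal.ofReal_ne_top]
  congr 1
  exact (lintegral_rotate_three (Φ := fun r => ‖tangentAverage χ δ F G r.2.2 (r.1, r.2.1)‖ₑ)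
    (measurable_tangentAverage hχ hF hG δ).enorm)

/-- Decay of the bilinear averages over the parabola for smooth functions of frequency about `L`, in
the sense that `F` is `L⁻¹` times a derivative of `H` and the derivative of `G` is `L G₁`. -/
theorem exists_bound_curve_average (hρ : ContDiff ℝ ∞ ρ) (hρs : tsupport ρ ⊆ Set.Icc (1 / 2) 2) :
    ∃ C : ℝ, 0 < C ∧
    ∀ {F H G G₁ : ℝ × ℝ → ℂ} (_ : Continuous F) (_ : ∀ y, ContDiff ℝ ∞ fun x => F (x, y))
    (_ : Continuous H) (_ : ∀ y, ContDiff ℝ ∞ fun x => H (x, y))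
    (_ : Continuous G) (_ : ∀ x, ContDiff ℝ ∞ fun y => G (x, y)) (_ : Continuous G₁) {L : ℝ}
    (_ : 1 ≤ L) (_ : ∀ x y, HasDerivAt (fun x => H (x, y)) (L * F (x, y)) x)
    (_ : ∀ x y, HasDerivAt (fun y => G (x, y)) (L * G₁ (x, y)) y),
    ∫⁻ x, ∫⁻ y, ‖∫ t, ρ t * (F (x + t, y) * G (x, y + t ^ 2))‖ₑ ≤
    ENNReal.ofReal (C * L ^ (-(1 / 75) : ℝ)) * ((∫⁻ x, ∫⁻ y, ‖F (x, y)‖ₑ ^ 2) +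
      (∫⁻ x, ∫⁻ y, ‖H (x, y)‖ₑ ^ 2) + ((∫⁻ x, ∫⁻ y, ‖G (x, y)‖ₑ ^ 2) +
        ∫⁻ x, ∫⁻ y, ‖G₁ (x, y)‖ₑ ^ 2)) := by
  obtain ⟨χ, χ₁, hχ, hχc, hχs, hχ1, hχ₁, hχ₁c, hχ₁1⟩ := exists_window
  obtain ⟨C₁, hC₁, hlin⟩ := exists_bound_sub_tangentAverage hρ hχ hρs hχs hχ1
  obtain ⟨C₂, hC₂, htan⟩ := exists_bound_tangentAverage hχ hχc hχs hχ₁ hχ₁c hχ₁1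
  obtain ⟨K, hK0, htav⟩ := exists_bound_integral_tangentAverage hρ.continuous hρs hχ.continuous
  refine ⟨2 * C₁ + 3 * K * C₂, by positivity, ?_⟩
  intro F H G G₁ hFc hF hHc hH hG hGs hG₁ L hL hHF hGG
  have hL0 : 0 < L := by linarith
  have hpow : ∀ {s : ℝ}, s ≤ -(1 / 75) → L ^ s ≤ L ^ (-(1 / 75) : ℝ) := fun h =>
    Real.rpow_le_rpow_of_exponent_le hL h
  -- the exponents are chosen so that every loss is at most `L ^ (-1/75)`
  set δ : ℝ := L ^ (-(3 / 5) : ℝ) with hδ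
  set R : ℝ := L ^ (1 / 3 : ℝ) with hR
  set d : ℝ := L ^ (1 / 60 : ℝ) with hd
  have hδ0 : 0 < δ := by positivity
  have hδ1 : δ ≤ 1 := Real.rpow_le_one_of_one_le_of_nonpos hL (by norm_num)
  have hR1 : 1 ≤ R := Real.one_le_rpow hL (by norm_num)
  have hd0 : 0 < d := by positivity
  have p1 : δ ≤ L ^ (-(1 / 75) : ℝ) := hpow (by norm_num)
  have p2 : L * δ ^ 2 ≤ L ^ (-(1 / 75) : ℝ) := by
    have : L * δ ^ 2 = L ^ (1 + -(3 / 5) * 2 : ℝ) := by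
      rw [Real.rpow_add hL0, Real.rpow_one, Real.rpow_mul hL0.le, Real.rpow_two]
    rw [this]
    exact hpow (by norm_num)
  have p3 : 1 / d ≤ L ^ (-(1 / 75) : ℝ) := by
    rw [hd, one_div, ← Real.rpow_neg hL0.le]
    exact hpow (by norm_num)
  have p4 : R / (L * δ) ≤ L ^ (-(1 / 75) : ℝ) := by
    have : R / (L * δ) = L ^ (1 / 3 - (1 + -(3 / 5)) : ℝ) := by
      rw [Real.rpow_sub hL0, Real.rpow_add hL0, Real.rpow_one]
    rw [this]
    exact hpow (by norm_num)
  have p5 : (d ^ 8 / R) ^ (1 / 10 : ℝ) ≤ L ^ (-(1 / 75) : ℝ) := by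
    have : d ^ 8 / R = L ^ (1 / 60 * (8 : ℕ) - 1 / 3 : ℝ) := by
      rw [Real.rpow_sub hL0, Real.rpow_mul hL0.le, Real.rpow_natCast]
    rw [this, ← Real.rpow_mul hL0.le]
    exact hpow (by norm_num)
  have e1 := hlin hFc hG hG₁ hL0 hGG hδ0 hδ1
  have e2 := htan hFc hF hHc hH hG hGs hHF (δ := δ) (R := R) (d := d) (by positivity) hR1 hd0
  set NF := ∫⁻ x, ∫⁻ y, ‖F (x, y)‖ₑ ^ 2
  set NH := ∫⁻ x, ∫⁻ y, ‖H (x, y)‖ₑ ^ 2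
  set NG := ∫⁻ x, ∫⁻ y, ‖G (x, y)‖ₑ ^ 2
  set NG₁ := ∫⁻ x, ∫⁻ y, ‖G₁ (x, y)‖ₑ ^ 2
  refine (lintegral_enorm_le_lintegral_sub_add
    (T := fun r => ∫ t, ρ t * (F (r.1 + t, r.2) * G (r.1, r.2 + t ^ 2)))
    (measurable_integral_tangentAverage hρ.continuous hχ.continuous hFc hG δ)).trans
    ((add_le_add e1 ((htav hFc hG δ).trans (mul_le_mul_right e2 _))).trans ?_)
  rw [← mul_assoc (ENNReal.ofReal K), ← ENNReal.ofReal_mul hK0]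
  set q := L ^ (-(1 / 75) : ℝ)
  have hq : 0 < q := by positivity
  calc _ ≤ ENNReal.ofReal (2 * C₁ * q) * (NF + NH + (NG + NG₁)) +
        ENNReal.ofReal (3 * K * C₂ * q) * (NF + NH + (NG + NG₁)) := by
        refine add_le_add (mul_le_mul' (ENNReal.ofReal_le_ofReal ?_) ?_)
          (mul_le_mul' (ENNReal.ofReal_le_ofReal ?_) ?_)
        · calc C₁ * (δ + L * δ ^ 2) ≤ C₁ * (q + q) := by gcongr
            _ = 2 * C₁ * q := by ring
        · rw [add_assoc]
          exact add_le_add le_self_add le_rfl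
        · calc K * (C₂ * (1 / d + R / (L * δ) + (d ^ 8 / R) ^ (1 / 10 : ℝ))) ≤
              K * (C₂ * (q + q + q)) := by gcongr
            _ = 3 * K * C₂ * q := by ring
        · exact add_le_add le_rfl le_self_add
    _ = _ := by
        rw [← add_mul, ← ENNReal.ofReal_add (by positivity) (by positivity), ← add_mul]

end

/-! ### Band-limited kernels -/

section

variable {ψ : ℝ → ℂ}

theorem norm_invFourier_le (ψ : ℝ → ℂ) (x : ℝ) : ‖invFourier ψ x‖ ≤ ∫ ξ, ‖ψ ξ‖ := by
  refine (norm_integral_le_integral_norm _).trans (le_of_eq ?_)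
  refine integral_congr_ae (.of_forall fun ξ => ?_)
  simp [Complex.norm_exp]

theorem hasDerivAt_invFourier (hψ : Continuous ψ) (hψc : HasCompactSupport ψ) (x : ℝ) :
    HasDerivAt (invFourier ψ) (invFourier (fun ξ => Complex.I * ξ * ψ ξ) x) x := by
  have hc : HasCompactSupport fun ξ : ℝ => Complex.I * ξ * ψ ξ := hψc.mul_left
  have h := hasDerivAt_integral_of_dominated_loc_of_deriv_le (μ := (volume : Measure ℝ))
    (F := fun (x ξ : ℝ) => ψ ξ * Complex.exp (Complex.I * (ξ : ℂ) * (x : ℂ)))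
    (F' := fun (x ξ : ℝ) => Complex.I * ξ * ψ ξ * Complex.exp (Complex.I * (ξ : ℂ) * (x : ℂ)))
    (bound := fun ξ => ‖Complex.I * ξ * ψ ξ‖) (x₀ := x) (s := Set.univ) Filter.univ_mem
    (.of_forall fun x => (by fun_prop : Continuous _).aestronglyMeasurable)
    ((by fun_prop : Continuous _).integrable_of_hasCompactSupport hψc.mul_right)
    (by fun_prop : Continuous _).aestronglyMeasurable
    (.of_forall fun ξ x _ => by simp [Complex.norm_exp])
    ((by fun_prop : Continuous _).integrable_of_hasCompactSupport hc).norm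
    (.of_forall fun ξ x _ => by
      have h1 : HasDerivAt (fun x : ℝ => Complex.I * (ξ : ℂ) * (x : ℂ)) (Complex.I * ξ * 1) x :=
        (Complex.ofRealCLM.hasDerivAt (x := x)).const_mul _
      exact (h1.cexp.const_mul (ψ ξ)).congr_deriv (by ring))
  exact h.2

theorem continuous_invFourier (hψ : Continuous ψ) (hψc : HasCompactSupport ψ) :
    Continuous (invFourier ψ) :=
  continuous_iff_continuousAt.2 fun x => (hasDerivAt_invFourier hψ hψc x).continuousAt

theorem integrable_invFourier (hψ : ContDiff ℝ ∞ ψ) (hψc : HasCompactSupport ψ) :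
    Integrable (invFourier ψ) := by
  have h1 : Integrable (FourierTransformInv.fourierInv (hψc.toSchwartzMap hψ)) :=
    SchwartzMap.integrable _
  have h2 := h1.comp_div (R := 2 * Real.pi) (by positivity)
  refine h2.congr (.of_forall fun x => ?_)
  simp only [SchwartzMap.fourierInv_coe, Real.fourierInv_eq', HasCompactSupport.toSchwartzMap_toFun,
    invFourier]
  refine integral_congr_ae (.of_forall fun ξ => ?_)
  simp only [smul_eq_mul, mul_comm (ψ ξ)]
  congr 2
  simp only [RCLike.inner_apply, conj_trivial]
  push_cast
  field_simp

theorem memLp_two_invFourier (hψ : ContDiff ℝ ∞ ψ) (hψc : HasCompactSupport ψ) :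
    MemLp (invFourier ψ) 2 := by
  have h1 := integrable_invFourier hψ hψc
  refine (memLp_two_iff_integrable_sq_norm h1.aestronglyMeasurable).2 ?_
  simp_rw [sq]
  exact h1.norm.bdd_mul (c := ∫ ξ, ‖ψ ξ‖) h1.norm.aestronglyMeasurable
    (.of_forall fun x => by simpa using norm_invFourier_le ψ x)

theorem ContDiff.dyadicDilate (hψ : ContDiff ℝ ∞ ψ) (m : ℕ) :
    ContDiff ℝ ∞ (dyadicDilate m ψ) :=
  hψ.comp (contDiff_id.div_const _)

theorem Continuous.dyadicDilate (hψ : Continuous ψ) (m : ℕ) : Continuous (dyadicDilate m ψ) :=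
  hψ.comp (continuous_id.div_const _)

theorem HasCompactSupport.dyadicDilate (hψ : HasCompactSupport ψ) (m : ℕ) :
    HasCompactSupport (dyadicDilate m ψ) := by
  have h := hψ.comp_homeomorph (Homeomorph.mulRight₀ ((2 : ℝ) ^ m)⁻¹ (by positivity))
  refine (congrArg HasCompactSupport (funext fun ξ => ?_)).mp h
  exact congrArg ψ (div_eq_mul_inv ξ _).symm

theorem invFourier_dyadicDilate (m : ℕ) (ψ : ℝ → ℂ) (x : ℝ) :
    invFourier (dyadicDilate m ψ) x = 2 ^ m * invFourier ψ (2 ^ m * x) := by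
  have h := Measure.integral_comp_div
    (fun ξ : ℝ => ψ ξ * Complex.exp (Complex.I * (ξ : ℂ) * ((2 ^ m * x : ℝ) : ℂ))) ((2 : ℝ) ^ m)
  rw [abs_of_pos (by positivity)] at h
  simp only [invFourier, dyadicDilate]
  rw [show (2 ^ m * ∫ ξ, ψ ξ * Complex.exp (Complex.I * (ξ : ℂ) * ((2 ^ m * x : ℝ) : ℂ)) : ℂ) =
    (2 ^ m : ℝ) • ∫ ξ, ψ ξ * Complex.exp (Complex.I * (ξ : ℂ) * ((2 ^ m * x : ℝ) : ℂ)) by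
      simp, ← h]
  refine integral_congr_ae (.of_forall fun ξ => ?_)
  simp only
  congr 2
  push_cast
  field_simp

/-- The `L¹` norm of the kernel does not depend on the scale. -/
theorem lintegral_enorm_invFourier_dyadicDilate (hψ : Continuous ψ) (hψc : HasCompactSupport ψ)
    (m : ℕ) : ∫⁻ x, ‖invFourier (dyadicDilate m ψ) x‖ₑ = ∫⁻ x, ‖invFourier ψ x‖ₑ := by
  have hm : 0 < (2 : ℝ) ^ m := by positivity
  have h := lintegral_comp_div hm (f := fun x => ‖invFourier (dyadicDilate m ψ) x‖ₑ)
    (continuous_invFourier (hψ.dyadicDilate m) (hψc.dyadicDilate m)).measurable.enorm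
  have h2 : ∀ x : ℝ, ‖invFourier (dyadicDilate m ψ) (x / 2 ^ m)‖ₑ =
      ENNReal.ofReal (2 ^ m) * ‖invFourier ψ x‖ₑ := by
    intro x
    rw [invFourier_dyadicDilate, enorm_mul, mul_div_cancel₀ x hm.ne', ← ofReal_norm (2 ^ m : ℂ),
      norm_pow, RCLike.norm_ofNat]
  simp_rw [h2] at h
  rw [lintegral_const_mul' _ _ ENNReal.ofReal_ne_top] at h
  exact ((ENNReal.mul_right_inj (ENNReal.ofReal_pos.2 hm).ne' ENNReal.ofReal_ne_top).1 h).symm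

theorem invFourier_const_mul (c : ℂ) (ψ : ℝ → ℂ) (x : ℝ) :
    invFourier (fun ξ => c * ψ ξ) x = c * invFourier ψ x := by
  simp only [invFourier, mul_assoc, integral_const_mul]

/-- Differentiating the kernel at scale `2 ^ m` costs a factor `2 ^ m`. -/
theorem hasDerivAt_invFourier_dyadicDilate (hψ : Continuous ψ) (hψc : HasCompactSupport ψ) (m : ℕ)
    (x : ℝ) : HasDerivAt (invFourier (dyadicDilate m ψ))
      (2 ^ m * invFourier (dyadicDilate m fun ξ => Complex.I * ξ * ψ ξ) x) x := by
  have h := hasDerivAt_invFourier (hψ.dyadicDilate m) (hψc.dyadicDilate m) x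
  rw [← invFourier_const_mul]
  convert h using 3 with ξ
  simp only [dyadicDilate]
  push_cast
  field_simp

/-- Antiderivatives on the Fourier side: `ψ(ξ) / (iξ)` is smooth if `ψ` vanishes near `0`. -/
theorem ContDiff.div_I_mul (hψ : ContDiff ℝ ∞ ψ) (h0 : (0 : ℝ) ∉ tsupport ψ) :
    ContDiff ℝ ∞ fun ξ : ℝ => ψ ξ / (Complex.I * ξ) := by
  refine contDiff_iff_contDiffAt.2 fun t => ?_
  by_cases ht : t = 0
  · subst ht
    refine contDiffAt_const (c := (0 : ℂ)) |>.congr_of_eventuallyEq ?_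
    filter_upwards [notMem_tsupport_iff_eventuallyEq.1 h0] with s hs
    simp [hs]
  · have h1 : ContDiff ℝ ∞ fun ξ : ℝ => Complex.I * (ξ : ℂ) :=
      contDiff_const.mul Complex.ofRealCLM.contDiff
    have h2 : Complex.I * (t : ℂ) ≠ 0 := by simpa using ht
    simp only [div_eq_mul_inv]
    exact hψ.contDiffAt.mul (h1.contDiffAt.inv h2)

theorem I_mul_div_I_mul (h0 : (0 : ℝ) ∉ tsupport ψ) (ξ : ℝ) :
    Complex.I * ξ * (ψ ξ / (Complex.I * ξ)) = ψ ξ := by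
  by_cases h : ξ = 0
  · subst h
    simp [image_eq_zero_of_notMem_tsupport h0]
  · have : (ξ : ℂ) ≠ 0 := by exact_mod_cast h
    field_simp

end

/-! ### Partial convolutions -/

section

variable {k ψ : ℝ → ℂ} {h : ℝ → ℂ} {f g : ℝ × ℝ → ℂ}

theorem integrable_mul_comp_sub (hh : MemLp h 2) (hk : MemLp k 2) (x : ℝ) :
    Integrable fun s => h (x - s) * k s := by
  have h1 : MemLp (fun s => h (x - s)) 2 :=
    hh.comp_measurePreserving (Measure.measurePreserving_sub_left volume x)
  exact h1.integrable_mul hk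

/-- Young's inequality for the convolution of `L¹` with `L²`. -/
theorem lintegral_enorm_convolution_sq_le (hh : Measurable h) (hk : Measurable k) :
    ∫⁻ x, ‖∫ s, h (x - s) * k s‖ₑ ^ 2 ≤ (∫⁻ s, ‖k s‖ₑ) ^ 2 * ∫⁻ x, ‖h x‖ₑ ^ 2 := by
  have h1 : ∀ x, ‖∫ s, h (x - s) * k s‖ₑ ^ 2 ≤
      (∫⁻ s, ‖k s‖ₑ) * ∫⁻ s, ‖h (x - s)‖ₑ ^ 2 * ‖k s‖ₑ := by
    intro x
    have e1 : ‖∫ s, h (x - s) * k s‖ₑ ≤ ∫⁻ s, ‖k s‖ₑ ^ (1 / 2 : ℝ) *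
        (‖h (x - s)‖ₑ * ‖k s‖ₑ ^ (1 / 2 : ℝ)) := by
      refine (enorm_integral_le_lintegral_enorm _).trans (le_of_eq (lintegral_congr fun s => ?_))
      rw [enorm_mul, mul_left_comm, ← ENNReal.rpow_add_of_nonneg _ _ (by norm_num) (by norm_num)]
      norm_num
    have e3 : ∀ z : ENNReal, (z ^ (1 / 2 : ℝ)) ^ 2 = z := by
      intro z
      rw [← ENNReal.rpow_natCast, ← ENNReal.rpow_mul]
      norm_num
    refine (pow_le_pow_left' e1 2).trans ((lintegral_mul_sq_le (Measurable.aemeasurable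
      (by fun_prop)) (Measurable.aemeasurable (by fun_prop))).trans (le_of_eq ?_))
    simp_rw [mul_pow, e3]
  refine (lintegral_mono h1).trans (le_of_eq ?_)
  rw [lintegral_const_mul _ (by fun_prop), lintegral_lintegral_swap
    (Measurable.aemeasurable (by fun_prop)), sq, mul_assoc]
  congr 1
  rw [← lintegral_mul_const _ (by fun_prop)]
  refine lintegral_congr fun s => ?_
  rw [lintegral_mul_const _ (by fun_prop), mul_comm,
    lintegral_sub_right_eq_self (fun x => ‖h x‖ₑ ^ 2) s]

theorem measurable_convFst (hf : Measurable f) (hk : Measurable k) : Measurable (convFst f k) := by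
  have : Measurable fun r : (ℝ × ℝ) × ℝ => f (r.1.1 - r.2, r.1.2) * k r.2 := by fun_prop
  exact this.stronglyMeasurable.integral_prod_right'.measurable

theorem measurable_convSnd (hg : Measurable g) (hk : Measurable k) : Measurable (convSnd g k) := by
  have : Measurable fun r : (ℝ × ℝ) × ℝ => g (r.1.1, r.1.2 - r.2) * k r.2 := by fun_prop
  exact this.stronglyMeasurable.integral_prod_right'.measurable

theorem lintegral_enorm_convFst_sq_le (hf : Measurable f) (hk : Measurable k) :
    ∫⁻ x, ∫⁻ y, ‖convFst f k (x, y)‖ₑ ^ 2 ≤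
      (∫⁻ s, ‖k s‖ₑ) ^ 2 * ∫⁻ x, ∫⁻ y, ‖f (x, y)‖ₑ ^ 2 := by
  have hm := measurable_convFst hf hk
  rw [lintegral_lintegral_swap (Measurable.aemeasurable (by fun_prop)),
    lintegral_lintegral_swap (f := fun x y => ‖f (x, y)‖ₑ ^ 2)
      (Measurable.aemeasurable (by fun_prop)), ← lintegral_const_mul _ (by fun_prop)]
  exact lintegral_mono fun y => lintegral_enorm_convolution_sq_le (h := fun x => f (x, y))
    (by fun_prop) hk

theorem lintegral_enorm_convSnd_sq_le (hg : Measurable g) (hk : Measurable k) :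
    ∫⁻ x, ∫⁻ y, ‖convSnd g k (x, y)‖ₑ ^ 2 ≤
      (∫⁻ s, ‖k s‖ₑ) ^ 2 * ∫⁻ x, ∫⁻ y, ‖g (x, y)‖ₑ ^ 2 := by
  rw [← lintegral_const_mul _ (by fun_prop)]
  exact lintegral_mono fun x => lintegral_enorm_convolution_sq_le (h := fun y => g (x, y))
    (by fun_prop) hk

theorem continuous_convFst (hf : Continuous f) (hfc : HasCompactSupport f) (hk : Integrable k) :
    Continuous (convFst f k) := by
  obtain ⟨C, hC⟩ := hfc.exists_bound_of_continuous hf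
  refine continuous_of_dominated (bound := fun s => C * ‖k s‖)
    (fun p => (by fun_prop : Continuous fun s => f (p.1 - s, p.2)).aestronglyMeasurable.mul
      hk.aestronglyMeasurable) (fun p => .of_forall fun s => ?_) (hk.norm.const_mul C)
    (.of_forall fun s => by fun_prop)
  rw [norm_mul]
  exact mul_le_mul_of_nonneg_right (hC _) (norm_nonneg _)

theorem continuous_convSnd (hg : Continuous g) (hgc : HasCompactSupport g) (hk : Integrable k) :
    Continuous (convSnd g k) := by
  obtain ⟨C, hC⟩ := hgc.exists_bound_of_continuous hg
  refine continuous_of_dominated (bound := fun s => C * ‖k s‖)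
    (fun p => (by fun_prop : Continuous fun s => g (p.1, p.2 - s)).aestronglyMeasurable.mul
      hk.aestronglyMeasurable) (fun p => .of_forall fun s => ?_) (hk.norm.const_mul C)
    (.of_forall fun s => by fun_prop)
  rw [norm_mul]
  exact mul_le_mul_of_nonneg_right (hC _) (norm_nonneg _)

theorem hasDerivAt_convolution {k' : ℝ → ℂ} (hh : Continuous h) (hhc : HasCompactSupport h)
    (hk' : Continuous k') {C : ℝ} (hC : ∀ s, ‖k' s‖ ≤ C) (hd : ∀ s, HasDerivAt k (k' s) s) (x : ℝ) :
    HasDerivAt (fun x => ∫ s, h (x - s) * k s) (∫ s, h (x - s) * k' s) x := by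
  have hk : Continuous k := continuous_iff_continuousAt.2 fun s => (hd s).continuousAt
  have e : ∀ (k : ℝ → ℂ) (x : ℝ), ∫ s, h (x - s) * k s = ∫ s, h s * k (x - s) := by
    intro k x
    rw [← integral_sub_left_eq_self (fun s => h (x - s) * k s) volume x]
    simp
  simp_rw [e]
  have hi := (hh.integrable_of_hasCompactSupport (μ := volume) hhc).norm.mul_const C
  exact (hasDerivAt_integral_of_dominated_loc_of_deriv_le (μ := (volume : Measure ℝ))
    (F := fun x s => h s * k (x - s)) (F' := fun x s => h s * k' (x - s))
    (bound := fun s => ‖h s‖ * C) (s := Set.univ) Filter.univ_mem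
    (.of_forall fun x => (by fun_prop : Continuous _).aestronglyMeasurable)
    ((by fun_prop : Continuous _).integrable_of_hasCompactSupport hhc.mul_right)
    (by fun_prop : Continuous _).aestronglyMeasurable
    (.of_forall fun s x _ => by
      rw [norm_mul]
      exact mul_le_mul_of_nonneg_left (hC _) (norm_nonneg _)) hi
    (.of_forall fun s x _ => ((hd (x - s)).comp_sub_const x s).const_mul (h s))).2

theorem hasDerivAt_convolution_invFourier (hh : Continuous h) (hhc : HasCompactSupport h)
    (hψ : Continuous ψ) (hψc : HasCompactSupport ψ) (x : ℝ) :
    HasDerivAt (fun x => ∫ s, h (x - s) * invFourier ψ s)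
      (∫ s, h (x - s) * invFourier (fun ξ => Complex.I * ξ * ψ ξ) s) x :=
  hasDerivAt_convolution hh hhc (continuous_invFourier (by fun_prop) hψc.mul_left)
    (norm_invFourier_le _) (hasDerivAt_invFourier hψ hψc) x

theorem contDiff_convolution_invFourier (hh : Continuous h) (hhc : HasCompactSupport h)
    (hψ : Continuous ψ) (hψc : HasCompactSupport ψ) :
    ContDiff ℝ ∞ fun x => ∫ s, h (x - s) * invFourier ψ s := by
  refine contDiff_infty.2 fun n => ?_
  induction n generalizing ψ with
  | zero =>
    exact contDiff_zero.2 (continuous_iff_continuousAt.2 fun x =>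
      (hasDerivAt_convolution_invFourier hh hhc hψ hψc x).continuousAt)
  | succ n ih =>
    have hd := hasDerivAt_convolution_invFourier hh hhc hψ hψc
    push_cast
    refine contDiff_succ_iff_deriv.2 ⟨fun x => (hd x).differentiableAt, by simp, ?_⟩
    rw [funext fun x => (hd x).deriv]
    exact ih (ψ := fun ξ => Complex.I * ξ * ψ ξ) (by fun_prop) hψc.mul_left

/-- At frequency `2 ^ m`, differentiating a convolution costs `2 ^ m` and changes the multiplier
from `ψ(ξ)` to `iξ ψ(ξ)`. -/
theorem hasDerivAt_convolution_invFourier_dyadicDilate (hh : Continuous h)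
    (hhc : HasCompactSupport h) (hψ : Continuous ψ) (hψc : HasCompactSupport ψ) (m : ℕ) (x : ℝ) :
    HasDerivAt (fun x => ∫ s, h (x - s) * invFourier (dyadicDilate m ψ) s)
      (2 ^ m * ∫ s, h (x - s) * invFourier (dyadicDilate m fun ξ => Complex.I * ξ * ψ ξ) s) x := by
  have hc : HasCompactSupport fun ξ : ℝ => Complex.I * ξ * ψ ξ := hψc.mul_left
  have hcont : Continuous fun ξ : ℝ => Complex.I * ξ * ψ ξ := by fun_prop
  have hd := hasDerivAt_convolution hh hhc
    ((continuous_invFourier (hcont.dyadicDilate m) (hc.dyadicDilate m)).const_mul (2 ^ m))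
    (C := 2 ^ m * ∫ ξ, ‖dyadicDilate m (fun ξ => Complex.I * ξ * ψ ξ) ξ‖) (fun s => by
      rw [norm_mul, norm_pow, RCLike.norm_ofNat]
      exact mul_le_mul_of_nonneg_left (norm_invFourier_le _ _) (by positivity))
    (hasDerivAt_invFourier_dyadicDilate hψ hψc m) x
  refine hd.congr_deriv ?_
  rw [← integral_const_mul]
  exact integral_congr_ae (.of_forall fun s => mul_left_comm _ _ _)

theorem HasCompactSupport.comp_mk_left (hf : HasCompactSupport f) (x : ℝ) :
    HasCompactSupport fun y => f (x, y) := by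
  refine HasCompactSupport.of_support_subset_isCompact (hf.isCompact.image continuous_snd)
    fun y hy => ⟨(x, y), subset_tsupport _ hy, rfl⟩

theorem HasCompactSupport.comp_mk_right (hf : HasCompactSupport f) (y : ℝ) :
    HasCompactSupport fun x => f (x, y) := by
  refine HasCompactSupport.of_support_subset_isCompact (hf.isCompact.image continuous_fst)
    fun x hx => ⟨(x, y), subset_tsupport _ hx, rfl⟩

end

/-! ### The estimate for continuous functions of compact support -/

section

variable {ρ : ℝ → ℂ}

/-- A density on `1/2 < |t| < 2` is a sum of densities on the two half-lines. -/
theorem exists_eq_add_comp_neg (hρ : ContDiff ℝ ∞ ρ)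
    (hρs : tsupport ρ ⊆ {ξ : ℝ | 1 / 2 < |ξ| ∧ |ξ| < 2}) : ∃ ρ₁ ρ₂ : ℝ → ℂ,
    ContDiff ℝ ∞ ρ₁ ∧ ContDiff ℝ ∞ ρ₂ ∧ tsupport ρ₁ ⊆ Set.Icc (1 / 2) 2 ∧
    tsupport ρ₂ ⊆ Set.Icc (1 / 2) 2 ∧ ∀ t, ρ t = ρ₁ t + ρ₂ (-t) := by
  obtain ⟨w, hw, -, hw1, hws, -⟩ := exists_contDiff_eq_one_of_mem_Icc (a := 1 / 2) (b := 2)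
    (1 / 4) 3 (by norm_num) (by norm_num)
  have hwc : ContDiff ℝ ∞ fun t => (w t : ℂ) := Complex.ofRealCLM.contDiff.comp hw
  have hwt : tsupport (fun t => (w t : ℂ)) ⊆ Set.Icc (1 / 4) 3 := by
    refine (closure_mono fun t ht => ?_).trans hws
    simpa using ht
  have hw0 : ∀ t, t < 1 / 4 → w t = 0 := fun t ht =>
    image_eq_zero_of_notMem_tsupport fun h => (hws h).1.not_gt ht
  have key : ∀ t : ℝ, t ∈ Set.Icc (1 / 4) 3 → 1 / 2 < |t| ∧ |t| < 2 →
      t ∈ Set.Icc (1 / 2 : ℝ) 2 := by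
    intro t ht h
    rw [abs_of_nonneg (by linarith [ht.1])] at h
    exact ⟨h.1.le, h.2.le⟩
  refine ⟨fun t => w t * ρ t, fun t => w t * ρ (-t), hwc.mul hρ, hwc.mul (hρ.comp contDiff_neg),
    fun t ht => key t (hwt (tsupport_mul_subset_left ht)) (hρs (tsupport_mul_subset_right ht)),
    fun t ht => key t (hwt (tsupport_mul_subset_left ht)) ?_, fun t => ?_⟩
  · have h1 := tsupport_mul_subset_right ht
    have h2 : tsupport (fun t => ρ (-t)) = (Homeomorph.neg ℝ) ⁻¹' tsupport ρ :=
      tsupport_comp_eq_preimage ρ (Homeomorph.neg ℝ)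
    rw [h2] at h1
    simpa using hρs h1
  · simp only [neg_neg]
    by_cases ht : t ∈ tsupport ρ
    · obtain ⟨h1, h2⟩ := hρs ht
      rcases le_total 0 t with h0 | h0
      · rw [abs_of_nonneg h0] at h1 h2
        rw [hw1 t ⟨h1.le, h2.le⟩, hw0 (-t) (by linarith)]
        simp
      · rw [abs_of_nonpos h0] at h1 h2
        rw [hw1 (-t) ⟨h1.le, h2.le⟩, hw0 t (by linarith)]
        simp
    · simp [image_eq_zero_of_notMem_tsupport ht]

/-- The reflection `x ↦ -x` exchanges the two branches of the parabola. -/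
theorem lintegral_curve_average_comp_neg (F G : ℝ × ℝ → ℂ) (ρ : ℝ → ℂ) :
    ∫⁻ x, ∫⁻ y, ‖∫ t, ρ (-t) * (F (x + t, y) * G (x, y + t ^ 2))‖ₑ =
      ∫⁻ x, ∫⁻ y, ‖∫ t, ρ t * (F (-(x + t), y) * G (-x, y + t ^ 2))‖ₑ := by
  rw [← lintegral_neg_eq_self]
  refine lintegral_congr fun x => lintegral_congr fun y => ?_
  rw [← integral_neg_eq_self]
  simp [add_comm]

/-- The decay estimate with both branches of the parabola. -/
theorem exists_bound_curve_average_abs (hρ : ContDiff ℝ ∞ ρ) (hρc : HasCompactSupport ρ)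
    (hρs : tsupport ρ ⊆ {ξ : ℝ | 1 / 2 < |ξ| ∧ |ξ| < 2}) :
    ∃ C : ℝ, 0 < C ∧
    ∀ {F H G G₁ : ℝ × ℝ → ℂ} (_ : Continuous F) (_ : ∀ y, ContDiff ℝ ∞ fun x => F (x, y))
    (_ : Continuous H) (_ : ∀ y, ContDiff ℝ ∞ fun x => H (x, y))
    (_ : Continuous G) (_ : ∀ x, ContDiff ℝ ∞ fun y => G (x, y)) (_ : Continuous G₁) {L : ℝ}
    (_ : 1 ≤ L) (_ : ∀ x y, HasDerivAt (fun x => H (x, y)) (L * F (x, y)) x)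
    (_ : ∀ x y, HasDerivAt (fun y => G (x, y)) (L * G₁ (x, y)) y),
    ∫⁻ x, ∫⁻ y, ‖∫ t, ρ t * (F (x + t, y) * G (x, y + t ^ 2))‖ₑ ≤
    ENNReal.ofReal (C * L ^ (-(1 / 75) : ℝ)) * ((∫⁻ x, ∫⁻ y, ‖F (x, y)‖ₑ ^ 2) +
      (∫⁻ x, ∫⁻ y, ‖H (x, y)‖ₑ ^ 2) + ((∫⁻ x, ∫⁻ y, ‖G (x, y)‖ₑ ^ 2) +
        ∫⁻ x, ∫⁻ y, ‖G₁ (x, y)‖ₑ ^ 2)) := by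
  obtain ⟨ρ₁, ρ₂, h₁, h₂, hs₁, hs₂, hadd⟩ := exists_eq_add_comp_neg hρ hρs
  obtain ⟨C₁, hC₁, hb₁⟩ := exists_bound_curve_average h₁ hs₁
  obtain ⟨C₂, hC₂, hb₂⟩ := exists_bound_curve_average h₂ hs₂
  refine ⟨C₁ + C₂, by positivity, ?_⟩
  intro F H G G₁ hFc hF hHc hH hG hGs hG₁ L hL hHF hGG
  have hρ₁c : HasCompactSupport ρ₁ := HasCompactSupport.of_support_subset_isCompact isCompact_Icc
    ((subset_tsupport _).trans hs₁)
  have hcn : Continuous fun t => ρ₂ (-t) := h₂.continuous.comp continuous_neg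
  have hρ₂c : HasCompactSupport fun t => ρ₂ (-t) := by
    have h : (fun t => ρ₂ (-t)) = fun t => ρ t - ρ₁ t := by
      funext t
      rw [hadd]
      ring
    rw [h]
    exact hρc.sub hρ₁c
  have hU : Measurable fun r : ℝ × ℝ =>
      ∫ t, ρ₂ (-t) * (F (r.1 + t, r.2) * G (r.1, r.2 + t ^ 2)) := by
    have hΘ : Continuous fun r : ℝ × ℝ × ℝ =>
        F (r.1 + r.2.2, r.2.1) * G (r.1, r.2.1 + r.2.2 ^ 2) := by
      fun_prop
    exact hΘ.measurable.integral_mul_snd hcn.measurable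
  have hneg : ∀ Φ : ℝ × ℝ → ℂ, ∫⁻ x, ∫⁻ y, ‖Φ (-x, y)‖ₑ ^ 2 = ∫⁻ x, ∫⁻ y, ‖Φ (x, y)‖ₑ ^ 2 :=
    fun Φ => lintegral_neg_eq_self (fun x => ∫⁻ y, ‖Φ (x, y)‖ₑ ^ 2)
  refine (lintegral_enorm_le_lintegral_sub_add
    (T := fun r => ∫ t, ρ t * (F (r.1 + t, r.2) * G (r.1, r.2 + t ^ 2))) hU).trans ?_
  rw [add_mul, ENNReal.ofReal_add (by positivity) (by positivity), add_mul]
  refine add_le_add (le_trans (le_of_eq ?_) (hb₁ hFc hF hHc hH hG hGs hG₁ hL hHF hGG)) ?_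
  · refine lintegral_congr fun x => lintegral_congr fun y => ?_
    congr 1
    simp only
    rw [← integral_sub]
    · refine integral_congr_ae (.of_forall fun t => ?_)
      simp only [hadd t]
      ring
    · have := hρ.continuous
      exact (by fun_prop : Continuous _).integrable_of_hasCompactSupport hρc.mul_right
    · exact (by fun_prop : Continuous _).integrable_of_hasCompactSupport hρ₂c.mul_right
  · simp only
    rw [lintegral_curve_average_comp_neg]
    have h := hb₂ (F := fun r => F (-r.1, r.2)) (H := fun r => -H (-r.1, r.2))
      (G := fun r => G (-r.1, r.2)) (G₁ := fun r => G₁ (-r.1, r.2)) (by fun_prop)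
      (fun y => (hF y).comp contDiff_neg) (by fun_prop) (fun y => ((hH y).comp contDiff_neg).neg)
      (by fun_prop) (fun x => hGs (-x)) (by fun_prop) hL (fun x y => ?_) (fun x y => hGG (-x) y)
    · refine h.trans (le_of_eq ?_)
      simp only [enorm_neg, hneg]
    · refine ((hHF (-x) y).scomp x (hasDerivAt_neg x)).neg.congr_deriv ?_
      simp

end

section

variable {φ : ℝ → ℂ} {f g : ℝ × ℝ → ℂ}

/-- The bound for continuous functions of compact support, with the product of the norms on the
right relaxed to a sum of squares. -/
theorem exists_bound_parabolic {ρ : ℝ → ℂ} (hρ : ContDiff ℝ ∞ ρ) (hρc : HasCompactSupport ρ)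
    (hρs : tsupport ρ ⊆ {ξ : ℝ | 1 / 2 < |ξ| ∧ |ξ| < 2}) (hφ : ContDiff ℝ ∞ φ)
    (hφc : HasCompactSupport φ) (hφ0 : (0 : ℝ) ∉ tsupport φ) : ∃ C : ℝ, 0 < C ∧
    ∀ (m : ℕ) {f g : ℝ × ℝ → ℂ} (_ : Continuous f) (_ : HasCompactSupport f) (_ : Continuous g)
    (_ : HasCompactSupport g), ∫⁻ x, ∫⁻ y, ‖∫ t, ρ t *
      (convFst f (invFourier (dyadicDilate m φ)) (x + t, y) *
        convSnd g (invFourier (dyadicDilate m φ)) (x, y + t ^ 2))‖ₑ ≤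
      ENNReal.ofReal (C * (2 : ℝ) ^ (-(1 / 75 : ℝ) * (m : ℝ))) *
        ((∫⁻ x, ∫⁻ y, ‖f (x, y)‖ₑ ^ 2) + ∫⁻ x, ∫⁻ y, ‖g (x, y)‖ₑ ^ 2) := by
  obtain ⟨C, hC, hb⟩ := exists_bound_curve_average_abs hρ hρc hρs
  -- `f *₁ φ̌_m` is `2 ^ (-m)` times a derivative, because `φ` vanishes near the origin
  set ψ : ℝ → ℂ := fun ξ => φ ξ / (Complex.I * ξ) with hψd
  set θ : ℝ → ℂ := fun ξ => Complex.I * ξ * φ ξ with hθd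
  have hψ : ContDiff ℝ ∞ ψ := hφ.div_I_mul hφ0
  have hψc : HasCompactSupport ψ := by
    simp only [hψd, div_eq_mul_inv]
    exact hφc.mul_right
  have hθ : ContDiff ℝ ∞ θ := (contDiff_const.mul Complex.ofRealCLM.contDiff).mul hφ
  have hθc : HasCompactSupport θ := hφc.mul_left
  have hψθ : (fun ξ : ℝ => Complex.I * ξ * ψ ξ) = φ := funext fun ξ => I_mul_div_I_mul hφ0 ξ
  set A : ENNReal := (∫⁻ s, ‖invFourier φ s‖ₑ) ^ 2 + (∫⁻ s, ‖invFourier ψ s‖ₑ) ^ 2 +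
    (∫⁻ s, ‖invFourier θ s‖ₑ) ^ 2 with hA
  have hA1 : A ≠ ⊤ := by
    have h1 := (integrable_invFourier hφ hφc).2.ne
    have h2 := (integrable_invFourier hψ hψc).2.ne
    have h3 := (integrable_invFourier hθ hθc).2.ne
    finiteness
  refine ⟨C * (A.toReal + 1), by positivity, fun m f g hf hfc hg hgc => ?_⟩
  have hk : ∀ {η : ℝ → ℂ}, ContDiff ℝ ∞ η → HasCompactSupport η →
      Integrable (invFourier (dyadicDilate m η)) ∧ Measurable (invFourier (dyadicDilate m η)) ∧
      ∫⁻ s, ‖invFourier (dyadicDilate m η) s‖ₑ = ∫⁻ s, ‖invFourier η s‖ₑ := fun hη hηc =>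
    ⟨integrable_invFourier (hη.dyadicDilate m) (hηc.dyadicDilate m), (continuous_invFourier
      (hη.continuous.dyadicDilate m) (hηc.dyadicDilate m)).measurable,
      lintegral_enorm_invFourier_dyadicDilate hη.continuous hηc m⟩
  obtain ⟨kφ1, kφ2, kφ3⟩ := hk hφ hφc
  obtain ⟨kψ1, kψ2, kψ3⟩ := hk hψ hψc
  obtain ⟨kθ1, kθ2, kθ3⟩ := hk hθ hθc
  have hφm := hφ.continuous.dyadicDilate m
  have hψm := hψ.continuous.dyadicDilate m
  have h := hb (F := convFst f (invFourier (dyadicDilate m φ)))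
    (H := convFst f (invFourier (dyadicDilate m ψ)))
    (G := convSnd g (invFourier (dyadicDilate m φ)))
    (G₁ := convSnd g (invFourier (dyadicDilate m θ))) (L := 2 ^ m)
    (continuous_convFst hf hfc kφ1)
    (fun y => contDiff_convolution_invFourier (h := fun x => f (x, y)) (by fun_prop)
      (hfc.comp_mk_right y) hφm (hφc.dyadicDilate m))
    (continuous_convFst hf hfc kψ1)
    (fun y => contDiff_convolution_invFourier (h := fun x => f (x, y)) (by fun_prop)
      (hfc.comp_mk_right y) hψm (hψc.dyadicDilate m))
    (continuous_convSnd hg hgc kφ1)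
    (fun x => contDiff_convolution_invFourier (h := fun y => g (x, y)) (by fun_prop)
      (hgc.comp_mk_left x) hφm (hφc.dyadicDilate m))
    (continuous_convSnd hg hgc kθ1) (one_le_pow₀ one_le_two)
    (fun x y => by
      have := hasDerivAt_convolution_invFourier_dyadicDilate (h := fun x => f (x, y)) (by fun_prop)
        (hfc.comp_mk_right y) hψ.continuous hψc m x
      rw [hψθ] at this
      exact this.congr_deriv (by push_cast; rfl))
    (fun x y => by
      have := hasDerivAt_convolution_invFourier_dyadicDilate (h := fun y => g (x, y)) (by fun_prop)
        (hgc.comp_mk_left x) hφ.continuous hφc m y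
      exact this.congr_deriv (by push_cast; rfl))
  refine h.trans ?_
  set Nf := ∫⁻ x, ∫⁻ y, ‖f (x, y)‖ₑ ^ 2
  set Ng := ∫⁻ x, ∫⁻ y, ‖g (x, y)‖ₑ ^ 2
  have e1 := lintegral_enorm_convFst_sq_le hf.measurable kφ2
  have e2 := lintegral_enorm_convFst_sq_le hf.measurable kψ2
  have e3 := lintegral_enorm_convSnd_sq_le hg.measurable kφ2
  have e4 := lintegral_enorm_convSnd_sq_le hg.measurable kθ2
  rw [kφ3] at e1 e3
  rw [kψ3] at e2
  rw [kθ3] at e4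
  have hpow : ((2 : ℝ) ^ m) ^ (-(1 / 75) : ℝ) = (2 : ℝ) ^ (-(1 / 75 : ℝ) * (m : ℝ)) := by
    rw [← Real.rpow_natCast, ← Real.rpow_mul (by norm_num), mul_comm]
  rw [hpow]
  set q := (2 : ℝ) ^ (-(1 / 75 : ℝ) * (m : ℝ))
  have hq : 0 < q := by positivity
  calc _ ≤ ENNReal.ofReal (C * q) * (A * (Nf + Ng)) := by
        refine mul_le_mul_right ?_ _
        rw [mul_add]
        refine add_le_add ((add_le_add e1 e2).trans ?_) ((add_le_add e3 e4).trans ?_)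
        · rw [← add_mul]
          exact mul_le_mul_left le_self_add _
        · rw [← add_mul]
          refine mul_le_mul_left ?_ _
          rw [hA, add_right_comm]
          exact le_self_add
    _ ≤ ENNReal.ofReal (C * q) * (ENNReal.ofReal (A.toReal + 1) * (Nf + Ng)) := by
        refine mul_le_mul_right (mul_le_mul_left ?_ _) _
        exact (ENNReal.ofReal_toReal hA1).symm.le.trans (ENNReal.ofReal_le_ofReal (by linarith))
    _ = _ := by
        rw [← mul_assoc, ← ENNReal.ofReal_mul (by positivity)]
        congr 2
        ring

end

/-! ### Passage to square integrable functions -/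

section

variable {ρ k : ℝ → ℂ} {F F' G G' f f' g g' : ℝ × ℝ → ℂ}

theorem eLpNorm_two_sq (f : ℝ × ℝ → ℂ) : eLpNorm f 2 volume ^ 2 = ∫⁻ p, ‖f p‖ₑ ^ 2 := by
  rw [eLpNorm_eq_lintegral_rpow_enorm_toReal two_ne_zero ENNReal.ofNat_ne_top,
    ← ENNReal.rpow_natCast, ← ENNReal.rpow_mul]
  simp

theorem lintegral_eq_lintegral_lintegral {Φ : ℝ × ℝ → ENNReal} (hΦ : Measurable Φ) :
    ∫⁻ p, Φ p = ∫⁻ x, ∫⁻ y, Φ (x, y) := by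
  rw [Measure.volume_eq_prod, lintegral_prod _ hΦ.aemeasurable]

/-- The trivial bound, by the Cauchy–Schwarz inequality for every `t`. -/
theorem lintegral_curve_le (hρ : Measurable ρ) (hF : Measurable F) (hG : Measurable G) :
    ∫⁻ p : ℝ × ℝ, ∫⁻ t, ‖ρ t * (F (p.1 + t, p.2) * G (p.1, p.2 + t ^ 2))‖ₑ ≤
      (∫⁻ t, ‖ρ t‖ₑ) * (eLpNorm F 2 volume * eLpNorm G 2 volume) := by
  rw [lintegral_lintegral_swap (Measurable.aemeasurable (by fun_prop)),
    ← lintegral_mul_const _ (by fun_prop)]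
  refine lintegral_mono fun t => ?_
  simp_rw [enorm_mul]
  rw [lintegral_const_mul _ (by fun_prop)]
  refine mul_le_mul_right ((ENNReal.pow_le_pow_left_iff two_ne_zero).1 ?_) _
  rw [mul_pow, eLpNorm_two_sq, eLpNorm_two_sq]
  refine (lintegral_mul_sq_le (Measurable.aemeasurable (by fun_prop))
    (Measurable.aemeasurable (by fun_prop))).trans (le_of_eq ?_)
  have h1 := lintegral_add_right_eq_self (μ := volume) (fun p : ℝ × ℝ => ‖F p‖ₑ ^ 2) (t, 0)
  have h2 := lintegral_add_right_eq_self (μ := volume) (fun p : ℝ × ℝ => ‖G p‖ₑ ^ 2) (0, t ^ 2)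
  rw [← h1, ← h2]
  congr 1
  · refine lintegral_congr fun p => ?_
    obtain ⟨a, b⟩ := p
    simp
  · refine lintegral_congr fun p => ?_
    obtain ⟨a, b⟩ := p
    simp

theorem ae_integrable_curve (hρ : Integrable ρ) (hρm : Measurable ρ) (hF : Measurable F)
    (hG : Measurable G) (hF2 : eLpNorm F 2 volume ≠ ⊤) (hG2 : eLpNorm G 2 volume ≠ ⊤) :
    ∀ᵐ p : ℝ × ℝ, Integrable fun t => ρ t * (F (p.1 + t, p.2) * G (p.1, p.2 + t ^ 2)) := by
  have h := ne_top_of_le_ne_top (ENNReal.mul_ne_top hρ.2.ne (ENNReal.mul_ne_top hF2 hG2))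
    (lintegral_curve_le hρm hF hG)
  filter_upwards [ae_lt_top (by fun_prop) h] with p hp
  exact ⟨(by fun_prop : Measurable _).aestronglyMeasurable, hp⟩

/-- The bilinear average depends continuously on its arguments in `L²`. -/
theorem lintegral_enorm_curve_le_add (hρ : Integrable ρ) (hρm : Measurable ρ) (hF : Measurable F)
    (hG : Measurable G) (hF2 : eLpNorm F 2 volume ≠ ⊤) (hG2 : eLpNorm G 2 volume ≠ ⊤)
    (hF' : Measurable F') (hG' : Measurable G') (hF2' : eLpNorm F' 2 volume ≠ ⊤)
    (hG2' : eLpNorm G' 2 volume ≠ ⊤) :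
    ∫⁻ p : ℝ × ℝ, ‖∫ t, ρ t * (F (p.1 + t, p.2) * G (p.1, p.2 + t ^ 2))‖ₑ ≤
      (∫⁻ p : ℝ × ℝ, ‖∫ t, ρ t * (F' (p.1 + t, p.2) * G' (p.1, p.2 + t ^ 2))‖ₑ) +
      (∫⁻ t, ‖ρ t‖ₑ) * (eLpNorm (F - F') 2 volume * eLpNorm G 2 volume +
        eLpNorm F' 2 volume * eLpNorm (G - G') 2 volume) := by
  have h1 := lintegral_curve_le hρm (hF.sub hF') hG
  have h2 := lintegral_curve_le hρm hF' (hG.sub hG')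
  rw [mul_add]
  refine le_trans ?_ (add_le_add le_rfl (add_le_add h1 h2))
  simp only [Pi.sub_apply]
  rw [← lintegral_add_left (by fun_prop), ← lintegral_add_right _ (by fun_prop)]
  refine lintegral_mono_ae ?_
  filter_upwards [ae_integrable_curve hρ hρm hF hG hF2 hG2,
    ae_integrable_curve hρ hρm hF' hG' hF2' hG2'] with p hp hp'
  rw [← lintegral_add_left (by fun_prop),
    ← add_sub_cancel (∫ t, ρ t * (F' (p.1 + t, p.2) * G' (p.1, p.2 + t ^ 2)))
      (∫ t, ρ t * (F (p.1 + t, p.2) * G (p.1, p.2 + t ^ 2))), ← integral_sub hp hp']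
  refine (enorm_add_le _ _).trans (add_le_add le_rfl
    ((enorm_integral_le_lintegral_enorm _).trans (lintegral_mono fun t => ?_)))
  refine le_trans (le_of_eq ?_) (enorm_add_le _ _)
  congr 1
  ring

theorem MeasureTheory.MemLp.ae_memLp_fst (hf : MemLp f 2 volume) :
    ∀ᵐ y : ℝ, MemLp (fun x => f (x, y)) 2 := by
  have hs : MemLp (fun p : ℝ × ℝ => f p.swap) 2 volume :=
    hf.comp_measurePreserving Measure.measurePreserving_swap
  have h2 := (memLp_two_iff_integrable_sq_norm hs.1).1 hs
  rw [Measure.volume_eq_prod] at h2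
  filter_upwards [h2.prod_right_ae, AEStronglyMeasurable.prodMk_left hs.1] with y h3 h4
  exact (memLp_two_iff_integrable_sq_norm h4).2 h3

theorem MeasureTheory.MemLp.ae_memLp_snd (hf : MemLp f 2 volume) :
    ∀ᵐ x : ℝ, MemLp (fun y => f (x, y)) 2 := by
  have h2 := (memLp_two_iff_integrable_sq_norm hf.1).1 hf
  rw [Measure.volume_eq_prod] at h2
  filter_upwards [h2.prod_right_ae, AEStronglyMeasurable.prodMk_left hf.1] with y h3 h4
  exact (memLp_two_iff_integrable_sq_norm h4).2 h3

theorem ae_integrable_convFst (hf : MemLp f 2 volume) (hk : MemLp k 2) :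
    ∀ᵐ y : ℝ, ∀ x : ℝ, Integrable fun s => f (x - s, y) * k s := by
  filter_upwards [hf.ae_memLp_fst] with y hy x
  exact integrable_mul_comp_sub hy hk x

theorem ae_integrable_convSnd (hg : MemLp g 2 volume) (hk : MemLp k 2) :
    ∀ᵐ x : ℝ, ∀ y : ℝ, Integrable fun s => g (x, y - s) * k s := by
  filter_upwards [hg.ae_memLp_snd] with x hx y
  exact integrable_mul_comp_sub hx hk y

theorem ae_of_ae_fst {P : ℝ → Prop} (h : ∀ᵐ x, P x) : ∀ᵐ p : ℝ × ℝ, P p.1 :=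
  Measure.quasiMeasurePreserving_fst.ae h

theorem ae_of_ae_snd {P : ℝ → Prop} (h : ∀ᵐ y, P y) : ∀ᵐ p : ℝ × ℝ, P p.2 :=
  Measure.quasiMeasurePreserving_snd.ae h

theorem eLpNorm_convFst_le (hf : Measurable f) (hk : Measurable k) :
    eLpNorm (convFst f k) 2 volume ≤ (∫⁻ s, ‖k s‖ₑ) * eLpNorm f 2 volume := by
  refine (ENNReal.pow_le_pow_left_iff two_ne_zero).1 ?_
  have hm := measurable_convFst hf hk
  rw [mul_pow, eLpNorm_two_sq, eLpNorm_two_sq, lintegral_eq_lintegral_lintegral (by fun_prop),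
    lintegral_eq_lintegral_lintegral (by fun_prop)]
  exact lintegral_enorm_convFst_sq_le hf hk

theorem eLpNorm_convSnd_le (hg : Measurable g) (hk : Measurable k) :
    eLpNorm (convSnd g k) 2 volume ≤ (∫⁻ s, ‖k s‖ₑ) * eLpNorm g 2 volume := by
  refine (ENNReal.pow_le_pow_left_iff two_ne_zero).1 ?_
  have hm := measurable_convSnd hg hk
  rw [mul_pow, eLpNorm_two_sq, eLpNorm_two_sq, lintegral_eq_lintegral_lintegral (by fun_prop),
    lintegral_eq_lintegral_lintegral (by fun_prop)]
  exact lintegral_enorm_convSnd_sq_le hg hk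

theorem eLpNorm_convFst_sub_le (hfm : Measurable f) (hfm' : Measurable f') (hf : MemLp f 2 volume)
    (hf' : MemLp f' 2 volume) (hk : MemLp k 2) (hkm : Measurable k) :
    eLpNorm (convFst f k - convFst f' k) 2 volume ≤
      (∫⁻ s, ‖k s‖ₑ) * eLpNorm (f - f') 2 volume := by
  refine le_trans (le_of_eq (eLpNorm_congr_ae ?_)) (eLpNorm_convFst_le (hfm.sub hfm') hkm)
  filter_upwards [ae_of_ae_snd (ae_integrable_convFst hf hk),
    ae_of_ae_snd (ae_integrable_convFst hf' hk)] with p h1 h2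
  simp only [Pi.sub_apply, convFst, sub_mul]
  exact (integral_sub (h1 p.1) (h2 p.1)).symm

theorem eLpNorm_convSnd_sub_le (hgm : Measurable g) (hgm' : Measurable g') (hg : MemLp g 2 volume)
    (hg' : MemLp g' 2 volume) (hk : MemLp k 2) (hkm : Measurable k) :
    eLpNorm (convSnd g k - convSnd g' k) 2 volume ≤
      (∫⁻ s, ‖k s‖ₑ) * eLpNorm (g - g') 2 volume := by
  refine le_trans (le_of_eq (eLpNorm_congr_ae ?_)) (eLpNorm_convSnd_le (hgm.sub hgm') hkm)
  filter_upwards [ae_of_ae_fst (ae_integrable_convSnd hg hk),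
    ae_of_ae_fst (ae_integrable_convSnd hg' hk)] with p h1 h2
  simp only [Pi.sub_apply, convSnd, sub_mul]
  exact (integral_sub (h1 p.2) (h2 p.2)).symm

theorem convFst_const_mul (c : ℂ) (f : ℝ × ℝ → ℂ) (k : ℝ → ℂ) (p : ℝ × ℝ) :
    convFst (fun r => c * f r) k p = c * convFst f k p := by
  simp only [convFst, mul_assoc, integral_const_mul]

theorem convSnd_const_mul (c : ℂ) (g : ℝ × ℝ → ℂ) (k : ℝ → ℂ) (p : ℝ × ℝ) :
    convSnd (fun r => c * g r) k p = c * convSnd g k p := by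
  simp only [convSnd, mul_assoc, integral_const_mul]

theorem convFst_ae_eq (h : f =ᵐ[volume] f') (k : ℝ → ℂ) :
    ∀ᵐ y : ℝ, ∀ x, convFst f k (x, y) = convFst f' k (x, y) := by
  have h1 : ∀ᵐ p : ℝ × ℝ, f p.swap = f' p.swap :=
    (Measure.measurePreserving_swap (μ := (volume : Measure ℝ))
      (ν := (volume : Measure ℝ))).quasiMeasurePreserving.ae h
  rw [Measure.volume_eq_prod] at h1
  filter_upwards [Measure.ae_ae_of_ae_prod h1] with y hy x
  refine integral_congr_ae ?_
  filter_upwards [(Measure.measurePreserving_sub_left volume x).quasiMeasurePreserving.ae hy]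
    with s hs
  simp only [Prod.swap_prod_mk] at hs
  simp only [hs]

theorem convSnd_ae_eq (h : g =ᵐ[volume] g') (k : ℝ → ℂ) :
    ∀ᵐ x : ℝ, ∀ y, convSnd g k (x, y) = convSnd g' k (x, y) := by
  rw [Measure.volume_eq_prod] at h
  filter_upwards [Measure.ae_ae_of_ae_prod h] with x hx y
  refine integral_congr_ae ?_
  filter_upwards [(Measure.measurePreserving_sub_left volume y).quasiMeasurePreserving.ae hx]
    with s hs
  simp only [hs]

end

section

variable {ρ φ : ℝ → ℂ}

/-- The bound for continuous functions of compact support, in its homogeneous form. -/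
theorem exists_bound_parabolic_mul (hρ : ContDiff ℝ ∞ ρ) (hρc : HasCompactSupport ρ)
    (hρs : tsupport ρ ⊆ {ξ : ℝ | 1 / 2 < |ξ| ∧ |ξ| < 2}) (hφ : ContDiff ℝ ∞ φ)
    (hφc : HasCompactSupport φ) (hφ0 : (0 : ℝ) ∉ tsupport φ) : ∃ C : ℝ, 0 < C ∧
    ∀ (m : ℕ) {f g : ℝ × ℝ → ℂ} (_ : Continuous f) (_ : HasCompactSupport f) (_ : Continuous g)
    (_ : HasCompactSupport g) {P R : ℝ} (_ : 0 < P) (_ : 0 < R)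
    (_ : eLpNorm f 2 volume ≤ ENNReal.ofReal P) (_ : eLpNorm g 2 volume ≤ ENNReal.ofReal R),
    ∫⁻ p : ℝ × ℝ, ‖∫ t, ρ t * (convFst f (invFourier (dyadicDilate m φ)) (p.1 + t, p.2) *
        convSnd g (invFourier (dyadicDilate m φ)) (p.1, p.2 + t ^ 2))‖ₑ ≤
      ENNReal.ofReal (C * (2 : ℝ) ^ (-(1 / 75 : ℝ) * (m : ℝ)) * (P * R)) := by
  obtain ⟨C, hC, hb⟩ := exists_bound_parabolic hρ hρc hρs hφ hφc hφ0
  refine ⟨2 * C, by positivity, fun m f g hf hfc hg hgc P R hP hR hfP hgR => ?_⟩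
  set k := invFourier (dyadicDilate m φ) with hk
  have hki : Integrable k := integrable_invFourier (hφ.dyadicDilate m) (hφc.dyadicDilate m)
  -- rescaling `f` and `g` inversely to each other equalizes the two norms
  set a : ℝ := √(R / P) with ha
  have ha0 : 0 < a := by positivity
  have ha2 : a ^ 2 = R / P := Real.sq_sqrt (by positivity)
  have h := hb m (f := fun r => (a : ℂ) * f r) (g := fun r => (a : ℂ)⁻¹ * g r) (by fun_prop)
    hfc.mul_left (by fun_prop) hgc.mul_left
  rw [← hk] at h
  have hac : (a : ℂ) ≠ 0 := by exact_mod_cast ha0.ne'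
  have e1 : ∀ x y, ∫ t, ρ t * (convFst (fun r => (a : ℂ) * f r) k (x + t, y) *
      convSnd (fun r => (a : ℂ)⁻¹ * g r) k (x, y + t ^ 2)) =
      ∫ t, ρ t * (convFst f k (x + t, y) * convSnd g k (x, y + t ^ 2)) := by
    intro x y
    refine integral_congr_ae (.of_forall fun t => ?_)
    simp only [convFst_const_mul, convSnd_const_mul]
    field_simp
  simp_rw [e1] at h
  have hm : Measurable fun r : ℝ × ℝ =>
      ∫ t, ρ t * (convFst f k (r.1 + t, r.2) * convSnd g k (r.1, r.2 + t ^ 2)) := by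
    have h1 := continuous_convFst hf hfc hki
    have h2 := continuous_convSnd hg hgc hki
    have hΘ : Continuous fun r : ℝ × ℝ × ℝ =>
        convFst f k (r.1 + r.2.2, r.2.1) * convSnd g k (r.1, r.2.1 + r.2.2 ^ 2) := by
      fun_prop
    exact hΘ.measurable.integral_mul_snd hρ.continuous.measurable
  have n1 : ∀ (c : ℝ) {S Q : ℝ} {u : ℝ × ℝ → ℂ}, 0 ≤ c → 0 ≤ S → c ^ 2 * S ^ 2 = Q →
      Continuous u → eLpNorm u 2 volume ≤ ENNReal.ofReal S →
      ∫⁻ x, ∫⁻ y, ‖(c : ℂ) * u (x, y)‖ₑ ^ 2 ≤ ENNReal.ofReal Q := by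
    intro c S Q u hc hS hQ hu huS
    rw [← lintegral_eq_lintegral_lintegral (Φ := fun p => ‖(c : ℂ) * u p‖ₑ ^ 2) (by fun_prop),
      ← eLpNorm_two_sq]
    have h2 : eLpNorm (fun p => (c : ℂ) * u p) 2 volume =
        ENNReal.ofReal c * eLpNorm u 2 volume := by
      have h3 := eLpNorm_const_smul (c : ℂ) u 2 (volume : Measure (ℝ × ℝ))
      rw [← ofReal_norm, Complex.norm_real, Real.norm_of_nonneg hc] at h3
      exact h3
    rw [h2, ← hQ, ← mul_pow, ENNReal.ofReal_pow (by positivity), ENNReal.ofReal_mul hc]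
    exact pow_le_pow_left' (mul_le_mul_right huS _) 2
  have n2 := n1 a (Q := P * R) ha0.le hP.le (by rw [ha2]; field_simp) hf hfP
  have n3 := n1 a⁻¹ (Q := P * R) (inv_nonneg.2 ha0.le) hR.le
    (by rw [inv_pow, ha2]; field_simp) hg hgR
  rw [Complex.ofReal_inv] at n3
  rw [lintegral_eq_lintegral_lintegral (by fun_prop)]
  refine h.trans ((mul_le_mul_right (add_le_add n2 n3) _).trans (le_of_eq ?_))
  rw [← ENNReal.ofReal_add (by positivity) (by positivity), ← ENNReal.ofReal_mul (by positivity)]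
  congr 1
  ring

/-- By density and the trivial bound, the estimate holds for all Borel functions in `L²`. -/
theorem exists_bound_parabolic_memLp (hρ : ContDiff ℝ ∞ ρ) (hρc : HasCompactSupport ρ)
    (hρs : tsupport ρ ⊆ {ξ : ℝ | 1 / 2 < |ξ| ∧ |ξ| < 2}) (hφ : ContDiff ℝ ∞ φ)
    (hφc : HasCompactSupport φ) (hφ0 : (0 : ℝ) ∉ tsupport φ) : ∃ C : ℝ, 0 < C ∧
    ∀ (m : ℕ) {f g : ℝ × ℝ → ℂ} (_ : Measurable f) (_ : MemLp f 2 volume) (_ : Measurable g)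
    (_ : MemLp g 2 volume),
    ∫⁻ p : ℝ × ℝ, ‖∫ t, ρ t * (convFst f (invFourier (dyadicDilate m φ)) (p.1 + t, p.2) *
        convSnd g (invFourier (dyadicDilate m φ)) (p.1, p.2 + t ^ 2))‖ₑ ≤
      ENNReal.ofReal (C * (2 : ℝ) ^ (-(1 / 75 : ℝ) * (m : ℝ))) * eLpNorm f 2 volume *
        eLpNorm g 2 volume := by
  obtain ⟨C, hC, hb⟩ := exists_bound_parabolic_mul hρ hρc hρs hφ hφc hφ0
  refine ⟨C, hC, fun m f g hfm hf hgm hg => ?_⟩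
  set k := invFourier (dyadicDilate m φ)
  have hki : Integrable k := integrable_invFourier (hφ.dyadicDilate m) (hφc.dyadicDilate m)
  have hk2 : MemLp k 2 := memLp_two_invFourier (hφ.dyadicDilate m) (hφc.dyadicDilate m)
  have hkm : Measurable k := (continuous_invFourier (hφ.continuous.dyadicDilate m)
    (hφc.dyadicDilate m)).measurable
  have hρi : Integrable ρ := hρ.continuous.integrable_of_hasCompactSupport hρc
  set q := C * (2 : ℝ) ^ (-(1 / 75 : ℝ) * (m : ℝ))
  have hq : 0 < q := by positivity
  set κ := ∫⁻ s, ‖k s‖ₑ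
  set ι := ∫⁻ t, ‖ρ t‖ₑ
  have hκ : κ ≠ ⊤ := hki.2.ne
  have hι : ι ≠ ⊤ := hρi.2.ne
  set P := (eLpNorm f 2 volume).toReal
  set R := (eLpNorm g 2 volume).toReal
  have hP : eLpNorm f 2 volume = ENNReal.ofReal P := (ENNReal.ofReal_toReal hf.2.ne).symm
  have hR : eLpNorm g 2 volume = ENNReal.ofReal R := (ENNReal.ofReal_toReal hg.2.ne).symm
  have hP0 : 0 ≤ P := ENNReal.toReal_nonneg
  have hR0 : 0 ≤ R := ENNReal.toReal_nonneg
  have hκ' : κ = ENNReal.ofReal κ.toReal := (ENNReal.ofReal_toReal hκ).symm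
  have hι' : ι = ENNReal.ofReal ι.toReal := (ENNReal.ofReal_toReal hι).symm
  set κ₀ := κ.toReal
  set ι₀ := ι.toReal
  have hκ0 : 0 ≤ κ₀ := ENNReal.toReal_nonneg
  have hι0 : 0 ≤ ι₀ := ENNReal.toReal_nonneg
  set I := ∫⁻ p : ℝ × ℝ, ‖∫ t, ρ t * (convFst f k (p.1 + t, p.2) *
        convSnd g k (p.1, p.2 + t ^ 2))‖ₑ
  have key : ∀ η : ℝ, 0 < η → I ≤ ENNReal.ofReal (q * ((P + η) * (R + η)) +
      ι₀ * (κ₀ * η * (κ₀ * R) + κ₀ * (P + η) * (κ₀ * η))) := by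
    intro η hη
    have approx : ∀ {u : ℝ × ℝ → ℂ} {S : ℝ}, MemLp u 2 volume → 0 ≤ S →
        eLpNorm u 2 volume = ENNReal.ofReal S → ∃ v : ℝ × ℝ → ℂ, Continuous v ∧
        HasCompactSupport v ∧ MemLp v 2 volume ∧ eLpNorm (u - v) 2 volume ≤ ENNReal.ofReal η ∧
        eLpNorm v 2 volume ≤ ENNReal.ofReal (S + η) := by
      intro u S hu hS huS
      obtain ⟨v, hvc, hv1, hv2, hv3⟩ := hu.exists_hasCompactSupport_eLpNorm_sub_le
        ENNReal.ofNat_ne_top (ENNReal.ofReal_pos.2 hη).ne'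
      refine ⟨v, hv2, hvc, hv3, hv1, ?_⟩
      have h1 := eLpNorm_sub_le hu.1 (hu.sub hv3).1 (p := 2) (by norm_num)
      rw [sub_sub_cancel] at h1
      rw [ENNReal.ofReal_add hS hη.le, ← huS]
      exact h1.trans (add_le_add le_rfl hv1)
    obtain ⟨f', hf'c, hf's, hf'2, hf'1, hf'3⟩ := approx hf hP0 hP
    obtain ⟨g', hg'c, hg's, hg'2, hg'1, hg'3⟩ := approx hg hR0 hR
    have c1 := eLpNorm_convFst_le hfm hkm
    have c2 := eLpNorm_convSnd_le hgm hkm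
    have c3 := eLpNorm_convFst_le hf'c.measurable hkm
    have c4 := eLpNorm_convSnd_le hg'c.measurable hkm
    have d1 := eLpNorm_convFst_sub_le hfm hf'c.measurable hf hf'2 hk2 hkm
    have d2 := eLpNorm_convSnd_sub_le hgm hg'c.measurable hg hg'2 hk2 hkm
    have hmain := hb m hf'c hf's hg'c hg's (P := P + η) (R := R + η) (by positivity)
      (by positivity) hf'3 hg'3
    have hcomp := lintegral_enorm_curve_le_add hρi hρ.continuous.measurable
      (measurable_convFst hfm hkm) (measurable_convSnd hgm hkm)
      (ne_top_of_le_ne_top (ENNReal.mul_ne_top hκ hf.2.ne) c1)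
      (ne_top_of_le_ne_top (ENNReal.mul_ne_top hκ hg.2.ne) c2)
      (measurable_convFst hf'c.measurable hkm) (measurable_convSnd hg'c.measurable hkm)
      (ne_top_of_le_ne_top (ENNReal.mul_ne_top hκ hf'2.2.ne) c3)
      (ne_top_of_le_ne_top (ENNReal.mul_ne_top hκ hg'2.2.ne) c4)
    refine hcomp.trans ((add_le_add hmain (mul_le_mul_right (add_le_add
      (mul_le_mul' (d1.trans (mul_le_mul_right hf'1 _)) c2)
      (mul_le_mul' (c3.trans (mul_le_mul_right hf'3 _))
        (d2.trans (mul_le_mul_right hg'1 _)))) _)).trans (le_of_eq ?_))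
    change _ + ι * (κ * _ * (κ * _) + κ * _ * (κ * _)) = _
    rw [hR, hκ', hι', ← ENNReal.ofReal_mul hκ0, ← ENNReal.ofReal_mul hκ0, ← ENNReal.ofReal_mul hκ0,
      ← ENNReal.ofReal_mul (by positivity), ← ENNReal.ofReal_mul (by positivity),
      ← ENNReal.ofReal_add (by positivity) (by positivity), ← ENNReal.ofReal_mul hι0,
      ← ENNReal.ofReal_add (by positivity) (by positivity)]
  rw [hP, hR, ← ENNReal.ofReal_mul hq.le, ← ENNReal.ofReal_mul (by positivity)]
  have hlim : Filter.Tendsto (fun η : ℝ => ENNReal.ofReal (q * ((P + η) * (R + η)) +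
      ι₀ * (κ₀ * η * (κ₀ * R) + κ₀ * (P + η) * (κ₀ * η)))) (nhdsWithin 0 (Set.Ioi 0))
      (nhds (ENNReal.ofReal (q * P * R))) := by
    have hc : Continuous fun η : ℝ => ENNReal.ofReal (q * ((P + η) * (R + η)) +
      ι₀ * (κ₀ * η * (κ₀ * R) + κ₀ * (P + η) * (κ₀ * η))) :=
      ENNReal.continuous_ofReal.comp (by fun_prop)
    have h := (hc.tendsto 0).mono_left (nhdsWithin_le_nhds (s := Set.Ioi (0 : ℝ)))
    simpa [mul_assoc] using h
  exact ge_of_tendsto hlim (Filter.eventually_of_mem self_mem_nhdsWithin fun η hη => key η hη)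

end

theorem mainTheorem5
    (ρ φ : ℝ → ℂ)
    (hρ : ContDiff ℝ ∞ ρ) (hφ : ContDiff ℝ ∞ φ)
    (hρc : HasCompactSupport ρ) (hφc : HasCompactSupport φ)
    (hρs : tsupport ρ ⊆ {ξ : ℝ | 1 / 2 < |ξ| ∧ |ξ| < 2})
    (hφs : tsupport φ ⊆ {ξ : ℝ | 1 / 2 < |ξ| ∧ |ξ| < 2}) :
    ∃ C : ℝ, 0 < C ∧ ∀ (m : ℕ) (f g : ℝ × ℝ → ℂ),
      MemLp f 2 (volume : Measure (ℝ × ℝ)) → MemLp g 2 (volume : Measure (ℝ × ℝ)) →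
        -- the convolutions, and the integral defining `T_m(f, g)`, converge absolutely
        (∀ᵐ y : ℝ, ∀ x : ℝ,
          Integrable (fun s : ℝ => f (x - s, y) * invFourier (dyadicDilate m φ) s)) ∧
        (∀ᵐ x : ℝ, ∀ y : ℝ,
          Integrable (fun s : ℝ => g (x, y - s) * invFourier (dyadicDilate m φ) s)) ∧
        (∀ᵐ p : ℝ × ℝ, Integrable (parabolicIntegrand ρ φ m f g p)) ∧
        -- `T_m(f, g)` lies in `L¹`, with the smoothing estimate
        MemLp (parabolicT ρ φ m f g) 1 (volume : Measure (ℝ × ℝ)) ∧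
        eLpNorm (parabolicT ρ φ m f g) 1 (volume : Measure (ℝ × ℝ)) ≤
          ENNReal.ofReal (C * (2 : ℝ) ^ (-(1 / 75 : ℝ) * (m : ℝ))) *
            eLpNorm f 2 (volume : Measure (ℝ × ℝ)) * eLpNorm g 2 (volume : Measure (ℝ × ℝ)) := by
  have hφ0 : (0 : ℝ) ∉ tsupport φ := fun h => by
    have := (hφs h).1
    norm_num at this
  obtain ⟨C, hC, hb⟩ := exists_bound_parabolic_memLp hρ hρc hρs hφ hφc hφ0
  refine ⟨C, hC, fun m f g hf hg => ?_⟩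
  have hk2 : MemLp (invFourier (dyadicDilate m φ)) 2 :=
    memLp_two_invFourier (hφ.dyadicDilate m) (hφc.dyadicDilate m)
  have hki : Integrable (invFourier (dyadicDilate m φ)) :=
    integrable_invFourier (hφ.dyadicDilate m) (hφc.dyadicDilate m)
  have hkm : Measurable (invFourier (dyadicDilate m φ)) :=
    (continuous_invFourier (hφ.continuous.dyadicDilate m) (hφc.dyadicDilate m)).measurable
  have hρi : Integrable ρ := hρ.continuous.integrable_of_hasCompactSupport hρc
  have hρm := hρ.continuous.measurable
  -- pass to Borel measurable representatives, on which the operators agree almost everywhere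
  obtain ⟨f', hfm, hff⟩ : ∃ f' : ℝ × ℝ → ℂ, Measurable f' ∧ f =ᵐ[volume] f' :=
    ⟨hf.1.mk f, hf.1.stronglyMeasurable_mk.measurable, hf.1.ae_eq_mk⟩
  obtain ⟨g', hgm, hgg⟩ : ∃ g' : ℝ × ℝ → ℂ, Measurable g' ∧ g =ᵐ[volume] g' :=
    ⟨hg.1.mk g, hg.1.stronglyMeasurable_mk.measurable, hg.1.ae_eq_mk⟩
  have hf' : MemLp f' 2 volume := hf.ae_eq hff
  have hg' : MemLp g' 2 volume := hg.ae_eq hgg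
  have heq : ∀ᵐ p : ℝ × ℝ, parabolicIntegrand ρ φ m f g p = fun t => ρ t *
      (convFst f' (invFourier (dyadicDilate m φ)) (p.1 + t, p.2) *
        convSnd g' (invFourier (dyadicDilate m φ)) (p.1, p.2 + t ^ 2)) := by
    filter_upwards [ae_of_ae_snd (convFst_ae_eq hff (invFourier (dyadicDilate m φ))),
      ae_of_ae_fst (convSnd_ae_eq hgg (invFourier (dyadicDilate m φ)))] with p h1 h2
    funext t
    rw [parabolicIntegrand, h1, h2, mul_comm]
  have hT : parabolicT ρ φ m f g =ᵐ[volume] fun p => ∫ t, ρ t *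
      (convFst f' (invFourier (dyadicDilate m φ)) (p.1 + t, p.2) *
        convSnd g' (invFourier (dyadicDilate m φ)) (p.1, p.2 + t ^ 2)) := by
    filter_upwards [heq] with p hp
    rw [parabolicT, hp]
  have hFm := measurable_convFst hfm hkm
  have hGm := measurable_convSnd hgm hkm
  have hint := ae_integrable_curve hρi hρm hFm hGm
    (ne_top_of_le_ne_top (ENNReal.mul_ne_top hki.2.ne hf'.2.ne) (eLpNorm_convFst_le hfm hkm))
    (ne_top_of_le_ne_top (ENNReal.mul_ne_top hki.2.ne hg'.2.ne) (eLpNorm_convSnd_le hgm hkm))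
  have hmeas : Measurable fun p : ℝ × ℝ => ∫ t, ρ t *
      (convFst f' (invFourier (dyadicDilate m φ)) (p.1 + t, p.2) *
        convSnd g' (invFourier (dyadicDilate m φ)) (p.1, p.2 + t ^ 2)) := by
    have hΘ : Measurable fun r : ℝ × ℝ × ℝ =>
        convFst f' (invFourier (dyadicDilate m φ)) (r.1 + r.2.2, r.2.1) *
          convSnd g' (invFourier (dyadicDilate m φ)) (r.1, r.2.1 + r.2.2 ^ 2) := by
      fun_prop
    exact hΘ.integral_mul_snd hρm
  have hbound : eLpNorm (parabolicT ρ φ m f g) 1 (volume : Measure (ℝ × ℝ)) ≤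
      ENNReal.ofReal (C * (2 : ℝ) ^ (-(1 / 75 : ℝ) * (m : ℝ))) *
        eLpNorm f 2 (volume : Measure (ℝ × ℝ)) * eLpNorm g 2 (volume : Measure (ℝ × ℝ)) := by
    rw [eLpNorm_congr_ae hT, eLpNorm_congr_ae hff, eLpNorm_congr_ae hgg,
      eLpNorm_one_eq_lintegral_enorm]
    exact hb m hfm hf' hgm hg'
  refine ⟨ae_integrable_convFst hf hk2, ae_integrable_convSnd hg hk2, ?_, ⟨?_, ?_⟩, hbound⟩
  · filter_upwards [heq, hint] with p h1 h2
    rw [h1]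
    exact h2
  · exact hmeas.aestronglyMeasurable.congr hT.symm
  · exact hbound.trans_lt (ENNReal.mul_lt_top (ENNReal.mul_lt_top ENNReal.ofReal_lt_top hf.2) hg.2)
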